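/- **Setup.** Let $d\ge 2$ and $\varsigma=(s_1,\dots,s_d)\in\mathbb Z_{>0}^d$ with $s_1+\dots+s_d=2N$. A $\varsigma$-valenced link pattern is a multiset $\alpha$ of links $\{i,k\}$, $1\le i<k\le d$, such that exactly $s_i$ links (with multiplicity) end at $i$ for each $i$ and no two links cross; $\mathsf{LP}_\varsigma$ is the set of these, and $\mathsf{LP}_N=\mathsf{LP}_{(1,\dots,1)}$ ($2N$ ones). Splitting each $i$ into $s_i$ consecutive indices, and attaching the links at $i$ to them without crossings, turns $\alpha\in\mathsf{LP}_\varsigma$ into its unfused pattern $\imath(\alpha)\in\mathsf{LP}_N$; the indices coming from $i$ are $q_{i-1}+1,\dots,q_i$ with $q_i=s_1+\dots+s_i$. A pattern $\beta\in\mathsf{LP}_N$ is identified with the Dyck path that goes up at left and down at right endpoints of links; $\beta\succeq\gamma$ means that the path of $\beta$ lies weakly above that of $\gamma$, and then $\#\mathcal C(\gamma/\beta)$ is the number of cover-inclusive Dyck tilings of the skew Young diagram between the two paths, i.e. of its partitions into Dyck tiles (ribbons of atomic squares whose centres form a translated Dyck path, possibly of length zero) such that whenever a tile has a square above a square of another tile,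 its horizontal extent is contained in that of the other tile. For $x_1<\dots<x_d$ put $$\mathcal Z_\alpha(x_1,\dots,x_d)=\sum_{\beta\in\mathsf{LP}_N,\ \beta\succeq\imath(\alpha)}\#\mathcal C(\imath(\alpha)/\beta)\,\det\big(\mathfrak K(a_k,b_\ell)\big)_{k,\ell=1}^N ,\qquad \beta=\{\{a_1,b_1\},\dots,\{a_N,b_N\}\},\ a_1<\dots<a_N,\ a_k<b_k,$$ where, for $a=q_{i-1}+m_a$ and $b=q_{k-1}+m_b$ with $1\le m_a\le s_i$ and $1\le m_b\le s_k$, $$\mathfrak K(a,b)=\partial_{x_i}^{m_a-1}\partial_{x_k}^{m_b-1}\,\frac1{\pi (x_i-x_k)^2}\ \text{ if } i\ne k,\qquad \mathfrak K(a,b)=0\ \text{ if } i=k,$$ and $\mathcal Z_\emptyset=1$. With $h_{1,\ell}=\ell(\ell-1)/2$, put $$\Delta^{s,t}_m=h_{1,s+t+1-2m}-h_{1,s+1}-h_{1,t+1} .$$ **Theorem.** There exist constants $C(s,t,m)\ge 0$, depending only on $s,t,m$, such that the following holds for all $d\ge2$, $\varsigma$, $\alpha\in\mathsf{LP}_\varsigma$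 and $1\le j\le d-1$. Let $m$ be the multiplicity of the link $\{j,j+1\}$ in $\alpha$, fix the points $x_i$ with $i\ne j,j+1$ in increasing order, and let $\xi\in(x_{j-1},x_{j+2})$ (with $x_0=-\infty$, $x_{d+1}=+\infty$). Then, as $x_j<x_{j+1}$ tend jointly to $\xi$, $$\lim_{x_j,x_{j+1}\to\xi}\frac{\mathcal Z_\alpha(x_1,\dots,x_d)}{|x_{j+1}-x_j|^{\Delta^{s_j,s_{j+1}}_m}}=C(s_j,s_{j+1},m)\;\mathcal Z_{\hat\alpha}(\hat{\boldsymbol x}) .$$ Here, if $m=s_j=s_{j+1}$, then $\hat\alpha$ is obtained from $\alpha$ by removing the points $j,j+1$ and their links (and relabeling), and $\hat{\boldsymbol x}=(x_1,\dots,x_{j-1},x_{j+2},\dots,x_d)$. Otherwise $\hat\alpha$ is obtained from $\alpha$ by removing the $m$ links $\{j,j+1\}$ and merging $j,j+1$ into a single point of valence $s_j+s_{j+1}-2m$, and $\hat{\boldsymbol x}=(x_1,\dots,x_{j-1},\xi,x_{j+2},\dots,x_d)$. Moreover $$\Delta^{s,t}_m=2m^2-m(2s+2t+1)+st ,$$ and,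 for $s,t\ge1$, $M=\max(s,t)$ and $\mu=\min(s,t)$, the constants for $m=0$ and $m=\mu$ are positive and equal to $$C(s,t,0)=\frac{\prod_{k=1}^{\mu}(k-1)!}{\prod_{\ell=1}^{\mu}(M+\ell-1)!},\qquad C(s,t,\mu)=\frac1{\pi^{\mu}}\prod_{\ell=1}^{\mu}(M-\mu+\ell)!\ \prod_{r=1}^{\mu}(r-1)! .$$ -/

import Mathlib

open Filter Topology

namespace PurePartition

/-! ### Planar link patterns and their walks -/

/-- A planar pair partition of `n` points on a line: `partner a` is the other endpoint of the
link of `a`, and no two links cross. (For odd `n` there is none.) -/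
@[ext]
structure LinkPattern (n : ℕ) where
  partner : Fin n → Fin n
  partner_partner : ∀ a, partner (partner a) = a
  partner_ne : ∀ a, partner a ≠ a
  planar : ∀ a b, ¬ (a < b ∧ b < partner a ∧ partner a < partner b)

noncomputable instance (n : ℕ) : Fintype (LinkPattern n) :=
  Fintype.ofInjective LinkPattern.partner (fun _ _ h => LinkPattern.ext h)

/-- The Dyck path of a link pattern: start at `0`, go up by one at each left endpoint of a link and
down by one at each right endpoint; `β.walk x` is the height after `x` steps. -/
def LinkPattern.walk {n : ℕ} (β : LinkPattern n) (x : ℕ) : ℤ :=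
  ∑ a : Fin n, if a.val < x then (if a < β.partner a then 1 else -1) else 0

/-- The partial order on link patterns: the Dyck path of `α` stays below that of `β`. -/
def LinkPattern.Below {n : ℕ} (α β : LinkPattern n) : Prop :=
  ∀ x : ℕ, α.walk x ≤ β.walk x

/-! ### Cover-inclusive Dyck tilings -/

/-- The centres of the atomic squares (the unit squares of the lattice rotated by 45 degrees, with
corners `(x ± 1, y)` and `(x, y ± 1)`) which lie between the Dyck paths of `α` and `β`. -/
def skewDiagram {n : ℕ} (α β : LinkPattern n) : Set (ℕ × ℤ) :=
  {p | p.1 ≤ n ∧ α.walk p.1 < p.2 ∧ p.2 < β.walk p.1 ∧ Odd (p.2 - α.walk p.1)}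

/-- A Dyck tile, as the set of centres of its atomic squares: a ribbon whose centres follow a
translated Dyck path (possibly of length zero, which gives a single atomic square). -/
def IsDyckTile (t : Finset (ℕ × ℤ)) : Prop :=
  ∃ (x₀ : ℕ) (y₀ : ℤ) (ℓ : ℕ) (h : ℕ → ℤ),
    h 0 = 0 ∧ h (2 * ℓ) = 0 ∧ (∀ i < 2 * ℓ, h (i + 1) = h i + 1 ∨ h (i + 1) = h i - 1) ∧
    (∀ i ≤ 2 * ℓ, 0 ≤ h i) ∧
    t = (Finset.range (2 * ℓ + 1)).image (fun i => (x₀ + i, y₀ + h i))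

/-- A cover-inclusive Dyck tiling of a region: a partition of the region into Dyck tiles such that,
whenever a tile `t` has a square above a square of another tile `t'`, the horizontal extent of `t`
is contained in that of `t'`. -/
structure IsCoverInclusiveTiling (D : Set (ℕ × ℤ)) (T : Finset (Finset (ℕ × ℤ))) : Prop where
  tile : ∀ t ∈ T, IsDyckTile t
  disjoint : ∀ t ∈ T, ∀ t' ∈ T, t ≠ t' → Disjoint t t'
  union : ∀ p, p ∈ D ↔ ∃ t ∈ T, p ∈ t
  cover : ∀ t ∈ T, ∀ t' ∈ T, (∃ p ∈ t, ∃ p' ∈ t', p.1 = p'.1 ∧ p'.2 < p.2) →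
    t.image Prod.fst ⊆ t'.image Prod.fst

/-- The number of cover-inclusive Dyck tilings of the skew Young diagram between the Dyck paths
of `α` (the lower one) and `β` (the upper one). -/
noncomputable def tilingCount {n : ℕ} (α β : LinkPattern n) : ℕ :=
  {T : Finset (Finset (ℕ × ℤ)) | IsCoverInclusiveTiling (skewDiagram α β) T}.ncard

/-! ### Inverse Fomin type sums -/

/-- The Fomin type determinant `det (K (a_k, b_l))`, where the links are `{a_k, b_k}` with
`a_k < b_k`. Rows and columns are both indexed by the left endpoints, in the same order. -/
noncomputable def fominDet {n : ℕ} (β : LinkPattern n) (K : Fin n → Fin n → ℝ) : ℝ :=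
  Matrix.det (Matrix.of fun k l : {a : Fin n // a < β.partner a} => K k.1 (β.partner l.1))

open Classical in
/-- The inverse Fomin type sum: the sum over the patterns `β` above `α` of the Fomin type
determinants, with the numbers of cover-inclusive Dyck tilings as coefficients. -/
noncomputable def inverseFominSum {n : ℕ} (α : LinkPattern n) (K : Fin n → Fin n → ℝ) : ℝ :=
  ∑ β : LinkPattern n with α.Below β, (tilingCount α β : ℝ) * fominDet β K

/-! ### The kernel -/

/-- The Brownian excursion kernel of the upper half-plane. -/
noncomputable def excursionKernel (x y : ℝ) : ℝ := 1 / Real.pi * (1 / (x - y) ^ 2)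

/-- The kernel with valences `s` at the points `x`. The `∑ i, s i` indices are split into consecutive
blocks of lengths `s 0, s 1, …`; the index number `m` (counted from `0`) of the block `i`
corresponds under `finSigmaFinEquiv` to the pair `⟨i, m⟩`, and it carries the derivative of order
`m` at the point `x i`. -/
noncomputable def valencedKernel {d : ℕ} (s : Fin d → ℕ) (x : Fin d → ℝ)
    (a b : Fin (∑ i, s i)) : ℝ :=
  let p := finSigmaFinEquiv.symm a
  let q := finSigmaFinEquiv.symm b
  if p.1 = q.1 then 0
  else iteratedDeriv p.2.val
    (fun u => iteratedDeriv q.2.val (fun v => excursionKernel u v) (x q.1)) (x p.1)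

/-! ### Valenced link patterns -/

/-- A planar link pattern with valences `s`, as a multiset of links between distinct points
of `Fin d`: `mult i k` is the multiplicity of the link `{i, k}`, exactly `s i` links end at `i`, and
no two links cross. -/
structure ValencedLinkPattern {d : ℕ} (s : Fin d → ℕ) where
  mult : Fin d → Fin d → ℕ
  symm : ∀ i k, mult i k = mult k i
  irrefl : ∀ i, mult i i = 0
  valence : ∀ i, ∑ k, mult i k = s i
  planar : ∀ a b c e, a < b → b < c → c < e → mult a c = 0 ∨ mult b e = 0

/-- The order in which the links at the point `i` are attached, from left to right, according to
their other endpoints: `i - 1, i - 2, …, 0, d - 1, d - 2, …, i + 1` (and then `i` itself, which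
carries no link to `i`). This is the only order without crossings. -/
def aroundFun {d : ℕ} (i t : Fin d) : Fin d :=
  if h : t.val < i.val then ⟨i.val - 1 - t.val, by omega⟩
  else ⟨d - 1 + i.val - t.val, by omega⟩

theorem aroundFun_val {d : ℕ} (i t : Fin d) : (aroundFun i t).val =
    if t.val < i.val then i.val - 1 - t.val else d - 1 + i.val - t.val := by
  unfold aroundFun
  split_ifs <;> rfl

theorem aroundFun_aroundFun {d : ℕ} (i t : Fin d) : aroundFun i (aroundFun i t) = t := by
  apply Fin.ext
  rw [aroundFun_val, aroundFun_val]
  split_ifs <;> omega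

/-- `aroundFun i` as a bijection (it is an involution). -/
def around {d : ℕ} (i : Fin d) : Fin d ≃ Fin d where
  toFun := aroundFun i
  invFun := aroundFun i
  left_inv := aroundFun_aroundFun i
  right_inv := aroundFun_aroundFun i

theorem around_symm_val {d : ℕ} (i k : Fin d) :
    ((around i).symm k).val =
      if k.val < i.val then i.val - 1 - k.val else d - 1 + i.val - k.val :=
  aroundFun_val i k

theorem finSigmaFinEquiv_lt_iff {d : ℕ} {f : Fin d → ℕ} (p q : (i : Fin d) × Fin (f i)) :
    finSigmaFinEquiv p < finSigmaFinEquiv q ↔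
      p.1 < q.1 ∨ (p.1 = q.1 ∧ p.2.val < q.2.val) := by
  have hval : ∀ r : (i : Fin d) × Fin (f i), (finSigmaFinEquiv r).val =
      (∑ i ∈ Finset.range r.1.val, if h : i < d then f ⟨i, h⟩ else 0) + r.2.val := by
    intro r
    rw [finSigmaFinEquiv_apply, Finset.sum_range]
    congr 1
    apply Finset.sum_congr rfl
    intro i _
    have : i.val < d := by omega
    simp only [this, dite_true]
    rfl
  have key : ∀ p q : (i : Fin d) × Fin (f i), p.1 < q.1 →
      finSigmaFinEquiv p < finSigmaFinEquiv q := by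
    intro p q h
    rw [Fin.lt_def, hval p, hval q]
    have h1 : (∑ i ∈ Finset.range (p.1.val + 1), if h : i < d then f ⟨i, h⟩ else 0) ≤
        ∑ i ∈ Finset.range q.1.val, if h : i < d then f ⟨i, h⟩ else 0 :=
      Finset.sum_le_sum_of_subset (Finset.range_mono h)
    rw [Finset.sum_range_succ] at h1
    have h2 := p.2.isLt
    simp only [Fin.is_lt, dite_true, Fin.eta] at h1
    omega
  have same : ∀ (i : Fin d) (a b : Fin (f i)),
      finSigmaFinEquiv ⟨i, a⟩ < finSigmaFinEquiv ⟨i, b⟩ ↔ a.val < b.val := by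
    intro i a b
    rw [Fin.lt_def, hval, hval]
    simp
  obtain ⟨i, a⟩ := p
  obtain ⟨k, b⟩ := q
  rcases lt_trichotomy i k with h | h | h
  · simp [h, key ⟨i, a⟩ ⟨k, b⟩ h]
  · subst h
    rw [same]
    simp
  · have h3 := key ⟨k, b⟩ ⟨i, a⟩ h
    simp [h.not_gt, h.ne', h3.le]

namespace ValencedLinkPattern

variable {d : ℕ} {s : Fin d → ℕ} (α : ValencedLinkPattern s)

theorem sum_around (i : Fin d) : s i = ∑ t, α.mult i (around i t) := by
  rw [← α.valence i]
  exact (Equiv.sum_comp (around i) (fun k => α.mult i k)).symm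

/-- The `s i` indices into which the point `i` is split, labelled by the links attached to them:
`⟨k, r⟩` stands for the `r`-th one (from the left, at `i`) of the links `{i, k}`. -/
def linkEnd (i : Fin d) : ((k : Fin d) × Fin (α.mult i k)) ≃ Fin (s i) :=
  ((Equiv.sigmaCongrLeft (around i)).symm.trans finSigmaFinEquiv).trans
    (finCongr (α.sum_around i).symm)

/-- The `∑ i, s i` indices, labelled by the links attached to them. -/
def linkEnds : ((i : Fin d) × (k : Fin d) × Fin (α.mult i k)) ≃ Fin (∑ i, s i) :=
  (Equiv.sigmaCongrRight α.linkEnd).trans finSigmaFinEquiv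

/-- The other end of a link: the `r`-th link from the left at `i` among the links `{i, k}` is the
`r`-th one from the right at `k`. -/
def otherEnd (e : (i : Fin d) × (k : Fin d) × Fin (α.mult i k)) :
    (i : Fin d) × (k : Fin d) × Fin (α.mult i k) :=
  ⟨e.2.1, e.1, Fin.cast (α.symm e.1 e.2.1) e.2.2.rev⟩

theorem otherEnd_otherEnd (e : (i : Fin d) × (k : Fin d) × Fin (α.mult i k)) :
    α.otherEnd (α.otherEnd e) = e := by
  obtain ⟨i, k, r⟩ := e
  refine Sigma.ext rfl (heq_of_eq (Sigma.ext rfl (heq_of_eq (Fin.ext ?_))))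
  have h := α.symm i k
  have hr := r.isLt
  simp only [otherEnd, Fin.val_cast, Fin.val_rev]
  omega

theorem linkEnds_lt_iff (e e' : (i : Fin d) × (k : Fin d) × Fin (α.mult i k)) :
    α.linkEnds e < α.linkEnds e' ↔ e.1 < e'.1 ∨ (e.1 = e'.1 ∧
      (((around e.1).symm e.2.1).val < ((around e'.1).symm e'.2.1).val ∨
        (e.2.1 = e'.2.1 ∧ e.2.2.val < e'.2.2.val))) := by
  have hsymm : ∀ (i : Fin d) (p : (k : Fin d) × Fin (α.mult i k)),
      ∃ q : (t : Fin d) × Fin (α.mult i (around i t)),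
        (α.linkEnd i p).val = (finSigmaFinEquiv q).val ∧
        q.1 = (around i).symm p.1 ∧ q.2.val = p.2.val := by
    intro i p
    obtain ⟨q, rfl⟩ := (Equiv.sigmaCongrLeft (β := fun k => Fin (α.mult i k)) (around i)).surjective p
    refine ⟨q, ?_, ?_, ?_⟩
    · simp only [linkEnd, Equiv.trans_apply, Equiv.symm_apply_apply, finCongr_apply, Fin.val_cast]
    · simp [Equiv.sigmaCongrLeft]
    · simp [Equiv.sigmaCongrLeft]
  obtain ⟨i, p⟩ := e
  obtain ⟨k, q⟩ := e'
  simp only [linkEnds, Equiv.trans_apply, finSigmaFinEquiv_lt_iff, Equiv.sigmaCongrRight_apply]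
  apply or_congr Iff.rfl
  apply and_congr_right
  intro hik
  change i = k at hik
  subst hik
  obtain ⟨p', h1, h2, h3⟩ := hsymm i p
  obtain ⟨q', h4, h5, h6⟩ := hsymm i q
  rw [h1, h4, ← Fin.lt_def, finSigmaFinEquiv_lt_iff, h3, h6, h2, h5, Fin.lt_def]
  simp

theorem not_crossing (e e' : (i : Fin d) × (k : Fin d) × Fin (α.mult i k)) :
    ¬ (α.linkEnds e < α.linkEnds e' ∧ α.linkEnds e' < α.linkEnds (α.otherEnd e) ∧
      α.linkEnds (α.otherEnd e) < α.linkEnds (α.otherEnd e')) := by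
  obtain ⟨i, k, r⟩ := e
  obtain ⟨i', k', r'⟩ := e'
  simp only [linkEnds_lt_iff, around_symm_val, otherEnd, Fin.val_cast, Fin.val_rev]
  have hr := r.isLt
  have hr' := r'.isLt
  have hik : i ≠ k := by
    rintro rfl
    exact (Fin.cast (α.irrefl _) r).elim0
  have hik' : i' ≠ k' := by
    rintro rfl
    exact (Fin.cast (α.irrefl _) r').elim0
  rintro ⟨h1, h2, h3⟩
  have hp := α.planar i i' k k'
  have hm : i = i' → k = k' → α.mult i k = α.mult i' k' := by
    rintro rfl rfl
    rfl
  simp only [Fin.lt_def, Fin.ext_iff, ne_eq] at *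
  generalize α.mult i k = m at *
  generalize α.mult i' k' = m' at *
  generalize r.val = ρ at *
  generalize r'.val = ρ' at *
  have hi := i.isLt
  have hi' := i'.isLt
  have hk := k.isLt
  have hk' := k'.isLt
  clear r r'
  split_ifs at * <;> omega

/-- The unfused link pattern of a valenced link pattern: each point `i` is split into `s i`
consecutive indices, and the links at `i` are attached to them without crossings. -/
def unfuse : LinkPattern (∑ i, s i) where
  partner a := α.linkEnds (α.otherEnd (α.linkEnds.symm a))
  partner_partner a := by simp [otherEnd_otherEnd]
  partner_ne a := by
    obtain ⟨⟨i, k, r⟩, rfl⟩ := α.linkEnds.surjective a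
    intro h
    rw [Equiv.symm_apply_apply, EmbeddingLike.apply_eq_iff_eq] at h
    have hk : k = i := congrArg Sigma.fst h
    subst hk
    exact (Fin.cast (α.irrefl k) r).elim0
  planar a b := by
    have h := α.not_crossing (α.linkEnds.symm a) (α.linkEnds.symm b)
    rwa [Equiv.apply_symm_apply, Equiv.apply_symm_apply] at h

/-- The pure partition function of the upper half-plane at the points `x`. -/
noncomputable def partitionFunction (x : Fin d → ℝ) : ℝ :=
  inverseFominSum α.unfuse (valencedKernel s x)

end ValencedLinkPattern

/-! ### Fusing two neighbouring points

The neighbouring points are `j.castSucc` and `j.succ` for some `j : Fin (n + 1)`, among the `n + 2`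
points of `Fin (n + 2)`. -/

section Fusion

variable {n : ℕ}

/-- The valences after fusing the points `j.castSucc`, `j.succ` and removing `m` links between
them; the fused point gets the number `j`. -/
def fusedValence (s : Fin (n + 2) → ℕ) (j : Fin (n + 1)) (m : ℕ) : Fin (n + 1) → ℕ :=
  fun a => if a = j then s j.castSucc + s j.succ - 2 * m else s (j.castSucc.succAbove a)

/-- The points other than `j.castSucc` and `j.succ`, in order. -/
def otherPoint (j : Fin (n + 1)) (i : Fin n) : Fin (n + 2) :=
  j.castSucc.succAbove (j.succAbove i)

theorem sum_pair_add_sum_otherPoint (j : Fin (n + 1)) (f : Fin (n + 2) → ℕ) :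
    ∑ k, f k = f j.castSucc + f j.succ + ∑ i, f (otherPoint j i) := by
  rw [Fin.sum_univ_succAbove f j.castSucc, Fin.sum_univ_succAbove _ j,
    Fin.succAbove_castSucc_self, add_assoc]
  rfl

theorem predAbove_otherPoint (j : Fin (n + 1)) (i : Fin n) :
    j.predAbove (otherPoint j i) = j.succAbove i :=
  Fin.predAbove_succAbove j _

variable {s : Fin (n + 2) → ℕ}

/-- The valenced link pattern in which the points `j.castSucc`, `j.succ` are fused into one point
(number `j`) and all the links between them are removed; the relabeling of the points
is `j.predAbove`. -/
def ValencedLinkPattern.fuse (α : ValencedLinkPattern s) (j : Fin (n + 1)) :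
    ValencedLinkPattern (fusedValence s j (α.mult j.castSucc j.succ)) where
  mult a b := if a = b then 0 else
    ∑ i with j.predAbove i = a, ∑ k with j.predAbove k = b, α.mult i k
  symm a b := by
    rw [Finset.sum_comm]
    simp only [α.symm, eq_comm]
  irrefl a := by simp
  valence a := by
    have hin : ∀ i, (∑ b, if a = b then 0 else ∑ k with j.predAbove k = b, α.mult i k) =
        ∑ k, if a = j.predAbove k then 0 else α.mult i k := by
      intro i
      have h1 : ∀ b, (if a = b then 0 else ∑ k with j.predAbove k = b, α.mult i k) =
          ∑ k, if j.predAbove k = b then (if a = j.predAbove k then 0 else α.mult i k) else 0 := by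
        intro b
        rw [← Finset.sum_filter]
        split_ifs with h
        · exact (Finset.sum_eq_zero fun k hk => by
            rw [(Finset.mem_filter.1 hk).2, if_pos h]).symm
        · exact Finset.sum_congr rfl fun k hk => by
            rw [(Finset.mem_filter.1 hk).2, if_neg h]
      simp only [h1]
      rw [Finset.sum_comm]
      simp
    have hout : (∑ b, if a = b then 0 else
        ∑ i with j.predAbove i = a, ∑ k with j.predAbove k = b, α.mult i k) =
        ∑ i, if j.predAbove i = a then (∑ k, if a = j.predAbove k then 0 else α.mult i k)
          else 0 := by
      rw [← Finset.sum_filter]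
      simp only [← hin]
      rw [Finset.sum_comm]
      refine Finset.sum_congr rfl fun b _ => ?_
      split_ifs <;> simp
    rw [hout]
    have hval := α.valence
    simp only [sum_pair_add_sum_otherPoint j] at hval ⊢
    simp only [Fin.predAbove_castSucc_self, Fin.predAbove_succ_self, predAbove_otherPoint]
    by_cases ha : a = j
    · subst ha
      have h1 := hval a.castSucc
      have h2 := hval a.succ
      rw [α.irrefl] at h1
      rw [α.irrefl, α.symm a.succ] at h2
      simp only [fusedValence, if_true, Fin.succAbove_ne, (Fin.succAbove_ne _ _).symm, if_false,
        Finset.sum_const_zero]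
      omega
    · obtain ⟨b, rfl⟩ := Fin.exists_succAbove_eq ha
      have h1 := hval (otherPoint j b)
      have h2 : ∀ k, (if b = k then 0 else α.mult (otherPoint j b) (otherPoint j k)) =
          α.mult (otherPoint j b) (otherPoint j k) := by
        intro k
        split_ifs with h
        · rw [h, α.irrefl]
        · rfl
      simp only [fusedValence, Fin.succAbove_ne, (Fin.succAbove_ne _ _).symm, if_false,
        Fin.succAbove_right_inj, Finset.sum_ite_eq', Finset.mem_univ, if_true, h2]
      simpa [otherPoint] using h1
  planar a b c e hab hbc hce := by
    rw [if_neg (hab.trans hbc).ne, if_neg (hbc.trans hce).ne]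
    by_contra! h
    obtain ⟨i, hi, h1⟩ := Finset.exists_ne_zero_of_sum_ne_zero h.1
    obtain ⟨k, hk, h1⟩ := Finset.exists_ne_zero_of_sum_ne_zero h1
    obtain ⟨i', hi', h2⟩ := Finset.exists_ne_zero_of_sum_ne_zero h.2
    obtain ⟨k', hk', h2⟩ := Finset.exists_ne_zero_of_sum_ne_zero h2
    simp only [Finset.mem_filter, Finset.mem_univ, true_and] at hi hk hi' hk'
    have mono := Fin.predAbove_right_monotone j
    have := α.planar i i' k k' (mono.reflect_lt (by omega)) (mono.reflect_lt (by omega))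
      (mono.reflect_lt (by omega))
    tauto

/-- If all the links at `j.castSucc` and `j.succ` connect these two points, the valenced link
pattern of the other points. -/
def ValencedLinkPattern.removePair (α : ValencedLinkPattern s) (j : Fin (n + 1))
    (hl : α.mult j.castSucc j.succ = s j.castSucc) (hr : α.mult j.castSucc j.succ = s j.succ) :
    ValencedLinkPattern (fun i => s (otherPoint j i)) where
  mult i k := α.mult (otherPoint j i) (otherPoint j k)
  symm i k := α.symm _ _
  irrefl i := α.irrefl _
  valence i := by
    have h1 := α.valence j.castSucc
    have h2 := α.valence j.succ
    have h3 := α.valence (otherPoint j i)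
    rw [sum_pair_add_sum_otherPoint j, α.irrefl] at h1
    rw [sum_pair_add_sum_otherPoint j, α.irrefl, α.symm j.succ] at h2
    rw [sum_pair_add_sum_otherPoint j, α.symm _ j.castSucc, α.symm _ j.succ] at h3
    have h4 := Finset.single_le_sum (f := fun i => α.mult j.castSucc (otherPoint j i))
      (fun _ _ => Nat.zero_le _) (Finset.mem_univ i)
    have h5 := Finset.single_le_sum (f := fun i => α.mult j.succ (otherPoint j i))
      (fun _ _ => Nat.zero_le _) (Finset.mem_univ i)
    omega
  planar a b c e hab hbc hce := by
    have mono : StrictMono (otherPoint j) :=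
      (Fin.strictMono_succAbove _).comp (Fin.strictMono_succAbove _)
    exact α.planar _ _ _ _ (mono hab) (mono hbc) (mono hce)

/-- The points of a configuration near the fusion: `j.castSucc` is at `u`, `j.succ` is at `v`, and the
other points are as in the fused configuration `y`. -/
def nearFusion (j : Fin (n + 1)) (y : Fin (n + 1) → ℝ) (u v : ℝ) : Fin (n + 2) → ℝ :=
  fun i => if i = j.castSucc then u else if i = j.succ then v else y (j.predAbove i)

end Fusion

/-- The Kac conformal weights `h_{1,l}` at central charge `c = -2`. -/
noncomputable def kacWeight (l : ℤ) : ℝ := l * (l - 1) / 2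

/-- The exponent of the asymptotics when points of valences `s`, `t` with `m` links between them
are fused. -/
noncomputable def fusionExponent (s t m : ℕ) : ℝ :=
  kacWeight (s + t + 1 - 2 * m) - kacWeight (s + 1) - kacWeight (t + 1)

end PurePartition

open PurePartition

namespace PurePartition

/-! ### Dyck tiles as graphs -/

/-! The partition functions are the coefficients of one Pfaffian. Give every point `i` a parameter
`t i`; then the Pfaffian of the matrix with entries `K a b * (t_b - t_a)` equals the sum over all
valenced patterns of `Z_α` times the product of `t_k - t_i` over the links `{i, k}` of `α`
(`pfaffian_eq_sum_partitionFunction`). Such products are linearly independent for different patterns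
(`eq_zero_of_sum_differenceProd`), so a limit of the generating function can be read off coefficient
by coefficient.

The generating function rests on a duality. Replace `t_b - t_a` by the bracket (determinant) of
plane vectors attached to the indices. The recursion for cover-inclusive tilings at a peak of the
upper path (`walkTilings_recursion`) has the same shape as a recursion for bracket products, and it
follows that the matrix of tiling counts inverts the matrix of values of planar bracket products at
Dyck words, where up- and down-steps are the two basis vectors (`tilingSum_stepVec`). A function in
the span of the planar bracket products is therefore recovered from its values at Dyck words. The
Pfaffian lies in this span by the Plücker relation (`pairProd_mem`), and its value at the Dyck word
of `β` is the Fomin determinant of `β` (`bracketPfaffian_stepVec`). Specializing the vectors to `(1,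
t_i)` kills the patterns with a link inside a block and leaves exactly the unfused ones.

For the asymptotics, let the two merging points carry the parameters `t_j - ε` and `t_j`, at
distance `δ`. A pattern with `m` links between them contributes `ε ^ m` times a polynomial in `ε`.
On the Pfaffian side, triangular row operations diagonalize the singular block between the two
points and turn the other entries into rows with explicit Taylor coefficients. In the coefficient of
`ε ^ m`, the leading terms choose `m` diagonal pairs, each worth a multiple of `δ ^ (-2)`; the
remaining `s + t - 2m` rows give a Vandermonde-type determinant and the power `δ ^ binom(s + t - 2m,
2)`. Together with the prefactor `δ ^ (-binom(s, 2) - binom(t, 2))` from the row operations this is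
the exponent `Δ`, and the limit is the Pfaffian of the fused configuration (`tendsto_fusionCoeff`).

The coefficient of `ε ^ m` also contains patterns with fewer than `m` links between the points.
Since `Δ` strictly decreases in `m`, an induction on `m` makes them negligible. For fixed `m` fusion
is injective on patterns, so independence of the fused products isolates each `Z_α`. -/

theorem isDyckTile_iff (t : Finset (ℕ × ℤ)) : IsDyckTile t ↔ ∃ (x₁ x₂ : ℕ) (Y : ℕ → ℤ),
    x₁ ≤ x₂ ∧ Y x₂ = Y x₁ ∧
    (∀ x, x₁ ≤ x → x < x₂ → Y (x + 1) = Y x + 1 ∨ Y (x + 1) = Y x - 1) ∧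
    (∀ x, x₁ ≤ x → x ≤ x₂ → Y x₁ ≤ Y x) ∧
    ∀ z : ℕ × ℤ, z ∈ t ↔ x₁ ≤ z.1 ∧ z.1 ≤ x₂ ∧ z.2 = Y z.1 := by
  constructor
  · rintro ⟨x₀, y₀, l, h, h0, hl, hs, hp, rfl⟩
    refine ⟨x₀, x₀ + 2 * l, fun x => y₀ + h (x - x₀), by omega, by simp [h0, hl], ?_, ?_, ?_⟩
    · intro x h1 h2
      have := hs (x - x₀) (by omega)
      simp only [show x + 1 - x₀ = x - x₀ + 1 by omega]
      omega
    · intro x h1 h2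
      have := hp (x - x₀) (by omega)
      simp only [Nat.sub_self, h0]
      omega
    · rintro ⟨x, y⟩
      simp only [Finset.mem_image, Finset.mem_range, Prod.mk.injEq]
      constructor
      · rintro ⟨i, hi, rfl, rfl⟩
        refine ⟨by omega, by omega, ?_⟩
        rw [Nat.add_sub_cancel_left]
      · rintro ⟨h1, h2, h3⟩
        refine ⟨x - x₀, by omega, by omega, h3.symm⟩
  · rintro ⟨x₁, x₂, Y, hx, hY, hs, hp, hm⟩
    -- Steps of size one that return to the initial height force an even length, which supplies the
    -- `2 * ℓ` of the definition.
    have hpar : ∀ i, x₁ + i ≤ x₂ → (Y (x₁ + i) - Y x₁ - i) % 2 = 0 := by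
      intro i
      induction i with
      | zero => intro _; simp
      | succ i ih =>
        intro hi
        have h1 := ih (by omega)
        have h2 := hs (x₁ + i) (by omega) (by omega)
        rw [← add_assoc]
        push_cast
        omega
    have h2 := hpar (x₂ - x₁) (by omega)
    rw [show x₁ + (x₂ - x₁) = x₂ by omega, hY] at h2
    obtain ⟨l, hl⟩ : ∃ l, x₂ = x₁ + 2 * l := ⟨(x₂ - x₁) / 2, by omega⟩
    subst hl
    refine ⟨x₁, Y x₁, l, fun i => Y (x₁ + i) - Y x₁, by simp, by simp [hY], ?_, ?_, ?_⟩
    · intro i hi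
      have := hs (x₁ + i) (by omega) (by omega)
      simp only [← add_assoc]
      omega
    · intro i hi
      have := hp (x₁ + i) (by omega) (by omega)
      simp only
      omega
    · ext ⟨x, y⟩
      rw [hm]
      simp only [Finset.mem_image, Finset.mem_range, Prod.mk.injEq]
      constructor
      · rintro ⟨h1, h3, h4⟩
        refine ⟨x - x₁, by omega, by omega, ?_⟩
        rw [show x₁ + (x - x₁) = x by omega]
        omega
      · rintro ⟨i, hi, rfl, rfl⟩
        refine ⟨by omega, by omega, by ring⟩

/-! ### Regions between two walks -/

/-- The centres of the atomic squares between the walks `p` and `q` on `[0, n]`. -/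
def region (n : ℕ) (p q : ℕ → ℤ) : Set (ℕ × ℤ) :=
  {z | z.1 ≤ n ∧ p z.1 < z.2 ∧ z.2 < q z.1 ∧ Odd (z.2 - p z.1)}

theorem region_finite (n : ℕ) (p q : ℕ → ℤ) : (region n p q).Finite := by
  refine Set.Finite.subset (Set.Finite.biUnion (Finset.range (n + 1)).finite_toSet
    (t := fun x => (fun y => (x, y)) '' Set.Ioo (p x) (q x))
    fun x _ => (Set.finite_Ioo _ _).image _) ?_
  rintro ⟨x, y⟩ ⟨h1, h2, h3, -⟩
  simp only [Set.mem_iUnion]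
  exact ⟨x, by simpa [Nat.lt_succ_iff] using h1, y, ⟨h2, h3⟩, rfl⟩

theorem tilings_finite {D : Set (ℕ × ℤ)} (hD : D.Finite) :
    {T | IsCoverInclusiveTiling D T}.Finite := by
  refine Set.Finite.subset (Finset.finite_toSet hD.toFinset.powerset.powerset) ?_
  intro T hT
  simp only [Finset.coe_powerset, Set.mem_ofPred_eq] at hT ⊢
  simp only [Set.mem_preimage, Set.mem_powerset_iff, Set.subset_def, Finset.mem_coe]
  intro t ht z hz
  simpa using (hT.union z).2 ⟨t, ht, hz⟩

/-- Number of cover-inclusive Dyck tilings between two walks. -/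
noncomputable def walkTilings (n : ℕ) (p q : ℕ → ℤ) : ℕ :=
  {T | IsCoverInclusiveTiling (region n p q) T}.ncard

/-! ### The recursion for tilings at a peak of the upper path -/

section Peak

variable {n a : ℕ} {p q : ℕ → ℤ}

theorem tile_unique {D : Set (ℕ × ℤ)} {T : Finset (Finset (ℕ × ℤ))}
    (hT : IsCoverInclusiveTiling D T) {t t' : Finset (ℕ × ℤ)} (ht : t ∈ T) (ht' : t' ∈ T)
    {z : ℕ × ℤ} (hz : z ∈ t) (hz' : z ∈ t') : t = t' := by
  by_contra h
  exact Finset.disjoint_left.1 (hT.disjoint t ht t' ht' h) hz hz'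

/-- If the topmost square below a peak of the upper walk is not a tile of its own, then all the
tiles have peaks there. -/
theorem tile_peak (h1 : q (a + 1) = q a + 1) (h2 : q (a + 2) = q a)
    (hpar : Even (q (a + 1) - p (a + 1)))
    {T : Finset (Finset (ℕ × ℤ))} (hT : IsCoverInclusiveTiling (region n p q) T)
    (htop : {(a + 1, q (a + 1) - 1)} ∉ T) (y : ℤ) {t : Finset (ℕ × ℤ)} (ht : t ∈ T)
    (hz : (a + 1, y) ∈ t) : (a, y - 1) ∈ t ∧ (a + 2, y - 1) ∈ t := by
  have hreg : ∀ t ∈ T, ∀ z ∈ t, z ∈ region n p q := fun t ht z hz => (hT.union z).2 ⟨t, ht, hz⟩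
  obtain ⟨k, hk⟩ : ∃ k : ℕ, y = q (a + 1) - 1 - 2 * k := by
    obtain ⟨-, h3, h4, h5⟩ := hreg t ht _ hz
    simp only at h3 h4 h5
    refine ⟨((q (a + 1) - 1 - y) / 2).toNat, ?_⟩
    rw [Int.even_iff] at hpar
    rw [Int.odd_iff] at h5
    omega
  -- Induction down the column `a + 1`, starting at its topmost square.
  induction k generalizing y t with
  | zero =>
    obtain ⟨x₁, x₂, Y, hx, hY, hs, hp, hm⟩ := (isDyckTile_iff t).1 (hT.tile t ht)
    obtain ⟨hx1, hx2, hyY⟩ := (hm _).1 hz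
    simp only at hx1 hx2 hyY
    have hin : ∀ x, x₁ ≤ x → x ≤ x₂ → Y x < q x := fun x h3 h4 =>
      (hreg t ht (x, Y x) ((hm _).2 ⟨h3, h4, rfl⟩)).2.2.1
    -- A tile with an end in column `a + 1` that is longer than one square cannot go below its end
    -- height, but just beside the peak the region only contains strictly lower squares. The single
    -- square is excluded by `htop`.
    have key : x₁ ≤ a ∧ a + 2 ≤ x₂ := by
      by_contra hcon
      by_cases h3 : x₁ = a + 1
      · by_cases h4 : x₂ = a + 1
        · apply htop
          convert ht
          ext ⟨x, y'⟩
          rw [hm, Finset.mem_singleton, Prod.mk.injEq]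
          simp only
          constructor
          · rintro ⟨rfl, rfl⟩
            refine ⟨by omega, by omega, by omega⟩
          · rintro ⟨h5, h6, h7⟩
            have : x = a + 1 := by omega
            subst this
            exact ⟨rfl, by omega⟩
        · have h5 := hs (a + 1) (by omega) (by omega)
          have h6 := hin (a + 2) (by omega) (by omega)
          have h7 := hp (a + 2) (by omega) (by omega)
          rw [h3] at h7
          rw [show a + 1 + 1 = a + 2 by omega] at h5
          omega
      · have h4 : x₂ = a + 1 := by omega
        have h5 := hs a (by omega) (by omega)
        have h6 := hin a (by omega) (by omega)
        have h7 := hp a (by omega) (by omega)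
        rw [h4] at hY
        omega
    have h3 := hs a (by omega) (by omega)
    have h4 := hs (a + 1) (by omega) (by omega)
    have h5 := hin a (by omega) (by omega)
    have h6 := hin (a + 2) (by omega) (by omega)
    rw [show a + 1 + 1 = a + 2 by omega] at h4
    rw [hm, hm]
    refine ⟨⟨by omega, by omega, ?_⟩, by omega, by omega, ?_⟩ <;> simp only <;> omega
  | succ k ih =>
    have hzr := hreg t ht _ hz
    have hz' : (a + 1, y + 2) ∈ region n p q := by
      obtain ⟨h3, h4, h5, h6⟩ := hzr
      simp only at h3 h4 h5 h6
      refine ⟨h3, ?_, ?_, ?_⟩ <;> simp only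
      · omega
      · push_cast at hk; omega
      · rw [Int.odd_iff] at h6 ⊢
        omega
    obtain ⟨t', ht', hzt'⟩ := (hT.union _).1 hz'
    obtain ⟨h3, h4⟩ := ih (y + 2) ht' hzt' (by push_cast at hk; omega)
    obtain ⟨x₁, x₂, Y, hx, hY, hs, hp, hm⟩ := (isDyckTile_iff t).1 (hT.tile t ht)
    have hne : t ≠ t' := by
      rintro rfl
      have h5 := (hm _).1 hz
      have h6 := (hm _).1 hzt'
      simp only at h5 h6
      omega
    -- The tile `t'` one square higher covers the columns `a` and `a + 2`, so by cover-inclusion `t`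
    -- does too. The higher of the two possible squares there already belongs to `t'`, so `t` must
    -- step down on both sides.
    have hc := hT.cover t' ht' t ht ⟨_, hzt', _, hz, rfl, by simp⟩
    have hdis : ∀ z ∈ t, z ∉ t' := fun z h5 h6 =>
      Finset.disjoint_left.1 (hT.disjoint t ht t' ht' hne) h5 h6
    have e1 : a ∈ t.image Prod.fst := hc (Finset.mem_image.2 ⟨_, h3, rfl⟩)
    have e2 : a + 2 ∈ t.image Prod.fst := hc (Finset.mem_image.2 ⟨_, h4, rfl⟩)
    simp only [Finset.mem_image, Prod.exists, exists_and_right, exists_eq_right] at e1 e2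
    obtain ⟨y₁, hy₁⟩ := e1
    obtain ⟨y₂, hy₂⟩ := e2
    have n1 : y₁ ≠ y + 2 - 1 := by
      rintro rfl
      exact hdis _ hy₁ h3
    have n2 : y₂ ≠ y + 2 - 1 := by
      rintro rfl
      exact hdis _ hy₂ h4
    have g0 := (hm _).1 hz
    have g1 := (hm _).1 hy₁
    have g2 := (hm _).1 hy₂
    simp only at g0 g1 g2
    have s1 := hs a (by omega) (by omega)
    have s2 := hs (a + 1) (by omega) (by omega)
    rw [show a + 1 + 1 = a + 2 by omega] at s2
    constructor
    · convert hy₁ using 2; omega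
    · convert hy₂ using 2; omega

/-- The walk `q` with its peak at `a + 1` turned into a valley. -/
def lowerAt (q : ℕ → ℤ) (a : ℕ) : ℕ → ℤ := fun x => if x = a + 1 then q x - 2 else q x

theorem mem_region_lowerAt (ha : a + 2 ≤ n) (hpq : p (a + 1) < q (a + 1))
    (hpar : Even (q (a + 1) - p (a + 1))) (z : ℕ × ℤ) :
    z ∈ region n p q ↔ z = (a + 1, q (a + 1) - 1) ∨ z ∈ region n p (lowerAt q a) := by
  obtain ⟨x, y⟩ := z
  simp only [region, lowerAt, Set.mem_ofPred_eq, Prod.mk.injEq]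
  rw [Int.even_iff] at hpar
  rw [Int.odd_iff]
  by_cases hx : x = a + 1
  · subst hx
    simp only [if_true, true_and]
    omega
  · simp only [if_neg hx]
    omega

/-- Removing the tile that consists of the top square alone is a bijection onto the tilings below
the lowered walk. Putting it back never violates cover-inclusion: it spans one column and nothing
lies above it. -/
theorem ncard_tilings_top (ha : a + 2 ≤ n) (hpq : p (a + 1) < q (a + 1))
    (hpar : Even (q (a + 1) - p (a + 1))) :
    {T | IsCoverInclusiveTiling (region n p q) T ∧ {(a + 1, q (a + 1) - 1)} ∈ T}.ncard =
      walkTilings n p (lowerAt q a) := by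
  set z₀ : ℕ × ℤ := (a + 1, q (a + 1) - 1) with hz₀
  have hreg := mem_region_lowerAt (n := n) ha hpq hpar
  have hnot : z₀ ∉ region n p (lowerAt q a) := by
    rintro ⟨-, -, h, -⟩
    simp only [lowerAt, hz₀, if_true] at h
    omega
  have hnotT : ∀ T, IsCoverInclusiveTiling (region n p (lowerAt q a)) T → ∀ t ∈ T, z₀ ∉ t :=
    fun T hT t ht hz => hnot ((hT.union _).2 ⟨t, ht, hz⟩)
  have htile : IsDyckTile {z₀} := ⟨a + 1, q (a + 1) - 1, 0, fun _ => 0, rfl, rfl, by simp, by simp,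
    by simp [hz₀]⟩
  symm
  refine Set.ncard_congr (fun T _ => insert {z₀} T) ?_ ?_ ?_
  · intro T hT
    have hT' : IsCoverInclusiveTiling (region n p (lowerAt q a)) T := hT
    refine ⟨⟨?_, ?_, ?_, ?_⟩, Finset.mem_insert_self _ _⟩
    · intro t ht
      rcases Finset.mem_insert.1 ht with rfl | ht
      · exact htile
      · exact hT'.tile t ht
    · intro t ht t' ht' hne
      rcases Finset.mem_insert.1 ht with rfl | ht <;> rcases Finset.mem_insert.1 ht' with rfl | ht'
      · exact absurd rfl hne
      · simpa using hnotT T hT' t' ht'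
      · simpa using hnotT T hT' t ht
      · exact hT'.disjoint t ht t' ht' hne
    · intro z
      rw [hreg, hT'.union]
      simp [hz₀]
    · intro t ht t' ht' h
      rcases Finset.mem_insert.1 ht with rfl | ht <;> rcases Finset.mem_insert.1 ht' with rfl | ht'
      · exact le_rfl
      · obtain ⟨z, hz, z', hz', h1, -⟩ := h
        rw [Finset.mem_singleton] at hz
        subst hz
        simp only [Finset.image_singleton, Finset.singleton_subset_iff]
        exact Finset.mem_image.2 ⟨z', hz', h1.symm⟩
      · obtain ⟨z, hz, z', hz', h1, h2⟩ := h
        rw [Finset.mem_singleton] at hz'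
        subst hz'
        exfalso
        have := ((hT'.union z).2 ⟨t, ht, hz⟩).2.2.1
        simp only [lowerAt, h1, hz₀, if_true] at this h2
        omega
      · exact hT'.cover t ht t' ht' h
  · intro T T' hT hT' h
    have h1 : ({z₀} : Finset (ℕ × ℤ)) ∉ T := fun h => hnotT T hT _ h (by simp)
    have h2 : ({z₀} : Finset (ℕ × ℤ)) ∉ T' := fun h => hnotT T' hT' _ h (by simp)
    rw [← Finset.erase_insert h1, ← Finset.erase_insert h2]
    rw [show insert {z₀} T = insert {z₀} T' from h]
  · rintro T ⟨hT, hz⟩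
    refine ⟨T.erase {z₀}, ?_, Finset.insert_erase hz⟩
    have hno : ∀ t ∈ T, t ≠ {z₀} → z₀ ∉ t := fun t ht hne h =>
      hne (tile_unique hT ht hz h (by simp))
    refine ⟨fun t ht => hT.tile t (Finset.mem_of_mem_erase ht), fun t ht t' ht' =>
      hT.disjoint t (Finset.mem_of_mem_erase ht) t' (Finset.mem_of_mem_erase ht'), ?_,
      fun t ht t' ht' => hT.cover t (Finset.mem_of_mem_erase ht) t' (Finset.mem_of_mem_erase ht')⟩
    intro z
    constructor
    · intro h
      obtain ⟨t, ht, hzt⟩ := (hT.union z).1 ((hreg z).2 (Or.inr h))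
      refine ⟨t, Finset.mem_erase.2 ⟨?_, ht⟩, hzt⟩
      rintro rfl
      rw [Finset.mem_singleton] at hzt
      exact hnot (hzt ▸ h)
    · rintro ⟨t, ht, hzt⟩
      obtain ⟨hne, ht⟩ := Finset.mem_erase.1 ht
      rcases (hreg z).1 ((hT.union z).2 ⟨t, ht, hzt⟩) with rfl | h
      · exact absurd hzt (hno t ht hne)
      · exact h

/-! ### Contraction of a peak -/

/-- The map from the columns to those of the contracted region. -/
def collapse (a x : ℕ) : ℕ := if x ≤ a then x else if x = a + 1 then a else x - 2

/-- The section of `collapse` that avoids the columns `a + 1` and `a + 2`. -/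
def skip (a x : ℕ) : ℕ := if x ≤ a then x else x + 2

/-- The height of the inserted peak. -/
def bump (a x : ℕ) : ℤ := if x = a + 1 then 1 else 0

/-- Insert a peak into a tile at the column `a`. -/
def expandTile (a : ℕ) (t : Finset (ℕ × ℤ)) : Finset (ℕ × ℤ) :=
  (t.filter (·.1 ≤ a)) ∪ (t.filter (a ≤ ·.1)).image (fun z => (z.1 + 2, z.2)) ∪
    (t.filter (·.1 = a)).image (fun z => (a + 1, z.2 + 1))

/-- Remove a peak from a tile. -/
def contractTile (a : ℕ) (t : Finset (ℕ × ℤ)) : Finset (ℕ × ℤ) :=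
  (t.filter (·.1 ≤ a)) ∪ (t.filter (a + 2 < ·.1)).image (fun z => (z.1 - 2, z.2))

theorem mem_expandTile (a : ℕ) (t : Finset (ℕ × ℤ)) (z : ℕ × ℤ) :
    z ∈ expandTile a t ↔ (collapse a z.1, z.2 - bump a z.1) ∈ t := by
  obtain ⟨x, y⟩ := z
  simp only [expandTile, Finset.mem_union, Finset.mem_filter, Finset.mem_image, Prod.mk.injEq,
    Prod.exists, collapse, bump]
  rcases lt_trichotomy x (a + 1) with h | rfl | h
  · rw [if_pos (by omega), if_neg (by omega), sub_zero]
    constructor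
    · rintro ((⟨h1, -⟩ | ⟨x', y', ⟨-, h1⟩, h2, -⟩) | ⟨x', y', -, h1, -⟩)
      · exact h1
      · omega
      · omega
    · intro h1
      exact Or.inl (Or.inl ⟨h1, by omega⟩)
  · rw [if_neg (by omega), if_pos rfl, if_pos rfl]
    constructor
    · rintro ((⟨h1, h2⟩ | ⟨x', y', ⟨-, h1⟩, h2, -⟩) | ⟨x', y', ⟨h1, rfl⟩, -, rfl⟩)
      · omega
      · omega
      · simpa using h1
    · intro h1
      exact Or.inr ⟨a, y - 1, ⟨h1, rfl⟩, rfl, by omega⟩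
  · rw [if_neg (by omega), if_neg (by omega), if_neg (by omega), sub_zero]
    constructor
    · rintro ((⟨h1, h2⟩ | ⟨x', y', ⟨h1, -⟩, rfl, rfl⟩) | ⟨x', y', ⟨h1, rfl⟩, h2, rfl⟩)
      · omega
      · simpa using h1
      · omega
    · intro h1
      exact Or.inl (Or.inr ⟨x - 2, y, ⟨h1, by omega⟩, by omega, rfl⟩)

theorem mem_contractTile (a : ℕ) (t : Finset (ℕ × ℤ)) (z : ℕ × ℤ) :
    z ∈ contractTile a t ↔ (skip a z.1, z.2) ∈ t := by
  obtain ⟨x, y⟩ := z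
  simp only [contractTile, Finset.mem_union, Finset.mem_filter, Finset.mem_image, Prod.mk.injEq,
    Prod.exists, skip]
  by_cases h : x ≤ a
  · rw [if_pos h]
    constructor
    · rintro (⟨h1, -⟩ | ⟨x', y', ⟨-, h1⟩, h2, -⟩)
      · exact h1
      · omega
    · intro h1
      exact Or.inl ⟨h1, h⟩
  · rw [if_neg h]
    constructor
    · rintro (⟨-, h1⟩ | ⟨x', y', ⟨h1, h2⟩, rfl, rfl⟩)
      · omega
      · rwa [show x' - 2 + 2 = x' by omega]
    · intro h1
      exact Or.inr ⟨x + 2, y, ⟨h1, by omega⟩, by omega, rfl⟩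

theorem collapse_skip (a x : ℕ) : collapse a (skip a x) = x := by
  unfold collapse skip
  split_ifs <;> omega

theorem bump_skip (a x : ℕ) : bump a (skip a x) = 0 := by
  unfold bump skip
  split_ifs <;> omega

theorem contractTile_expandTile (a : ℕ) (t : Finset (ℕ × ℤ)) :
    contractTile a (expandTile a t) = t := by
  ext z
  rw [mem_contractTile, mem_expandTile]
  simp [collapse_skip, bump_skip]

theorem image_fst_expandTile (a : ℕ) (t : Finset (ℕ × ℤ)) (x : ℕ) :
    x ∈ (expandTile a t).image Prod.fst ↔ collapse a x ∈ t.image Prod.fst := by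
  simp only [Finset.mem_image, Prod.exists, exists_and_right, exists_eq_right, mem_expandTile]
  exact ⟨fun ⟨y, h⟩ => ⟨_, h⟩, fun ⟨y, h⟩ => ⟨y + bump a x, by simpa using h⟩⟩

theorem image_fst_contractTile (a : ℕ) (t : Finset (ℕ × ℤ)) (x : ℕ) :
    x ∈ (contractTile a t).image Prod.fst ↔ skip a x ∈ t.image Prod.fst := by
  simp only [Finset.mem_image, Prod.exists, exists_and_right, exists_eq_right, mem_contractTile]

theorem isDyckTile_expandTile {t : Finset (ℕ × ℤ)} (ht : IsDyckTile t) (a : ℕ) :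
    IsDyckTile (expandTile a t) := by
  obtain ⟨x₁, x₂, Y, hx, hY, hs, hp, hm⟩ := (isDyckTile_iff t).1 ht
  rw [isDyckTile_iff]
  -- Column `a` is replaced by the three columns `a`, `a + 1`, `a + 2`. A tile starting at `a` keeps
  -- its start, while a tile ending at `a` has its end moved to `a + 2`; hence one inequality is
  -- weak and the other strict.
  refine ⟨if x₁ ≤ a then x₁ else x₁ + 2, if x₂ < a then x₂ else x₂ + 2,
    fun x => Y (collapse a x) + bump a x, ?_, ?_, ?_, ?_, ?_⟩
  · split_ifs <;> omega
  · have e1 : collapse a (if x₂ < a then x₂ else x₂ + 2) = x₂ := by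
      unfold collapse; split_ifs <;> omega
    have e2 : collapse a (if x₁ ≤ a then x₁ else x₁ + 2) = x₁ := by
      unfold collapse; split_ifs <;> omega
    have e3 : bump a (if x₂ < a then x₂ else x₂ + 2) = 0 := by
      unfold bump; split_ifs <;> omega
    have e4 : bump a (if x₁ ≤ a then x₁ else x₁ + 2) = 0 := by
      unfold bump; split_ifs <;> omega
    simp only [e1, e2, e3, e4, hY]
  · intro x h1 h2
    simp only [collapse, bump]
    rcases lt_trichotomy x a with h | h | h
    · have := hs x (by split_ifs at h1 <;> omega) (by split_ifs at h2 <;> omega)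
      simp only [if_pos (show x + 1 ≤ a by omega), if_pos (show x ≤ a by omega),
        if_neg (show ¬ x + 1 = a + 1 by omega), if_neg (show ¬ x = a + 1 by omega)]
      omega
    · subst h
      simp
    · rcases Nat.lt_or_ge x (a + 2) with h3 | h3
      · have : x = a + 1 := by omega
        subst this
        simp
      · have := hs (x - 2) (by split_ifs at h1 <;> omega) (by split_ifs at h2 <;> omega)
        rw [if_neg (by omega), if_neg (by omega), if_neg (by omega), if_neg (by omega),
          if_neg (by omega), if_neg (by omega), show x + 1 - 2 = x - 2 + 1 by omega]
        omega
  · intro x h1 h2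
    have e2 : collapse a (if x₁ ≤ a then x₁ else x₁ + 2) = x₁ := by
      unfold collapse; split_ifs <;> omega
    have e4 : bump a (if x₁ ≤ a then x₁ else x₁ + 2) = 0 := by
      unfold bump; split_ifs <;> omega
    simp only [e2, e4]
    have h3 : x₁ ≤ collapse a x ∧ collapse a x ≤ x₂ := by
      unfold collapse
      split_ifs at h1 h2 ⊢ <;> omega
    have := hp (collapse a x) h3.1 h3.2
    have hb : 0 ≤ bump a x := by unfold bump; split_ifs <;> omega
    omega
  · rintro ⟨x, y⟩
    rw [mem_expandTile, hm]
    simp only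
    have e : x₁ ≤ collapse a x ∧ collapse a x ≤ x₂ ↔
        (if x₁ ≤ a then x₁ else x₁ + 2) ≤ x ∧ x ≤ (if x₂ < a then x₂ else x₂ + 2) := by
      unfold collapse
      split_ifs <;> omega
    rw [← and_assoc, e, and_assoc]
    apply and_congr_right
    intro _
    apply and_congr_right
    intro _
    omega

theorem isDyckTile_contractTile {t : Finset (ℕ × ℤ)} (ht : IsDyckTile t) {a : ℕ}
    (h1 : ∀ y, (a + 1, y) ∈ t ↔ (a, y - 1) ∈ t)
    (h2 : ∀ y, (a + 1, y) ∈ t ↔ (a + 2, y - 1) ∈ t) :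
    IsDyckTile (contractTile a t) := by
  obtain ⟨x₁, x₂, Y, hx, hY, hs, hp, hm⟩ := (isDyckTile_iff t).1 ht
  -- A tile that meets one of the three columns passes through all of them and has its peak there,
  -- so cutting out two columns joins equal heights.
  have g1 : x₁ ≤ a + 2 → a ≤ x₂ → x₁ ≤ a ∧ a + 2 ≤ x₂ ∧ Y (a + 2) = Y a := by
    intro h3 h4
    have h5 : ∃ y, (a + 1, y) ∈ t := by
      rcases Nat.lt_or_ge a x₁ with h | h
      · rcases Nat.lt_or_ge (a + 1) x₁ with h' | h'
        · refine ⟨Y (a + 2) + 1, (h2 _).2 ((hm _).2 ?_)⟩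
          refine ⟨?_, ?_, ?_⟩ <;> simp only <;> omega
        · refine ⟨Y (a + 1), (hm _).2 ?_⟩
          refine ⟨?_, ?_, ?_⟩ <;> simp only <;> omega
      · refine ⟨Y a + 1, (h1 _).2 ((hm _).2 ?_)⟩
        refine ⟨?_, ?_, ?_⟩ <;> simp only <;> omega
    obtain ⟨y, hy⟩ := h5
    have h6 := (hm _).1 ((h1 _).1 hy)
    have h7 := (hm _).1 ((h2 _).1 hy)
    simp only at h6 h7
    omega
  rw [isDyckTile_iff]
  refine ⟨if x₁ ≤ a then x₁ else x₁ - 2, if x₂ < a then x₂ else x₂ - 2,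
    fun x => Y (skip a x), ?_, ?_, ?_, ?_, ?_⟩
  · split_ifs <;> omega
  · by_cases h3 : x₁ ≤ a + 2 ∧ a ≤ x₂
    · obtain ⟨h4, h5, h6⟩ := g1 h3.1 h3.2
      rw [if_pos h4, if_neg (by omega)]
      simp only [skip]
      by_cases h7 : x₂ = a + 2
      · rw [if_pos (by omega), if_pos h4, show x₂ - 2 = a by omega, ← h6, ← h7, hY]
      · rw [if_neg (by omega), if_pos h4, show x₂ - 2 + 2 = x₂ by omega, hY]
    · simp only [skip]
      rcases Nat.lt_or_ge x₂ a with h4 | h4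
      · simp only [if_pos h4, if_pos (show x₂ ≤ a by omega), if_pos (show x₁ ≤ a by omega), hY]
      · simp only [if_neg (show ¬ x₂ < a by omega), if_neg (show ¬ x₁ ≤ a by omega),
          if_neg (show ¬ x₂ - 2 ≤ a by omega), if_neg (show ¬ x₁ - 2 ≤ a by omega),
          show x₂ - 2 + 2 = x₂ by omega, show x₁ - 2 + 2 = x₁ by omega, hY]
  · intro x h3 h4
    simp only [skip]
    rcases lt_trichotomy x a with h | h | h
    · rw [if_pos (by omega), if_pos (by omega)]
      exact hs x (by split_ifs at h3 <;> omega) (by split_ifs at h4 <;> omega)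
    · subst h
      rw [if_neg (by omega), if_pos le_rfl]
      obtain ⟨h5, h6, h7⟩ := g1 (by split_ifs at h3 <;> omega) (by split_ifs at h4 <;> omega)
      rw [← h7, show x + 1 + 2 = x + 2 + 1 by omega]
      exact hs (x + 2) (by omega) (by split_ifs at h4 <;> omega)
    · rw [if_neg (by omega), if_neg (by omega), show x + 1 + 2 = x + 2 + 1 by omega]
      exact hs (x + 2) (by split_ifs at h3 <;> omega) (by split_ifs at h4 <;> omega)
  · intro x h3 h4
    have e : skip a (if x₁ ≤ a then x₁ else x₁ - 2) = x₁ := by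
      unfold skip
      by_cases h5 : x₁ ≤ a + 2 ∧ a ≤ x₂
      · rw [if_pos (g1 h5.1 h5.2).1, if_pos (g1 h5.1 h5.2).1]
      · split_ifs <;> omega
    simp only [e]
    apply hp
    · unfold skip; split_ifs at h3 ⊢ <;> omega
    · unfold skip; split_ifs at h4 ⊢ <;> omega
  · rintro ⟨x, y⟩
    rw [mem_contractTile, hm]
    simp only
    have e : x₁ ≤ skip a x ∧ skip a x ≤ x₂ ↔
        (if x₁ ≤ a then x₁ else x₁ - 2) ≤ x ∧ x ≤ (if x₂ < a then x₂ else x₂ - 2) := by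
      unfold skip
      by_cases h5 : x₁ ≤ a + 2 ∧ a ≤ x₂
      · obtain ⟨h6, h7, h8⟩ := g1 h5.1 h5.2
        split_ifs <;> omega
      · split_ifs <;> omega
    rw [← and_assoc, e, and_assoc]

theorem mem_region_skip (ha : a ≤ n) (h1 : q (a + 1) = q a + 1) (h2 : q (a + 2) = q a)
    (h3 : p (a + 1) = p a + 1) (h4 : p (a + 2) = p a) (z : ℕ × ℤ) :
    z ∈ region (n + 2) p q ↔ (collapse a z.1, z.2 - bump a z.1) ∈
      region n (fun x => p (skip a x)) (fun x => q (skip a x)) := by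
  obtain ⟨x, y⟩ := z
  simp only [region, Set.mem_ofPred_eq]
  by_cases h5 : x = a + 1
  · subst h5
    simp only [collapse, bump, skip, if_true, if_neg (show ¬ a + 1 ≤ a by omega), le_refl, h1, h3]
    rw [show y - (p a + 1) = y - 1 - p a by ring]
    refine and_congr (by omega) (and_congr (by omega) (and_congr (by omega) Iff.rfl))
  · by_cases h6 : x = a + 2
    · subst h6
      simp only [collapse, bump, skip, if_neg h5, if_neg (show ¬ a + 2 ≤ a by omega),
        show a + 2 - 2 = a by omega, le_refl, if_true, h2, h4, sub_zero]
      refine and_congr (by omega) Iff.rfl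
    · have e : skip a (collapse a x) = x := by
        unfold skip collapse; split_ifs <;> omega
      have e2 : bump a x = 0 := by
        unfold bump; rw [if_neg h5]
      rw [e, e2, sub_zero]
      refine and_congr ?_ Iff.rfl
      unfold collapse
      split_ifs <;> omega

/-- By `tile_peak` all tiles over the peak have peaks there themselves, so the peak can be
contracted simultaneously in both walks and in every tile. Inserting it again is the inverse
operation. -/
theorem ncard_tilings_peak (ha : a ≤ n) (h1 : q (a + 1) = q a + 1) (h2 : q (a + 2) = q a)
    (h3 : p (a + 1) = p a + 1) (h4 : p (a + 2) = p a) (hpar : Even (q (a + 1) - p (a + 1))) :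
    {T | IsCoverInclusiveTiling (region (n + 2) p q) T ∧ {(a + 1, q (a + 1) - 1)} ∉ T}.ncard =
      walkTilings n (fun x => p (skip a x)) (fun x => q (skip a x)) := by
  have hreg := mem_region_skip (n := n) ha h1 h2 h3 h4
  have hinj : Function.Injective (expandTile a) := fun t t' h => by
    rw [← contractTile_expandTile a t, h, contractTile_expandTile]
  symm
  refine Set.ncard_congr (fun T _ => T.image (expandTile a)) ?_ ?_ ?_
  · intro T hT
    have hT' : IsCoverInclusiveTiling (region n (fun x => p (skip a x)) (fun x => q (skip a x))) T :=
      hT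
    refine ⟨⟨?_, ?_, ?_, ?_⟩, ?_⟩
    · intro t ht
      obtain ⟨r, hr, rfl⟩ := Finset.mem_image.1 ht
      exact isDyckTile_expandTile (hT'.tile r hr) a
    · intro t ht t' ht' hne
      obtain ⟨r, hr, rfl⟩ := Finset.mem_image.1 ht
      obtain ⟨r', hr', rfl⟩ := Finset.mem_image.1 ht'
      rw [Finset.disjoint_left]
      intro z hz hz'
      rw [mem_expandTile] at hz hz'
      exact hne (by rw [tile_unique hT' hr hr' hz hz'])
    · intro z
      rw [hreg, hT'.union]
      simp only [Finset.mem_image, exists_exists_and_eq_and, mem_expandTile]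
    · intro t ht t' ht' h
      obtain ⟨r, hr, rfl⟩ := Finset.mem_image.1 ht
      obtain ⟨r', hr', rfl⟩ := Finset.mem_image.1 ht'
      obtain ⟨z, hz, z', hz', h5, h6⟩ := h
      rw [mem_expandTile] at hz hz'
      have := hT'.cover r hr r' hr' ⟨_, hz, _, hz', by simp [h5], by simpa [h5] using h6⟩
      intro x hx
      rw [image_fst_expandTile] at hx ⊢
      exact this hx
    · intro h
      obtain ⟨t, ht, h⟩ := Finset.mem_image.1 h
      have h5 : ((a + 1, q (a + 1) - 1) : ℕ × ℤ) ∈ expandTile a t := by rw [h]; simp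
      -- An expanded tile through the top square also contains the neighbour below it on the left,
      -- hence is not a single square.
      have h6 : ((a, q (a + 1) - 1 - 1) : ℕ × ℤ) ∈ expandTile a t := by
        rw [mem_expandTile] at h5 ⊢
        simpa [collapse, bump] using h5
      rw [h, Finset.mem_singleton, Prod.mk.injEq] at h6
      omega
  · intro T T' _ _ h
    exact Finset.image_injective hinj h
  · rintro T ⟨hT, htop⟩
    have hpk := fun y {t} ht hz =>
      tile_peak (n := n + 2) (a := a) (p := p) (q := q) h1 h2 hpar hT htop y (t := t) ht hz
    have hcol : ∀ y, (a, y - 1) ∈ region (n + 2) p q ↔ (a + 1, y) ∈ region (n + 2) p q := by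
      intro y
      rw [hreg, hreg]
      simp [collapse, bump]
    have hcol' : ∀ y, (a + 2, y - 1) ∈ region (n + 2) p q ↔ (a + 1, y) ∈ region (n + 2) p q := by
      intro y
      rw [hreg, hreg]
      simp [collapse, bump]
    have c1 : ∀ t ∈ T, ∀ y, (a + 1, y) ∈ t ↔ (a, y - 1) ∈ t := by
      intro t ht y
      refine ⟨fun h => (hpk y ht h).1, fun h => ?_⟩
      obtain ⟨t', ht', h'⟩ := (hT.union _).1 ((hcol y).1 ((hT.union _).2 ⟨t, ht, h⟩))
      rwa [tile_unique hT ht ht' h (hpk y ht' h').1]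
    have c2 : ∀ t ∈ T, ∀ y, (a + 1, y) ∈ t ↔ (a + 2, y - 1) ∈ t := by
      intro t ht y
      refine ⟨fun h => (hpk y ht h).2, fun h => ?_⟩
      obtain ⟨t', ht', h'⟩ := (hT.union _).1 ((hcol' y).1 ((hT.union _).2 ⟨t, ht, h⟩))
      rwa [tile_unique hT ht ht' h (hpk y ht' h').2]
    have hec : ∀ t ∈ T, expandTile a (contractTile a t) = t := by
      intro t ht
      ext ⟨x, y⟩
      rw [mem_expandTile, mem_contractTile]
      simp only
      by_cases h5 : x = a + 1
      · subst h5
        rw [c1 t ht]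
        simp [collapse, bump, skip]
      · by_cases h6 : x = a + 2
        · subst h6
          have e1 := c1 t ht (y + 1)
          have e2 := c2 t ht (y + 1)
          simp only [add_sub_cancel_right] at e1 e2
          rw [← e2, e1]
          simp [collapse, bump, skip]
        · have e : skip a (collapse a x) = x := by
            unfold skip collapse; split_ifs <;> omega
          have e2 : bump a x = 0 := by
            unfold bump; rw [if_neg h5]
          rw [e, e2, sub_zero]
    refine ⟨T.image (contractTile a), ⟨?_, ?_, ?_, ?_⟩, ?_⟩
    · intro t ht
      obtain ⟨r, hr, rfl⟩ := Finset.mem_image.1 ht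
      exact isDyckTile_contractTile (hT.tile r hr) (c1 r hr) (c2 r hr)
    · intro t ht t' ht' hne'
      obtain ⟨r, hr, rfl⟩ := Finset.mem_image.1 ht
      obtain ⟨r', hr', rfl⟩ := Finset.mem_image.1 ht'
      rw [Finset.disjoint_left]
      intro z hz hz'
      rw [mem_contractTile] at hz hz'
      exact hne' (by rw [tile_unique hT hr hr' hz hz'])
    · intro z
      have e : z ∈ region n (fun x => p (skip a x)) (fun x => q (skip a x)) ↔
          (skip a z.1, z.2) ∈ region (n + 2) p q := by
        rw [hreg]
        simp [collapse_skip, bump_skip]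
      rw [e, hT.union]
      simp only [Finset.mem_image, exists_exists_and_eq_and, mem_contractTile]
    · intro t ht t' ht' h
      obtain ⟨r, hr, rfl⟩ := Finset.mem_image.1 ht
      obtain ⟨r', hr', rfl⟩ := Finset.mem_image.1 ht'
      obtain ⟨z, hz, z', hz', h5, h6⟩ := h
      rw [mem_contractTile] at hz hz'
      have := hT.cover r hr r' hr' ⟨_, hz, _, hz', by simp [h5], by simpa [h5] using h6⟩
      intro x hx
      rw [image_fst_contractTile] at hx ⊢
      exact this hx
    · simp only [Finset.image_image]
      ext t
      simp only [Finset.mem_image, Function.comp]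
      constructor
      · rintro ⟨t', ht', rfl⟩
        rwa [hec t' ht']
      · intro ht
        exact ⟨t, ht, hec t ht⟩

/-- Otherwise `tile_peak` applies to the lowest square of the column `a + 1`: its tile has squares
one unit lower on both sides, and these lie above `p`, so `p` would have a peak as well. -/
theorem top_mem_of_not_peak (ha : a + 2 ≤ n) (h1 : q (a + 1) = q a + 1) (h2 : q (a + 2) = q a)
    (hpq : p (a + 1) < q (a + 1)) (hpar : Even (q (a + 1) - p (a + 1)))
    (hstep : p (a + 1) = p a + 1 ∨ p (a + 1) = p a - 1)
    (hstep' : p (a + 2) = p (a + 1) + 1 ∨ p (a + 2) = p (a + 1) - 1)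
    (hp : ¬ (p (a + 1) = p a + 1 ∧ p (a + 2) = p a))
    {T : Finset (Finset (ℕ × ℤ))} (hT : IsCoverInclusiveTiling (region n p q) T) :
    {(a + 1, q (a + 1) - 1)} ∈ T := by
  by_contra htop
  have hz : (a + 1, p (a + 1) + 1) ∈ region n p q := by
    rw [Int.even_iff] at hpar
    refine ⟨?_, ?_, ?_, ?_⟩ <;> simp only
    · omega
    · omega
    · omega
    · rw [Int.odd_iff]; omega
  obtain ⟨t, ht, hzt⟩ := (hT.union _).1 hz
  obtain ⟨h5, h6⟩ := tile_peak h1 h2 hpar hT htop _ ht hzt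
  have h7 := ((hT.union _).2 ⟨t, ht, h5⟩).2.1
  have h8 := ((hT.union _).2 ⟨t, ht, h6⟩).2.1
  simp only at h7 h8
  omega

/-- The recursion for the number of cover-inclusive tilings at a peak of the upper walk. -/
theorem walkTilings_recursion (ha : a ≤ n) (h1 : q (a + 1) = q a + 1) (h2 : q (a + 2) = q a)
    (hpq : p (a + 1) ≤ q (a + 1))
    (hpq' : p a ≤ q a) (hpq'' : p (a + 2) ≤ q (a + 2)) (hpar : Even (q (a + 1) - p (a + 1)))
    (hstep : p (a + 1) = p a + 1 ∨ p (a + 1) = p a - 1)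
    (hstep' : p (a + 2) = p (a + 1) + 1 ∨ p (a + 2) = p (a + 1) - 1) :
    walkTilings (n + 2) p q =
      (if p (a + 1) < q (a + 1) then walkTilings (n + 2) p (lowerAt q a) else 0) +
      (if p (a + 1) = p a + 1 ∧ p (a + 2) = p a then
        walkTilings n (fun x => p (skip a x)) (fun x => q (skip a x)) else 0) := by
  have hfin := tilings_finite (region_finite (n + 2) p q)
  have hsplit : walkTilings (n + 2) p q =
      {T | IsCoverInclusiveTiling (region (n + 2) p q) T ∧ {(a + 1, q (a + 1) - 1)} ∈ T}.ncard +
      {T | IsCoverInclusiveTiling (region (n + 2) p q) T ∧ {(a + 1, q (a + 1) - 1)} ∉ T}.ncard := by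
    rw [← Set.ncard_union_eq ?_ (hfin.subset fun T h => h.1) (hfin.subset fun T h => h.1)]
    · unfold walkTilings
      congr 1
      ext T
      simp only [Set.mem_ofPred_eq, Set.mem_union]
      tauto
    · rw [Set.disjoint_left]
      rintro T ⟨-, h⟩ ⟨-, h'⟩
      exact h' h
  rw [hsplit]
  congr 1
  · split_ifs with h
    · exact ncard_tilings_top (by omega) h hpar
    · rw [Set.ncard_eq_zero (hfin.subset fun T h => h.1), Set.eq_empty_iff_forall_notMem]
      rintro T ⟨hT, hz⟩
      have := ((hT.union (a + 1, q (a + 1) - 1)).2 ⟨_, hz, by simp⟩).2.1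
      simp only at this
      omega
  · split_ifs with h
    · exact ncard_tilings_peak ha h1 h2 h.1 h.2 hpar
    · rw [Set.ncard_eq_zero (hfin.subset fun T h => h.1), Set.eq_empty_iff_forall_notMem]
      rintro T ⟨hT, hz⟩
      refine hz (top_mem_of_not_peak (by omega) h1 h2 (lt_of_le_of_ne hpq ?_) hpar hstep hstep' h hT)
      -- If the walks meet at the peak of `q`, then `p ≤ q` on both sides forces a peak of `p`.
      intro heq
      omega

end Peak

theorem walkTilings_zero (p q : ℕ → ℤ) (h : p 0 = q 0) : walkTilings 0 p q = 1 := by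
  have hD : region 0 p q = ∅ := by
    rw [Set.eq_empty_iff_forall_notMem]
    rintro ⟨x, y⟩ ⟨h1, h2, h3, -⟩
    simp only at h1 h2 h3
    obtain rfl : x = 0 := by omega
    omega
  unfold walkTilings
  rw [hD, Set.ncard_eq_one]
  refine ⟨∅, ?_⟩
  ext T
  simp only [Set.mem_ofPred_eq, Set.mem_singleton_iff]
  constructor
  · intro hT
    rw [Finset.eq_empty_iff_forall_notMem]
    intro t ht
    obtain ⟨x₁, x₂, Y, hx, -, -, -, hm⟩ := (isDyckTile_iff t).1 (hT.tile t ht)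
    exact (hT.union (x₁, Y x₁)).2 ⟨t, ht, (hm _).2 ⟨le_rfl, hx, rfl⟩⟩
  · rintro rfl
    exact ⟨by simp, by simp, by simp, by simp⟩


/-! ### Words and their walks -/

/-- The walk of a word of up-steps (`true`) and down-steps (`false`). -/
def wordWalk {n : ℕ} (w : Fin n → Bool) (x : ℕ) : ℤ :=
  ∑ a : Fin n, if a.val < x then (if w a then 1 else -1) else 0

/-- The word of the Dyck path of a link pattern. -/
def LinkPattern.word {n : ℕ} (β : LinkPattern n) (a : Fin n) : Bool := decide (a < β.partner a)

theorem LinkPattern.walk_eq {n : ℕ} (β : LinkPattern n) : β.walk = wordWalk β.word := by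
  funext x
  simp [LinkPattern.walk, wordWalk, LinkPattern.word]

theorem wordWalk_zero {n : ℕ} (w : Fin n → Bool) : wordWalk w 0 = 0 := by simp [wordWalk]

theorem wordWalk_succ {n : ℕ} (w : Fin n → Bool) (x : ℕ) :
    wordWalk w (x + 1) = wordWalk w x +
      if h : x < n then (if w ⟨x, h⟩ then 1 else -1) else 0 := by
  unfold wordWalk
  rw [← sub_eq_iff_eq_add', ← Finset.sum_sub_distrib]
  have : ∀ a : Fin n, ((if a.val < x + 1 then (if w a then (1 : ℤ) else -1) else 0) -
      if a.val < x then (if w a then 1 else -1) else 0) =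
      if a.val = x then (if w a then 1 else -1) else 0 := by
    intro a
    rcases lt_trichotomy a.val x with h | h | h
    · simp only [if_pos (show a.val < x + 1 by omega), if_pos h, if_neg h.ne, sub_self]
    · simp only [if_pos (show a.val < x + 1 by omega), if_neg h.not_lt, if_pos h, sub_zero]
    · simp only [if_neg (show ¬ a.val < x + 1 by omega), if_neg h.not_gt, if_neg h.ne', sub_zero]
  simp only [this]
  split_ifs with h h'
  · rw [Finset.sum_eq_single ⟨x, h⟩]
    · simp [h']
    · intro b _ hb
      rw [if_neg fun hbx => hb (Fin.ext hbx)]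
    · simp
  · rw [Finset.sum_eq_single ⟨x, h⟩]
    · simp [h']
    · intro b _ hb
      rw [if_neg fun hbx => hb (Fin.ext hbx)]
    · simp
  · exact Finset.sum_eq_zero fun b _ => if_neg (by omega)

theorem wordWalk_step {n : ℕ} (w : Fin n → Bool) {x : ℕ} (hx : x < n) :
    wordWalk w (x + 1) = wordWalk w x + 1 ∨ wordWalk w (x + 1) = wordWalk w x - 1 := by
  rw [wordWalk_succ, dif_pos hx]
  split_ifs
  · exact Or.inl rfl
  · exact Or.inr rfl

theorem even_wordWalk_sub {n : ℕ} (w w' : Fin n → Bool) (x : ℕ) :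
    Even (wordWalk w x - wordWalk w' x) := by
  induction x with
  | zero => simp [wordWalk_zero]
  | succ x ih =>
    rw [wordWalk_succ, wordWalk_succ]
    rw [Int.even_iff] at ih ⊢
    split_ifs <;> omega

/-! ### Inserting and deleting a link between neighbours -/

section Insert

variable {n : ℕ}

theorem otherPoint_val (a : Fin (n + 1)) (i : Fin n) :
    (otherPoint a i).val = if i.val < a.val then i.val else i.val + 2 := by
  simp only [otherPoint, Fin.succAbove, Fin.lt_def, Fin.val_castSucc]
  split_ifs <;> simp_all <;> omega

theorem otherPoint_strictMono (a : Fin (n + 1)) : StrictMono (otherPoint a) :=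
  (Fin.strictMono_succAbove _).comp (Fin.strictMono_succAbove _)

theorem otherPoint_ne_castSucc (a : Fin (n + 1)) (i : Fin n) : otherPoint a i ≠ a.castSucc := by
  intro h
  have := congrArg Fin.val h
  rw [otherPoint_val, Fin.val_castSucc] at this
  split_ifs at this <;> omega

theorem otherPoint_ne_succ (a : Fin (n + 1)) (i : Fin n) : otherPoint a i ≠ a.succ := by
  intro h
  have := congrArg Fin.val h
  rw [otherPoint_val, Fin.val_succ] at this
  split_ifs at this <;> omega

theorem eq_or_eq_otherPoint (a : Fin (n + 1)) (x : Fin (n + 2)) :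
    x = a.castSucc ∨ x = a.succ ∨ ∃ i, x = otherPoint a i := by
  by_cases h : x = a.castSucc
  · exact Or.inl h
  · obtain ⟨y, rfl⟩ := Fin.exists_succAbove_eq h
    by_cases h' : y = a
    · subst h'
      exact Or.inr (Or.inl (Fin.succAbove_castSucc_self _))
    · obtain ⟨i, rfl⟩ := Fin.exists_succAbove_eq h'
      exact Or.inr (Or.inr ⟨i, rfl⟩)

theorem sum_pair_otherPoint {M : Type*} [AddCommMonoid M] (a : Fin (n + 1)) (f : Fin (n + 2) → M) :
    ∑ k, f k = f a.castSucc + f a.succ + ∑ i, f (otherPoint a i) := by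
  rw [Fin.sum_univ_succAbove f a.castSucc, Fin.sum_univ_succAbove _ a,
    Fin.succAbove_castSucc_self, add_assoc]
  rfl

theorem prod_pair_otherPoint {M : Type*} [CommMonoid M] (a : Fin (n + 1)) (f : Fin (n + 2) → M) :
    ∏ k, f k = f a.castSucc * f a.succ * ∏ i, f (otherPoint a i) := by
  rw [Fin.prod_univ_succAbove f a.castSucc, Fin.prod_univ_succAbove _ a,
    Fin.succAbove_castSucc_self, mul_assoc]
  rfl

/-- Two opposite neighbouring steps, in either order, do not change the height after them; this
expresses the contraction of walks on the level of words. -/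
theorem wordWalk_comp_otherPoint (a : Fin (n + 1)) (w : Fin (n + 2) → Bool)
    (h : w a.castSucc = !w a.succ) (x : ℕ) :
    wordWalk (w ∘ otherPoint a) x = wordWalk w (skip a x) := by
  unfold wordWalk
  rw [sum_pair_otherPoint a]
  have h1 : (if a.castSucc.val < skip a x then (if w a.castSucc then (1 : ℤ) else -1) else 0) +
      (if a.succ.val < skip a x then (if w a.succ then 1 else -1) else 0) = 0 := by
    rw [h, Fin.val_castSucc, Fin.val_succ]
    unfold skip
    split_ifs <;> simp_all <;> omega
  rw [h1, zero_add]
  refine Finset.sum_congr rfl fun i _ => ?_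
  have h2 : i.val < x ↔ (otherPoint a i).val < skip a x := by
    rw [otherPoint_val]
    unfold skip
    split_ifs <;> omega
  simp only [h2, Function.comp]

theorem wordWalk_comp_swap (a : Fin (n + 1)) (w : Fin (n + 2) → Bool)
    (h1 : w a.castSucc = true) (h2 : w a.succ = false) :
    wordWalk (w ∘ Equiv.swap a.castSucc a.succ) = lowerAt (wordWalk w) a := by
  have e1 : ∀ h : a.val < n + 2, (⟨a.val, h⟩ : Fin (n + 2)) = a.castSucc := fun _ => rfl
  have e2 : ∀ h : a.val + 1 < n + 2, (⟨a.val + 1, h⟩ : Fin (n + 2)) = a.succ := fun _ => rfl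
  funext x
  unfold lowerAt
  induction x with
  | zero => simp [wordWalk_zero]
  | succ x ih =>
    rw [wordWalk_succ, wordWalk_succ w, ih]
    by_cases h3 : x = a.val
    · subst h3
      rw [dif_pos (by omega), dif_pos (by omega), e1]
      simp [h1, h2]
      ring
    · by_cases h4 : x = a.val + 1
      · subst h4
        rw [dif_pos (by omega), dif_pos (by omega), e2]
        simp [h1, h2]
        ring
      · rw [if_neg h4, if_neg (by omega)]
        congr 1
        split_ifs with h5 h6 h7 h7 <;> try rfl
        · exfalso
          rw [Function.comp, Equiv.swap_apply_of_ne_of_ne] at h6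
          · exact h7 h6
          · exact fun h => h3 (congrArg Fin.val h)
          · exact fun h => h4 (congrArg Fin.val h)
        · exfalso
          rw [Function.comp, Equiv.swap_apply_of_ne_of_ne] at h6
          · exact h6 h7
          · exact fun h => h3 (congrArg Fin.val h)
          · exact fun h => h4 (congrArg Fin.val h)

/-- The partner function after inserting a link between `a` and `a + 1`. -/
def insertPartner (β : LinkPattern n) (a : Fin (n + 1)) (x : Fin (n + 2)) : Fin (n + 2) :=
  match finSuccEquiv' a.castSucc x with
  | none => a.succ
  | some y => match finSuccEquiv' a y with
    | none => a.castSucc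
    | some i => otherPoint a (β.partner i)

theorem insertPartner_castSucc (β : LinkPattern n) (a : Fin (n + 1)) :
    insertPartner β a a.castSucc = a.succ := by
  simp [insertPartner]

theorem insertPartner_succ (β : LinkPattern n) (a : Fin (n + 1)) :
    insertPartner β a a.succ = a.castSucc := by
  have : finSuccEquiv' a.castSucc a.succ = some a := by
    conv_lhs => rw [← Fin.succAbove_castSucc_self a, finSuccEquiv'_succAbove]
  simp [insertPartner, this]

theorem insertPartner_otherPoint (β : LinkPattern n) (a : Fin (n + 1)) (i : Fin n) :
    insertPartner β a (otherPoint a i) = otherPoint a (β.partner i) := by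
  simp [insertPartner, otherPoint]

/-- Insert a link between the neighbouring indices `a` and `a + 1`. -/
def LinkPattern.insertLink (β : LinkPattern n) (a : Fin (n + 1)) : LinkPattern (n + 2) where
  partner := insertPartner β a
  partner_partner x := by
    rcases eq_or_eq_otherPoint a x with rfl | rfl | ⟨i, rfl⟩
    · rw [insertPartner_castSucc, insertPartner_succ]
    · rw [insertPartner_succ, insertPartner_castSucc]
    · rw [insertPartner_otherPoint, insertPartner_otherPoint, β.partner_partner]
  partner_ne x := by
    rcases eq_or_eq_otherPoint a x with rfl | rfl | ⟨i, rfl⟩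
    · rw [insertPartner_castSucc]
      exact (Fin.castSucc_lt_succ).ne'
    · rw [insertPartner_succ]
      exact (Fin.castSucc_lt_succ).ne
    · rw [insertPartner_otherPoint]
      exact fun h => β.partner_ne i ((otherPoint_strictMono a).injective h)
  planar x y := by
    have hv := otherPoint_val a
    rcases eq_or_eq_otherPoint a x with rfl | rfl | ⟨i, rfl⟩
    · rw [insertPartner_castSucc]
      simp only [Fin.lt_def, Fin.val_castSucc, Fin.val_succ]
      omega
    · rw [insertPartner_succ]
      simp only [Fin.lt_def, Fin.val_castSucc, Fin.val_succ]
      omega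
    · rw [insertPartner_otherPoint]
      rcases eq_or_eq_otherPoint a y with rfl | rfl | ⟨k, rfl⟩
      · rw [insertPartner_castSucc]
        have := hv (β.partner i)
        simp only [Fin.lt_def, Fin.val_castSucc, Fin.val_succ]
        split_ifs at this <;> omega
      · rw [insertPartner_succ]
        simp only [Fin.lt_def, Fin.val_castSucc, Fin.val_succ]
        omega
      · rw [insertPartner_otherPoint]
        simp only [(otherPoint_strictMono a).lt_iff_lt]
        exact β.planar i k

theorem LinkPattern.exists_insertLink (α : LinkPattern (n + 2)) (a : Fin (n + 1))
    (h : α.partner a.castSucc = a.succ) : ∃ β : LinkPattern n, β.insertLink a = α := by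
  have h' : α.partner a.succ = a.castSucc := by rw [← h, α.partner_partner]
  have hex : ∀ i, ∃ k, otherPoint a k = α.partner (otherPoint a i) := by
    intro i
    rcases eq_or_eq_otherPoint a (α.partner (otherPoint a i)) with h1 | h1 | ⟨k, hk⟩
    · exfalso
      have := congrArg α.partner h1
      rw [α.partner_partner, h] at this
      exact otherPoint_ne_succ a i this
    · exfalso
      have := congrArg α.partner h1
      rw [α.partner_partner, h'] at this
      exact otherPoint_ne_castSucc a i this
    · exact ⟨k, hk.symm⟩
  choose f hf using hex
  have hmono := otherPoint_strictMono a
  refine ⟨⟨f, ?_, ?_, ?_⟩, ?_⟩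
  · intro i
    apply hmono.injective
    rw [hf, hf, α.partner_partner]
  · intro i hi
    have := hf i
    rw [hi] at this
    exact α.partner_ne _ this.symm
  · intro i k
    have := α.planar (otherPoint a i) (otherPoint a k)
    simpa only [← hf, hmono.lt_iff_lt] using this
  · ext1
    funext x
    change insertPartner _ a x = _
    rcases eq_or_eq_otherPoint a x with rfl | rfl | ⟨i, rfl⟩
    · rw [insertPartner_castSucc, h]
    · rw [insertPartner_succ, h']
    · rw [insertPartner_otherPoint, hf]

theorem LinkPattern.insertLink_injective (a : Fin (n + 1)) :
    Function.Injective (fun β : LinkPattern n => β.insertLink a) := by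
  intro β γ h
  ext1
  funext i
  have := congrArg (fun δ : LinkPattern (n + 2) => δ.partner (otherPoint a i)) h
  simp only [LinkPattern.insertLink, insertPartner_otherPoint] at this
  exact (otherPoint_strictMono a).injective this

theorem sum_insertLink {M : Type*} [AddCommMonoid M] (a : Fin (n + 1)) (F : LinkPattern (n + 2) → M) :
    ∑ α : LinkPattern (n + 2), (if α.partner a.castSucc = a.succ then F α else 0) =
      ∑ β : LinkPattern n, F (β.insertLink a) := by
  classical
  rw [← Finset.sum_filter]
  symm
  refine Finset.sum_bij (fun β _ => β.insertLink a) ?_ ?_ ?_ ?_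
  · intro β _
    simp only [Finset.mem_filter, Finset.mem_univ, true_and]
    exact insertPartner_castSucc β a
  · intro β _ γ _ h
    exact LinkPattern.insertLink_injective a h
  · intro α hα
    obtain ⟨β, hβ⟩ := α.exists_insertLink a (by simpa using hα)
    exact ⟨β, Finset.mem_univ _, hβ⟩
  · intro β _
    rfl

theorem LinkPattern.word_insertLink_otherPoint (β : LinkPattern n) (a : Fin (n + 1)) :
    (β.insertLink a).word ∘ otherPoint a = β.word := by
  funext i
  simp only [LinkPattern.word, LinkPattern.insertLink, Function.comp, insertPartner_otherPoint,
    (otherPoint_strictMono a).lt_iff_lt]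

theorem LinkPattern.word_insertLink_castSucc (β : LinkPattern n) (a : Fin (n + 1)) :
    (β.insertLink a).word a.castSucc = true := by
  simp [LinkPattern.word, LinkPattern.insertLink, insertPartner_castSucc]

theorem LinkPattern.word_insertLink_succ (β : LinkPattern n) (a : Fin (n + 1)) :
    (β.insertLink a).word a.succ = false := by
  simp [LinkPattern.word, LinkPattern.insertLink, insertPartner_succ, Fin.castSucc_lt_succ.le]

/-- A peak of the Dyck path is a link between neighbours. -/
theorem LinkPattern.partner_eq_succ_iff (α : LinkPattern (n + 2)) (a : Fin (n + 1)) :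
    α.partner a.castSucc = a.succ ↔ α.word a.castSucc = true ∧ α.word a.succ = false := by
  constructor
  · intro h
    have h' : α.partner a.succ = a.castSucc := by rw [← h, α.partner_partner]
    simp [LinkPattern.word, h, h', Fin.castSucc_lt_succ.le]
  · simp only [LinkPattern.word, decide_eq_true_eq, decide_eq_false_iff_not, not_lt]
    rintro ⟨h1, h2⟩
    -- An up-step at `a` and a down-step at `a + 1` that are not linked to each other would belong
    -- to crossing links.
    by_contra h3
    have h4 := α.partner_ne a.succ
    have h5 : α.partner a.succ ≠ a.castSucc := by
      intro h
      apply h3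
      rw [← h, α.partner_partner]
    have := α.planar (α.partner a.succ) a.castSucc
    rw [α.partner_partner] at this
    simp only [Fin.lt_def, Fin.le_def, ne_eq, Fin.ext_iff, Fin.val_castSucc, Fin.val_succ] at *
    omega

end Insert

theorem LinkPattern.word_partner {n : ℕ} (β : LinkPattern n) (a : Fin n) :
    β.word (β.partner a) = !β.word a := by
  have h := β.partner_ne a
  simp only [LinkPattern.word, β.partner_partner]
  rcases lt_or_gt_of_ne h with h' | h'
  · simp [h', h'.le]
  · simp [h', h'.le]

/-- A link pattern is determined by its Dyck path. -/
theorem LinkPattern.word_injective {n : ℕ} :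
    Function.Injective (LinkPattern.word : LinkPattern n → _) := by
  -- Descent on the length of a link. If an up-step `a` is linked to `b` in `β` and further to the
  -- right in `γ`, then `b` is linked in `γ` to some `c` between `a` and `b`, and planarity of `β`
  -- makes the link of `c` in `β` shorter and again too short compared with `γ`.
  suffices key : ∀ (N : ℕ) (β γ : LinkPattern n), β.word = γ.word → ∀ a : Fin n, β.word a = true →
      β.partner a < γ.partner a → (β.partner a).val - a.val < N → False by
    intro β γ h
    have hup : ∀ a, β.word a = true → β.partner a = γ.partner a := by
      intro a ha
      by_contra hne
      rcases lt_or_gt_of_ne hne with h' | h'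
      · exact key _ β γ h a ha h' (Nat.lt_succ_self _)
      · exact key _ γ β h.symm a (h ▸ ha) h' (Nat.lt_succ_self _)
    ext1
    funext a
    cases ha : β.word a
    · have h1 : β.word (β.partner a) = true := by rw [β.word_partner, ha]; rfl
      have h2 := hup _ h1
      rw [β.partner_partner] at h2
      conv_rhs => rw [h2]
      rw [γ.partner_partner]
    · exact hup a ha
  intro N
  induction N with
  | zero => intro β γ _ a _ _ h; omega
  | succ N ih =>
    intro β γ h a ha hlt hN
    set b := β.partner a with hb
    have hab : a < b := by simpa [LinkPattern.word] using ha
    have hbw : γ.word b = false := by rw [← h, hb, β.word_partner, ha]; rfl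
    set c := γ.partner b with hc
    have hcb : c < b := by
      have h1 : ¬ b < c := by simpa [LinkPattern.word] using hbw
      exact lt_of_le_of_ne (not_lt.1 h1) (γ.partner_ne b)
    have hcb' : γ.partner c = b := by rw [hc, γ.partner_partner]
    have hca : c ≠ a := by
      rintro h1
      rw [h1] at hcb'
      exact hlt.ne hcb'.symm
    have hac : a < c := by
      by_contra h1
      have h2 : c < a := lt_of_le_of_ne (not_lt.1 h1) hca
      have h3 := γ.planar c a
      rw [hcb'] at h3
      exact h3 ⟨h2, hab, hlt⟩
    have hcw : β.word c = true := by rw [h, hc, γ.word_partner, hbw]; rfl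
    have h4 : c < β.partner c := by simpa [LinkPattern.word] using hcw
    have h5 : β.partner c < b := by
      have h6 := β.planar a c
      rw [← hb] at h6
      have h7 : β.partner c ≠ b := by
        intro h8
        have := congrArg β.partner h8
        rw [β.partner_partner, hb, β.partner_partner] at this
        exact hca this
      by_contra h8
      exact h6 ⟨hac, hcb, lt_of_le_of_ne (not_lt.1 h8) h7.symm⟩
    refine ih β γ h c hcw (hcb' ▸ h5) ?_
    simp only [Fin.lt_def] at *
    omega

theorem wordWalk_word_eq_zero {n : ℕ} (β : LinkPattern n) : wordWalk β.word n = 0 := by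
  have h1 : wordWalk β.word n = ∑ a, if β.word a then (1 : ℤ) else -1 := by
    unfold wordWalk
    exact Finset.sum_congr rfl fun a _ => if_pos a.isLt
  have h2 : ∑ a, (if β.word a then (1 : ℤ) else -1) =
      ∑ a, if β.word (β.partner a) then (1 : ℤ) else -1 :=
    (Equiv.sum_comp (Function.Involutive.toPerm β.partner β.partner_partner)
      (fun a => if β.word a then (1 : ℤ) else -1)).symm
  have h3 : ∑ a, (if β.word (β.partner a) then (1 : ℤ) else -1) =
      - ∑ a, if β.word a then (1 : ℤ) else -1 := by
    rw [← Finset.sum_neg_distrib]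
    refine Finset.sum_congr rfl fun a _ => ?_
    rw [β.word_partner]
    cases β.word a <;> simp
  rw [h1]
  omega

/-- Links with both ends before `x` contribute zero in total, since the partner involution exchanges
up- and down-steps; every link straddling `x` contributes one. -/
theorem wordWalk_word_nonneg {n : ℕ} (β : LinkPattern n) (x : ℕ) : 0 ≤ wordWalk β.word x := by
  have h2 : wordWalk β.word x = ∑ a : Fin n,
      (if a.val < x ∧ β.word a = true ∧ x ≤ (β.partner a).val then (1 : ℤ) else 0) +
      ∑ a : Fin n, (if a.val < x ∧ (β.partner a).val < x then (if β.word a then 1 else -1) else 0) := by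
    unfold wordWalk
    rw [← Finset.sum_add_distrib]
    refine Finset.sum_congr rfl fun a _ => ?_
    cases ha : β.word a
    · have : β.partner a < a := by
        have h1 : ¬ a < β.partner a := by simpa [LinkPattern.word] using ha
        exact lt_of_le_of_ne (not_lt.1 h1) (β.partner_ne a)
      rw [Fin.lt_def] at this
      simp only [Bool.false_eq_true, if_false, false_and, and_false, zero_add]
      split_ifs <;> omega
    · simp only [if_true, true_and]
      split_ifs <;> omega
  have h3 : ∑ a : Fin n, (if a.val < x ∧ (β.partner a).val < x then
      (if β.word a then (1 : ℤ) else -1) else 0) = 0 := by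
    have h4 := (Equiv.sum_comp (Function.Involutive.toPerm β.partner β.partner_partner)
      (fun a : Fin n => if a.val < x ∧ (β.partner a).val < x then
      (if β.word a then (1 : ℤ) else -1) else 0)).symm
    have h5 : ∑ a : Fin n, (if (β.partner a).val < x ∧ a.val < x then
      (if (!β.word a) then (1 : ℤ) else -1) else 0) = -∑ a : Fin n,
      (if a.val < x ∧ (β.partner a).val < x then (if β.word a then (1 : ℤ) else -1) else 0) := by
      rw [← Finset.sum_neg_distrib]
      refine Finset.sum_congr rfl fun a _ => ?_
      cases β.word a <;> simp only [and_comm] <;> split_ifs <;> simp_all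
    have h6 : ∑ a : Fin n, (if a.val < x ∧ (β.partner a).val < x then
        (if β.word a then (1 : ℤ) else -1) else 0) = ∑ a : Fin n,
        (if (β.partner a).val < x ∧ a.val < x then (if (!β.word a) then (1 : ℤ) else -1) else 0) := by
      refine h4.trans (Finset.sum_congr rfl fun a _ => ?_)
      change (if (β.partner a).val < x ∧ (β.partner (β.partner a)).val < x then
        (if β.word (β.partner a) then (1 : ℤ) else -1) else 0) = _
      rw [β.partner_partner, β.word_partner]
    omega
  rw [h2, h3, add_zero]
  exact Finset.sum_nonneg fun a _ => by split_ifs <;> simp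

/-! ### The dual basis given by tilings -/

/-- The determinant of two vectors in the plane. -/
def bracket (u v : ℝ × ℝ) : ℝ := u.1 * v.2 - v.1 * u.2

/-- The product of the brackets over the links. -/
def bracketProd {n : ℕ} (α : LinkPattern n) (v : Fin n → ℝ × ℝ) : ℝ :=
  ∏ a, if α.word a then bracket (v a) (v (α.partner a)) else 1

/-- Up-steps and down-steps as basis vectors. -/
def stepVec (b : Bool) : ℝ × ℝ := if b then (1, 0) else (0, 1)

open Classical in
/-- The number of tilings, and zero if the pattern is not below the word. -/
noncomputable def wordCount {n : ℕ} (α : LinkPattern n) (q : Fin n → Bool) : ℕ :=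
  if ∀ x, wordWalk α.word x ≤ wordWalk q x then
    walkTilings n (wordWalk α.word) (wordWalk q) else 0

/-- The sum of the bracket products over the patterns below a word. -/
noncomputable def tilingSum {n : ℕ} (q : Fin n → Bool) (v : Fin n → ℝ × ℝ) : ℝ :=
  ∑ α : LinkPattern n, (wordCount α q : ℝ) * bracketProd α v

theorem bracketProd_insertLink {n : ℕ} (β : LinkPattern n) (a : Fin (n + 1))
    (v : Fin (n + 2) → ℝ × ℝ) : bracketProd (β.insertLink a) v =
      bracket (v a.castSucc) (v a.succ) * bracketProd β (v ∘ otherPoint a) := by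
  unfold bracketProd
  rw [prod_pair_otherPoint a, β.word_insertLink_castSucc, β.word_insertLink_succ]
  have h1 : (β.insertLink a).partner a.castSucc = a.succ := insertPartner_castSucc β a
  simp only [if_true, Bool.false_eq_true, if_false, mul_one, h1]
  congr 1
  refine Finset.prod_congr rfl fun i _ => ?_
  have h2 := congrFun (β.word_insertLink_otherPoint a) i
  simp only [Function.comp] at h2
  have h3 : (β.insertLink a).partner (otherPoint a i) = otherPoint a (β.partner i) :=
    insertPartner_otherPoint β a i
  rw [h2, h3]
  rfl

/-- The tiling recursion rewritten for words: lowering the peak of `q` exchanges its two steps,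
contracting it deletes them. With the value zero for patterns that are not below the word, the
recursion holds unconditionally. -/
theorem wordCount_recursion {n : ℕ} (α : LinkPattern (n + 2)) (q : Fin (n + 2) → Bool)
    (a : Fin (n + 1)) (h1 : q a.castSucc = true) (h2 : q a.succ = false) :
    wordCount α q = wordCount α (q ∘ Equiv.swap a.castSucc a.succ) +
      if α.partner a.castSucc = a.succ then
        (open Classical in
        if ∀ x, wordWalk (α.word ∘ otherPoint a) x ≤ wordWalk (q ∘ otherPoint a) x then
          walkTilings n (wordWalk (α.word ∘ otherPoint a)) (wordWalk (q ∘ otherPoint a)) else 0)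
      else 0 := by
  classical
  set p := wordWalk α.word with hp
  have ha := a.isLt
  have hstepq : ∀ w : Fin (n + 2) → Bool,
      (wordWalk w (a.val + 1) = wordWalk w a + if w a.castSucc then 1 else -1) ∧
      wordWalk w (a.val + 2) = wordWalk w (a.val + 1) + if w a.succ then 1 else -1 := by
    intro w
    constructor
    · rw [wordWalk_succ, dif_pos (by omega)]; rfl
    · rw [show a.val + 2 = a.val + 1 + 1 by ring, wordWalk_succ, dif_pos (by omega)]; rfl
  have q1 := (hstepq q).1
  have q2 := (hstepq q).2
  rw [h1, if_pos rfl] at q1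
  rw [h2, q1] at q2
  simp only [Bool.false_eq_true, if_false, add_neg_cancel_right] at q2
  have p1 := (hstepq α.word).1
  have p2 := (hstepq α.word).2
  rw [← hp] at p1 p2
  have hpeak : α.partner a.castSucc = a.succ ↔ p (a.val + 1) = p a + 1 ∧ p (a.val + 2) = p a := by
    rw [α.partner_eq_succ_iff, p2, p1]
    cases α.word a.castSucc <;> cases α.word a.succ <;> simp <;> omega
  have hpar := even_wordWalk_sub q α.word (a.val + 1)
  rw [← hp] at hpar
  have hq' : wordWalk (q ∘ Equiv.swap a.castSucc a.succ) = lowerAt (wordWalk q) a :=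
    wordWalk_comp_swap a q h1 h2
  have hqo : wordWalk (q ∘ otherPoint a) = fun x => wordWalk q (skip a x) :=
    funext (wordWalk_comp_otherPoint a q (by rw [h1, h2]; rfl))
  unfold wordCount
  rw [hq', hqo, ← hp]
  by_cases hle : ∀ x, p x ≤ wordWalk q x
  · rw [if_pos hle, walkTilings_recursion (by omega) q1 q2 (hle _) (hle _) (hle _) hpar
      (wordWalk_step _ (by omega)) (wordWalk_step _ (by omega))]
    congr 1
    · by_cases h3 : p (a.val + 1) < wordWalk q (a.val + 1)
      · rw [if_pos h3, if_pos]
        intro x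
        unfold lowerAt
        split_ifs with hx
        · subst hx
          rw [Int.even_iff] at hpar
          omega
        · exact hle x
      · rw [if_neg h3, if_neg]
        intro h4
        have := h4 (a.val + 1)
        rw [lowerAt, if_pos rfl] at this
        omega
    · by_cases h3 : α.partner a.castSucc = a.succ
      · rw [if_pos h3, if_pos (hpeak.1 h3)]
        have hw := (α.partner_eq_succ_iff a).1 h3
        have hpo : wordWalk (α.word ∘ otherPoint a) = fun x => p (skip a x) :=
          funext (wordWalk_comp_otherPoint a α.word (by rw [hw.1, hw.2]; rfl))
        rw [hpo, if_pos fun x => hle _]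
      · rw [if_neg h3, if_neg fun h => h3 (hpeak.2 h)]
  · rw [if_neg hle, if_neg]
    · rw [zero_add]
      by_cases h3 : α.partner a.castSucc = a.succ
      · rw [if_pos h3]
        have hw := (α.partner_eq_succ_iff a).1 h3
        have hpo : wordWalk (α.word ∘ otherPoint a) = fun x => p (skip a x) :=
          funext (wordWalk_comp_otherPoint a α.word (by rw [hw.1, hw.2]; rfl))
        rw [hpo, if_neg]
        intro h4
        apply hle
        -- Here the pattern is not below `q`. If its contraction were below that of `q`, inserting
        -- equal peaks would preserve the comparison, a contradiction; so all terms vanish.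
        have h5 := hpeak.1 h3
        have h6 := h4 a
        simp only [skip, le_refl, if_true] at h6
        intro x
        rcases Nat.lt_or_ge a x with h7 | h7
        · by_cases h8 : x = a.val + 1
          · subst h8; omega
          · by_cases h9 : x = a.val + 2
            · subst h9; omega
            · have := h4 (x - 2)
              simp only [skip, if_neg (show ¬ x - 2 ≤ a.val by omega),
                show x - 2 + 2 = x by omega] at this
              exact this
        · have := h4 x
          simpa only [skip, if_pos h7] using this
      · rw [if_neg h3]
    · intro h4
      apply hle
      intro x
      have := h4 x
      unfold lowerAt at this
      split_ifs at this
      · omega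
      · exact this

/-- The contracted term only occurs for patterns with the link `{a, a + 1}`. These are the
`β.insertLink a`, and the bracket of that link factors out of their products. -/
theorem tilingSum_recursion {n : ℕ} (q : Fin (n + 2) → Bool) (a : Fin (n + 1))
    (h1 : q a.castSucc = true) (h2 : q a.succ = false) (v : Fin (n + 2) → ℝ × ℝ) :
    tilingSum q v = tilingSum (q ∘ Equiv.swap a.castSucc a.succ) v +
      bracket (v a.castSucc) (v a.succ) * tilingSum (q ∘ otherPoint a) (v ∘ otherPoint a) := by
  classical
  unfold tilingSum
  rw [Finset.mul_sum]
  have h3 : ∑ β : LinkPattern n, bracket (v a.castSucc) (v a.succ) *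
      ((wordCount β (q ∘ otherPoint a) : ℝ) * bracketProd β (v ∘ otherPoint a)) =
      ∑ β : LinkPattern n, ((fun α : LinkPattern (n + 2) =>
        (((if ∀ x, wordWalk (α.word ∘ otherPoint a) x ≤ wordWalk (q ∘ otherPoint a) x then
          walkTilings n (wordWalk (α.word ∘ otherPoint a)) (wordWalk (q ∘ otherPoint a))
            else 0 : ℕ) : ℝ) * bracketProd α v)) (β.insertLink a)) := by
    refine Finset.sum_congr rfl fun β _ => ?_
    simp only [β.word_insertLink_otherPoint, bracketProd_insertLink]
    unfold wordCount
    ring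
  rw [h3, ← sum_insertLink a (fun α : LinkPattern (n + 2) =>
        (((if ∀ x, wordWalk (α.word ∘ otherPoint a) x ≤ wordWalk (q ∘ otherPoint a) x then
          walkTilings n (wordWalk (α.word ∘ otherPoint a)) (wordWalk (q ∘ otherPoint a))
            else 0 : ℕ) : ℝ) * bracketProd α v)), ← Finset.sum_add_distrib]
  refine Finset.sum_congr rfl fun α _ => ?_
  rw [wordCount_recursion α q a h1 h2]
  push_cast
  split_ifs <;> ring

theorem wordWalk_one {n : ℕ} (w : Fin (n + 2) → Bool) :
    wordWalk w 1 = if w 0 then 1 else -1 := by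
  have := wordWalk_succ w 0
  rw [wordWalk_zero, dif_pos (by omega), zero_add, zero_add] at this
  exact this

/-- Induction on the length and, for fixed length, on the sum of `n - i` over the up-steps, which
drops by one when a peak is lowered. At a peak of `q` the recursion applies; the bracket of the two
steps of `γ` is `1`, `-1` or `0`, and in each case both sides agree. The word `q` only has to end at
height zero, because lowering peaks leads out of the Dyck words. -/
theorem tilingSum_stepVec_aux (n : ℕ) : ∀ (μ : ℕ) (q γ : Fin n → Bool),
    (∑ i, if q i then n - i.val else 0) < μ → wordWalk q n = 0 → (∀ x, 0 ≤ wordWalk γ x) →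
    tilingSum q (stepVec ∘ γ) = if q = γ then 1 else 0 := by
  induction n using Nat.strong_induction_on with
  | _ n ihn =>
  intro μ
  induction μ with
  | zero => intro q γ h; omega
  | succ μ ih =>
    intro q γ hμ hq hγ
    obtain _ | _ | n := n
    · rw [if_pos (funext fun i => i.elim0)]
      have hu : ∀ α β : LinkPattern 0, α = β := fun α β => LinkPattern.ext (funext fun i => i.elim0)
      let α₀ : LinkPattern 0 := ⟨fun i => i, fun i => i.elim0, fun i => i.elim0, fun i => i.elim0⟩
      unfold tilingSum
      rw [Finset.sum_eq_single α₀ (fun b _ hb => absurd (hu b α₀) hb) (by simp)]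
      have hw : ∀ (w : Fin 0 → Bool) (x : ℕ), wordWalk w x = 0 := fun w x => by simp [wordWalk]
      unfold wordCount
      rw [if_pos (by simp [hw]), walkTilings_zero _ _ (by simp [hw])]
      simp [bracketProd]
    · exfalso
      rw [wordWalk_succ, wordWalk_zero] at hq
      split_ifs at hq
      all_goals omega
    · by_cases hex : ∃ a : Fin (n + 1), q a.castSucc = true ∧ q a.succ = false
      · obtain ⟨a, h1, h2⟩ := hex
        have hlt : wordWalk (q ∘ Equiv.swap a.castSucc a.succ) (n + 2) = 0 := by
          rw [wordWalk_comp_swap a q h1 h2, lowerAt, if_neg (by omega), hq]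
        have hμ' : (∑ i, if (q ∘ Equiv.swap a.castSucc a.succ) i then n + 2 - i.val else 0) < μ := by
          replace hμ : (∑ i : Fin (n + 2), if q i then n + 2 - i.val else 0) < μ + 1 := hμ
          rw [sum_pair_otherPoint a] at hμ ⊢
          have : ∀ i, (q ∘ Equiv.swap a.castSucc a.succ) (otherPoint a i) = q (otherPoint a i) := by
            intro i
            rw [Function.comp, Equiv.swap_apply_of_ne_of_ne (otherPoint_ne_castSucc a i)
              (otherPoint_ne_succ a i)]
          simp only [this]
          simp only [Function.comp, Equiv.swap_apply_left, Equiv.swap_apply_right, h1, h2, if_true,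
            Bool.false_eq_true, if_false, Fin.val_castSucc, Fin.val_succ] at hμ ⊢
          have := a.isLt
          omega
        rw [tilingSum_recursion q a h1 h2, ih _ γ hμ' hlt hγ]
        have hqo : wordWalk (q ∘ otherPoint a) n = 0 := by
          rw [wordWalk_comp_otherPoint a q (by rw [h1, h2]; rfl)]
          unfold skip
          split_ifs
          · have h3 : n = a.val := by omega
            have h4 := wordWalk_succ q (n + 1)
            have h5 := wordWalk_succ q n
            rw [dif_pos (by omega)] at h4 h5
            have e1 : (⟨n, by omega⟩ : Fin (n + 2)) = a.castSucc := Fin.ext h3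
            have e2 : (⟨n + 1, by omega⟩ : Fin (n + 2)) = a.succ := Fin.ext (by simp [h3])
            rw [e2, h2] at h4
            rw [e1, h1] at h5
            simp at h4 h5
            omega
          · exact hq
        have hcomp : (stepVec ∘ γ) ∘ otherPoint a = stepVec ∘ (γ ∘ otherPoint a) := rfl
        have hqγ : ∀ q' : Fin (n + 2) → Bool, q' = γ ↔ q' a.castSucc = γ a.castSucc ∧
            q' a.succ = γ a.succ ∧ q' ∘ otherPoint a = γ ∘ otherPoint a := by
          intro q'
          constructor
          · rintro rfl; exact ⟨rfl, rfl, rfl⟩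
          · rintro ⟨h3, h4, h5⟩
            funext x
            rcases eq_or_eq_otherPoint a x with rfl | rfl | ⟨i, rfl⟩
            · exact h3
            · exact h4
            · exact congrFun h5 i
        have hsw : (q ∘ Equiv.swap a.castSucc a.succ) ∘ otherPoint a = q ∘ otherPoint a := by
          funext i
          simp only [Function.comp]
          rw [Equiv.swap_apply_of_ne_of_ne (otherPoint_ne_castSucc a i) (otherPoint_ne_succ a i)]
        have hs1 : (q ∘ Equiv.swap a.castSucc a.succ) a.castSucc = false := by
          simp [Function.comp, h2]
        have hs2 : (q ∘ Equiv.swap a.castSucc a.succ) a.succ = true := by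
          simp [Function.comp, h1]
        have hrec : γ a.castSucc = (!γ a.succ) →
            tilingSum (q ∘ otherPoint a) (stepVec ∘ (γ ∘ otherPoint a)) =
            if q ∘ otherPoint a = γ ∘ otherPoint a then 1 else 0 := by
          intro h3
          refine ihn n (by omega) _ _ _ (Nat.lt_succ_self _) hqo ?_
          intro x
          rw [wordWalk_comp_otherPoint a γ h3]
          exact hγ _
        simp only [hcomp, hqγ, hsw, hs1, hs2, h1, h2]
        cases h3 : γ a.castSucc <;> cases h4 : γ a.succ
        · simp [bracket, stepVec, h3, h4]
        · rw [hrec (by rw [h3, h4]; rfl)]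
          simp only [bracket, stepVec, h3, h4, Function.comp]
          split_ifs <;> simp_all
        · rw [hrec (by rw [h3, h4]; rfl)]
          simp [bracket, stepVec, h3, h4]
        · simp [bracket, stepVec, h3, h4]
      · push Not at hex
        -- A word without peaks that starts with an up-step has only up-steps, which contradicts its
        -- total height zero. Starting with a down-step, `q` is neither the word `γ` nor above any
        -- Dyck path.
        have hq0 : q 0 = false := by
          by_contra h0
          have h1 : ∀ i : Fin (n + 2), q i = true := by
            intro i
            induction i using Fin.induction with
            | zero => simpa using h0
            | succ a ih => simpa using hex a ih
          unfold wordWalk at hq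
          simp only [h1, if_true, Fin.is_lt, Finset.sum_const, Finset.card_univ, Fintype.card_fin]
            at hq
          simp at hq
          omega
        have hγ0 : γ 0 = true := by
          have := hγ 1
          rw [wordWalk_one] at this
          by_contra h0
          rw [if_neg h0] at this
          omega
        rw [if_neg (by rintro rfl; rw [hq0] at hγ0; cases hγ0)]
        unfold tilingSum
        refine Finset.sum_eq_zero fun α _ => ?_
        unfold wordCount
        rw [if_neg, Nat.cast_zero, zero_mul]
        intro h
        have h1 := h 1
        have h2 := wordWalk_word_nonneg α 1
        rw [wordWalk_one q, hq0] at h1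
        simp only [Bool.false_eq_true, if_false] at h1
        omega

/-- The duality: evaluation at Dyck words and tiling sums form dual families. -/
theorem tilingSum_stepVec {n : ℕ} (β γ : LinkPattern n) :
    tilingSum β.word (stepVec ∘ γ.word) = open Classical in if γ = β then 1 else 0 := by
  rw [tilingSum_stepVec_aux n _ _ _ (Nat.lt_succ_self _) (wordWalk_word_eq_zero β)
    (wordWalk_word_nonneg γ)]
  by_cases h : γ = β
  · rw [if_pos (by rw [h]), if_pos h]
  · rw [if_neg fun h' => h (LinkPattern.word_injective h').symm, if_neg h]

/-- The reproducing property: a bracket product is determined by its values at Dyck words. -/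
theorem bracketProd_eq_sum {n : ℕ} (α : LinkPattern n) (v : Fin n → ℝ × ℝ) :
    bracketProd α v = ∑ β : LinkPattern n,
      bracketProd α (stepVec ∘ β.word) * tilingSum β.word v := by
  classical
  let M : Matrix (LinkPattern n) (LinkPattern n) ℝ :=
    Matrix.of fun γ α => bracketProd α (stepVec ∘ γ.word)
  let c : Matrix (LinkPattern n) (LinkPattern n) ℝ := Matrix.of fun α β => (wordCount α β.word : ℝ)
  have h1 : M * c = 1 := by
    ext γ β
    rw [Matrix.mul_apply, Matrix.one_apply]
    have := tilingSum_stepVec β γ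
    unfold tilingSum at this
    simp only [M, c, Matrix.of_apply]
    rw [← this]
    exact Finset.sum_congr rfl fun _ _ => mul_comm _ _
  -- For square matrices a right inverse is a left inverse; this converts the duality into the
  -- reproducing property.
  have h2 : c * M = 1 := mul_eq_one_comm.1 h1
  have h3 : ∀ α', ∑ β : LinkPattern n, (wordCount α' β.word : ℝ) * bracketProd α (stepVec ∘ β.word) =
      if α' = α then 1 else 0 := by
    intro α'
    have := congrFun (congrFun h2 α') α
    rw [Matrix.mul_apply, Matrix.one_apply] at this
    exact this
  unfold tilingSum
  simp only [Finset.mul_sum]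
  rw [Finset.sum_comm]
  have h4 : ∀ α', ∑ β : LinkPattern n, bracketProd α (stepVec ∘ β.word) *
      ((wordCount α' β.word : ℝ) * bracketProd α' v) = if α' = α then bracketProd α' v else 0 := by
    intro α'
    rw [← ite_zero_mul_one α' α (bracketProd α' v), ← h3, Finset.sum_mul]
    exact Finset.sum_congr rfl fun _ _ => by ring
  simp only [h4]
  simp
where
  ite_zero_mul_one (α' α : LinkPattern n) (r : ℝ) :
      (open Classical in if α' = α then (1 : ℝ) else 0) * r =
        open Classical in if α' = α then r else 0 := by
    split_ifs <;> simp


/-! ### Pfaffians as functionals on the exterior algebra -/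

section Pfaffian

variable {V V' κ : Type*} [AddCommGroup V] [Module ℝ V] [AddCommGroup V'] [Module ℝ V']

/-- An alternating form has zero quadratic form, so `changeForm` along it maps the exterior algebra
to itself. This map is not the identity: the scalar part of the image of a product of vectors is a
Pfaffian. -/
theorem toQuadraticMap_neg_eq {B : LinearMap.BilinForm ℝ V} (hB : ∀ v, B v v = 0) :
    LinearMap.BilinMap.toQuadraticMap (-B) = (0 : QuadraticForm ℝ V) - 0 := by
  ext v
  simp [hB]

/-- The linear functional on the exterior algebra whose value at a product of vectors is the
Pfaffian of their Gram matrix. -/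
noncomputable def pfFun (B : LinearMap.BilinForm ℝ V) (hB : ∀ v, B v v = 0) :
    ExteriorAlgebra ℝ V →ₗ[ℝ] ℝ :=
  ExteriorAlgebra.algebraMapInv.toLinearMap ∘ₗ
    CliffordAlgebra.changeForm (toQuadraticMap_neg_eq hB)

/-- The product of a list of vectors in the exterior algebra. -/
noncomputable def wedge (l : List V) : ExteriorAlgebra ℝ V :=
  (l.map (ExteriorAlgebra.ι ℝ)).prod

/-- The Pfaffian of the Gram matrix of a list of vectors. -/
noncomputable def pfaffian (B : LinearMap.BilinForm ℝ V) (hB : ∀ v, B v v = 0) (l : List V) : ℝ :=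
  pfFun B hB (wedge l)

theorem wedge_nil : wedge ([] : List V) = 1 := rfl

theorem wedge_cons (v : V) (l : List V) : wedge (v :: l) = ExteriorAlgebra.ι ℝ v * wedge l := by
  simp [wedge]

theorem wedge_append (l l' : List V) : wedge (l ++ l') = wedge l * wedge l' := by
  simp [wedge]

variable (B : LinearMap.BilinForm ℝ V) (hB : ∀ v, B v v = 0)

theorem pfaffian_nil : pfaffian B hB [] = 1 := by
  simp [pfaffian, wedge_nil, pfFun]

/-- Expansion along the first vector. `changeForm` turns multiplication by `v` into multiplication
plus a contraction with `B v`, and the multiplied term has no scalar part. -/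
theorem pfFun_ι_mul (v : V) (x : ExteriorAlgebra ℝ V) :
    pfFun B hB (ExteriorAlgebra.ι ℝ v * x) =
      pfFun B hB (CliffordAlgebra.contractLeft (B v) x) := by
  simp only [pfFun, LinearMap.comp_apply, CliffordAlgebra.changeForm_contractLeft]
  rw [ExteriorAlgebra.ι, CliffordAlgebra.changeForm_ι_mul]
  simp only [LinearMap.neg_apply, map_neg, sub_neg_eq_add, map_add, AlgHom.toLinearMap_apply,
    map_mul]
  have : ExteriorAlgebra.algebraMapInv (ExteriorAlgebra.ι ℝ v) = 0 := by
    simp [ExteriorAlgebra.algebraMapInv]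
  rw [ExteriorAlgebra.ι] at this
  rw [this]
  ring

theorem contractLeft_wedge (d : Module.Dual ℝ V) (φ : κ → V) (l : List κ) :
    CliffordAlgebra.contractLeft d (wedge (l.map φ)) =
      ∑ i : Fin l.length, ((-1) ^ i.val * d (φ (l.get i))) • wedge ((l.eraseIdx i).map φ) := by
  induction l with
  | nil => simp [wedge_nil, CliffordAlgebra.contractLeft_one]
  | cons b l ih =>
    rw [List.map_cons, wedge_cons, ExteriorAlgebra.ι, CliffordAlgebra.contractLeft_ι_mul, ih]
    refine Eq.trans ?_ (Fin.sum_univ_succ (n := l.length) (fun i =>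
      ((-1) ^ i.val * d (φ ((b :: l).get i))) • wedge (((b :: l).eraseIdx i).map φ))).symm
    rw [Finset.mul_sum, sub_eq_add_neg, ← Finset.sum_neg_distrib]
    congr 1
    · simp
    · refine Finset.sum_congr rfl fun i _ => ?_
      simp only [List.length_cons, List.get_eq_getElem, Fin.val_succ, List.getElem_cons_succ,
        List.eraseIdx_cons_succ, List.map_cons, wedge_cons, pow_succ]
      rw [mul_smul_comm, ← neg_smul, ExteriorAlgebra.ι]
      congr 1
      ring

/-- The usual expansion of a Pfaffian along its first row. It determines the Pfaffian recursively,
and the inductive arguments about Gram matrices use only this. -/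
theorem pfaffian_cons (φ : κ → V) (a : κ) (l : List κ) :
    pfaffian B hB (φ a :: l.map φ) =
      ∑ i : Fin l.length, (-1) ^ i.val * B (φ a) (φ (l.get i)) *
        pfaffian B hB ((l.eraseIdx i).map φ) := by
  rw [pfaffian, wedge_cons, pfFun_ι_mul, contractLeft_wedge, map_sum]
  simp only [map_smul, smul_eq_mul, pfaffian]

/-- The Pfaffian depends only on the Gram matrix. -/
theorem pfaffian_congr {B : LinearMap.BilinForm ℝ V} {hB : ∀ v, B v v = 0}
    {B' : LinearMap.BilinForm ℝ V'} {hB' : ∀ v, B' v v = 0} (φ : κ → V) (φ' : κ → V') (l : List κ)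
    (h : ∀ a ∈ l, ∀ b ∈ l, B (φ a) (φ b) = B' (φ' a) (φ' b)) :
    pfaffian B hB (l.map φ) = pfaffian B' hB' (l.map φ') := by
  induction hn : l.length using Nat.strong_induction_on generalizing l with
  | _ n ih =>
  cases l with
  | nil => simp only [List.map_nil, pfaffian_nil]
  | cons a l =>
    rw [List.map_cons, List.map_cons, pfaffian_cons, pfaffian_cons]
    refine Finset.sum_congr rfl fun i _ => ?_
    rw [h a (by simp) _ (List.mem_cons_of_mem _ (List.get_mem l i))]
    congr 1
    refine ih _ ?_ (l.eraseIdx i) ?_ rfl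
    · have := List.length_eraseIdx_le l i
      simp only [List.length_cons] at hn
      omega
    · intro b hb c hc
      exact h b (List.mem_cons_of_mem _ (List.mem_of_mem_eraseIdx hb)) c
        (List.mem_cons_of_mem _ (List.mem_of_mem_eraseIdx hc))

theorem wedge_mul_ι (l : List V) (v : V) :
    wedge l * ExteriorAlgebra.ι ℝ v = (-1 : ℝ) ^ l.length • (ExteriorAlgebra.ι ℝ v * wedge l) := by
  induction l with
  | nil => simp [wedge_nil]
  | cons b l ih =>
    have hs : ExteriorAlgebra.ι ℝ b * ExteriorAlgebra.ι ℝ v =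
        -(ExteriorAlgebra.ι ℝ v * ExteriorAlgebra.ι ℝ b) :=
      eq_neg_of_add_eq_zero_left (ExteriorAlgebra.ι_add_mul_swap b v)
    rw [wedge_cons, mul_assoc, ih, mul_smul_comm, ← mul_assoc, hs, List.length_cons, pow_succ,
      mul_neg_one, neg_smul, neg_mul, smul_neg, mul_assoc]

theorem contractLeft_wedge_eq_zero (d : Module.Dual ℝ V) (l : List V) (h : ∀ w ∈ l, d w = 0) :
    CliffordAlgebra.contractLeft d (wedge l) = 0 := by
  induction l with
  | nil => simp [wedge_nil, CliffordAlgebra.contractLeft_one]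
  | cons b l ih =>
    rw [wedge_cons, ExteriorAlgebra.ι, CliffordAlgebra.contractLeft_ι_mul, h b (by simp),
      ih fun w hw => h w (List.mem_cons_of_mem _ hw)]
    simp

theorem contractLeft_wedge_append (d : Module.Dual ℝ V) (l : List V) (h : ∀ w ∈ l, d w = 0)
    (x : ExteriorAlgebra ℝ V) : CliffordAlgebra.contractLeft d (wedge l * x) =
      (-1 : ℝ) ^ l.length • (wedge l * CliffordAlgebra.contractLeft d x) := by
  induction l with
  | nil => simp [wedge_nil]
  | cons b l ih =>
    rw [wedge_cons, mul_assoc, ExteriorAlgebra.ι, CliffordAlgebra.contractLeft_ι_mul, h b (by simp),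
      ih fun w hw => h w (List.mem_cons_of_mem _ hw), List.length_cons, pow_succ, mul_neg_one,
      neg_smul, mul_smul_comm, ← mul_assoc, zero_smul, zero_sub]

theorem pfaffian_move (l₁ l₂ : List V) (v : V) :
    pfaffian B hB (l₁ ++ v :: l₂) = (-1) ^ l₁.length * pfaffian B hB (v :: (l₁ ++ l₂)) := by
  rw [pfaffian, wedge_append, wedge_cons, ← mul_assoc, wedge_mul_ι, smul_mul_assoc, map_smul,
    smul_eq_mul, mul_assoc, ← wedge_append, ← wedge_cons]
  rfl

/-- If a vector is orthogonal to all the others but one, these two can be removed. -/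
theorem pfaffian_remove (l₁ l₂ l₃ : List V) (p q : V) (h₁ : ∀ w ∈ l₁, B p w = 0)
    (h₂ : ∀ w ∈ l₂, B p w = 0) (h₃ : ∀ w ∈ l₃, B p w = 0) :
    pfaffian B hB (l₁ ++ p :: (l₂ ++ q :: l₃)) =
      (-1) ^ l₂.length * B p q * pfaffian B hB (l₁ ++ (l₂ ++ l₃)) := by
  rw [pfaffian_move, pfaffian, wedge_cons, pfFun_ι_mul, ← List.append_assoc, wedge_append,
    contractLeft_wedge_append, wedge_cons, ExteriorAlgebra.ι, CliffordAlgebra.contractLeft_ι_mul,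
    contractLeft_wedge_eq_zero _ l₃ h₃, mul_zero, sub_zero, mul_smul_comm, ← wedge_append,
    map_smul, map_smul, smul_eq_mul, smul_eq_mul, List.append_assoc, List.length_append, pow_add,
    pfaffian]
  · have : ((-1 : ℝ) ^ l₁.length) * ((-1) ^ l₁.length) = 1 := by
      rw [← mul_pow]; simp
    linear_combination ((-1 : ℝ) ^ l₂.length * B p q *
      pfFun B hB (wedge (l₁ ++ (l₂ ++ l₃)))) * this
  · intro w hw
    rcases List.mem_append.1 hw with h | h
    · exact h₁ w h
    · exact h₂ w h

theorem pfaffian_smul (l₁ l₂ : List V) (c : ℝ) (v : V) :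
    pfaffian B hB (l₁ ++ (c • v) :: l₂) = c * pfaffian B hB (l₁ ++ v :: l₂) := by
  simp only [pfaffian, wedge_append, wedge_cons, map_smul, smul_mul_assoc, mul_smul_comm,
    smul_eq_mul]

/-- The Pfaffian as an alternating function of consecutive vectors. -/
noncomputable def pfaffianAlt (l₁ l₂ : List V) (k : ℕ) : V [⋀^Fin k]→ₗ[ℝ] ℝ :=
  (pfFun B hB ∘ₗ LinearMap.mulLeft ℝ (wedge l₁) ∘ₗ LinearMap.mulRight ℝ (wedge l₂)).compAlternatingMap
    (ExteriorAlgebra.ιMulti ℝ k)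

theorem pfaffianAlt_apply (l₁ l₂ : List V) (k : ℕ) (z : Fin k → V) :
    pfaffianAlt B hB l₁ l₂ k z = pfaffian B hB (l₁ ++ (List.ofFn z ++ l₂)) := by
  rw [pfaffian, wedge_append, wedge_append]
  simp [pfaffianAlt, ExteriorAlgebra.ιMulti_apply, wedge, List.map_ofFn, Function.comp_def]

end Pfaffian

/-- Both sides are alternating in the rows of `T`, and such a form on as many vectors as the
dimension is a multiple of the determinant. -/
theorem alternatingMap_sum_smul {V ι : Type*} [AddCommGroup V] [Module ℝ V] [Fintype ι]
    [DecidableEq ι] (f : V [⋀^ι]→ₗ[ℝ] ℝ) (T : Matrix ι ι ℝ) (u : ι → V) :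
    f (fun i => ∑ k, T i k • u k) = T.det * f u := by
  let L : (ι → ℝ) →ₗ[ℝ] V := Fintype.linearCombination ℝ u
  have h2 : (L ∘ Pi.basisFun ℝ ι) = u := by
    funext i
    simp [L, Fintype.linearCombination_apply_single]
  calc f (fun i => ∑ k, T i k • u k) = (f.compLinearMap L) (fun i k => T i k) := rfl
    _ = ((f.compLinearMap L) (Pi.basisFun ℝ ι) • (Pi.basisFun ℝ ι).det) (fun i k => T i k) := by
      rw [← AlternatingMap.eq_smul_basis_det]
    _ = f (L ∘ Pi.basisFun ℝ ι) * T.det := by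
      rw [AlternatingMap.smul_apply, Pi.basisFun_det_apply]
      rfl
    _ = T.det * f u := by rw [h2, mul_comm]


/-! ### Uncrossing -/

section Uncrossing

variable {n : ℕ}

/-- The product of the brackets of a list of pairs. -/
def pairProd (ps : List (Fin n × Fin n)) (v : Fin n → ℝ × ℝ) : ℝ :=
  (ps.map fun p => bracket (v p.1) (v p.2)).prod

/-- The list of all the endpoints of a list of pairs. -/
def endpoints (ps : List (Fin n × Fin n)) : List (Fin n) := ps.flatMap fun p => [p.1, p.2]

theorem bracket_swap (u v : ℝ × ℝ) : bracket u v = -bracket v u := by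
  unfold bracket; ring

/-- The Plücker relation: for `a < b < c < e` a crossing pair of links is replaced by the two ways
to uncross it, both with positive sign. -/
theorem bracket_plucker (a b c e : ℝ × ℝ) :
    bracket a c * bracket b e = bracket a b * bracket c e + bracket a e * bracket b c := by
  unfold bracket; ring

/-- The span of the bracket products of the planar link patterns. -/
def bracketSpan (n : ℕ) : Submodule ℝ ((Fin n → ℝ × ℝ) → ℝ) :=
  Submodule.span ℝ (Set.range (bracketProd (n := n)))

theorem pairProd_perm {ps ps' : List (Fin n × Fin n)} (h : ps.Perm ps') :
    pairProd ps = pairProd ps' := by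
  funext v
  exact (h.map _).prod_eq

theorem pairProd_mem_of_noncrossing (ps : List (Fin n × Fin n))
    (hps : (endpoints ps).Perm (List.finRange n)) (hlt : ∀ p ∈ ps, p.1 < p.2)
    (hnc : ∀ p ∈ ps, ∀ q ∈ ps, ¬ (p.1 < q.1 ∧ q.1 < p.2 ∧ p.2 < q.2)) :
    pairProd ps ∈ bracketSpan n := by
  have hnd : (endpoints ps).Nodup := hps.nodup_iff.2 (List.nodup_finRange n)
  have hdis := (List.nodup_flatMap.1 hnd).2
  have hex : ∀ a, ∃ b, (a, b) ∈ ps ∨ (b, a) ∈ ps := by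
    intro a
    have h := hps.mem_iff.2 (List.mem_finRange a)
    simp only [endpoints, List.mem_flatMap, List.mem_cons, List.not_mem_nil, or_false] at h
    obtain ⟨⟨x, y⟩, hp, rfl | rfl⟩ := h
    · exact ⟨_, Or.inl hp⟩
    · exact ⟨_, Or.inr hp⟩
  have hshare : ∀ p ∈ ps, ∀ q ∈ ps, ∀ a, (a = p.1 ∨ a = p.2) → (a = q.1 ∨ a = q.2) → p = q := by
    intro p hp q hq a h1 h2
    by_contra hne
    have hsymm : Std.Symm (Function.onFun List.Disjoint fun p : Fin n × Fin n => [p.1, p.2]) :=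
      ⟨fun x y h => h.symm⟩
    have h3 := hdis.forall hp hq hne
    exact h3 (a := a) (by simpa using h1) (by simpa using h2)
  have hun : ∀ a b c, ((a, b) ∈ ps ∨ (b, a) ∈ ps) → ((a, c) ∈ ps ∨ (c, a) ∈ ps) → b = c := by
    rintro a b c (h1 | h1) (h2 | h2)
    · exact congrArg Prod.snd (hshare _ h1 _ h2 a (Or.inl rfl) (Or.inl rfl))
    · have := hshare _ h1 _ h2 a (Or.inl rfl) (Or.inr rfl)
      have h3 := hlt _ h1
      simp only [Prod.mk.injEq] at this h3
      rw [this.2] at h3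
      exact absurd h3 (lt_irrefl _)
    · have := hshare _ h1 _ h2 a (Or.inr rfl) (Or.inl rfl)
      have h3 := hlt _ h1
      simp only [Prod.mk.injEq] at this h3
      rw [this.1] at h3
      exact absurd h3 (lt_irrefl _)
    · exact congrArg Prod.fst (hshare _ h1 _ h2 a (Or.inr rfl) (Or.inr rfl))
  choose f hf using hex
  have hup : ∀ a, a < f a → (a, f a) ∈ ps := by
    intro a h
    rcases hf a with h' | h'
    · exact h'
    · exact absurd (hlt _ h') h.not_gt
  let α : LinkPattern n :=
    { partner := f
      partner_partner := fun a => hun (f a) _ _ (hf (f a)) (hf a).symm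
      partner_ne := by
        intro a h
        have := hf a
        rw [h, or_self] at this
        exact lt_irrefl _ (hlt _ this)
      planar := by
        rintro a b ⟨h1, h2, h3⟩
        exact hnc _ (hup a (h1.trans h2)) _ (hup b (h2.trans h3)) ⟨h1, h2, h3⟩ }
  have hnd' : ps.Nodup := by
    rw [List.nodup_iff_pairwise_ne]
    refine hdis.imp fun {p q} h hpq => ?_
    subst hpq
    exact h (a := p.1) (by simp) (by simp)
  refine Submodule.subset_span ⟨α, ?_⟩
  funext v
  unfold bracketProd pairProd
  rw [← List.prod_toFinset _ hnd', ← Finset.prod_filter]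
  symm
  refine Finset.prod_bij (fun p _ => p.1) ?_ ?_ ?_ ?_
  · rintro ⟨a, b⟩ hp
    rw [List.mem_toFinset] at hp
    have hb : f a = b := hun a _ _ (hf a) (Or.inl hp)
    simpa [LinkPattern.word, α, hb] using hlt _ hp
  · intro p hp q hq h
    rw [List.mem_toFinset] at hp hq
    exact hshare p hp q hq p.1 (Or.inl rfl) (Or.inl h)
  · intro a ha
    have ha' : a < f a := by simpa [LinkPattern.word, α] using ha
    exact ⟨(a, f a), by simpa using hup a ha', rfl⟩
  · rintro ⟨a, b⟩ hp
    rw [List.mem_toFinset] at hp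
    have hb : f a = b := hun a _ _ (hf a) (Or.inl hp)
    simp [α, hb]

/-- A measure that decreases under uncrossing. -/
def spread (p : Fin n × Fin n) : ℕ := (p.2.val - p.1.val) * (2 * n - (p.2.val - p.1.val))

/-- The function `x (2n - x)` of the length of a link is increasing up to `n` and strictly concave.
The first uncrossing shortens both links; the second keeps the total length but makes the lengths
more unequal. -/
theorem spread_lt {a b c e : Fin n} (h1 : a < b) (h2 : b < c) (h3 : c < e) :
    spread (a, b) + spread (c, e) < spread (a, c) + spread (b, e) ∧
    spread (a, e) + spread (b, c) < spread (a, c) + spread (b, e) := by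
  obtain ⟨x, hx⟩ := Nat.exists_eq_add_of_lt h1
  obtain ⟨y, hy⟩ := Nat.exists_eq_add_of_lt h2
  obtain ⟨z, hz⟩ := Nat.exists_eq_add_of_lt h3
  obtain ⟨r, hr⟩ := Nat.exists_eq_add_of_lt e.isLt
  unfold spread
  simp only
  rw [show b.val - a.val = x + 1 by omega, show e.val - c.val = z + 1 by omega,
    show c.val - a.val = x + y + 2 by omega, show e.val - b.val = y + z + 2 by omega,
    show e.val - a.val = x + y + z + 3 by omega, show c.val - b.val = y + 1 by omega]
  obtain ⟨N, hN⟩ : ∃ N, 2 * n = N + (x + y + z + 3) := ⟨2 * n - (x + y + z + 3), by omega⟩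
  have hN' : x + y + z + 3 ≤ N := by omega
  rw [hN, show N + (x + y + z + 3) - (x + 1) = N + (y + z + 2) by omega,
    show N + (x + y + z + 3) - (z + 1) = N + (x + y + 2) by omega,
    show N + (x + y + z + 3) - (x + y + 2) = N + (z + 1) by omega,
    show N + (x + y + z + 3) - (y + z + 2) = N + (x + 1) by omega,
    show N + (x + y + z + 3) - (x + y + z + 3) = N by omega,
    show N + (x + y + z + 3) - (y + 1) = N + (x + z + 2) by omega]
  constructor <;> nlinarith

/-- Each application of the Plücker relation to a crossing lowers the total spread, so uncrossing
terminates in planar patterns. -/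
theorem pairProd_mem_of_oriented (ps : List (Fin n × Fin n))
    (hps : (endpoints ps).Perm (List.finRange n)) (hlt : ∀ p ∈ ps, p.1 < p.2) :
    pairProd ps ∈ bracketSpan n := by
  induction hμ : (ps.map spread).sum using Nat.strong_induction_on generalizing ps with
  | _ μ ih =>
  by_cases hnc : ∀ p ∈ ps, ∀ q ∈ ps, ¬ (p.1 < q.1 ∧ q.1 < p.2 ∧ p.2 < q.2)
  · exact pairProd_mem_of_noncrossing ps hps hlt hnc
  · push Not at hnc
    obtain ⟨⟨a, c⟩, hp, ⟨b, e⟩, hq, h1, h2, h3⟩ := hnc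
    simp only at h1 h2 h3
    have hq' : (b, e) ∈ ps.erase (a, c) := by
      rw [List.mem_erase_of_ne]
      · exact hq
      · intro h
        rw [Prod.mk.injEq] at h
        exact h1.ne' h.1
    set r := (ps.erase (a, c)).erase (b, e) with hr
    have hperm : ps.Perm ((a, c) :: (b, e) :: r) :=
      (List.perm_cons_erase hp).trans ((List.perm_cons_erase hq').cons _)
    have hperm' : (endpoints ((a, c) :: (b, e) :: r)).Perm (List.finRange n) :=
      (hperm.flatMap_right _).symm.trans hps
    have hsum : spread (a, c) + (spread (b, e) + (r.map spread).sum) = μ := by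
      rw [← hμ, (hperm.map spread).sum_eq]
      simp
    have hltr : ∀ p ∈ r, p.1 < p.2 := fun p hpr => hlt p (hperm.mem_iff.2 (by simp [hpr]))
    obtain ⟨s1, s2⟩ := spread_lt h1 h2 h3
    have m1 : pairProd ((a, b) :: (c, e) :: r) ∈ bracketSpan n := by
      refine ih _ ?_ _ ?_ ?_ rfl
      · simp only [List.map_cons, List.sum_cons]
        omega
      · refine List.Perm.trans ?_ hperm'
        simp only [endpoints, List.flatMap_cons, List.cons_append, List.nil_append]
        exact (List.Perm.swap _ _ _).cons a
      · simp only [List.mem_cons, forall_eq_or_imp]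
        exact ⟨h1, h3, hltr⟩
    have m2 : pairProd ((a, e) :: (b, c) :: r) ∈ bracketSpan n := by
      refine ih _ ?_ _ ?_ ?_ rfl
      · simp only [List.map_cons, List.sum_cons]
        omega
      · refine List.Perm.trans ?_ hperm'
        simp only [endpoints, List.flatMap_cons, List.cons_append, List.nil_append]
        refine List.Perm.cons a ?_
        exact ((List.Perm.swap _ _ _).trans ((List.Perm.swap _ _ _).cons b)).trans
          (List.Perm.swap _ _ _)
      · simp only [List.mem_cons, forall_eq_or_imp]
        exact ⟨(h1.trans h2).trans h3, h2, hltr⟩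
    have : pairProd ps = pairProd ((a, b) :: (c, e) :: r) + pairProd ((a, e) :: (b, c) :: r) := by
      rw [pairProd_perm hperm]
      funext v
      simp only [pairProd, List.map_cons, List.prod_cons, Pi.add_apply, ← mul_assoc]
      rw [bracket_plucker (v a) (v b) (v c) (v e)]
      ring
    rw [this]
    exact Submodule.add_mem _ m1 m2

/-- Every product of brackets over a perfect matching is a combination of the planar ones. -/
theorem pairProd_mem (ps : List (Fin n × Fin n))
    (hps : (endpoints ps).Perm (List.finRange n)) : pairProd ps ∈ bracketSpan n := by
  -- Orienting all pairs from left to right only costs a sign.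
  suffices key : ∀ qs : List (Fin n × Fin n), (endpoints qs).Nodup →
      ∃ qs' : List (Fin n × Fin n), (endpoints qs').Perm (endpoints qs) ∧ (∀ p ∈ qs', p.1 < p.2) ∧
        ∃ c : ℝ, pairProd qs = c • pairProd qs' by
    obtain ⟨ps', h1, h2, c, h3⟩ := key ps (hps.nodup_iff.2 (List.nodup_finRange n))
    rw [h3]
    exact Submodule.smul_mem _ _ (pairProd_mem_of_oriented ps' (h1.trans hps) h2)
  intro qs
  induction qs with
  | nil => exact fun _ => ⟨[], List.Perm.refl _, by simp, 1, by simp⟩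
  | cons p qs ih =>
    intro hnd
    obtain ⟨a, b⟩ := p
    simp only [endpoints, List.flatMap_cons, List.cons_append, List.nil_append, List.nodup_cons,
      List.mem_cons, not_or] at hnd
    obtain ⟨qs', h1, h2, c, h3⟩ := ih hnd.2.2
    have h4 := fun v => congrFun h3 v
    rcases lt_or_gt_of_ne hnd.1.1 with h | h
    · refine ⟨(a, b) :: qs', ?_, ?_, c, ?_⟩
      · simpa [endpoints] using h1
      · simpa [h] using fun x y => h2 (x, y)
      · funext v
        have := h4 v
        simp only [pairProd, List.map_cons, List.prod_cons, Pi.smul_apply, smul_eq_mul] at this ⊢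
        rw [this]; ring
    · refine ⟨(b, a) :: qs', ?_, ?_, -c, ?_⟩
      · simp only [endpoints, List.flatMap_cons, List.cons_append, List.nil_append]
        exact (List.Perm.swap _ _ _).trans ((h1.cons b).cons a)
      · simpa [h] using fun x y => h2 (x, y)
      · funext v
        have := h4 v
        simp only [pairProd, List.map_cons, List.prod_cons, Pi.smul_apply, smul_eq_mul] at this ⊢
        rw [this, bracket_swap]; ring

/-- The reproducing property on the whole span. -/
theorem eq_sum_of_mem_bracketSpan {G : (Fin n → ℝ × ℝ) → ℝ} (hG : G ∈ bracketSpan n)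
    (v : Fin n → ℝ × ℝ) :
    G v = ∑ β : LinkPattern n, G (stepVec ∘ β.word) * tilingSum β.word v := by
  induction hG using Submodule.span_induction with
  | mem x h =>
    obtain ⟨α, rfl⟩ := h
    exact bracketProd_eq_sum α v
  | zero => simp
  | add x y _ _ hx hy =>
    simp only [Pi.add_apply, add_mul, Finset.sum_add_distrib]
    rw [← hx, ← hy]
  | smul c x _ hx =>
    simp only [Pi.smul_apply, smul_eq_mul, mul_assoc, ← Finset.mul_sum]
    rw [← hx]

end Uncrossing

/-! ### The generating function of the inverse Fomin type sums -/

section Generating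

variable {n : ℕ}

/-- The alternating form with the values `K a b * bracket (v a) (v b)` for symmetric `K`. -/
noncomputable def bracketForm (K : Fin n → Fin n → ℝ) (v : Fin n → ℝ × ℝ) :
    LinearMap.BilinForm ℝ (Fin n → ℝ) :=
  Matrix.toBilin' (Matrix.of fun a b => (K a b + K b a) / 2 * bracket (v a) (v b))

theorem toBilin'_self_eq_zero {ι : Type*} [Fintype ι] [DecidableEq ι] (A : Matrix ι ι ℝ)
    (hA : ∀ a b, A a b = -A b a) (x : ι → ℝ) : Matrix.toBilin' A x x = 0 := by
  rw [Matrix.toBilin'_apply]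
  have h : ∑ i, ∑ j, x i * A i j * x j = -∑ i, ∑ j, x i * A i j * x j := by
    conv_lhs => rw [Finset.sum_comm]
    rw [← Finset.sum_neg_distrib]
    refine Finset.sum_congr rfl fun i _ => ?_
    rw [← Finset.sum_neg_distrib]
    refine Finset.sum_congr rfl fun j _ => ?_
    rw [hA j i]
    ring
  linarith

theorem bracketForm_self (K : Fin n → Fin n → ℝ) (v : Fin n → ℝ × ℝ) (x : Fin n → ℝ) :
    bracketForm K v x x = 0 := by
  refine toBilin'_self_eq_zero _ (fun a b => ?_) x
  simp only [Matrix.of_apply]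
  rw [bracket_swap]
  ring

theorem bracketForm_single (K : Fin n → Fin n → ℝ) (v : Fin n → ℝ × ℝ) (a b : Fin n) :
    bracketForm K v (Pi.single a 1) (Pi.single b 1) =
      (K a b + K b a) / 2 * bracket (v a) (v b) := by
  rw [bracketForm, Matrix.toBilin'_single]
  rfl

/-- The Pfaffian of the matrix with the entries `K a b * bracket (v a) (v b)`. -/
noncomputable def bracketPfaffian (K : Fin n → Fin n → ℝ) (l : List (Fin n))
    (v : Fin n → ℝ × ℝ) : ℝ :=
  pfaffian (bracketForm K v) (bracketForm_self K v) (l.map fun a => Pi.single a 1)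

/-- Repeated expansion along the first row writes the Pfaffian as a combination of bracket products
over perfect matchings, in general crossing ones. -/
theorem bracketPfaffian_mem_span (K : Fin n → Fin n → ℝ) (l : List (Fin n)) :
    bracketPfaffian K l ∈ Submodule.span ℝ
      {f | ∃ ps : List (Fin n × Fin n), (endpoints ps).Perm l ∧ f = pairProd ps} := by
  induction hn : l.length using Nat.strong_induction_on generalizing l with
  | _ N ih =>
  cases l with
  | nil =>
    refine Submodule.subset_span ⟨[], List.Perm.refl _, ?_⟩
    funext v
    simp [bracketPfaffian, pfaffian_nil, pairProd]
  | cons a l =>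
    have h1 : bracketPfaffian K (a :: l) = ∑ i : Fin l.length,
        ((-1) ^ i.val * ((K a (l.get i) + K (l.get i) a) / 2)) •
          ((fun v => bracket (v a) (v (l.get i))) * bracketPfaffian K (l.eraseIdx i)) := by
      funext v
      rw [bracketPfaffian, List.map_cons,
        pfaffian_cons _ _ (fun a : Fin n => (Pi.single a 1 : Fin n → ℝ)), Finset.sum_apply]
      refine Finset.sum_congr rfl fun i _ => ?_
      rw [bracketForm_single]
      simp only [Pi.smul_apply, Pi.mul_apply, smul_eq_mul, bracketPfaffian]
      ring
    rw [h1]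
    refine Submodule.sum_mem _ fun i _ => Submodule.smul_mem _ _ ?_
    have h2 := ih (l.eraseIdx i).length (by
      have := List.length_eraseIdx_le l i
      simp only [List.length_cons] at hn
      omega) (l.eraseIdx i) rfl
    generalize bracketPfaffian K (l.eraseIdx i) = g at h2 ⊢
    induction h2 using Submodule.span_induction with
    | mem f hf =>
      obtain ⟨ps, hps, rfl⟩ := hf
      refine Submodule.subset_span ⟨(a, l.get i) :: ps, ?_, ?_⟩
      · simp only [endpoints, List.flatMap_cons, List.cons_append, List.nil_append]
        exact List.Perm.cons a ((List.Perm.cons _ hps).trans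
          (List.getElem_cons_eraseIdx_perm i.isLt))
      · funext v
        simp [pairProd]
    | zero => simp
    | add f g _ _ hf hg =>
      rw [mul_add]
      exact Submodule.add_mem _ hf hg
    | smul c f _ hf =>
      rw [mul_smul_comm]
      exact Submodule.smul_mem _ _ hf

theorem bracketPfaffian_mem (K : Fin n → Fin n → ℝ) :
    bracketPfaffian K (List.finRange n) ∈ bracketSpan n := by
  have h := bracketPfaffian_mem_span K (List.finRange n)
  refine (Submodule.span_le.2 ?_) h
  rintro f ⟨ps, hps, rfl⟩
  exact pairProd_mem ps hps

theorem ofFn_otherPoint {X : Type*} (a : Fin (n + 1)) (f : Fin (n + 2) → X) :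
    List.ofFn f = (List.ofFn (f ∘ otherPoint a)).take a ++
      f a.castSucc :: f a.succ :: (List.ofFn (f ∘ otherPoint a)).drop a := by
  have ha := a.isLt
  apply List.ext_getElem
  · simp
    omega
  · intro i h1 h2
    rw [List.getElem_ofFn, List.getElem_append]
    simp only [List.length_take, List.length_ofFn, min_eq_left (Nat.lt_succ_iff.1 ha)]
    split_ifs with h
    · simp only [List.getElem_take, List.getElem_ofFn, Function.comp]
      congr 1
      apply Fin.ext
      rw [otherPoint_val, if_pos h]
    · rw [List.length_ofFn] at h1
      rcases Nat.lt_or_ge a.val i with h3 | h3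
      · rcases Nat.lt_or_ge (a.val + 1) i with h4 | h4
        · obtain ⟨k, hk⟩ : ∃ k, i - a.val = k + 2 := ⟨i - a.val - 2, by omega⟩
          simp only [hk, List.getElem_cons_succ, List.getElem_drop, List.getElem_ofFn, Function.comp]
          congr 1
          apply Fin.ext
          rw [otherPoint_val]
          simp only
          rw [if_neg (by omega)]
          omega
        · have hk : i - a.val = 1 := by omega
          simp only [hk, List.getElem_cons_succ, List.getElem_cons_zero]
          congr 1
          apply Fin.ext
          simp only [Fin.val_succ]
          omega
      · have hk : i - a.val = 0 := by omega
        simp only [hk, List.getElem_cons_zero]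
        congr 1
        apply Fin.ext
        simp only [Fin.val_castSucc]
        omega

theorem LinkPattern.exists_peak (β : LinkPattern (n + 2)) :
    ∃ a : Fin (n + 1), β.partner a.castSucc = a.succ := by
  by_contra hcon
  push Not at hcon
  have h0 : β.word 0 = true := by
    have := β.partner_ne 0
    simpa [LinkPattern.word] using Fin.pos_iff_ne_zero.2 this
  have h1 : ∀ i : Fin (n + 2), β.word i = true := by
    intro i
    induction i using Fin.induction with
    | zero => exact h0
    | succ a ih =>
      by_contra h
      exact hcon a ((β.partner_eq_succ_iff a).2 ⟨ih, by simpa using h⟩)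
  have h2 := wordWalk_word_eq_zero β
  unfold wordWalk at h2
  simp only [h1, if_true, Fin.is_lt, Finset.sum_const, Finset.card_univ, Fintype.card_fin] at h2
  simp at h2
  omega

/-- The Gram matrix of a symplectic basis whose dual pairs are the links. -/
def linkSign (β : LinkPattern n) (a b : Fin n) : ℝ :=
  if b = β.partner a then (if β.word a then 1 else -1) else 0

theorem linkSign_swap (β : LinkPattern n) (a b : Fin n) : linkSign β a b = -linkSign β b a := by
  unfold linkSign
  by_cases h : b = β.partner a
  · subst h
    rw [if_pos rfl, if_pos (β.partner_partner a).symm, β.word_partner]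
    cases β.word a <;> simp
  · rw [if_neg h, if_neg, neg_zero]
    rintro rfl
    exact h (β.partner_partner b).symm

/-- An innermost link joins neighbours whose vectors pair only with each other, with value one;
peeling it off leaves the same situation for a smaller pattern, without any sign. -/
theorem pfaffian_linkSign {V : Type*} [AddCommGroup V] [Module ℝ V] (B : LinearMap.BilinForm ℝ V)
    (hB : ∀ v, B v v = 0) (β : LinkPattern n) (φ : Fin n → V)
    (h : ∀ a b, B (φ a) (φ b) = linkSign β a b) : pfaffian B hB (List.ofFn φ) = 1 := by
  induction n using Nat.strong_induction_on with
  | _ n ih =>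
  obtain _ | _ | n := n
  · simp [pfaffian_nil]
  · exact absurd (Fin.ext (by omega)) (β.partner_ne 0)
  · obtain ⟨a, ha⟩ := β.exists_peak
    obtain ⟨β', rfl⟩ := β.exists_insertLink a ha
    have h1 : ∀ i, B (φ a.castSucc) ((φ ∘ otherPoint a) i) = 0 := by
      intro i
      rw [Function.comp, h, linkSign, if_neg]
      rw [ha]
      exact otherPoint_ne_succ a i
    rw [ofFn_otherPoint a φ]
    have := pfaffian_remove B hB ((List.ofFn (φ ∘ otherPoint a)).take a) []
      ((List.ofFn (φ ∘ otherPoint a)).drop a) (φ a.castSucc) (φ a.succ)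
      (fun w hw => by
        obtain ⟨i, rfl⟩ := (List.mem_ofFn' _ _).1 (List.mem_of_mem_take hw)
        exact h1 i) (by simp)
      (fun w hw => by
        obtain ⟨i, rfl⟩ := (List.mem_ofFn' _ _).1 (List.mem_of_mem_drop hw)
        exact h1 i)
    rw [List.nil_append, List.nil_append, List.take_append_drop] at this
    rw [this, h, linkSign, if_pos ha.symm, β'.word_insertLink_castSucc]
    simp only [List.length_nil, pow_zero, if_true, one_mul]
    refine ih n (by omega) β' (φ ∘ otherPoint a) fun i k => ?_
    rw [Function.comp, Function.comp, h, linkSign, linkSign]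
    have h2 : (β'.insertLink a).partner (otherPoint a i) = otherPoint a (β'.partner i) :=
      insertPartner_otherPoint β' a i
    have h3 : (β'.insertLink a).word (otherPoint a i) = β'.word i :=
      congrFun (β'.word_insertLink_otherPoint a) i
    simp only [h2, h3, (otherPoint_strictMono a).injective.eq_iff]

/-- At a Dyck word the brackets of two up-vectors and of two down-vectors vanish, so only the
entries between left and right endpoints survive. To avoid tracking the sign of the shuffle, the
Gram matrix is written as a transform of the standard one in `linkSign`, whose Pfaffian is one; the
determinant of the transformation is the Fomin determinant. -/
theorem bracketPfaffian_stepVec (K : Fin n → Fin n → ℝ) (hK : ∀ a b, K a b = K b a)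
    (β : LinkPattern n) :
    bracketPfaffian K (List.finRange n) (stepVec ∘ β.word) = fominDet β K := by
  let J : LinearMap.BilinForm ℝ (Fin n → ℝ) := Matrix.toBilin' (Matrix.of (linkSign β))
  have hJ : ∀ x, J x x = 0 := toBilin'_self_eq_zero _ (linkSign_swap β)
  have hJs : ∀ a b, J (Pi.single a 1) (Pi.single b 1) = linkSign β a b := fun a b =>
    Matrix.toBilin'_single _ a b
  -- Left endpoints are expanded in the left endpoints with coefficients `K a (partner k)`, right
  -- endpoints are kept. Hence `T` is block triangular with an identity block.
  let T : Matrix (Fin n) (Fin n) ℝ := Matrix.of fun a k =>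
    if a < β.partner a then (if k < β.partner k then K a (β.partner k) else 0)
    else (if a = k then 1 else 0)
  let φ' : Fin n → Fin n → ℝ := fun a => ∑ k, T a k • Pi.single k 1
  have hgram : ∀ a b, bracketForm K (stepVec ∘ β.word) (Pi.single a 1) (Pi.single b 1) =
      J (φ' a) (φ' b) := by
    intro a b
    rw [bracketForm_single, ← hK a b]
    have hJe : J (φ' a) (φ' b) = ∑ k, ∑ l, T a k * T b l * linkSign β k l := by
      simp only [φ', map_sum, LinearMap.sum_apply, map_smul, LinearMap.smul_apply, hJs, smul_eq_mul]
      rw [Finset.sum_comm]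
      refine Finset.sum_congr rfl fun k _ => ?_
      rw [Finset.mul_sum]
      exact Finset.sum_congr rfl fun l _ => by ring
    have hJe' : J (φ' a) (φ' b) = ∑ k, T a k * T b (β.partner k) *
        (if β.word k then 1 else -1) := by
      rw [hJe]
      refine Finset.sum_congr rfl fun k _ => ?_
      rw [Finset.sum_eq_single (β.partner k)]
      · simp [linkSign]
      · intro l _ hl
        simp [linkSign, hl]
      · simp
    rw [hJe']
    have hpp := β.partner_partner
    by_cases ha : a < β.partner a <;> by_cases hb : b < β.partner b
    · have hz : ∀ k, T a k * T b (β.partner k) * (if β.word k then (1 : ℝ) else -1) = 0 := by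
        intro k
        simp only [T, Matrix.of_apply, if_pos ha, if_pos hb, hpp]
        by_cases hk : k < β.partner k
        · rw [if_neg hk.not_gt]; ring
        · rw [if_neg hk]; ring
      rw [Finset.sum_eq_zero fun k _ => hz k]
      simp [LinkPattern.word, ha, hb, bracket, stepVec]
    · rw [Finset.sum_eq_single (β.partner b)]
      · have hb' : β.partner b < β.partner (β.partner b) := by
          rw [hpp]
          exact lt_of_le_of_ne (not_lt.1 hb) (β.partner_ne b)
        have hb2 : β.partner b < b := by rwa [hpp] at hb'
        simp [T, LinkPattern.word, ha, hb, bracket, stepVec, hpp, hb2]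
      · intro k _ hk
        have : ¬ b = β.partner k := by
          rintro rfl
          exact hk (hpp k).symm
        simp [T, hb, this]
      · simp
    · rw [Finset.sum_eq_single a]
      · have ha' : β.partner a < a := lt_of_le_of_ne (not_lt.1 ha) (β.partner_ne a)
        simp [T, LinkPattern.word, ha, hb, bracket, stepVec, hpp, ha']
        exact hK a b
      · intro k _ hk
        simp [T, ha, hk.symm]
      · simp
    · rw [Finset.sum_eq_single a]
      · have : ¬ b = β.partner a := by
          rintro rfl
          rw [hpp] at hb
          exact β.partner_ne a (le_antisymm (not_lt.1 ha) (not_lt.1 hb))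
        simp [T, LinkPattern.word, ha, hb, bracket, stepVec, this]
      · intro k _ hk
        simp [T, ha, hk.symm]
      · simp
  rw [bracketPfaffian, pfaffian_congr (B' := J) (hB' := hJ) _ φ' _ fun a _ b _ => hgram a b,
    ← List.ofFn_eq_map]
  have h1 := pfaffianAlt_apply J hJ [] [] n φ'
  rw [List.nil_append, List.append_nil] at h1
  rw [← h1]
  have h2 := alternatingMap_sum_smul (pfaffianAlt J hJ [] [] n) T fun k => Pi.single k 1
  have h3 : pfaffianAlt J hJ [] [] n φ' = T.det *
      (pfaffianAlt J hJ [] [] n) fun k => Pi.single k 1 := h2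
  rw [h3, pfaffianAlt_apply, List.nil_append, List.append_nil, pfaffian_linkSign J hJ β _ hJs,
    mul_one, Matrix.twoBlockTriangular_det T (fun a => a < β.partner a)]
  · have h4 : (T.toSquareBlockProp fun a => ¬ a < β.partner a) = 1 := by
      ext ⟨a, ha⟩ ⟨b, hb⟩
      simp [Matrix.toSquareBlockProp, T, Matrix.one_apply, ha]
    rw [h4, Matrix.det_one, mul_one]
    unfold fominDet
    congr 1
    ext ⟨a, ha⟩ ⟨b, hb⟩
    simp [Matrix.toSquareBlockProp, T, ha, hb]
  · intro a ha b hb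
    simp only [T, Matrix.of_apply, if_neg ha]
    rw [if_neg]
    rintro rfl
    exact ha hb

theorem inverseFominSum_eq (α : LinkPattern n) (K : Fin n → Fin n → ℝ) :
    inverseFominSum α K = ∑ β : LinkPattern n, (wordCount α β.word : ℝ) * fominDet β K := by
  classical
  unfold inverseFominSum
  rw [Finset.sum_filter]
  refine Finset.sum_congr rfl fun β _ => ?_
  have h1 : α.Below β ↔ ∀ x, wordWalk α.word x ≤ wordWalk β.word x := by
    rw [← α.walk_eq, ← β.walk_eq]
    rfl
  unfold wordCount
  by_cases h : α.Below β
  · rw [if_pos h, if_pos (h1.1 h), ← α.walk_eq, ← β.walk_eq]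
    rfl
  · rw [if_neg h, if_neg fun h' => h (h1.2 h')]
    simp

/-- The Pfaffian of the matrix with the entries `K a b * bracket (v a) (v b)` is the generating
function of the inverse Fomin type sums. -/
theorem pfaffian_eq_sum_inverseFominSum {V : Type*} [AddCommGroup V] [Module ℝ V]
    (B : LinearMap.BilinForm ℝ V) (hB : ∀ v, B v v = 0) (K : Fin n → Fin n → ℝ)
    (hK : ∀ a b, K a b = K b a) (v : Fin n → ℝ × ℝ) (φ : Fin n → V)
    (h : ∀ a b, B (φ a) (φ b) = K a b * bracket (v a) (v b)) :
    pfaffian B hB (List.ofFn φ) = ∑ α : LinkPattern n, inverseFominSum α K * bracketProd α v := by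
  have h1 : pfaffian B hB (List.ofFn φ) = bracketPfaffian K (List.finRange n) v := by
    rw [List.ofFn_eq_map, bracketPfaffian]
    refine pfaffian_congr _ _ _ fun a _ b _ => ?_
    rw [h, bracketForm_single, ← hK a b]
    ring
  -- The reproducing property applies to the Pfaffian; its values at Dyck words are Fomin
  -- determinants, and exchanging the sums collects the tiling coefficients into `inverseFominSum`.
  rw [h1, eq_sum_of_mem_bracketSpan (bracketPfaffian_mem K) v]
  simp only [bracketPfaffian_stepVec K hK, inverseFominSum_eq, tilingSum, Finset.mul_sum,
    Finset.sum_mul]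
  rw [Finset.sum_comm]
  exact Finset.sum_congr rfl fun α _ => Finset.sum_congr rfl fun β _ => by ring

end Generating


/-! ### Link patterns of consecutive blocks -/

section Blocks

variable {d : ℕ} {s : Fin d → ℕ}

/-- The block of an index. -/
def blockOf (a : Fin (∑ i, s i)) : Fin d := (finSigmaFinEquiv.symm a).1

theorem lt_of_blockOf_lt {a b : Fin (∑ i, s i)} (h : blockOf a < blockOf b) : a < b := by
  have := (finSigmaFinEquiv_lt_iff (finSigmaFinEquiv.symm a) (finSigmaFinEquiv.symm b)).2 (Or.inl h)
  simpa using this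

theorem blockOf_mono {a b : Fin (∑ i, s i)} (h : a ≤ b) : blockOf a ≤ blockOf b :=
  not_lt.1 fun h' => absurd (lt_of_blockOf_lt h') h.not_gt

theorem blockOf_lt_of_lt {a b : Fin (∑ i, s i)} (h : a < b) (hne : blockOf a ≠ blockOf b) :
    blockOf a < blockOf b := lt_of_le_of_ne (blockOf_mono h.le) hne

/-- No link connects two indices of the same block. -/
def Unblocked (β : LinkPattern (∑ i, s i)) : Prop := ∀ a, blockOf (β.partner a) ≠ blockOf a

/-- The number of links between two blocks. -/
def blockMult (β : LinkPattern (∑ i, s i)) (i k : Fin d) : ℕ :=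
  (Finset.univ.filter fun a => blockOf a = i ∧ blockOf (β.partner a) = k).card

/-- The right endpoints in a block. -/
def downSteps (β : LinkPattern (∑ i, s i)) (i : Fin d) : Finset (Fin (∑ i, s i)) :=
  Finset.univ.filter fun a => blockOf a = i ∧ β.word a = false

theorem word_eq_false_iff {n : ℕ} (β : LinkPattern n) (a : Fin n) :
    β.word a = false ↔ β.partner a < a := by
  have := β.partner_ne a
  simp only [LinkPattern.word, decide_eq_false_iff_not, not_lt]
  exact ⟨fun h => lt_of_le_of_ne h this, le_of_lt⟩

theorem word_eq_true_iff {n : ℕ} (β : LinkPattern n) (a : Fin n) :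
    β.word a = true ↔ a < β.partner a := by
  simp [LinkPattern.word]

/-- Inside a block all down-steps come before all up-steps: an up-step followed by a down-step of
the same block, both linked outside the block, would give crossing links. -/
theorem Unblocked.word_eq_false {β : LinkPattern (∑ i, s i)} (hβ : Unblocked β)
    {a b : Fin (∑ i, s i)} (hab : a < b) (hblk : blockOf a = blockOf b) (hb : β.word b = false) :
    β.word a = false := by
  by_contra ha
  rw [Bool.not_eq_false, word_eq_true_iff] at ha
  rw [word_eq_false_iff] at hb
  have h1 : β.partner b < a := lt_of_blockOf_lt (by
    rw [hblk]
    exact blockOf_lt_of_lt hb (hβ b))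
  have h2 : b < β.partner a := lt_of_blockOf_lt (by
    rw [← hblk]
    exact blockOf_lt_of_lt ha (hβ a).symm)
  refine β.planar (β.partner b) a ⟨h1, ?_⟩
  rw [β.partner_partner]
  exact ⟨hab, h2⟩

/-- The down-steps of a block form an initial segment of it, so their number determines the word,
and the word determines the pattern. -/
theorem Unblocked.eq_of_card_downSteps {β γ : LinkPattern (∑ i, s i)} (hβ : Unblocked β)
    (hγ : Unblocked γ) (h : ∀ i, (downSteps β i).card = (downSteps γ i).card) : β = γ := by
  apply LinkPattern.word_injective
  have key : ∀ i, downSteps β i = downSteps γ i := by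
    intro i
    have hmem : ∀ (β : LinkPattern (∑ i, s i)) a, a ∈ downSteps β i ↔
        blockOf a = i ∧ β.word a = false := fun β a => by simp [downSteps]
    have htot : downSteps β i ⊆ downSteps γ i ∨ downSteps γ i ⊆ downSteps β i := by
      by_contra hcon
      rw [not_or, Finset.not_subset, Finset.not_subset] at hcon
      obtain ⟨⟨a, ha, ha'⟩, ⟨b, hb, hb'⟩⟩ := hcon
      rw [hmem] at ha ha' hb hb'
      rcases lt_trichotomy a b with h | h | h
      · exact ha' ⟨ha.1, hγ.word_eq_false h (ha.1.trans hb.1.symm) hb.2⟩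
      · exact ha' (h ▸ hb)
      · exact hb' ⟨hb.1, hβ.word_eq_false h (hb.1.trans ha.1.symm) ha.2⟩
    rcases htot with h' | h'
    · exact Finset.eq_of_subset_of_card_le h' (h i).ge
    · exact (Finset.eq_of_subset_of_card_le h' (h i).le).symm
  funext a
  have := Finset.ext_iff.1 (key (blockOf a)) a
  simp only [downSteps, Finset.mem_filter, Finset.mem_univ, true_and] at this
  cases h1 : β.word a <;> cases h2 : γ.word a <;> simp_all

theorem Unblocked.card_downSteps {β : LinkPattern (∑ i, s i)} (hβ : Unblocked β) (i : Fin d) :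
    (downSteps β i).card = ∑ k with k < i, blockMult β i k := by
  have hmaps : ∀ a ∈ downSteps β i, blockOf (β.partner a) ∈ Finset.univ.filter (· < i) := by
    intro a ha
    simp only [downSteps, Finset.mem_filter, Finset.mem_univ, true_and, word_eq_false_iff] at ha ⊢
    rw [← ha.1]
    exact blockOf_lt_of_lt ha.2 (hβ a)
  rw [Finset.card_eq_sum_card_fiberwise hmaps]
  refine Finset.sum_congr rfl fun k hk => ?_
  congr 1
  ext a
  simp only [downSteps, Finset.mem_filter, Finset.mem_univ, true_and, word_eq_false_iff] at hk ⊢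
  constructor
  · rintro ⟨⟨h1, -⟩, h2⟩
    exact ⟨h1, h2⟩
  · rintro ⟨h1, h2⟩
    exact ⟨⟨h1, lt_of_blockOf_lt (by rw [h1, h2]; exact hk)⟩, h2⟩

namespace ValencedLinkPattern

theorem mult_injective : Function.Injective (ValencedLinkPattern.mult (s := s)) := by
  rintro ⟨m, _, _, _, _⟩ ⟨m', _, _, _, _⟩ h
  cases h
  rfl

variable (α : ValencedLinkPattern s)

theorem blockOf_linkEnds (e : (i : Fin d) × (k : Fin d) × Fin (α.mult i k)) :
    blockOf (α.linkEnds e) = e.1 := by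
  simp [blockOf, linkEnds]

theorem unfuse_partner_linkEnds (e : (i : Fin d) × (k : Fin d) × Fin (α.mult i k)) :
    α.unfuse.partner (α.linkEnds e) = α.linkEnds (α.otherEnd e) := by
  simp [unfuse]

theorem unblocked_unfuse : Unblocked α.unfuse := by
  intro a
  obtain ⟨⟨i, k, r⟩, rfl⟩ := α.linkEnds.surjective a
  rw [unfuse_partner_linkEnds, blockOf_linkEnds, blockOf_linkEnds]
  rintro h
  change k = i at h
  subst h
  exact (Fin.cast (α.irrefl k) r).elim0

theorem blockMult_unfuse (i k : Fin d) : blockMult α.unfuse i k = α.mult i k := by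
  have h := Finset.card_fin (α.mult i k)
  rw [← h]
  symm
  refine Finset.card_bij (fun r _ => α.linkEnds ⟨i, k, r⟩) ?_ ?_ ?_
  · intro r _
    simp only [Finset.mem_filter, Finset.mem_univ, true_and]
    rw [unfuse_partner_linkEnds, blockOf_linkEnds, blockOf_linkEnds]
    exact ⟨rfl, rfl⟩
  · intro r _ r' _ hr
    simpa using hr
  · intro a ha
    obtain ⟨⟨i', k', r⟩, rfl⟩ := α.linkEnds.surjective a
    simp only [Finset.mem_filter, Finset.mem_univ, true_and] at ha
    rw [unfuse_partner_linkEnds, blockOf_linkEnds, blockOf_linkEnds] at ha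
    obtain ⟨h1, h2⟩ := ha
    change i' = i at h1
    change k' = k at h2
    subst h1 h2
    exact ⟨r, Finset.mem_univ _, rfl⟩

theorem unfuse_injective : Function.Injective (unfuse (s := s)) := by
  intro α γ h
  apply mult_injective
  funext i k
  rw [← blockMult_unfuse, ← blockMult_unfuse, h]

noncomputable instance : Fintype (ValencedLinkPattern s) := Fintype.ofInjective _ unfuse_injective

/-- The number of links to the left at a point. -/
def leftValence (i : Fin d) : ℕ := ∑ k with k < i, α.mult i k

theorem eq_of_leftValence {α γ : ValencedLinkPattern s}
    (h : ∀ i, α.leftValence i = γ.leftValence i) : α = γ := by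
  apply unfuse_injective
  refine α.unblocked_unfuse.eq_of_card_downSteps γ.unblocked_unfuse fun i => ?_
  rw [α.unblocked_unfuse.card_downSteps, γ.unblocked_unfuse.card_downSteps]
  simp only [blockMult_unfuse]
  exact h i

end ValencedLinkPattern

theorem card_block (i : Fin d) :
    (Finset.univ.filter fun a : Fin (∑ i, s i) => blockOf a = i).card = s i := by
  rw [← Finset.card_fin (s i)]
  symm
  refine Finset.card_bij (fun r _ => finSigmaFinEquiv ⟨i, r⟩) ?_ ?_ ?_
  · intro r _
    exact Finset.mem_filter.2 ⟨Finset.mem_univ _, by simp [blockOf]⟩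
  · intro r _ r' _ h
    simpa using h
  · intro a ha
    obtain ⟨⟨i', r⟩, rfl⟩ := finSigmaFinEquiv.surjective a
    have ha' := (Finset.mem_filter.1 ha).2
    rw [blockOf, Equiv.symm_apply_apply] at ha'
    subst ha'
    exact ⟨r, Finset.mem_univ _, rfl⟩

/-- The block multiplicities form a valenced pattern. Its unfused pattern has the same number of
down-steps in each block and therefore is `β`. -/
theorem Unblocked.exists_unfuse {β : LinkPattern (∑ i, s i)} (hβ : Unblocked β) :
    ∃ α : ValencedLinkPattern s, α.unfuse = β := by
  let α : ValencedLinkPattern s :=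
    { mult := blockMult β
      symm := by
        intro i k
        refine Finset.card_bij (fun a _ => β.partner a) ?_ ?_ ?_
        · intro a ha
          simp only [Finset.mem_filter, Finset.mem_univ, true_and, β.partner_partner] at ha ⊢
          exact ha.symm
        · intro a _ b _ h
          rw [← β.partner_partner a, h, β.partner_partner]
        · intro a ha
          refine ⟨β.partner a, ?_, β.partner_partner a⟩
          simp only [Finset.mem_filter, Finset.mem_univ, true_and, β.partner_partner] at ha ⊢
          exact ha.symm
      irrefl := by
        intro i
        rw [blockMult, Finset.card_eq_zero, Finset.filter_eq_empty_iff]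
        rintro a - ⟨h1, h2⟩
        exact hβ a (h2.trans h1.symm)
      valence := by
        intro i
        rw [← card_block (s := s) i,
          Finset.card_eq_sum_card_fiberwise (f := fun a => blockOf (β.partner a))
            (t := Finset.univ) (by intro a _; simp)]
        refine Finset.sum_congr rfl fun k _ => ?_
        rw [blockMult, Finset.filter_filter]
      planar := by
        intro a b c e hab hbc hce
        by_contra hcon
        rw [not_or, blockMult, blockMult, Finset.card_eq_zero, Finset.card_eq_zero,
          ← ne_eq, ← ne_eq, ← Finset.nonempty_iff_ne_empty, ← Finset.nonempty_iff_ne_empty] at hcon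
        obtain ⟨⟨x, hx⟩, y, hy⟩ := hcon
        simp only [Finset.mem_filter, Finset.mem_univ, true_and] at hx hy
        exact β.planar x y ⟨lt_of_blockOf_lt (by rw [hx.1, hy.1]; exact hab),
          lt_of_blockOf_lt (by rw [hx.2, hy.1]; exact hbc),
          lt_of_blockOf_lt (by rw [hx.2, hy.2]; exact hce)⟩ }
  refine ⟨α, α.unblocked_unfuse.eq_of_card_downSteps hβ fun i => ?_⟩
  rw [α.unblocked_unfuse.card_downSteps, hβ.card_downSteps]
  simp only [ValencedLinkPattern.blockMult_unfuse]
  rfl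

namespace ValencedLinkPattern

variable (α : ValencedLinkPattern s)

/-- The product of the differences over the links. -/
def differenceProd (t : Fin d → ℝ) : ℝ :=
  ∏ i, ∏ k, if i < k then (t k - t i) ^ α.mult i k else 1

theorem bracketProd_unfuse (t : Fin d → ℝ) :
    bracketProd α.unfuse (fun a => (1, t (blockOf a))) = α.differenceProd t := by
  unfold bracketProd differenceProd
  rw [← Equiv.prod_comp α.linkEnds, Fintype.prod_sigma]
  refine Finset.prod_congr rfl fun i _ => ?_
  rw [Fintype.prod_sigma]
  refine Finset.prod_congr rfl fun k _ => ?_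
  have h : ∀ r : Fin (α.mult i k), (if α.unfuse.word (α.linkEnds ⟨i, k, r⟩) = true then
      bracket (1, t (blockOf (α.linkEnds ⟨i, k, r⟩)))
        (1, t (blockOf (α.unfuse.partner (α.linkEnds ⟨i, k, r⟩)))) else 1) =
      if i < k then t k - t i else 1 := by
    intro r
    have hu := α.unblocked_unfuse (α.linkEnds ⟨i, k, r⟩)
    have h1 : α.unfuse.word (α.linkEnds ⟨i, k, r⟩) = true ↔ i < k := by
      rw [word_eq_true_iff]
      have e1 : blockOf (α.linkEnds ⟨i, k, r⟩) = i := α.blockOf_linkEnds _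
      have e2 : blockOf (α.unfuse.partner (α.linkEnds ⟨i, k, r⟩)) = k := by
        rw [unfuse_partner_linkEnds, blockOf_linkEnds]
        rfl
      constructor
      · intro h
        have := blockOf_lt_of_lt h hu.symm
        rwa [e1, e2] at this
      · intro h
        apply lt_of_blockOf_lt
        rwa [e1, e2]
    simp only [h1, unfuse_partner_linkEnds, blockOf_linkEnds, otherEnd, bracket]
    split_ifs <;> ring
  rw [Finset.prod_congr rfl fun r _ => h r]
  split_ifs <;> simp

end ValencedLinkPattern

/-- The Pfaffian of the matrix with the entries `K a b * (t_b - t_a)` is the generating function of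
the sums `inverseFominSum α.unfuse K`. -/
theorem pfaffian_eq_sum_valenced {V : Type*} [AddCommGroup V] [Module ℝ V]
    (B : LinearMap.BilinForm ℝ V) (hB : ∀ v, B v v = 0)
    (K : Fin (∑ i, s i) → Fin (∑ i, s i) → ℝ) (hK : ∀ a b, K a b = K b a) (t : Fin d → ℝ)
    (φ : Fin (∑ i, s i) → V)
    (h : ∀ a b, B (φ a) (φ b) = K a b * (t (blockOf b) - t (blockOf a))) :
    pfaffian B hB (List.ofFn φ) =
      ∑ α : ValencedLinkPattern s, inverseFominSum α.unfuse K * α.differenceProd t := by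
  rw [pfaffian_eq_sum_inverseFominSum B hB K hK (fun a => (1, t (blockOf a))) φ
    (fun a b => by rw [h, bracket]; ring)]
  symm
  simp only [← ValencedLinkPattern.bracketProd_unfuse]
  refine Finset.sum_of_injOn (fun α => α.unfuse) (ValencedLinkPattern.unfuse_injective.injOn)
    (fun _ _ => Finset.mem_coe.2 (Finset.mem_univ _)) ?_ (fun _ _ => rfl)
  intro β _ hβ
  -- A pattern that does not come from unfusing links two indices of one block; the bracket of this
  -- link is zero, so the pattern drops out.
  have hun : ¬ Unblocked β := by
    intro hun
    obtain ⟨α, rfl⟩ := hun.exists_unfuse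
    exact hβ ⟨α, by simp, rfl⟩
  unfold Unblocked at hun
  push Not at hun
  obtain ⟨a, ha⟩ := hun
  refine mul_eq_zero_of_right _ ?_
  cases hw : β.word a
  · refine Finset.prod_eq_zero (Finset.mem_univ (β.partner a)) ?_
    simp [β.word_partner, hw, β.partner_partner, ha, bracket]
  · refine Finset.prod_eq_zero (Finset.mem_univ a) ?_
    simp [hw, ha, bracket]

end Blocks

/-! ### Independence of the products of differences -/

section Independence

variable {d : ℕ} {s : Fin d → ℕ}

namespace ValencedLinkPattern

open Polynomial in
/-- The product of differences of monomials with rapidly growing degrees. -/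
noncomputable def differencePoly (α : ValencedLinkPattern s) (b : ℕ) : ℝ[X] :=
  ∏ i, ∏ k, if i < k then ((X : ℝ[X]) ^ b ^ k.val - X ^ b ^ i.val) ^ α.mult i k else 1

open Polynomial in
theorem differencePoly_eval (α : ValencedLinkPattern s) (b : ℕ) (z : ℝ) :
    (α.differencePoly b).eval z = α.differenceProd fun i => z ^ b ^ i.val := by
  simp only [differencePoly, differenceProd, Polynomial.eval_prod]
  refine Finset.prod_congr rfl fun i _ => Finset.prod_congr rfl fun k _ => ?_
  split_ifs <;> simp

open Polynomial in
-- In each factor the power with the larger exponent dominates, so the product is monic and its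
-- degree has the left valences as digits in base `b`.
theorem differencePoly_spec (α : ValencedLinkPattern s) {b : ℕ} (hb : 1 < b) :
    (α.differencePoly b).Monic ∧
      (α.differencePoly b).natDegree = ∑ k, α.leftValence k * b ^ k.val := by
  have hfac : ∀ i k : Fin d, i < k → ((X : ℝ[X]) ^ b ^ k.val - X ^ b ^ i.val).Monic ∧
      ((X : ℝ[X]) ^ b ^ k.val - X ^ b ^ i.val).natDegree = b ^ k.val := by
    intro i k h
    have h1 : b ^ i.val < b ^ k.val := Nat.pow_lt_pow_right hb h
    have h2 : ((X : ℝ[X]) ^ b ^ i.val).degree < ((X : ℝ[X]) ^ b ^ k.val).degree := by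
      rw [degree_X_pow, degree_X_pow]
      exact_mod_cast h1
    refine ⟨(monic_X_pow _).sub_of_left h2, ?_⟩
    rw [natDegree_sub_eq_left_of_natDegree_lt, natDegree_X_pow]
    rwa [natDegree_X_pow, natDegree_X_pow]
  have hfac' : ∀ i k : Fin d,
      (if i < k then ((X : ℝ[X]) ^ b ^ k.val - X ^ b ^ i.val) ^ α.mult i k else 1).Monic ∧
      (if i < k then ((X : ℝ[X]) ^ b ^ k.val - X ^ b ^ i.val) ^ α.mult i k else 1).natDegree =
        if i < k then α.mult i k * b ^ k.val else 0 := by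
    intro i k
    split_ifs with h
    · obtain ⟨h1, h2⟩ := hfac i k h
      exact ⟨h1.pow _, by rw [h1.natDegree_pow, h2]⟩
    · exact ⟨monic_one, natDegree_one⟩
  have hrow : ∀ i : Fin d, (∏ k, if i < k then
      ((X : ℝ[X]) ^ b ^ k.val - X ^ b ^ i.val) ^ α.mult i k else 1).Monic := fun i =>
    monic_prod_of_monic _ _ fun k _ => (hfac' i k).1
  refine ⟨monic_prod_of_monic _ _ fun i _ => hrow i, ?_⟩
  rw [differencePoly, natDegree_prod_of_monic _ _ fun i _ => hrow i]
  simp only [fun i : Fin d => natDegree_prod_of_monic (Finset.univ : Finset (Fin d)) _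
    fun k _ => (hfac' i k).1, (hfac' _ _).2]
  rw [Finset.sum_comm]
  refine Finset.sum_congr rfl fun k _ => ?_
  rw [leftValence, Finset.sum_mul, Finset.sum_filter]
  refine Finset.sum_congr rfl fun i _ => ?_
  rw [α.symm k i]

theorem leftValence_le (α : ValencedLinkPattern s) (i : Fin d) : α.leftValence i ≤ s i := by
  rw [← α.valence i]
  exact Finset.sum_le_sum_of_subset (Finset.filter_subset _ _)

/-- Uniqueness of digits in base `b`, which exceeds all valences, together with the fact that left
valences determine the pattern. -/
theorem differencePoly_natDegree_injective {b : ℕ} (hb : 1 < b) (hs : ∀ i, s i < b)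
    {α γ : ValencedLinkPattern s}
    (h : (α.differencePoly b).natDegree = (γ.differencePoly b).natDegree) : α = γ := by
  rw [(α.differencePoly_spec hb).2, (γ.differencePoly_spec hb).2] at h
  have hdig : ∀ f : Fin d → ℕ, ∑ k, f k * b ^ k.val = Nat.ofDigits b (List.ofFn f) := by
    intro f
    rw [Nat.ofDigits_eq_sum_mapIdx, List.mapIdx_eq_ofFn, List.sum_ofFn]
    exact Fintype.sum_equiv (finCongr (by simp)) _ _ fun i => by simp
  rw [hdig, hdig] at h
  have h2 := Nat.ofDigits_inj_of_len_eq hb (by simp) (by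
    intro x hx
    obtain ⟨i, rfl⟩ := (List.mem_ofFn' _ _).1 hx
    exact (α.leftValence_le i).trans_lt (hs i)) (by
    intro x hx
    obtain ⟨i, rfl⟩ := (List.mem_ofFn' _ _).1 hx
    exact (γ.leftValence_le i).trans_lt (hs i)) h
  exact eq_of_leftValence fun i => congrFun (List.ofFn_injective h2) i

/-- The products of differences of the valenced link patterns are linearly independent. -/
theorem eq_zero_of_sum_differenceProd (c : ValencedLinkPattern s → ℝ)
    (h : ∀ t, ∑ α, c α * α.differenceProd t = 0) : c = 0 := by
  obtain ⟨b, hb, hs⟩ : ∃ b, 1 < b ∧ ∀ i, s i < b := by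
    refine ⟨(∑ i, s i) + 2, by omega, fun i => ?_⟩
    have := Finset.single_le_sum (f := s) (fun _ _ => Nat.zero_le _) (Finset.mem_univ i)
    omega
  have hpoly : ∑ α, c α • α.differencePoly b = 0 := by
    apply Polynomial.funext
    intro z
    rw [Polynomial.eval_finsetSum]
    simp only [Polynomial.eval_smul, differencePoly_eval, smul_eq_mul, Polynomial.eval_zero]
    exact h _
  by_contra hc
  obtain ⟨α₀, hα₀⟩ := Function.ne_iff.1 hc
  -- Among the patterns with nonzero coefficient, the one of largest degree cannot be cancelled,
  -- since the degrees are distinct and the polynomials monic.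
  obtain ⟨α, hα, hmax⟩ := Finset.exists_max_image (Finset.univ.filter fun α => c α ≠ 0)
    (fun α => (α.differencePoly b).natDegree) ⟨α₀, by simpa using hα₀⟩
  simp only [Finset.mem_filter, Finset.mem_univ, true_and] at hα hmax
  have h1 := congrArg (fun p => p.coeff (α.differencePoly b).natDegree) hpoly
  simp only [Polynomial.finsetSum_coeff, Polynomial.coeff_smul, smul_eq_mul,
    Polynomial.coeff_zero] at h1
  rw [Finset.sum_eq_single α] at h1
  · rw [(α.differencePoly_spec hb).1.coeff_natDegree, mul_one] at h1
    exact hα h1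
  · intro γ _ hγ
    by_cases hcγ : c γ = 0
    · rw [hcγ, zero_mul]
    · rw [Polynomial.coeff_eq_zero_of_natDegree_lt, mul_zero]
      exact lt_of_le_of_ne (hmax γ hcγ) fun h => hγ (differencePoly_natDegree_injective hb hs h)
  · simp

/-- Convergence of the generating function implies convergence of the coefficients. -/
theorem tendsto_of_tendsto_sum {X : Type*} {l : Filter X} (c : X → ValencedLinkPattern s → ℝ)
    (c₀ : ValencedLinkPattern s → ℝ)
    (h : ∀ t, Tendsto (fun x => ∑ α, c x α * α.differenceProd t) l
      (𝓝 (∑ α, c₀ α * α.differenceProd t))) (α : ValencedLinkPattern s) :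
    Tendsto (fun x => c x α) l (𝓝 (c₀ α)) := by
  let Φ : (ValencedLinkPattern s → ℝ) →ₗ[ℝ] (Fin d → ℝ) → ℝ :=
    { toFun := fun c t => ∑ α, c α * α.differenceProd t
      map_add' := fun c c' => by
        funext t
        simp [add_mul, Finset.sum_add_distrib]
      map_smul' := fun a c => by
        funext t
        simp [mul_assoc, Finset.mul_sum] }
  have hΦ : Function.Injective Φ := by
    rw [injective_iff_map_eq_zero]
    exact fun c hc => eq_zero_of_sum_differenceProd c fun t => congrFun hc t
  -- The coefficient space is finite-dimensional, so an injective linear map on it is a topological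
  -- embedding and convergence can be pulled back.
  have h1 := (LinearMap.isClosedEmbedding_of_injective (LinearMap.ker_eq_bot.2 hΦ)).isInducing
  have h2 : Tendsto (fun x => Φ (c x)) l (𝓝 (Φ c₀)) := tendsto_pi_nhds.2 h
  exact tendsto_pi_nhds.1 (h1.tendsto_nhds_iff.2 h2) α

end ValencedLinkPattern

end Independence


/-! ### The derivatives of the kernel -/

/-- The derivatives of the Brownian excursion kernel. -/
noncomputable def kernelDeriv (i j : ℕ) (x y : ℝ) : ℝ :=
  (-1) ^ i * (i + j + 1).factorial / Real.pi / (x - y) ^ (2 + i + j)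

theorem kernelDeriv_swap (i j : ℕ) (x y : ℝ) : kernelDeriv i j x y = kernelDeriv j i y x := by
  unfold kernelDeriv
  have h : (x - y) ^ (2 + i + j) = (-1) ^ i * (-1) ^ j * (y - x) ^ (2 + j + i) := by
    rw [show x - y = -1 * (y - x) by ring, mul_pow, show 2 + j + i = 2 + i + j by ring,
      show 2 + i + j = i + j + 2 by ring, pow_add (-1 : ℝ), pow_add (-1 : ℝ) i j]
    norm_num
  have h2 : ∀ k : ℕ, ((-1 : ℝ) ^ k) * (-1) ^ k = 1 := fun k => by rw [← mul_pow]; norm_num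
  have h3 : ∀ k : ℕ, ((-1 : ℝ) ^ k) ≠ 0 := fun k => pow_ne_zero _ (by norm_num)
  rw [h, show i + j + 1 = j + i + 1 by ring, ← div_div, ← div_div]
  congr 1
  rw [div_eq_iff (h3 j), div_eq_iff (h3 i)]
  linear_combination (-((j + i + 1).factorial : ℝ) / Real.pi) * ((-1 : ℝ) ^ i) * h2 j

theorem hasDerivAt_kernelDeriv (i j : ℕ) {x y : ℝ} (h : x ≠ y) :
    HasDerivAt (fun x => kernelDeriv i j x y) (kernelDeriv (i + 1) j x y) x := by
  have h' : x - y ≠ 0 := sub_ne_zero.2 h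
  have h1 : HasDerivAt (fun x : ℝ => (x - y) ^ (2 + i + j))
      (((2 + i + j : ℕ) : ℝ) * (x - y) ^ (2 + i + j - 1) * 1) x :=
    ((hasDerivAt_id x).sub_const y).pow (2 + i + j)
  have h2 := (h1.inv (pow_ne_zero _ h')).const_mul ((-1) ^ i * ((i + j + 1).factorial : ℝ) / Real.pi)
  refine h2.congr_deriv ?_
  unfold kernelDeriv
  have e1 : (((i + 1 + j + 1).factorial : ℕ) : ℝ) = (i + j + 2) * (i + j + 1).factorial := by
    rw [show i + 1 + j + 1 = (i + j + 1) + 1 by ring, Nat.factorial_succ]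
    push_cast
    ring
  rw [e1, show 2 + i + j - 1 = 1 + i + j by omega, show 2 + (i + 1) + j = (1 + i + j) + 2 by ring,
    show 2 + i + j = (1 + i + j) + 1 by ring]
  have := Real.pi_ne_zero
  generalize x - y = z at h'
  push_cast
  field_simp
  ring

theorem iteratedDeriv_eq_of_hasDerivAt {U : Set ℝ} (hU : IsOpen U) (f : ℝ → ℝ) (g : ℕ → ℝ → ℝ)
    (h0 : ∀ x ∈ U, f x = g 0 x) (hg : ∀ i, ∀ x ∈ U, HasDerivAt (g i) (g (i + 1) x) x) (i : ℕ) :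
    ∀ x ∈ U, iteratedDeriv i f x = g i x := by
  induction i with
  | zero => simpa using h0
  | succ i ih =>
    intro x hx
    rw [iteratedDeriv_succ]
    have h1 : iteratedDeriv i f =ᶠ[𝓝 x] g i :=
      Filter.eventually_of_mem (hU.mem_nhds hx) ih
    rw [h1.deriv_eq, (hg i x hx).deriv]

theorem iteratedDeriv_excursionKernel (i j : ℕ) {x y : ℝ} (h : x ≠ y) :
    iteratedDeriv i (fun u => iteratedDeriv j (fun v => excursionKernel u v) y) x =
      kernelDeriv i j x y := by
  have h1 : ∀ u, u ≠ y → iteratedDeriv j (fun v => excursionKernel u v) y =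
      kernelDeriv 0 j u y := by
    intro u hu
    refine iteratedDeriv_eq_of_hasDerivAt (U := {u}ᶜ) isOpen_compl_singleton _
      (fun j y => kernelDeriv 0 j u y) ?_ ?_ j y hu.symm
    · intro y _
      simp only [excursionKernel, kernelDeriv, pow_zero, Nat.factorial, add_zero]
      ring
    · intro j y hy
      simp only [kernelDeriv_swap 0]
      exact hasDerivAt_kernelDeriv j 0 hy
  exact iteratedDeriv_eq_of_hasDerivAt (U := {y}ᶜ) isOpen_compl_singleton _
    (fun i x => kernelDeriv i j x y) (fun u hu => h1 u hu)
    (fun i x hx => hasDerivAt_kernelDeriv i j hx) i x h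

theorem valencedKernel_eq {d : ℕ} (s : Fin d → ℕ) {x : Fin d → ℝ} (hx : Function.Injective x)
    (a b : Fin (∑ i, s i)) : valencedKernel s x a b = if blockOf a = blockOf b then 0 else
      kernelDeriv (finSigmaFinEquiv.symm a).2.val (finSigmaFinEquiv.symm b).2.val
        (x (blockOf a)) (x (blockOf b)) := by
  unfold valencedKernel blockOf
  split_ifs with h
  · simp [h]
  · simp only [h, if_false]
    exact iteratedDeriv_excursionKernel _ _ fun h' => h (hx h')

theorem valencedKernel_symm {d : ℕ} (s : Fin d → ℕ) {x : Fin d → ℝ} (hx : Function.Injective x)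
    (a b : Fin (∑ i, s i)) : valencedKernel s x a b = valencedKernel s x b a := by
  rw [valencedKernel_eq s hx, valencedKernel_eq s hx, kernelDeriv_swap]
  simp only [eq_comm]

/-! ### Sums of binomial coefficients -/

theorem sum_choose_mul_choose (p l : ℕ) : ∀ (q N : ℕ), l < N →
    ∑ i ∈ Finset.range N, p.choose (i + q) * l.choose i = (p + l).choose (l + q) := by
  induction l with
  | zero =>
    intro q N hN
    rw [Finset.sum_eq_single 0]
    · simp
    · intro i _ hi
      rw [Nat.choose_eq_zero_of_lt (by omega : 0 < i), mul_zero]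
    · intro h
      exact absurd (Finset.mem_range.2 hN) h
  | succ l ih =>
    intro q N hN
    obtain ⟨N, rfl⟩ : ∃ M, N = M + 1 := ⟨N - 1, by omega⟩
    have h1 := ih q (N + 1) (by omega)
    have h2 := ih (q + 1) N (by omega)
    rw [Finset.sum_range_succ'] at h1 ⊢
    simp only [Nat.choose_succ_succ l, mul_add, Finset.sum_add_distrib, Nat.choose_zero_right] at h1 ⊢
    have h3 : ∑ i ∈ Finset.range N, p.choose (i + 1 + q) * l.choose i =
        ∑ i ∈ Finset.range N, p.choose (i + (q + 1)) * l.choose i :=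
      Finset.sum_congr rfl fun i _ => by rw [show i + 1 + q = i + (q + 1) by ring]
    rw [h3, h2, show p + (l + 1) = (p + l) + 1 by ring, show l + 1 + q = (l + q) + 1 by ring,
      Nat.choose_succ_succ, ← h1]
    simp only [Nat.succ_eq_add_one, ← add_assoc]
    ring

theorem sum_choose_succ_mul_choose (k l N : ℕ) (h : k < N) :
    ∑ i ∈ Finset.range N, ((k + 1).choose (i + 1) : ℝ) * l.choose i = (k + l + 1).choose (l + 1) := by
  have h1 := sum_choose_mul_choose (k + 1) l 1 (max N (l + 1)) (by omega)
  have h2 : ∑ i ∈ Finset.range (max N (l + 1)), (k + 1).choose (i + 1) * l.choose i =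
      ∑ i ∈ Finset.range N, (k + 1).choose (i + 1) * l.choose i := by
    symm
    refine Finset.sum_subset (Finset.range_mono (le_max_left _ _)) fun i _ hi => ?_
    rw [Finset.mem_range, not_lt] at hi
    rw [Nat.choose_eq_zero_of_lt (by omega : k + 1 < i + 1), zero_mul]
  rw [h2, show k + 1 + l = k + l + 1 by ring] at h1
  exact_mod_cast h1

/-- A triangular-diagonal-triangular factorization of the matrix `(i + l + 1)! / (i! l!)`. It
diagonalizes the singular pairings between the derivatives at the two merging points, with diagonal
entries proportional to `k + 1`. -/
theorem sum_succ_mul_choose_mul_choose (i l N : ℕ) (h : l < N) :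
    ∑ k ∈ Finset.range N, ((k : ℝ) + 1) * (i + 1).choose (k + 1) * (l + 1).choose (k + 1) =
      (i + l + 1).factorial / (i.factorial * l.factorial) := by
  have h1 : ∀ k ∈ Finset.range N, ((k : ℝ) + 1) * (i + 1).choose (k + 1) * (l + 1).choose (k + 1) =
      (i + 1) * (((l + 1).choose (k + 1) : ℝ) * i.choose k) := by
    intro k _
    have := Nat.add_one_mul_choose_eq i k
    have h2 : ((i : ℝ) + 1) * i.choose k = (i + 1).choose (k + 1) * (k + 1) := by exact_mod_cast this
    linear_combination (-((l + 1).choose (k + 1) : ℝ)) * h2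
  rw [Finset.sum_congr rfl h1, ← Finset.mul_sum, sum_choose_succ_mul_choose l i N h]
  have h3 := Nat.add_choose_mul_factorial_mul_factorial l (i + 1)
  have h4 : (((l + i + 1).choose (i + 1) : ℝ)) * l.factorial * ((i + 1) * i.factorial) =
      (i + l + 1).factorial := by
    rw [show i + l + 1 = l + (i + 1) by ring, ← h3, Nat.factorial_succ]
    push_cast
    rw [← add_assoc]
  have := Nat.factorial_ne_zero i
  have := Nat.factorial_ne_zero l
  field_simp
  linear_combination h4

/-- Binomial inversion: the triangular matrix of the row operations is inverted by its signed
version. -/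
theorem sum_choose_mul_choose_neg (i l N : ℕ) (h : i < N) :
    ∑ k ∈ Finset.range N, ((i + 1).choose (k + 1) : ℝ) * ((-1) ^ (k + l) * (k + 1).choose (l + 1)) =
      if i = l then 1 else 0 := by
  rcases Nat.lt_or_ge i l with hil | hil
  · rw [if_neg (by omega)]
    refine Finset.sum_eq_zero fun k _ => ?_
    rcases Nat.lt_or_ge k l with h1 | h1
    · rw [Nat.choose_eq_zero_of_lt (by omega : k + 1 < l + 1)]; simp
    · rw [Nat.choose_eq_zero_of_lt (by omega : i + 1 < k + 1)]; simp
  · obtain ⟨r, rfl⟩ := Nat.exists_eq_add_of_le hil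
    have h1 : ∑ k ∈ Finset.range N,
        ((l + r + 1).choose (k + 1) : ℝ) * ((-1) ^ (k + l) * (k + 1).choose (l + 1)) =
        ∑ k ∈ Finset.Ico l (l + r + 1),
        ((l + r + 1).choose (k + 1) : ℝ) * ((-1) ^ (k + l) * (k + 1).choose (l + 1)) := by
      symm
      refine Finset.sum_subset ?_ fun k _ hk => ?_
      · intro k hk
        rw [Finset.mem_Ico] at hk
        exact Finset.mem_range.2 (by omega)
      · rw [Finset.mem_Ico] at hk
        rcases Nat.lt_or_ge k l with h1 | h1
        · rw [Nat.choose_eq_zero_of_lt (by omega : k + 1 < l + 1)]; simp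
        · rw [Nat.choose_eq_zero_of_lt (by omega : l + r + 1 < k + 1)]; simp
    rw [h1, Finset.sum_Ico_eq_sum_range, show l + r + 1 - l = r + 1 by omega]
    have h2 : ∀ j ∈ Finset.range (r + 1), ((l + r + 1).choose (l + j + 1) : ℝ) *
        ((-1) ^ (l + j + l) * (l + j + 1).choose (l + 1)) =
        (l + r + 1).choose (l + 1) * ((-1) ^ j * r.choose j) := by
      intro j hj
      rw [Finset.mem_range] at hj
      have h3 := Nat.choose_mul (n := l + r + 1) (k := l + j + 1) (s := l + 1)
        (by omega)
      rw [show l + r + 1 - (l + 1) = r by omega, show l + j + 1 - (l + 1) = j by omega] at h3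
      have h4 : ((l + r + 1).choose (l + j + 1) : ℝ) * (l + j + 1).choose (l + 1) =
        (l + r + 1).choose (l + 1) * r.choose j := by exact_mod_cast h3
      rw [show l + j + l = j + (l + l) by ring, pow_add, pow_add (-1 : ℝ) l, ← mul_pow]
      simp only [neg_mul_neg, one_pow, mul_one]
      linear_combination ((-1 : ℝ) ^ j) * h4
    rw [Finset.sum_congr rfl h2, ← Finset.mul_sum]
    have h5 := Int.alternating_sum_range_choose (n := r)
    have h6 : ∑ j ∈ Finset.range (r + 1), ((-1 : ℝ) ^ j * r.choose j) = if r = 0 then 1 else 0 := by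
      exact_mod_cast h5
    rw [h6]
    rcases Nat.eq_zero_or_pos r with rfl | hr
    · simp
    · simp [hr.ne']

/-! ### Taylor expansions near the fusion -/

/-- The filter of pairs `u < v` which tend jointly to `ξ`. -/
def fusionFilter (ξ : ℝ) : Filter (ℝ × ℝ) := 𝓝[{p : ℝ × ℝ | p.1 < p.2}] (ξ, ξ)

theorem tendsto_fst_fusionFilter (ξ : ℝ) : Tendsto Prod.fst (fusionFilter ξ) (𝓝 ξ) :=
  (continuous_fst.tendsto (ξ, ξ)).mono_left nhdsWithin_le_nhds

theorem tendsto_snd_fusionFilter (ξ : ℝ) : Tendsto Prod.snd (fusionFilter ξ) (𝓝 ξ) :=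
  (continuous_snd.tendsto (ξ, ξ)).mono_left nhdsWithin_le_nhds

theorem eventually_lt_fusionFilter (ξ : ℝ) : ∀ᶠ p in fusionFilter ξ, p.1 < p.2 :=
  eventually_mem_nhdsWithin

theorem tendsto_sub_fusionFilter (ξ : ℝ) :
    Tendsto (fun p : ℝ × ℝ => p.2 - p.1) (fusionFilter ξ) (𝓝 0) := by
  simpa using (tendsto_snd_fusionFilter ξ).sub (tendsto_fst_fusionFilter ξ)

/-- The sequence of the successive derivatives of a function near a point. -/
def DerivativesNear (ξ : ℝ) (g : ℕ → ℝ → ℝ) : Prop :=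
  ∀ᶠ x in 𝓝 ξ, ∀ i, HasDerivAt (g i) (g (i + 1) x) x

theorem DerivativesNear.continuousAt {ξ : ℝ} {g : ℕ → ℝ → ℝ} (hg : DerivativesNear ξ g) (i : ℕ) :
    ContinuousAt (g i) ξ := (hg.self_of_nhds i).continuousAt

/-- Induction on the order: the derivative of a remainder is the remainder of the derivative, and
the mean value inequality gains one factor `v - u`. The factorial in the sharp bound is not needed.
-/
theorem taylor_remainder_le {a b C : ℝ} {L : ℕ} : ∀ {g : ℕ → ℝ → ℝ},
    (∀ x ∈ Set.Ioo a b, ∀ i, HasDerivAt (g i) (g (i + 1) x) x) →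
    (∀ x ∈ Set.Ioo a b, |g L x| ≤ C) → ∀ u ∈ Set.Ioo a b, ∀ v ∈ Set.Ioo a b, u ≤ v →
      |g 0 v - ∑ j ∈ Finset.range L, (v - u) ^ j / j.factorial * g j u| ≤ C * (v - u) ^ L := by
  induction L with
  | zero =>
    intro g _ hC u _ v hv _
    simpa using hC v hv
  | succ L ih =>
    intro g hg hC u hu v hv huv
    have hsub : ∀ x ∈ Set.Icc u v, x ∈ Set.Ioo a b := fun x hx =>
      ⟨hu.1.trans_le hx.1, hx.2.trans_lt hv.2⟩
    have hder : ∀ x ∈ Set.Icc u v, HasDerivWithinAt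
        (fun x => g 0 x - ∑ j ∈ Finset.range (L + 1), (x - u) ^ j / j.factorial * g j u)
        (g 1 x - ∑ j ∈ Finset.range L, (x - u) ^ j / j.factorial * g (j + 1) u) (Set.Icc u v) x := by
      intro x hx
      refine HasDerivAt.hasDerivWithinAt ?_
      refine (hg x (hsub x hx) 0).sub ?_
      have h1 : (fun x => ∑ j ∈ Finset.range (L + 1), (x - u) ^ j / j.factorial * g j u) =
          fun x => (∑ j ∈ Finset.range L, (x - u) ^ (j + 1) / (j + 1).factorial * g (j + 1) u) +
            g 0 u := by
        funext x
        rw [Finset.sum_range_succ']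
        simp
      rw [h1]
      refine HasDerivAt.add_const _ ?_
      refine HasDerivAt.fun_sum fun j _ => ?_
      have h2 : HasDerivAt (fun x : ℝ => (x - u) ^ (j + 1))
          (((j + 1 : ℕ) : ℝ) * (x - u) ^ (j + 1 - 1) * 1) x :=
        ((hasDerivAt_id x).sub_const u).pow (j + 1)
      refine ((h2.div_const _).mul_const _).congr_deriv ?_
      have h3 := Nat.factorial_ne_zero j
      rw [Nat.factorial_succ]
      push_cast
      field_simp
    have hbound : ∀ x ∈ Set.Icc u v,
        ‖g 1 x - ∑ j ∈ Finset.range L, (x - u) ^ j / j.factorial * g (j + 1) u‖ ≤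
          C * (v - u) ^ L := by
      intro x hx
      have h1 := ih (g := fun i => g (i + 1)) (fun y hy i => hg y hy (i + 1)) hC u hu x (hsub x hx) hx.1
      have hC0 : 0 ≤ C := (abs_nonneg _).trans (hC u hu)
      rw [Real.norm_eq_abs]
      refine h1.trans (mul_le_mul_of_nonneg_left ?_ hC0)
      exact pow_le_pow_left₀ (by linarith [hx.1]) (by linarith [hx.2]) L
    have h2 := (convex_Icc u v).norm_image_sub_le_of_norm_hasDerivWithin_le hder hbound
      (Set.left_mem_Icc.2 huv) (Set.right_mem_Icc.2 huv)
    have h3 : g 0 u - ∑ j ∈ Finset.range (L + 1), (u - u) ^ j / j.factorial * g j u = 0 := by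
      rw [Finset.sum_range_succ']
      simp
    rw [h3, sub_zero, Real.norm_eq_abs, Real.norm_eq_abs, abs_of_nonneg (sub_nonneg.2 huv)] at h2
    rw [pow_succ, ← mul_assoc]
    exact h2

/-- The expansion is around the moving left point rather than around `ξ`, so its error is controlled
by the distance of the two points alone, however they approach `ξ`. -/
theorem DerivativesNear.taylor_isBigO {ξ : ℝ} {g : ℕ → ℝ → ℝ} (hg : DerivativesNear ξ g)
    (i L : ℕ) : (fun p : ℝ × ℝ => g i p.2 -
      ∑ j ∈ Finset.range L, (p.2 - p.1) ^ j / j.factorial * g (i + j) p.1) =O[fusionFilter ξ]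
        fun p => (p.2 - p.1) ^ L := by
  have h1 : ∀ᶠ x in 𝓝 ξ, |g (i + L) x| ≤ |g (i + L) ξ| + 1 := by
    have := (hg.continuousAt (i + L)).abs
    exact (this.eventually_lt_const (lt_add_one _)).mono fun _ h => le_of_lt h
  obtain ⟨a, b, hab, hsub⟩ := mem_nhds_iff_exists_Ioo_subset.1 (hg.and h1)
  refine Asymptotics.IsBigO.of_bound (|g (i + L) ξ| + 1) ?_
  filter_upwards [(tendsto_fst_fusionFilter ξ).eventually (Ioo_mem_nhds hab.1 hab.2),
    (tendsto_snd_fusionFilter ξ).eventually (Ioo_mem_nhds hab.1 hab.2),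
    eventually_lt_fusionFilter ξ] with p hp1 hp2 hlt
  have h2 := taylor_remainder_le (L := L) (g := fun j => g (i + j))
    (fun x hx j => (hsub hx).1 (i + j)) (fun x hx => (hsub hx).2) p.1 hp1 p.2 hp2 hlt.le
  rw [Real.norm_eq_abs, Real.norm_eq_abs, abs_of_nonneg (pow_nonneg (sub_nonneg.2 hlt.le) L)]
  exact h2

theorem isBigO_pow_sub_of_le (ξ : ℝ) {k l : ℕ} (h : k ≤ l) :
    (fun p : ℝ × ℝ => (p.2 - p.1) ^ l) =O[fusionFilter ξ] fun p => (p.2 - p.1) ^ k := by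
  obtain ⟨r, rfl⟩ := Nat.exists_eq_add_of_le h
  simp only [pow_add]
  have h1 := ((tendsto_sub_fusionFilter ξ).pow r).isBigO_one ℝ
  simpa using (Asymptotics.isBigO_refl (fun p : ℝ × ℝ => (p.2 - p.1) ^ k) (fusionFilter ξ)).mul h1

theorem DerivativesNear.isBigO_one {ξ : ℝ} {g : ℕ → ℝ → ℝ} (hg : DerivativesNear ξ g) (i : ℕ) :
    (fun p : ℝ × ℝ => g i p.1) =O[fusionFilter ξ] fun _ => (1 : ℝ) :=
  ((hg.continuousAt i).tendsto.comp (tendsto_fst_fusionFilter ξ)).isBigO_one ℝ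


/-! ### More on Pfaffians -/

section Pfaffian

variable {V : Type*} [AddCommGroup V] [Module ℝ V] (B : LinearMap.BilinForm ℝ V)
  (hB : ∀ v, B v v = 0)

theorem wedge_reverse (l : List V) :
    wedge l.reverse = (-1 : ℝ) ^ l.length.choose 2 • wedge l := by
  induction l with
  | nil => simp
  | cons v l ih =>
    rw [List.reverse_cons, wedge_append, wedge_cons, wedge_nil, mul_one, wedge_mul_ι,
      List.length_reverse, ih, wedge_cons, mul_smul_comm, smul_smul, List.length_cons,
      Nat.choose_succ_succ, Nat.choose_one_right, pow_add]

theorem pfaffian_reverse (l₁ l l₂ : List V) : pfaffian B hB (l₁ ++ (l.reverse ++ l₂)) =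
    (-1) ^ l.length.choose 2 * pfaffian B hB (l₁ ++ (l ++ l₂)) := by
  simp only [pfaffian, wedge_append, wedge_reverse, smul_mul_assoc, mul_smul_comm, map_smul,
    smul_eq_mul]

theorem ofFn_eq_map_range {X : Type*} (f : ℕ → X) (n : ℕ) :
    List.ofFn (fun i : Fin n => f i) = (List.range n).map f := by
  apply List.ext_getElem <;> simp

/-- A triangular change of consecutive vectors multiplies the Pfaffian by the product of the
diagonal entries. -/
theorem pfaffian_triangular (l₁ l₂ : List V) (n : ℕ) (T : ℕ → ℕ → ℝ) (hT : ∀ i k, i < k → T i k = 0)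
    (w : ℕ → V) : pfaffian B hB
      (l₁ ++ ((List.range n).map (fun i => ∑ k ∈ Finset.range n, T i k • w k) ++ l₂)) =
      (∏ i ∈ Finset.range n, T i i) * pfaffian B hB (l₁ ++ ((List.range n).map w ++ l₂)) := by
  rw [← ofFn_eq_map_range, ← ofFn_eq_map_range, ← pfaffianAlt_apply, ← pfaffianAlt_apply]
  have h := alternatingMap_sum_smul (pfaffianAlt B hB l₁ l₂ n)
    (Matrix.of fun i k : Fin n => T i k) fun k => w k
  have hdet : (Matrix.of fun i k : Fin n => T i k).det = ∏ i ∈ Finset.range n, T i i := by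
    rw [Matrix.det_of_isLowerTriangular, Finset.prod_range]
    · rfl
    · intro i k hik
      exact hT i k hik
  rw [hdet] at h
  rw [← h]
  congr 1
  funext i
  rw [Finset.sum_range]
  rfl

theorem pfaffian_sum (l₁ l₂ : List V) (n r : ℕ) (c : Fin r → ℝ) (w : Fin r → ℕ → V) :
    pfaffian B hB (l₁ ++ ((List.range n).map (fun k => ∑ j, c j • w j k) ++ l₂)) =
      ∑ σ : Fin n → Fin r, (∏ k, c (σ k)) *
        pfaffian B hB (l₁ ++ (List.ofFn (fun k : Fin n => w (σ k) k) ++ l₂)) := by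
  rw [← ofFn_eq_map_range, ← pfaffianAlt_apply]
  refine ((pfaffianAlt B hB l₁ l₂ n).toMultilinearMap.map_sum
    (fun (k : Fin n) j => c j • w j k)).trans ?_
  refine Finset.sum_congr rfl fun σ _ => ?_
  rw [← pfaffianAlt_apply]
  exact (pfaffianAlt B hB l₁ l₂ n).toMultilinearMap.map_smul_univ (fun k => c (σ k)) _

theorem exists_range_split {k n : ℕ} (h : k < n) :
    ∃ r : List ℕ, List.range n = List.range k ++ k :: r ∧ k ∉ r := by
  obtain ⟨m, rfl⟩ : ∃ m, n = k + (m + 1) := ⟨n - k - 1, by omega⟩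
  refine ⟨((List.range m).map Nat.succ).map (k + ·), ?_, ?_⟩
  · rw [List.range_add, List.range_succ_eq_map]
    simp
  · simp

theorem filter_insert_eq {l : List ℕ} {k : ℕ} (hk : k ∉ l) (X : Finset ℕ) :
    l.filter (fun i => i ∉ insert k X) = l.filter (fun i => i ∉ X) := by
  refine List.filter_congr fun i hi => ?_
  have : i ≠ k := by
    rintro rfl
    exact hk hi
  simp [this]

/-- Nested pairs which are orthogonal to everything else can be removed. -/
theorem pfaffian_remove_pairs (l₁ l₂ : List V) (s t : ℕ) (a b : ℕ → V) (X : Finset ℕ)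
    (hX : ∀ k ∈ X, k < s ∧ k < t) (h₁ : ∀ k ∈ X, ∀ w ∈ l₁, B (a k) w = 0)
    (h₂ : ∀ k ∈ X, ∀ w ∈ l₂, B (a k) w = 0) (ha : ∀ k ∈ X, ∀ l, B (a k) (a l) = 0)
    (hb : ∀ k ∈ X, ∀ l, l ≠ k → B (a k) (b l) = 0) :
    pfaffian B hB (l₁ ++ ((List.range s).reverse.map a ++ ((List.range t).map b ++ l₂))) =
      (∏ k ∈ X, B (a k) (b k)) *
      pfaffian B hB (l₁ ++ (((List.range s).filter fun i => i ∉ X).reverse.map a ++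
        (((List.range t).filter fun i => i ∉ X).map b ++ l₂))) := by
  induction X using Finset.induction_on with
  | empty => simp
  | insert k X hkX ih =>
    have hsub : ∀ i ∈ X, i ∈ insert k X := fun i hi => Finset.mem_insert_of_mem hi
    have hk : k ∈ insert k X := Finset.mem_insert_self _ _
    rw [ih (fun i hi => hX i (hsub i hi)) (fun i hi => h₁ i (hsub i hi))
      (fun i hi => h₂ i (hsub i hi)) (fun i hi => ha i (hsub i hi)) (fun i hi => hb i (hsub i hi)),
      Finset.prod_insert hkX]
    obtain ⟨r, hr, hkr⟩ := exists_range_split (hX k hk).1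
    obtain ⟨r', hr', hkr'⟩ := exists_range_split (hX k hk).2
    have hkk : k ∉ List.range k := by simp
    have e : ∀ q : List ℕ, k ∉ q → (List.range k ++ k :: q).filter (fun i => i ∉ X) =
        (List.range k).filter (fun i => i ∉ X) ++ k :: q.filter (fun i => i ∉ X) := by
      intro q _
      rw [List.filter_append, List.filter_cons_of_pos (by simpa using hkX)]
    have e' : ∀ q : List ℕ, k ∉ q → (List.range k ++ k :: q).filter (fun i => i ∉ insert k X) =
        (List.range k).filter (fun i => i ∉ X) ++ q.filter (fun i => i ∉ X) := by
      intro q hq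
      rw [List.filter_append, List.filter_cons_of_neg (by simp), filter_insert_eq hkk,
        filter_insert_eq hq]
    rw [hr, hr', e r hkr, e r' hkr', e' r hkr, e' r' hkr']
    generalize hq : (List.range k).filter (fun i => i ∉ X) = q
    generalize r.filter (fun i => i ∉ X) = q₁
    generalize hq₂ : r'.filter (fun i => i ∉ X) = q₂
    have hkq₂ : k ∉ q₂ := fun h => hkr' (List.mem_of_mem_filter (hq₂ ▸ h))
    have hkq : k ∉ q := fun h => hkk (List.mem_of_mem_filter (hq ▸ h))
    have key := pfaffian_remove B hB (l₁ ++ q₁.reverse.map a) (q.reverse.map a ++ q.map b)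
      (q₂.map b ++ l₂) (a k) (b k) ?_ ?_ ?_
    · simp only [List.reverse_append, List.reverse_cons, List.map_append, List.map_cons,
        List.append_assoc, List.cons_append, List.nil_append] at key ⊢
      rw [key]
      -- Since the pairs are nested, the vectors between the two partners come in equal numbers from
      -- both sides and removal produces no sign.
      have : (-1 : ℝ) ^ (List.map a q.reverse ++ List.map b q).length = 1 := by
        rw [List.length_append, List.length_map, List.length_map, List.length_reverse, ← two_mul,
          pow_mul]
        norm_num
      rw [this]
      ring
    · intro w hw
      rcases List.mem_append.1 hw with h | h
      · exact h₁ k hk w h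
      · obtain ⟨i, -, rfl⟩ := List.mem_map.1 h
        exact ha k hk i
    · intro w hw
      rcases List.mem_append.1 hw with h | h
      · obtain ⟨i, -, rfl⟩ := List.mem_map.1 h
        exact ha k hk i
      · obtain ⟨i, hi, rfl⟩ := List.mem_map.1 h
        exact hb k hk i fun h => hkq (h ▸ hi)
    · intro w hw
      rcases List.mem_append.1 hw with h | h
      · obtain ⟨i, hi, rfl⟩ := List.mem_map.1 h
        exact hb k hk i fun h => hkq₂ (h ▸ hi)
      · exact h₂ k hk w h

end Pfaffian

/-! ### Limits of alternating maps -/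

section AlternatingLimit

variable {O ι κ : Type*} [Fintype O] [Fintype κ] [DecidableEq κ]

theorem continuous_alternatingMap [Fintype ι] (f : (O → ℝ) [⋀^ι]→ₗ[ℝ] ℝ) :
    Continuous fun z : ι → O → ℝ => f z := by
  classical
  have h : ∀ z : ι → O → ℝ, f z = ∑ r : ι → O, (∏ i, z i (r i)) *
      f fun i => Pi.single (r i) (1 : ℝ) := by
    intro z
    have h1 : z = fun i => ∑ o, z i o • (Pi.single o (1 : ℝ) : O → ℝ) := by
      funext i
      exact pi_eq_sum_univ' (z i)
    conv_lhs => rw [h1]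
    refine (f.toMultilinearMap.map_sum
      (fun i o => z i o • (Pi.single o (1 : ℝ) : O → ℝ))).trans ?_
    exact Finset.sum_congr rfl fun r _ => f.toMultilinearMap.map_smul_univ (fun i => z i (r i)) _
  rw [show (fun z : ι → O → ℝ => f z) = _ from funext h]
  refine continuous_finsetSum _ fun r _ => Continuous.mul ?_ continuous_const
  exact continuous_finsetProd _ fun i _ => (continuous_apply _).comp (continuous_apply _)

/-- The rows in `Fin p` all approach the span of lower-order data: up to `δ ^ p` they are
combinations of `y l` with coefficients `δ ^ l * M i l`. Undoing `M` and the powers of `δ` gives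
convergent vectors, and the determinant of this change is `M.det * δ ^ (0 + 1 + ... + (p - 1))`. The
rows in `κ` merely have to converge. -/
theorem tendsto_alternatingMap {X : Type*} {F : Filter X} {p : ℕ} (f : (O → ℝ) [⋀^ι]→ₗ[ℝ] ℝ)
    (e : κ ⊕ Fin p ≃ ι) (δ : X → ℝ) (hδ : ∀ᶠ x in F, δ x ≠ 0) (hδ0 : Tendsto δ F (𝓝 0))
    (z : X → ι → O → ℝ) (z₀ : κ → O → ℝ)
    (hz₀ : ∀ i, Tendsto (fun x => z x (e (Sum.inl i))) F (𝓝 (z₀ i)))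
    (M : Matrix (Fin p) (Fin p) ℝ) (hM : M.det ≠ 0) (y : X → Fin p → O → ℝ) (y₀ : Fin p → O → ℝ)
    (hy : ∀ l, Tendsto (fun x => y x l) F (𝓝 (y₀ l)))
    (hz : ∀ i, (fun x => z x (e (Sum.inr i)) - ∑ l, (δ x ^ l.val * M i l) • y x l) =O[F]
      fun x => δ x ^ p) :
    Tendsto (fun x => f (z x) / δ x ^ p.choose 2) F
      (𝓝 (M.det * f fun i => Sum.elim z₀ y₀ (e.symm i))) := by
  have hMu : IsUnit M.det := isUnit_iff_ne_zero.2 hM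
  -- The rows after inverting `M` and dividing the one of index `l` by `δ ^ l`.
  let Y : X → Fin p → O → ℝ := fun x l => (δ x ^ l.val)⁻¹ • ∑ i, M⁻¹ l i • z x (e (Sum.inr i))
  have hY : ∀ l, Tendsto (fun x => Y x l) F (𝓝 (y₀ l)) := by
    intro l
    have h1 : ∀ᶠ x in F, Y x l = y x l + ∑ i, M⁻¹ l i • ((δ x ^ l.val)⁻¹ •
        (z x (e (Sum.inr i)) - ∑ l, (δ x ^ l.val * M i l) • y x l)) := by
      filter_upwards [hδ] with x hx
      have h2 : ∑ i, M⁻¹ l i • ((δ x ^ l.val)⁻¹ • ∑ l, (δ x ^ l.val * M i l) • y x l) = y x l := by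
        simp only [Finset.smul_sum, smul_smul]
        rw [Finset.sum_comm]
        have h3 : ∀ k, ∑ i, (M⁻¹ l i * ((δ x ^ l.val)⁻¹ * (δ x ^ k.val * M i k))) • y x k =
            (if l = k then (1 : ℝ) else 0) • y x k := by
          intro k
          rw [← Finset.sum_smul]
          congr 1
          have h4 : ∑ i, M⁻¹ l i * M i k = if l = k then 1 else 0 := by
            rw [← Matrix.mul_apply, Matrix.nonsing_inv_mul _ hMu, Matrix.one_apply]
          have h5 : ∑ i, M⁻¹ l i * ((δ x ^ l.val)⁻¹ * (δ x ^ k.val * M i k)) =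
              ((δ x ^ l.val)⁻¹ * δ x ^ k.val) * ∑ i, M⁻¹ l i * M i k := by
            rw [Finset.mul_sum]
            exact Finset.sum_congr rfl fun i _ => by ring
          rw [h5, h4]
          split_ifs with h6
          · rw [h6, mul_one, inv_mul_cancel₀ (pow_ne_zero _ hx)]
          · rw [mul_zero]
        rw [Finset.sum_congr rfl fun k _ => h3 k]
        simp
      simp only [smul_sub, Finset.sum_sub_distrib]
      rw [h2]
      simp only [Y, Finset.smul_sum]
      rw [add_sub_cancel]
      exact Finset.sum_congr rfl fun i _ => smul_comm _ _ _
    refine Tendsto.congr' (h1.mono fun x hx => hx.symm) ?_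
    have h2 : ∀ i, Tendsto (fun x => M⁻¹ l i • ((δ x ^ l.val)⁻¹ •
        (z x (e (Sum.inr i)) - ∑ l, (δ x ^ l.val * M i l) • y x l))) F (𝓝 0) := by
      intro i
      rw [← smul_zero (M⁻¹ l i)]
      refine Tendsto.const_smul ?_ _
      -- The error `δ ^ p` divided by `δ ^ l` still tends to zero, as `l < p`.
      have h3 := (Asymptotics.isBigO_refl (fun x => (δ x ^ l.val)⁻¹) F).smul (hz i)
      have h4 : (fun x => (δ x ^ l.val)⁻¹ • δ x ^ p) =ᶠ[F] fun x => δ x ^ (p - l.val) := by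
        filter_upwards [hδ] with x hx
        have hl := l.isLt
        obtain ⟨q, hq⟩ := Nat.exists_eq_add_of_lt hl
        rw [show p - l.val = q + 1 by omega, show δ x ^ p = δ x ^ l.val * δ x ^ (q + 1) by
          rw [← pow_add]; congr 1, smul_eq_mul, inv_mul_cancel_left₀ (pow_ne_zero _ hx)]
      refine (h3.trans_eventuallyEq h4).trans_tendsto ?_
      have := hδ0.pow (p - l.val)
      rwa [zero_pow (by have := l.isLt; omega)] at this
    have h3 := (hy l).add (tendsto_finsetSum Finset.univ fun i _ => h2 i)
    simpa using h3
  let f' := f.domDomCongr e.symm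
  have hf' : ∀ w : κ ⊕ Fin p → O → ℝ, f' w = f fun i => w (e.symm i) := fun w => rfl
  have hval : ∀ᶠ x in F, f (z x) / δ x ^ p.choose 2 =
      M.det * f' (Sum.elim (fun i => z x (e (Sum.inl i))) (Y x)) := by
    filter_upwards [hδ] with x hx
    let T : Matrix (κ ⊕ Fin p) (κ ⊕ Fin p) ℝ :=
      Matrix.fromBlocks 1 0 0 (M * Matrix.diagonal fun l => δ x ^ l.val)
    have h1 : f (z x) = f' fun i => ∑ k, T i k •
        (Sum.elim (fun i => z x (e (Sum.inl i))) (Y x)) k := by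
      rw [hf']
      congr 1
      funext i
      obtain ⟨i, rfl⟩ := e.surjective i
      rw [e.symm_apply_apply]
      rcases i with i | i
      · simp [T, Matrix.one_apply]
      · simp only [T, Fintype.sum_sum_type, Matrix.fromBlocks_apply₂₁, Matrix.fromBlocks_apply₂₂,
          Matrix.zero_apply, zero_smul, Finset.sum_const_zero, zero_add, Sum.elim_inr,
          Matrix.mul_diagonal, Y, smul_smul]
        have h2 : ∀ l : Fin p, (M i l * δ x ^ l.val * (δ x ^ l.val)⁻¹) •
            ∑ k, M⁻¹ l k • z x (e (Sum.inr k)) = ∑ k, (M i l * M⁻¹ l k) • z x (e (Sum.inr k)) := by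
          intro l
          rw [mul_assoc, mul_inv_cancel₀ (pow_ne_zero _ hx), mul_one, Finset.smul_sum]
          simp only [smul_smul]
        rw [Finset.sum_congr rfl fun l _ => h2 l, Finset.sum_comm]
        simp only [← Finset.sum_smul, ← Matrix.mul_apply, Matrix.mul_nonsing_inv _ hMu,
          Matrix.one_apply, ite_smul, one_smul, zero_smul, Finset.sum_ite_eq, Finset.mem_univ,
          if_true]
    have hdet : T.det = M.det * δ x ^ p.choose 2 := by
      rw [Matrix.det_fromBlocks_zero₂₁, Matrix.det_one, one_mul, Matrix.det_mul,
        Matrix.det_diagonal, Finset.prod_pow_eq_pow_sum, ← Finset.sum_range fun l => l,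
        Finset.sum_range_id, ← Nat.choose_two_right]
    rw [h1, alternatingMap_sum_smul, hdet]
    have := pow_ne_zero (p.choose 2) hx
    field_simp
  refine Tendsto.congr' (hval.mono fun x hx => hx.symm) ?_
  refine Tendsto.const_mul _ ?_
  have hc := (continuous_alternatingMap f').tendsto (Sum.elim z₀ y₀)
  refine hc.comp (tendsto_pi_nhds.2 fun i => ?_)
  rcases i with i | i
  · exact hz₀ i
  · exact hY i

end AlternatingLimit


/-! ### The rows near the fusion and their leading coefficients -/

section Coefficients

/-- The coefficient `(-1) ^ l * binom x (l + 1)`. -/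
noncomputable def rowCoeff (x : ℝ) (l : ℕ) : ℝ :=
  x * (∏ i ∈ Finset.range l, ((i : ℝ) + 1 - x)) / (l + 1).factorial

theorem rowCoeff_succ (x : ℝ) (l : ℕ) :
    rowCoeff x (l + 1) = rowCoeff x l * (l + 1 - x) / (l + 2) := by
  unfold rowCoeff
  rw [Finset.prod_range_succ, Nat.factorial_succ (l + 1)]
  have := Nat.factorial_ne_zero (l + 1)
  push_cast
  have h : (l : ℝ) + 1 + 1 ≠ 0 := by positivity
  have h2 : (l : ℝ) + 2 ≠ 0 := by positivity
  field_simp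
  ring

/-- Positive integers give the coefficients of the eliminated left rows; negative ones, in
`rowCoeff_neg`, give those of the right rows. One polynomial family thus describes both. -/
theorem rowCoeff_natCast (k l : ℕ) : rowCoeff (k + 1) l = (-1) ^ l * (k + 1).choose (l + 1) := by
  induction l with
  | zero => simp [rowCoeff]
  | succ l ih =>
    rw [rowCoeff_succ, ih]
    have h : (l : ℝ) + 2 ≠ 0 := by positivity
    rcases Nat.lt_or_ge k l with hkl | hkl
    · rw [Nat.choose_eq_zero_of_lt (by omega : k + 1 < l + 1),
        Nat.choose_eq_zero_of_lt (by omega : k + 1 < l + 1 + 1)]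
      simp
    · obtain ⟨r, rfl⟩ := Nat.exists_eq_add_of_le hkl
      have h1 := Nat.choose_succ_right_eq (l + r + 1) (l + 1)
      rw [show l + r + 1 - (l + 1) = r by omega] at h1
      have h2 : ((l + r + 1).choose (l + 1 + 1) : ℝ) * (l + 1 + 1) = (l + r + 1).choose (l + 1) * r := by
        exact_mod_cast h1
      rw [div_eq_iff h, pow_succ]
      push_cast
      linear_combination ((-1 : ℝ) ^ l) * h2

theorem rowCoeff_neg (k l : ℕ) : rowCoeff (-(k + 1)) l = -((k + l + 1).choose (l + 1)) := by
  induction l with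
  | zero => simp [rowCoeff]
  | succ l ih =>
    rw [rowCoeff_succ, ih]
    have h : (l : ℝ) + 2 ≠ 0 := by positivity
    have h1 := Nat.add_one_mul_choose_eq (k + l + 1) (l + 1)
    have h2 : ((k + l + 1 : ℝ) + 1) * (k + l + 1).choose (l + 1) =
        (k + l + 1 + 1).choose (l + 1 + 1) * (l + 1 + 1) := by exact_mod_cast h1
    rw [div_eq_iff h, show k + (l + 1) + 1 = k + l + 1 + 1 by ring]
    linear_combination -h2

/-- Up to the factors `x` and `1 / (l + 1)!`, the entries are monic polynomials of degree `l` in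
`-x`, so the determinant is a Vandermonde determinant. -/
theorem det_rowCoeff {n : ℕ} (x : Fin n → ℝ) :
    (Matrix.of fun i l : Fin n => rowCoeff (x i) l).det =
      (∏ i, x i) * (∏ i, ∏ j ∈ Finset.Ioi i, (x i - x j)) /
        ∏ l ∈ Finset.range n, ((l + 1).factorial : ℝ) := by
  open Polynomial in
  let q : Fin n → ℝ[X] := fun l => ∏ i ∈ Finset.range l, (X + C ((i : ℝ) + 1))
  have hq : ∀ l, (q l).Monic := fun l =>
    Polynomial.monic_prod_of_monic _ _ fun i _ => Polynomial.monic_X_add_C _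
  have hdeg : ∀ l : Fin n, (q l).natDegree = l := by
    intro l
    simp only [q]
    rw [Polynomial.natDegree_prod_of_monic _ _ fun i _ => Polynomial.monic_X_add_C _]
    simp only [Polynomial.natDegree_X_add_C]
    simp
  have h1 : (Matrix.of fun i l : Fin n => rowCoeff (x i) l) =
      Matrix.diagonal x * (Matrix.of fun i l => (q l).eval (-x i)) *
        Matrix.diagonal fun l : Fin n => (((l.val + 1).factorial : ℝ))⁻¹ := by
    ext i l
    rw [Matrix.mul_diagonal, Matrix.diagonal_mul]
    simp only [Matrix.of_apply, rowCoeff, q, Polynomial.eval_prod, Polynomial.eval_add,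
      Polynomial.eval_X, Polynomial.eval_C]
    rw [div_eq_mul_inv]
    congr 2
    exact Finset.prod_congr rfl fun i _ => by ring
  rw [h1, Matrix.det_mul, Matrix.det_mul, Matrix.det_diagonal, Matrix.det_diagonal,
    ← Matrix.det_eval_matrixOfPolynomials_eq_det_vandermonde _ q hdeg hq, Matrix.det_vandermonde,
    Finset.prod_range, Finset.prod_inv_distrib, div_eq_mul_inv]
  congr 2
  exact Finset.prod_congr rfl fun i _ => Finset.prod_congr rfl fun j _ => by ring

theorem det_rowCoeff_ne_zero {n : ℕ} {x : Fin n → ℝ} (hx : Function.Injective x)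
    (h0 : ∀ i, x i ≠ 0) : (Matrix.of fun i l : Fin n => rowCoeff (x i) l).det ≠ 0 := by
  rw [det_rowCoeff]
  refine div_ne_zero (mul_ne_zero (Finset.prod_ne_zero_iff.2 fun i _ => h0 i) ?_)
    (Finset.prod_ne_zero_iff.2 fun l _ => by positivity)
  refine Finset.prod_ne_zero_iff.2 fun i _ => Finset.prod_ne_zero_iff.2 fun j hj => ?_
  exact sub_ne_zero.2 fun h => (Finset.mem_Ioi.1 hj).ne (hx h)

end Coefficients

section Rows

variable {O : Type*}

/-- The rows from the left point after the elimination. -/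
noncomputable def leftRow (g : O → ℕ → ℝ → ℝ) (k : ℕ) (p : ℝ × ℝ) : O → ℝ := fun o =>
  ∑ l ∈ Finset.range (k + 1), (p.2 - p.1) ^ l * ((-1) ^ (k + l) * (k + 1).choose (l + 1)) *
    (g o l p.1 / l.factorial)

/-- The rows from the right point after the elimination. -/
noncomputable def rightRow (g : O → ℕ → ℝ → ℝ) (k : ℕ) (p : ℝ × ℝ) : O → ℝ := fun o =>
  ∑ i ∈ Finset.range (k + 1), (p.2 - p.1) ^ i * (k + 1).choose (i + 1) *
    (g o i p.2 / i.factorial)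

/-- The original derivative rows are triangular combinations of the eliminated ones, with diagonal
`i! δ ^ (-i)`; this follows from binomial inversion. -/
theorem sum_leftRow (g : O → ℕ → ℝ → ℝ) {i n : ℕ} (hi : i < n) (p : ℝ × ℝ) (hp : p.1 < p.2) (o : O) :
    ∑ k ∈ Finset.range n, (i.factorial * ((p.2 - p.1) ^ i)⁻¹ * (i + 1).choose (k + 1)) *
      leftRow g k p o = g o i p.1 := by
  have h0 : p.2 - p.1 ≠ 0 := (sub_pos.2 hp).ne'
  have h1 : ∀ k ∈ Finset.range n, leftRow g k p o = ∑ l ∈ Finset.range n,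
      (p.2 - p.1) ^ l * ((-1) ^ (k + l) * (k + 1).choose (l + 1)) * (g o l p.1 / l.factorial) := by
    intro k hk
    refine Finset.sum_subset (Finset.range_mono (by have := Finset.mem_range.1 hk; omega))
      fun l _ hl => ?_
    rw [Finset.mem_range] at hl
    rw [Nat.choose_eq_zero_of_lt (by omega : k + 1 < l + 1)]
    simp
  rw [Finset.sum_congr rfl fun k hk => by rw [h1 k hk, Finset.mul_sum], Finset.sum_comm]
  have h2 : ∀ l ∈ Finset.range n, ∑ k ∈ Finset.range n,
      (i.factorial * ((p.2 - p.1) ^ i)⁻¹ * (i + 1).choose (k + 1)) *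
        ((p.2 - p.1) ^ l * ((-1) ^ (k + l) * (k + 1).choose (l + 1)) * (g o l p.1 / l.factorial)) =
      i.factorial * ((p.2 - p.1) ^ i)⁻¹ * (p.2 - p.1) ^ l * (g o l p.1 / l.factorial) *
        if i = l then 1 else 0 := by
    intro l _
    rw [← sum_choose_mul_choose_neg i l n hi, Finset.mul_sum]
    exact Finset.sum_congr rfl fun k _ => by ring
  rw [Finset.sum_congr rfl h2, Finset.sum_eq_single i]
  · have := Nat.factorial_ne_zero i
    rw [if_pos rfl]
    field_simp
  · intro l _ hl
    rw [if_neg hl.symm, mul_zero]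
  · intro h
    exact absurd (Finset.mem_range.2 hi) h

theorem sum_rightRow (g : O → ℕ → ℝ → ℝ) {i n : ℕ} (hi : i < n) (p : ℝ × ℝ) (hp : p.1 < p.2)
    (o : O) : ∑ k ∈ Finset.range n,
      (i.factorial * ((p.2 - p.1) ^ i)⁻¹ * ((-1) ^ (i + k) * (i + 1).choose (k + 1))) *
      rightRow g k p o = g o i p.2 := by
  have h0 : p.2 - p.1 ≠ 0 := (sub_pos.2 hp).ne'
  have h1 : ∀ k ∈ Finset.range n, rightRow g k p o = ∑ l ∈ Finset.range n,
      (p.2 - p.1) ^ l * (k + 1).choose (l + 1) * (g o l p.2 / l.factorial) := by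
    intro k hk
    refine Finset.sum_subset (Finset.range_mono (by have := Finset.mem_range.1 hk; omega))
      fun l _ hl => ?_
    rw [Finset.mem_range] at hl
    rw [Nat.choose_eq_zero_of_lt (by omega : k + 1 < l + 1)]
    simp
  rw [Finset.sum_congr rfl fun k hk => by rw [h1 k hk, Finset.mul_sum], Finset.sum_comm]
  have hsq : ∀ k : ℕ, ((-1 : ℝ) ^ k) * (-1) ^ k = 1 := fun k => by rw [← mul_pow]; norm_num
  have h2 : ∀ l ∈ Finset.range n, ∑ k ∈ Finset.range n,
      (i.factorial * ((p.2 - p.1) ^ i)⁻¹ * ((-1) ^ (i + k) * (i + 1).choose (k + 1))) *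
        ((p.2 - p.1) ^ l * (k + 1).choose (l + 1) * (g o l p.2 / l.factorial)) =
      i.factorial * ((p.2 - p.1) ^ i)⁻¹ * (p.2 - p.1) ^ l * (g o l p.2 / l.factorial) *
        ((-1) ^ i * (-1) ^ l) * if i = l then 1 else 0 := by
    intro l _
    rw [← sum_choose_mul_choose_neg i l n hi, Finset.mul_sum]
    refine Finset.sum_congr rfl fun k _ => ?_
    rw [pow_add, pow_add]
    linear_combination (-(i.factorial * ((p.2 - p.1) ^ i)⁻¹ * ((-1) ^ i * (-1) ^ k *
      (i + 1).choose (k + 1)) * ((p.2 - p.1) ^ l * (k + 1).choose (l + 1) *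
      (g o l p.2 / l.factorial)))) * hsq l
  rw [Finset.sum_congr rfl h2, Finset.sum_eq_single i]
  · have := Nat.factorial_ne_zero i
    rw [if_pos rfl, hsq]
    field_simp
  · intro l _ hl
    rw [if_neg hl.symm, mul_zero]
  · intro h
    exact absurd (Finset.mem_range.2 hi) h

/-- The rows of both kinds, labelled by their integer points up to the sign. -/
noncomputable def fusionRow (g : O → ℕ → ℝ → ℝ) (p : ℝ × ℝ) : ℕ ⊕ ℕ → O → ℝ
  | Sum.inl k => (-1 : ℝ) ^ k • leftRow g k p
  | Sum.inr k => -rightRow g k p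

/-- The point that governs the leading coefficients of a row. -/
def rowPoint : ℕ ⊕ ℕ → ℝ
  | Sum.inl k => k + 1
  | Sum.inr k => -(k + 1)

/-- Left rows sit at positive and right rows at negative integers, so a mixture of both kinds never
makes the Vandermonde determinant vanish. -/
theorem rowPoint_injective : Function.Injective rowPoint := by
  rintro (k | k) (l | l) h <;> simp only [rowPoint] at h
  · rw [Nat.cast_injective (R := ℝ) (by linarith : (k : ℝ) = l)]
  · have : (0 : ℝ) ≤ k := Nat.cast_nonneg k
    have : (0 : ℝ) ≤ l := Nat.cast_nonneg l
    linarith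
  · have : (0 : ℝ) ≤ k := Nat.cast_nonneg k
    have : (0 : ℝ) ≤ l := Nat.cast_nonneg l
    linarith
  · rw [Nat.cast_injective (R := ℝ) (by linarith : (k : ℝ) = l)]

theorem rowPoint_ne_zero (q : ℕ ⊕ ℕ) : rowPoint q ≠ 0 := by
  rcases q with k | k <;> simp only [rowPoint]
  · positivity
  · rw [neg_ne_zero]
    positivity

theorem sum_range_sub_shift (h : ℕ → ℝ) (i L : ℕ) :
    ∑ j ∈ Finset.range (L - i), h (i + j) = ∑ l ∈ Finset.range L, if i ≤ l then h l else 0 := by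
  rcases Nat.lt_or_ge L i with hi | hi
  · rw [Nat.sub_eq_zero_of_le hi.le, Finset.range_zero, Finset.sum_empty]
    refine (Finset.sum_eq_zero fun l hl => ?_).symm
    rw [Finset.mem_range] at hl
    rw [if_neg (by omega)]
  · rw [← Finset.sum_filter, ← Finset.sum_Ico_eq_sum_range]
    refine Finset.sum_congr ?_ fun _ _ => rfl
    ext l
    simp [and_comm]

/-- The left rows are finite sums of exactly this form. For the right rows, the derivatives at the
right point are expanded around the left point, and the convolution of `(k + 1).choose (i + 1)` with
`l.choose i` produces the coefficient at `-(k + 1)`. -/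
theorem fusionRow_isBigO {ξ : ℝ} {g : O → ℕ → ℝ → ℝ} (hg : ∀ o, DerivativesNear ξ (g o))
    (q : ℕ ⊕ ℕ) (L : ℕ) (o : O) : (fun p : ℝ × ℝ => fusionRow g p q o -
      ∑ l ∈ Finset.range L, (p.2 - p.1) ^ l * rowCoeff (rowPoint q) l * (g o l p.1 / l.factorial))
        =O[fusionFilter ξ] fun p => (p.2 - p.1) ^ L := by
  rcases q with k | k
  · have h1 : ∀ p : ℝ × ℝ, fusionRow g p (Sum.inl k) o =
        ∑ l ∈ Finset.range (L + (k + 1)), (p.2 - p.1) ^ l * rowCoeff (rowPoint (Sum.inl k)) l *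
          (g o l p.1 / l.factorial) := by
      intro p
      have h2 : fusionRow g p (Sum.inl k) o = ∑ l ∈ Finset.range (k + 1),
          (p.2 - p.1) ^ l * rowCoeff (rowPoint (Sum.inl k)) l * (g o l p.1 / l.factorial) := by
        simp only [fusionRow, Pi.smul_apply, smul_eq_mul, leftRow, Finset.mul_sum, rowPoint,
          rowCoeff_natCast]
        refine Finset.sum_congr rfl fun l _ => ?_
        have hsq : ((-1 : ℝ) ^ k) * (-1) ^ k = 1 := by rw [← mul_pow]; norm_num
        rw [pow_add]
        linear_combination ((p.2 - p.1) ^ l * ((-1) ^ l * (k + 1).choose (l + 1)) *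
          (g o l p.1 / l.factorial)) * hsq
      rw [h2]
      refine Finset.sum_subset (Finset.range_mono (by omega)) fun l _ hl => ?_
      rw [Finset.mem_range] at hl
      simp only [rowPoint, rowCoeff_natCast]
      rw [Nat.choose_eq_zero_of_lt (by omega : k + 1 < l + 1)]
      simp
    have h2 : ∀ p : ℝ × ℝ, fusionRow g p (Sum.inl k) o - ∑ l ∈ Finset.range L,
        (p.2 - p.1) ^ l * rowCoeff (rowPoint (Sum.inl k)) l * (g o l p.1 / l.factorial) =
        ∑ j ∈ Finset.range (k + 1), (p.2 - p.1) ^ (L + j) * (rowCoeff (rowPoint (Sum.inl k)) (L + j) *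
          (g o (L + j) p.1 / (L + j).factorial)) := by
      intro p
      rw [h1, Finset.sum_range_add, add_sub_cancel_left]
      exact Finset.sum_congr rfl fun j _ => by ring
    simp only [h2]
    refine Asymptotics.IsBigO.fun_sum fun j _ => ?_
    have h3 : (fun p : ℝ × ℝ => rowCoeff (rowPoint (Sum.inl k)) (L + j) *
        (g o (L + j) p.1 / (L + j).factorial)) =O[fusionFilter ξ] fun _ => (1 : ℝ) := by
      simp only [div_eq_inv_mul]
      exact (((hg o).isBigO_one (L + j)).const_mul_left _).const_mul_left _
    simpa using (isBigO_pow_sub_of_le ξ (Nat.le_add_right L j)).mul h3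
  · have h1 : ∀ p : ℝ × ℝ, fusionRow g p (Sum.inr k) o - ∑ l ∈ Finset.range L,
        (p.2 - p.1) ^ l * rowCoeff (rowPoint (Sum.inr k)) l * (g o l p.1 / l.factorial) =
        -∑ i ∈ Finset.range (k + 1), ((k + 1).choose (i + 1) / i.factorial : ℝ) *
          ((p.2 - p.1) ^ i * (g o i p.2 - ∑ j ∈ Finset.range (L - i),
            (p.2 - p.1) ^ j / j.factorial * g o (i + j) p.1)) := by
      intro p
      have h2 : ∑ i ∈ Finset.range (k + 1), ((k + 1).choose (i + 1) / i.factorial : ℝ) *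
          ((p.2 - p.1) ^ i * ∑ j ∈ Finset.range (L - i),
            (p.2 - p.1) ^ j / j.factorial * g o (i + j) p.1) =
          ∑ l ∈ Finset.range L, (p.2 - p.1) ^ l * (k + l + 1).choose (l + 1) *
            (g o l p.1 / l.factorial) := by
        have h3 : ∀ i ∈ Finset.range (k + 1), ((k + 1).choose (i + 1) / i.factorial : ℝ) *
            ((p.2 - p.1) ^ i * ∑ j ∈ Finset.range (L - i),
              (p.2 - p.1) ^ j / j.factorial * g o (i + j) p.1) = ∑ l ∈ Finset.range L,
            ((k + 1).choose (i + 1) : ℝ) * l.choose i * ((p.2 - p.1) ^ l *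
              (g o l p.1 / l.factorial)) := by
          intro i _
          have h4 : ∀ j ∈ Finset.range (L - i), (p.2 - p.1) ^ i *
              ((p.2 - p.1) ^ j / j.factorial * g o (i + j) p.1) =
              (fun l => (p.2 - p.1) ^ l / (l - i).factorial * g o l p.1) (i + j) := by
            intro j _
            simp only [Nat.add_sub_cancel_left, pow_add]
            ring
          rw [Finset.mul_sum, Finset.sum_congr rfl h4,
            sum_range_sub_shift (fun l => (p.2 - p.1) ^ l / (l - i).factorial * g o l p.1),
            Finset.mul_sum]
          refine Finset.sum_congr rfl fun l _ => ?_
          split_ifs with hil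
          · rw [Nat.cast_choose ℝ hil]
            have := Nat.factorial_ne_zero i
            have := Nat.factorial_ne_zero l
            have := Nat.factorial_ne_zero (l - i)
            field_simp
          · rw [Nat.choose_eq_zero_of_lt (not_le.1 hil)]
            simp
        rw [Finset.sum_congr rfl h3, Finset.sum_comm]
        refine Finset.sum_congr rfl fun l _ => ?_
        rw [← Finset.sum_mul, sum_choose_succ_mul_choose k l (k + 1) (Nat.lt_succ_self k)]
        ring
      simp only [mul_sub, Finset.sum_sub_distrib]
      rw [h2]
      simp only [fusionRow, Pi.neg_apply, rightRow, rowPoint, rowCoeff_neg]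
      have h5 : ∑ i ∈ Finset.range (k + 1), (p.2 - p.1) ^ i * ((k + 1).choose (i + 1) : ℝ) *
          (g o i p.2 / i.factorial) = ∑ i ∈ Finset.range (k + 1),
          ((k + 1).choose (i + 1) / i.factorial : ℝ) * ((p.2 - p.1) ^ i * g o i p.2) :=
        Finset.sum_congr rfl fun i _ => by ring
      rw [h5]
      simp only [mul_neg, neg_mul, Finset.sum_neg_distrib]
      ring
    simp only [h1]
    refine Asymptotics.IsBigO.neg_left (Asymptotics.IsBigO.fun_sum fun i _ => ?_)
    refine Asymptotics.IsBigO.const_mul_left ?_ _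
    have h2 := (Asymptotics.isBigO_refl (fun p : ℝ × ℝ => (p.2 - p.1) ^ i) (fusionFilter ξ)).mul
      ((hg o).taylor_isBigO i (L - i))
    refine h2.trans ?_
    simp only [← pow_add]
    exact isBigO_pow_sub_of_le ξ (by omega)

theorem tendsto_leftRow {ξ : ℝ} {g : O → ℕ → ℝ → ℝ} (hg : ∀ o, DerivativesNear ξ (g o)) (k : ℕ) :
    ∃ z : O → ℝ, Tendsto (leftRow g k) (fusionFilter ξ) (𝓝 z) := by
  refine ⟨leftRow g k (ξ, ξ), ?_⟩
  rw [tendsto_pi_nhds]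
  intro o
  refine tendsto_finsetSum _ fun l _ => ?_
  refine ((Tendsto.pow ?_ l).mul_const _).mul (Tendsto.div_const ?_ _)
  · simpa using tendsto_sub_fusionFilter ξ
  · exact ((hg o).continuousAt l).tendsto.comp (tendsto_fst_fusionFilter ξ)

end Rows


/-! ### Pfaffians of rows -/

section RowForm

variable {O : Type*} [Fintype O] [DecidableEq O]

/-- The alternating form on pairs of a combination of points and a row of values at the points. -/
noncomputable def rowForm (S : Matrix O O ℝ) : LinearMap.BilinForm ℝ ((O → ℝ) × (O → ℝ)) :=
  (Matrix.toBilin' S).compl₁₂ (LinearMap.fst ℝ _ _) (LinearMap.fst ℝ _ _) +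
    (dotProductBilin ℝ ℝ).compl₁₂ (LinearMap.snd ℝ _ _) (LinearMap.fst ℝ _ _) -
    (dotProductBilin ℝ ℝ).compl₁₂ (LinearMap.fst ℝ _ _) (LinearMap.snd ℝ _ _)

theorem rowForm_apply (S : Matrix O O ℝ) (p q : (O → ℝ) × (O → ℝ)) :
    rowForm S p q = Matrix.toBilin' S p.1 q.1 + p.2 ⬝ᵥ q.1 - p.1 ⬝ᵥ q.2 := rfl

theorem rowForm_self {S : Matrix O O ℝ} (hS : ∀ a b, S a b = -S b a) (p : (O → ℝ) × (O → ℝ)) :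
    rowForm S p p = 0 := by
  rw [rowForm_apply, toBilin'_self_eq_zero S hS, dotProduct_comm]
  ring

/-- A point as a vector. -/
def pointVec (o : O) : (O → ℝ) × (O → ℝ) := (Pi.single o 1, 0)

/-- A row of values as a vector. -/
def rowVec (z : O → ℝ) : (O → ℝ) × (O → ℝ) := (0, z)

theorem rowForm_point_point (S : Matrix O O ℝ) (o o' : O) :
    rowForm S (pointVec o) (pointVec o') = S o o' := by
  simp [rowForm_apply, pointVec]

theorem rowForm_row_point (S : Matrix O O ℝ) (z : O → ℝ) (o : O) :
    rowForm S (rowVec z) (pointVec o) = z o := by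
  simp [rowForm_apply, pointVec, rowVec]

theorem rowForm_row_row (S : Matrix O O ℝ) (z z' : O → ℝ) :
    rowForm S (rowVec z) (rowVec z') = 0 := by
  simp [rowForm_apply, rowVec]

/-- The form on rows with additional pairings between them. -/
noncomputable def pairedForm (S : Matrix O O ℝ) (t : ℕ) : LinearMap.BilinForm ℝ
    (((O → ℝ) × (O → ℝ)) × ((Fin t → ℝ) × (Fin t → ℝ))) :=
  (rowForm S).compl₁₂ (LinearMap.fst ℝ _ _) (LinearMap.fst ℝ _ _) +
    (rowForm 0).compl₁₂ (LinearMap.snd ℝ _ _) (LinearMap.snd ℝ _ _)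

theorem pairedForm_apply (S : Matrix O O ℝ) (t : ℕ)
    (p q : ((O → ℝ) × (O → ℝ)) × ((Fin t → ℝ) × (Fin t → ℝ))) :
    pairedForm S t p q = rowForm S p.1 q.1 + rowForm 0 p.2 q.2 := rfl

theorem pairedForm_self {S : Matrix O O ℝ} (hS : ∀ a b, S a b = -S b a) (t : ℕ)
    (p : ((O → ℝ) × (O → ℝ)) × ((Fin t → ℝ) × (Fin t → ℝ))) : pairedForm S t p p = 0 := by
  rw [pairedForm_apply, rowForm_self hS, rowForm_self (by simp), add_zero]

end RowForm

/-! ### Elimination and expansion in powers of the parameter difference -/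

section Expansion

variable {O : Type*} [Fintype O] [DecidableEq O]

/-- The indicator of an index. -/
def marker (t k : ℕ) : Fin t → ℝ := fun x => if x.val = k then 1 else 0

/-- The pairing between the eliminated rows of the same number, up to the factor `ε`. -/
noncomputable def rowPairing (k : ℕ) (p : ℝ × ℝ) : ℝ :=
  (-1) ^ k * (k + 1) / Real.pi / (p.2 - p.1) ^ 2

/-- The three parts of the eliminated rows from the left point: the constant one, and those
proportional to `ε` which pair with the points and with the other rows. -/
noncomputable def leftPart (g : O → ℕ → ℝ → ℝ) (c : O → ℝ) (t : ℕ) (p : ℝ × ℝ) (j : Fin 3) (k : ℕ) :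
    ((O → ℝ) × (O → ℝ)) × ((Fin t → ℝ) × (Fin t → ℝ)) :=
  ![(rowVec (c * leftRow g k p), 0), (rowVec (leftRow g k p), 0),
    (0, rowVec (rowPairing k p • marker t k))] j

/-- The eliminated rows from the right point. -/
noncomputable def rightVec (g : O → ℕ → ℝ → ℝ) (c : O → ℝ) (t : ℕ) (p : ℝ × ℝ) (k : ℕ) :
    ((O → ℝ) × (O → ℝ)) × ((Fin t → ℝ) × (Fin t → ℝ)) :=
  (rowVec (c * rightRow g k p), (marker t k, 0))

/-- The contribution of an assignment of parts to the rows. -/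
noncomputable def partTerm {S : Matrix O O ℝ} (hS : ∀ a b, S a b = -S b a) (g : O → ℕ → ℝ → ℝ)
    (c : O → ℝ) (l₁ l₂ : List O) {s : ℕ} (t : ℕ) (σ : Fin s → Fin 3) (p : ℝ × ℝ) : ℝ :=
  pfaffian (pairedForm S t) (pairedForm_self hS t) (l₁.map (fun o => (pointVec o, 0)) ++
    (List.ofFn (fun k : Fin s => leftPart g c t p (σ k) k) ++
      ((List.range t).map (rightVec g c t p) ++ l₂.map (fun o => (pointVec o, 0)))))

/-- The prefactor from the elimination. -/
noncomputable def eliminationFactor (s t : ℕ) (p : ℝ × ℝ) : ℝ :=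
  (∏ i ∈ Finset.range s, (i.factorial : ℝ) * ((p.2 - p.1) ^ i)⁻¹) *
    ∏ i ∈ Finset.range t, (i.factorial : ℝ) * ((p.2 - p.1) ^ i)⁻¹

/-- The number of rows to which a part proportional to `ε` is assigned. -/
def partDegree {s : ℕ} (σ : Fin s → Fin 3) : ℕ := (Finset.univ.filter fun k => σ k ≠ 0).card

theorem sum_smul_marker (f : ℕ → ℝ) (n t : ℕ) (hf : ∀ k, n ≤ k → f k = 0) (x : Fin t) :
    (∑ k ∈ Finset.range n, f k • marker t k) x = f x := by
  simp only [Finset.sum_apply, Pi.smul_apply, marker, smul_eq_mul, mul_ite, mul_one, mul_zero,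
    Finset.sum_ite_eq, Finset.mem_range]
  split_ifs with h
  · rfl
  · exact (hf _ (not_lt.1 h)).symm

/-- Only the Gram matrix matters, so the vectors are replaced by triangular combinations `M`, `M'`
of eliminated rows with the same pairings. The triangular determinants form the elimination factor,
and multilinearity in the left rows splits each of them into its constant part and its two parts
proportional to `ε`. -/
theorem pfaffian_eq_sum_partTerm {V : Type*} [AddCommGroup V] [Module ℝ V]
    (B : LinearMap.BilinForm ℝ V) (hB : ∀ v, B v v = 0) {S : Matrix O O ℝ}
    (hS : ∀ a b, S a b = -S b a) (g : O → ℕ → ℝ → ℝ) (c : O → ℝ) (l₁ l₂ : List O) (s t : ℕ)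
    (p : ℝ × ℝ) (hp : p.1 < p.2) (ε : ℝ) (ψ : O → V) (A A' : ℕ → V)
    (hO : ∀ o o', B (ψ o) (ψ o') = S o o')
    (hAO : ∀ i < s, ∀ o, B (A i) (ψ o) = g o i p.1 * (c o + ε))
    (hAO' : ∀ i < t, ∀ o, B (A' i) (ψ o) = g o i p.2 * c o)
    (hA : ∀ i < s, ∀ k < s, B (A i) (A k) = 0) (hA' : ∀ i < t, ∀ k < t, B (A' i) (A' k) = 0)
    (hAA' : ∀ i < s, ∀ l < t, B (A i) (A' l) =
      ε * ((-1) ^ l * (i + l + 1).factorial / Real.pi / (p.2 - p.1) ^ (2 + i + l))) :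
    pfaffian B hB (l₁.map ψ ++ ((List.range s).map A ++ ((List.range t).map A' ++ l₂.map ψ))) =
      eliminationFactor s t p * ∑ σ : Fin s → Fin 3, ε ^ partDegree σ *
        partTerm hS g c l₁ l₂ t σ p := by
  have hδ : p.2 - p.1 ≠ 0 := (sub_pos.2 hp).ne'
  let T : ℕ → ℕ → ℝ := fun i k => i.factorial * ((p.2 - p.1) ^ i)⁻¹ * (i + 1).choose (k + 1)
  let T' : ℕ → ℕ → ℝ := fun i k =>
    i.factorial * ((p.2 - p.1) ^ i)⁻¹ * ((-1) ^ (i + k) * (i + 1).choose (k + 1))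
  have hT : ∀ i k, i < k → T i k = 0 := fun i k h => by
    simp only [T]
    rw [Nat.choose_eq_zero_of_lt (by omega : i + 1 < k + 1)]
    simp
  have hT' : ∀ i k, i < k → T' i k = 0 := fun i k h => by
    simp only [T']
    rw [Nat.choose_eq_zero_of_lt (by omega : i + 1 < k + 1)]
    simp
  -- The weights of the three parts: a pairing with an outer point carries `c + ε`, and one with a
  -- right row carries `ε`.
  let w : Fin 3 → ℝ := ![1, ε, ε]
  let L : ℕ → ((O → ℝ) × (O → ℝ)) × ((Fin t → ℝ) × (Fin t → ℝ)) := fun k =>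
    ∑ j, w j • leftPart g c t p j k
  have hL : ∀ k, L k = (rowVec (c * leftRow g k p + ε • leftRow g k p),
      rowVec ((ε * rowPairing k p) • marker t k)) := by
    intro k
    simp only [L, w, Fin.sum_univ_three, leftPart, rowVec]
    simp [smul_smul]
  let M : ℕ → ((O → ℝ) × (O → ℝ)) × ((Fin t → ℝ) × (Fin t → ℝ)) := fun i =>
    ∑ k ∈ Finset.range s, T i k • L k
  let M' : ℕ → ((O → ℝ) × (O → ℝ)) × ((Fin t → ℝ) × (Fin t → ℝ)) := fun i =>
    ∑ k ∈ Finset.range t, T' i k • rightVec g c t p k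
  have hM : ∀ i < s, M i = (rowVec fun o => g o i p.1 * (c o + ε),
      rowVec fun x : Fin t => T i x * (ε * rowPairing x p)) := by
    intro i hi
    simp only [M, hL]
    refine Prod.ext (Prod.ext ?_ ?_) (Prod.ext ?_ ?_)
    · simp [rowVec, Prod.fst_sum]
    · funext o
      simp only [Prod.fst_sum, Prod.snd_sum, Prod.smul_fst, Prod.smul_snd, rowVec,
        Finset.sum_apply, Pi.smul_apply, Pi.add_apply, Pi.mul_apply, smul_eq_mul]
      rw [← sum_leftRow g hi p hp o, Finset.sum_mul]
      exact Finset.sum_congr rfl fun k _ => by simp only [T]; ring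
    · simp [rowVec, Prod.fst_sum, Prod.snd_sum]
    · funext x
      simp only [Prod.snd_sum, Prod.smul_snd, rowVec, smul_smul]
      exact sum_smul_marker (fun k => T i k * (ε * rowPairing k p)) s t
        (fun k hk => by rw [hT i k (by omega), zero_mul]) x
  have hM' : ∀ i < t, M' i = (rowVec fun o => g o i p.2 * c o, ((fun x : Fin t => T' i x), 0)) := by
    intro i hi
    simp only [M', rightVec]
    refine Prod.ext (Prod.ext ?_ ?_) (Prod.ext ?_ ?_)
    · simp [rowVec, Prod.fst_sum]
    · funext o
      simp only [Prod.fst_sum, Prod.snd_sum, Prod.smul_fst, Prod.smul_snd, rowVec,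
        Finset.sum_apply, Pi.smul_apply, Pi.mul_apply, smul_eq_mul]
      rw [← sum_rightRow g hi p hp o, Finset.sum_mul]
      exact Finset.sum_congr rfl fun k _ => by simp only [T']; ring
    · funext x
      simp only [Prod.fst_sum, Prod.snd_sum, Prod.smul_fst, Prod.smul_snd]
      exact sum_smul_marker (fun k => T' i k) t t (fun k hk => hT' i k (by omega)) x
    · simp [Prod.snd_sum]
  have hMM' : ∀ i < s, ∀ l < t, pairedForm S t (M i) (M' l) =
      ε * ((-1) ^ l * (i + l + 1).factorial / Real.pi / (p.2 - p.1) ^ (2 + i + l)) := by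
    intro i hi l hl
    rw [hM i hi, hM' l hl, pairedForm_apply, rowForm_row_row, zero_add, rowForm_apply]
    simp only [rowVec, map_zero, LinearMap.zero_apply, zero_add, zero_dotProduct, sub_zero]
    -- The diagonal pairings of the eliminated rows reproduce the full singular block of kernel
    -- derivatives.
    have h1 := sum_succ_mul_choose_mul_choose i l t hl
    have h2 : (fun x : Fin t => T i x * (ε * rowPairing x p)) ⬝ᵥ (fun x => T' l x) =
        (i.factorial * l.factorial * ε * (-1) ^ l / Real.pi / (p.2 - p.1) ^ (2 + i + l)) *
        ∑ k ∈ Finset.range t, ((k : ℝ) + 1) * (i + 1).choose (k + 1) * (l + 1).choose (k + 1) := by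
      rw [dotProduct, Finset.sum_range, Finset.mul_sum]
      refine Finset.sum_congr rfl fun x _ => ?_
      simp only [T, T', rowPairing]
      have hsq : ((-1 : ℝ) ^ x.val) * (-1) ^ x.val = 1 := by rw [← mul_pow]; norm_num
      rw [pow_add (-1 : ℝ), pow_add _ (2 + i), pow_add _ 2]
      have := Real.pi_ne_zero
      field_simp
      rw [← sq] at hsq
      rw [hsq]
      ring
    rw [h2, h1]
    have := Nat.factorial_ne_zero i
    have := Nat.factorial_ne_zero l
    have := Real.pi_ne_zero
    field_simp
  have hneg : ∀ x y, B x y = -B y x := fun x y => (LinearMap.IsAlt.neg hB y x).symm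
  have hneg' : ∀ x y, pairedForm S t x y = -pairedForm S t y x := fun x y =>
    (LinearMap.IsAlt.neg (pairedForm_self hS t) y x).symm
  have hMO : ∀ i < s, ∀ o, pairedForm S t (M i) (pointVec o, 0) = g o i p.1 * (c o + ε) := by
    intro i hi o
    rw [hM i hi, pairedForm_apply, rowForm_row_point, map_zero, add_zero]
  have hMO' : ∀ i < t, ∀ o, pairedForm S t (M' i) (pointVec o, 0) = g o i p.2 * c o := by
    intro i hi o
    rw [hM' i hi, pairedForm_apply, rowForm_row_point, map_zero, add_zero]
  have h1 : pfaffian B hB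
      (l₁.map ψ ++ ((List.range s).map A ++ ((List.range t).map A' ++ l₂.map ψ))) =
      pfaffian (pairedForm S t) (pairedForm_self hS t) (l₁.map (fun o => (pointVec o, 0)) ++
        ((List.range s).map M ++ ((List.range t).map M' ++ l₂.map (fun o => (pointVec o, 0))))) := by
    have h2 := pfaffian_congr (hB := hB) (hB' := pairedForm_self hS t)
      (Sum.elim ψ (Sum.elim A A')) (Sum.elim (fun o => (pointVec o, 0)) (Sum.elim M M'))
      (l₁.map Sum.inl ++ ((List.range s).map (fun i => Sum.inr (Sum.inl i)) ++
        ((List.range t).map (fun i => Sum.inr (Sum.inr i)) ++ l₂.map Sum.inl))) ?_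
    · simpa [Function.comp_def] using h2
    · have hmem : ∀ a : O ⊕ ℕ ⊕ ℕ,
          a ∈ (l₁.map Sum.inl ++ ((List.range s).map (fun i => Sum.inr (Sum.inl i)) ++
          ((List.range t).map (fun i => Sum.inr (Sum.inr i)) ++ l₂.map Sum.inl))) →
          (∃ o, a = Sum.inl o) ∨ (∃ i < s, a = Sum.inr (Sum.inl i)) ∨
            ∃ i < t, a = Sum.inr (Sum.inr i) := by
        intro a ha
        simp only [List.mem_append, List.mem_map, List.mem_range] at ha
        rcases ha with ⟨o, -, rfl⟩ | ⟨i, hi, rfl⟩ | ⟨i, hi, rfl⟩ | ⟨o, -, rfl⟩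
        · exact Or.inl ⟨o, rfl⟩
        · exact Or.inr (Or.inl ⟨i, hi, rfl⟩)
        · exact Or.inr (Or.inr ⟨i, hi, rfl⟩)
        · exact Or.inl ⟨o, rfl⟩
      intro a ha b hb
      rcases hmem a ha with ⟨o, rfl⟩ | ⟨i, hi, rfl⟩ | ⟨i, hi, rfl⟩ <;>
        rcases hmem b hb with ⟨o', rfl⟩ | ⟨l, hl, rfl⟩ | ⟨l, hl, rfl⟩ <;>
        simp only [Sum.elim_inl, Sum.elim_inr]
      · rw [hO, pairedForm_apply, rowForm_point_point, map_zero, add_zero]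
      · rw [hneg, hneg', hAO l hl, hMO l hl]
      · rw [hneg, hneg', hAO' l hl, hMO' l hl]
      · rw [hAO i hi, hMO i hi]
      · rw [hA i hi l hl, hM i hi, hM l hl, pairedForm_apply, rowForm_row_row, rowForm_row_row,
          add_zero]
      · rw [hAA' i hi l hl, hMM' i hi l hl]
      · rw [hAO' i hi, hMO' i hi]
      · rw [hneg, hneg', hAA' l hl i hi, hMM' l hl i hi]
      · rw [hA' i hi l hl, hM' i hi, hM' l hl, pairedForm_apply, rowForm_row_row, rowForm_apply]
        simp
  rw [h1, pfaffian_triangular _ _ _ _ s T hT L]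
  have h3 := pfaffian_triangular (pairedForm S t) (pairedForm_self hS t)
    (l₁.map (fun o => (pointVec o, 0)) ++ (List.range s).map L)
    (l₂.map (fun o => (pointVec o, 0))) t T' hT' (rightVec g c t p)
  rw [List.append_assoc, List.append_assoc] at h3
  rw [h3, pfaffian_sum, ← mul_assoc]
  congr 1
  · unfold eliminationFactor
    congr 1
    · exact Finset.prod_congr rfl fun i _ => by simp [T]
    · refine Finset.prod_congr rfl fun i _ => ?_
      simp only [T']
      rw [← two_mul, pow_mul]
      simp
  · refine Finset.sum_congr rfl fun σ _ => ?_
    congr 1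
    have hw : ∀ j : Fin 3, w j = if j ≠ 0 then ε else 1 := by
      intro j
      fin_cases j <;> simp [w]
    simp only [hw, partDegree]
    rw [Finset.prod_ite]
    simp

end Expansion


/-! ### Removal of the paired rows and limits of row Pfaffians -/

section TermLimit

variable {O : Type*} [Fintype O] [DecidableEq O]

theorem map_eq_ofFn_get {X Y : Type*} (l : List X) (F : X → Y) :
    l.map F = List.ofFn fun i : Fin l.length => F (l.get i) := by
  apply List.ext_getElem <;> simp

theorem pfaffian_smul_map {V X : Type*} [AddCommGroup V] [Module ℝ V] (B : LinearMap.BilinForm ℝ V)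
    (hB : ∀ v, B v v = 0) (l : List X) (a : X → ℝ) (w : X → V) (l₂ : List V) : ∀ l₁ : List V,
    pfaffian B hB (l₁ ++ (l.map (fun q => a q • w q) ++ l₂)) =
      (l.map a).prod * pfaffian B hB (l₁ ++ (l.map w ++ l₂)) := by
  induction l with
  | nil => simp
  | cons q l ih =>
    intro l₁
    rw [List.map_cons, List.cons_append, pfaffian_smul]
    have h := ih (l₁ ++ [w q])
    simp only [List.append_assoc, List.cons_append, List.nil_append] at h
    rw [h]
    simp only [List.map_cons, List.prod_cons, List.cons_append]
    ring

/-- The Pfaffian of a list of points and rows between them. -/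
noncomputable def rowPfaffian {S : Matrix O O ℝ} (hS : ∀ a b, S a b = -S b a) (l₁ l₂ : List O)
    (rows : List (O → ℝ)) : ℝ :=
  pfaffian (rowForm S) (rowForm_self hS)
    (l₁.map pointVec ++ (rows.map rowVec ++ l₂.map pointVec))

/-- The Pfaffian as an alternating function of the rows. -/
noncomputable def rowPfaffianAlt {S : Matrix O O ℝ} (hS : ∀ a b, S a b = -S b a) (l₁ l₂ : List O)
    (n : ℕ) : (O → ℝ) [⋀^Fin n]→ₗ[ℝ] ℝ :=
  (pfaffianAlt (rowForm S) (rowForm_self hS) (l₁.map pointVec) (l₂.map pointVec) n).compLinearMap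
    (LinearMap.inr ℝ (O → ℝ) (O → ℝ))

theorem rowPfaffianAlt_apply {S : Matrix O O ℝ} (hS : ∀ a b, S a b = -S b a) (l₁ l₂ : List O)
    (n : ℕ) (z : Fin n → O → ℝ) :
    rowPfaffianAlt hS l₁ l₂ n z = rowPfaffian hS l₁ l₂ (List.ofFn z) := by
  rw [rowPfaffian, List.map_ofFn]
  exact pfaffianAlt_apply _ _ _ _ _ _

/-- Distinct labels have distinct nonzero points, so the matrix of leading coefficients is
invertible and the limit lemma for alternating maps applies to the rows carrying the factor `c`. The
rows in `κ` may be arbitrary convergent ones. -/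
theorem tendsto_rowPfaffian {S : Matrix O O ℝ} (hS : ∀ a b, S a b = -S b a) (l₁ l₂ : List O)
    {ξ : ℝ} {g : O → ℕ → ℝ → ℝ} (hg : ∀ o, DerivativesNear ξ (g o)) (c : O → ℝ)
    {l : List (ℕ ⊕ ℕ)} (hl : l.Nodup) (r : ℝ × ℝ → ℕ ⊕ ℕ → O → ℝ) {κ : Type*} [Fintype κ]
    [DecidableEq κ] {n : ℕ} (e : κ ⊕ Fin n ≃ Fin l.length) (z₀ : κ → O → ℝ)
    (hκ : ∀ i, Tendsto (fun p => r p (l.get (e (Sum.inl i)))) (fusionFilter ξ) (𝓝 (z₀ i)))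
    (hn : ∀ i p, r p (l.get (e (Sum.inr i))) = c * fusionRow g p (l.get (e (Sum.inr i)))) :
    Tendsto (fun p => rowPfaffian hS l₁ l₂ (l.map (r p)) / (p.2 - p.1) ^ n.choose 2)
      (fusionFilter ξ) (𝓝 ((Matrix.of fun i k : Fin n =>
        rowCoeff (rowPoint (l.get (e (Sum.inr i)))) k).det *
        rowPfaffianAlt hS l₁ l₂ l.length fun i =>
          Sum.elim z₀ (fun (k : Fin n) o => c o * (g o k ξ / k.val.factorial)) (e.symm i))) := by
  have hinj : Function.Injective fun i : Fin n => rowPoint (l.get (e (Sum.inr i))) := by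
    intro i k h
    have := e.injective (hl.injective_get (rowPoint_injective h))
    exact Sum.inr_injective this
  have hdet := det_rowCoeff_ne_zero hinj fun i => rowPoint_ne_zero _
  have hδ : ∀ᶠ p : ℝ × ℝ in fusionFilter ξ, p.2 - p.1 ≠ 0 :=
    (eventually_lt_fusionFilter ξ).mono fun p hp => (sub_pos.2 hp).ne'
  have h := tendsto_alternatingMap (rowPfaffianAlt hS l₁ l₂ l.length) e
    (fun p : ℝ × ℝ => p.2 - p.1) hδ (tendsto_sub_fusionFilter ξ) (fun p i => r p (l.get i)) z₀ hκ
    (Matrix.of fun i k : Fin n => rowCoeff (rowPoint (l.get (e (Sum.inr i)))) k) hdet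
    (fun p k o => c o * (g o k p.1 / k.val.factorial))
    (fun k o => c o * (g o k ξ / k.val.factorial)) ?_ ?_
  · refine h.congr fun p => ?_
    rw [rowPfaffianAlt_apply, map_eq_ofFn_get]
  · intro k
    rw [tendsto_pi_nhds]
    intro o
    exact ((((hg o).continuousAt k).tendsto.comp (tendsto_fst_fusionFilter ξ)).div_const _).const_mul _
  · intro i
    rw [Asymptotics.isBigO_pi]
    intro o
    have h1 := (fusionRow_isBigO hg (l.get (e (Sum.inr i))) n o).const_mul_left (c o)
    refine h1.congr_left fun p => ?_
    simp only [hn, Pi.sub_apply, Pi.mul_apply, Finset.sum_apply, Pi.smul_apply, smul_eq_mul,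
      Matrix.of_apply]
    rw [mul_sub, Finset.sum_range, Finset.mul_sum]
    congr 1
    exact Finset.sum_congr rfl fun k _ => by ring

/-- The labels of the rows that are left after the removal of the pairs in `X`. -/
def rowLabels (s t : ℕ) (X : Finset ℕ) : List (ℕ ⊕ ℕ) :=
  ((List.range s).filter fun k => k ∉ X).reverse.map Sum.inl ++
    ((List.range t).filter fun k => k ∉ X).map Sum.inr

theorem nodup_rowLabels (s t : ℕ) (X : Finset ℕ) : (rowLabels s t X).Nodup := by
  unfold rowLabels
  rw [List.nodup_append]
  refine ⟨((List.nodup_reverse.2 (List.nodup_range.filter _)).map Sum.inl_injective),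
    (List.nodup_range.filter _).map Sum.inr_injective, ?_⟩
  intro a ha b hb
  obtain ⟨i, -, rfl⟩ := List.mem_map.1 ha
  obtain ⟨k, -, rfl⟩ := List.mem_map.1 hb
  simp

theorem length_filter_range (s : ℕ) {X : Finset ℕ} (hX : X ⊆ Finset.range s) :
    ((List.range s).filter fun k => k ∉ X).length = s - X.card := by
  have h1 : ((List.range s).filter fun k => k ∉ X).toFinset = Finset.range s \ X := by
    ext k
    simp
  rw [← List.toFinset_card_of_nodup (List.nodup_range.filter _), h1, Finset.card_sdiff_of_subset hX,
    Finset.card_range]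

theorem length_rowLabels {s t : ℕ} {X : Finset ℕ} (hs : X ⊆ Finset.range s)
    (ht : X ⊆ Finset.range t) : (rowLabels s t X).length = s - X.card + (t - X.card) := by
  simp only [rowLabels, List.length_append, List.length_map, List.length_reverse]
  rw [length_filter_range s hs, length_filter_range t ht]

/-- The extension of an assignment of parts to all numbers. -/
def extendPart {s : ℕ} (σ : Fin s → Fin 3) (k : ℕ) : Fin 3 := if h : k < s then σ ⟨k, h⟩ else 0

/-- The rows to which the part with the pairing is assigned. -/
def pairedRows {s : ℕ} (σ : Fin s → Fin 3) : Finset ℕ :=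
  (Finset.range s).filter fun k => extendPart σ k = 2

/-- The rows that are left after the removal of the pairs, up to signs. -/
noncomputable def remainingRow {s : ℕ} (g : O → ℕ → ℝ → ℝ) (c : O → ℝ) (σ : Fin s → Fin 3)
    (p : ℝ × ℝ) : ℕ ⊕ ℕ → O → ℝ
  | Sum.inl k => if extendPart σ k = 1 then fusionRow g p (Sum.inl k)
      else c * fusionRow g p (Sum.inl k)
  | Sum.inr k => c * fusionRow g p (Sum.inr k)

/-- The sign of a row in `fusionRow`. -/
def rowSign : ℕ ⊕ ℕ → ℝ
  | Sum.inl k => (-1) ^ k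
  | Sum.inr _ => -1

/-- A left row of number at least `t` has no right row to be paired with, so its pairing part is the
zero vector. -/
theorem partTerm_eq_zero {S : Matrix O O ℝ} (hS : ∀ a b, S a b = -S b a) (g : O → ℕ → ℝ → ℝ)
    (c : O → ℝ) (l₁ l₂ : List O) {s : ℕ} (t : ℕ) (σ : Fin s → Fin 3) (p : ℝ × ℝ)
    (h : ¬ pairedRows σ ⊆ Finset.range t) : partTerm hS g c l₁ l₂ t σ p = 0 := by
  rw [Finset.not_subset] at h
  obtain ⟨k, hk, hkt⟩ := h
  obtain ⟨hks, hk2⟩ := Finset.mem_filter.1 hk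
  rw [Finset.mem_range] at hks hkt
  rw [extendPart, dif_pos hks] at hk2
  rw [partTerm, ← pfaffianAlt_apply]
  refine (pfaffianAlt _ _ _ _ _).map_coord_zero ⟨k, hks⟩ ?_
  have hm : marker t k = 0 := by
    funext x
    have := x.isLt
    simp only [marker, Pi.zero_apply]
    rw [if_neg (by omega)]
  rw [hk2]
  simp [leftPart, hm, rowVec]

/-- A row in its pairing part is orthogonal to everything except the right row of the same number.
Reversing the left rows makes these pairs nested, so they can be removed at the cost of the single
sign of the reversal. -/
theorem partTerm_eq {S : Matrix O O ℝ} (hS : ∀ a b, S a b = -S b a) (g : O → ℕ → ℝ → ℝ)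
    (c : O → ℝ) (l₁ l₂ : List O) {s : ℕ} (t : ℕ) (σ : Fin s → Fin 3) (p : ℝ × ℝ)
    (h : pairedRows σ ⊆ Finset.range t) : partTerm hS g c l₁ l₂ t σ p =
      (-1) ^ s.choose 2 * (∏ k ∈ pairedRows σ, rowPairing k p) *
        (((rowLabels s t (pairedRows σ)).map rowSign).prod *
          rowPfaffian hS l₁ l₂ ((rowLabels s t (pairedRows σ)).map (remainingRow g c σ p))) := by
  set X := pairedRows σ with hX
  have hXs : ∀ k ∈ X, k < s ∧ extendPart σ k = 2 := by
    intro k hk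
    simpa [hX, pairedRows] using hk
  let a : ℕ → ((O → ℝ) × (O → ℝ)) × ((Fin t → ℝ) × (Fin t → ℝ)) := fun k =>
    leftPart g c t p (extendPart σ k) k
  have ha2 : ∀ k ∈ X, a k = (0, rowVec (rowPairing k p • marker t k)) := by
    intro k hk
    simp only [a, (hXs k hk).2]
    rfl
  have hofFn : List.ofFn (fun k : Fin s => leftPart g c t p (σ k) k) = (List.range s).map a := by
    rw [← ofFn_eq_map_range]
    congr 1
    funext k
    simp [a, extendPart]
  have hsq : (-1 : ℝ) ^ s.choose 2 * (-1) ^ s.choose 2 = 1 := by rw [← mul_pow]; norm_num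
  have h1 := pfaffian_reverse (pairedForm S t) (pairedForm_self hS t)
    (l₁.map (fun o => (pointVec o, 0))) ((List.range s).map a)
    ((List.range t).map (rightVec g c t p) ++ l₂.map (fun o => (pointVec o, 0)))
  rw [List.length_map, List.length_range, ← List.map_reverse] at h1
  have h2 : partTerm hS g c l₁ l₂ t σ p = (-1) ^ s.choose 2 *
      pfaffian (pairedForm S t) (pairedForm_self hS t) (l₁.map (fun o => (pointVec o, 0)) ++
        ((List.range s).reverse.map a ++
        ((List.range t).map (rightVec g c t p) ++ l₂.map (fun o => (pointVec o, 0))))) := by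
    rw [h1, ← mul_assoc, hsq, one_mul, partTerm, hofFn]
  have hpt : ∀ k ∈ X, ∀ o : O, pairedForm S t (a k) (pointVec o, 0) = 0 := by
    intro k hk o
    rw [ha2 k hk, pairedForm_apply]
    simp
  have hpair : ∀ k ∈ X, ∀ l, pairedForm S t (a k) (rightVec g c t p l) =
      if l = k then rowPairing k p else 0 := by
    intro k hk l
    have hkt : k < t := Finset.mem_range.1 (h hk)
    rw [ha2 k hk, pairedForm_apply, rightVec, rowForm_apply 0]
    simp only [map_zero, LinearMap.zero_apply, rowVec, zero_dotProduct, zero_add, sub_zero,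
      smul_dotProduct, smul_eq_mul]
    have : marker t k ⬝ᵥ marker t l = if l = k then 1 else 0 := by
      rw [dotProduct, Finset.sum_eq_single ⟨k, hkt⟩]
      · simp [marker, eq_comm]
      · intro x _ hx
        have : x.val ≠ k := fun h => hx (Fin.ext h)
        simp [marker, this]
      · simp
    rw [this, mul_ite, mul_one, mul_zero]
  rw [h2, pfaffian_remove_pairs _ _ _ _ s t a (rightVec g c t p) X
    (fun k hk => ⟨(hXs k hk).1, Finset.mem_range.1 (h hk)⟩)]
  · rw [Finset.prod_congr rfl fun k hk => by rw [hpair k hk k, if_pos rfl], ← mul_assoc]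
    congr 1
    let ρ : ℕ ⊕ ℕ → O → ℝ := fun q => rowSign q • remainingRow g c σ p q
    have h3 := pfaffian_smul_map (rowForm S) (rowForm_self hS) (rowLabels s t X) rowSign
      (fun q => rowVec (remainingRow g c σ p q)) (l₂.map pointVec) (l₁.map pointVec)
    have h4 : ∀ q, rowSign q • rowVec (remainingRow g c σ p q) = rowVec (ρ q) := by
      intro q
      simp [rowVec, ρ]
    simp only [h4] at h3
    rw [rowPfaffian, List.map_map, Function.comp_def, ← h3]
    have h5 := pfaffian_congr (hB := pairedForm_self hS t) (hB' := rowForm_self hS)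
      (Sum.elim (fun o : O => (pointVec o, (0 : (Fin t → ℝ) × (Fin t → ℝ))))
        (Sum.elim a (rightVec g c t p)))
      (Sum.elim pointVec fun q => rowVec (ρ q))
      (l₁.map Sum.inl ++ ((rowLabels s t X).map Sum.inr ++ l₂.map Sum.inl)) ?_
    · simpa [Function.comp_def, rowLabels] using h5
    · have hsq : ∀ k : ℕ, (-1 : ℝ) ^ k * (-1) ^ k = 1 := fun k => by rw [← mul_pow]; norm_num
      have hleft : ∀ k, k ∉ X → k < s → a k = (rowVec (ρ (Sum.inl k)), 0) := by
        intro k hk hks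
        have hk2 : extendPart σ k ≠ 2 := fun h' =>
          hk (by simp only [hX, pairedRows, Finset.mem_filter, Finset.mem_range]; exact ⟨hks, h'⟩)
        simp only [a, ρ, remainingRow, rowSign, fusionRow]
        generalize extendPart σ k = j at hk2
        fin_cases j
        · simp [leftPart, smul_smul, hsq]
        · simp [leftPart, smul_smul, hsq]
        · exact absurd rfl hk2
      have hright : ∀ k, rightVec g c t p k = (rowVec (ρ (Sum.inr k)), (marker t k, 0)) := by
        intro k
        simp [rightVec, ρ, remainingRow, rowSign, fusionRow]
      -- After the removal no vector has a second component of pairing type; what remains of the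
      -- markers pairs to zero, and the form reduces to `rowForm`.
      have hmem : ∀ b : O ⊕ ℕ ⊕ ℕ,
          b ∈ (l₁.map Sum.inl ++ ((rowLabels s t X).map Sum.inr ++ l₂.map Sum.inl)) →
          ∃ y : Fin t → ℝ, Sum.elim (fun o : O => (pointVec o, (0 : (Fin t → ℝ) × (Fin t → ℝ))))
            (Sum.elim a (rightVec g c t p)) b =
              (Sum.elim pointVec (fun q => rowVec (ρ q)) b, (y, 0)) := by
        intro b hb
        simp only [List.mem_append, List.mem_map, rowLabels, List.mem_reverse, List.mem_filter,
          List.mem_range, decide_eq_true_eq] at hb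
        rcases hb with ⟨o, -, rfl⟩ | ⟨q, ⟨k, hk, rfl⟩ | ⟨k, hk, rfl⟩, rfl⟩ | ⟨o, -, rfl⟩
        · exact ⟨0, rfl⟩
        · exact ⟨0, hleft k hk.2 hk.1⟩
        · exact ⟨_, hright k⟩
        · exact ⟨0, rfl⟩
      intro b hb b' hb'
      obtain ⟨y, hy⟩ := hmem b hb
      obtain ⟨y', hy'⟩ := hmem b' hb'
      rw [hy, hy', pairedForm_apply, rowForm_apply 0]
      simp
  · intro k hk w hw
    obtain ⟨o, -, rfl⟩ := List.mem_map.1 hw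
    exact hpt k hk o
  · intro k hk w hw
    obtain ⟨o, -, rfl⟩ := List.mem_map.1 hw
    exact hpt k hk o
  · intro k hk l
    rw [ha2 k hk, pairedForm_apply]
    simp only [a]
    generalize extendPart σ l = j
    fin_cases j <;> simp [leftPart, rowForm_apply, rowVec]
  · intro k hk l hl
    rw [hpair k hk, if_neg hl]

end TermLimit


/-! ### The constants -/

section Constants

/-- The absolute value of the leading coefficient of the Pfaffian with the given rows. -/
noncomputable def labelWeight (l : List (ℕ ⊕ ℕ)) : ℝ :=
  (∏ i : Fin l.length, |rowPoint (l.get i)|) *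
    (∏ i : Fin l.length, ∏ k ∈ Finset.Ioi i, (rowPoint (l.get i) - rowPoint (l.get k))) /
      ((∏ k ∈ Finset.range l.length, ((k + 1).factorial : ℝ)) *
        ∏ k ∈ Finset.range l.length, (k.factorial : ℝ))

/-- The constant in the asymptotics when points of valences `s`, `t` with `m` links between them
are fused. -/
noncomputable def fusionConstant (s t m : ℕ) : ℝ :=
  (∏ i ∈ Finset.range s, (i.factorial : ℝ)) * (∏ i ∈ Finset.range t, (i.factorial : ℝ)) /
    Real.pi ^ m * ∑ X ∈ (Finset.range (min s t)).powersetCard m,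
      (∏ k ∈ X, ((k : ℝ) + 1)) * labelWeight (rowLabels s t X)

theorem prod_map_filter_range (n : ℕ) (X : Finset ℕ) (f : ℕ → ℝ) :
    (((List.range n).filter fun k => k ∉ X).map f).prod = ∏ k ∈ Finset.range n \ X, f k := by
  rw [← List.prod_toFinset _ (List.nodup_range.filter _)]
  refine Finset.prod_congr ?_ fun _ _ => rfl
  ext k
  simp

theorem prod_map_rowLabels (s t : ℕ) (X : Finset ℕ) (f : ℕ ⊕ ℕ → ℝ) :
    ((rowLabels s t X).map f).prod = (∏ k ∈ Finset.range s \ X, f (Sum.inl k)) *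
      ∏ k ∈ Finset.range t \ X, f (Sum.inr k) := by
  rw [rowLabels, List.map_append, List.prod_append, List.map_map, List.map_map,
    ((List.reverse_perm _).map _).prod_eq, prod_map_filter_range, prod_map_filter_range]
  rfl

theorem prod_get {X : Type*} (l : List X) (f : X → ℝ) :
    ∏ i : Fin l.length, f (l.get i) = (l.map f).prod := by
  rw [map_eq_ofFn_get, List.prod_ofFn]

/-- The sign of the reversal, the signs of the pairings and the normalizing signs of the rows cancel
against the negative row points. This is the source of the nonnegativity of the constants. -/
theorem prod_rowSign (s t : ℕ) {X : Finset ℕ} (hX : X ⊆ Finset.range s) :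
    (-1) ^ s.choose 2 * (∏ k ∈ X, (-1 : ℝ) ^ k) * ((rowLabels s t X).map rowSign).prod *
      ((rowLabels s t X).map rowPoint).prod = ((rowLabels s t X).map fun q => |rowPoint q|).prod := by
  simp only [prod_map_rowLabels, rowSign, rowPoint]
  have h1 : (∏ k ∈ X, (-1 : ℝ) ^ k) * ∏ k ∈ Finset.range s \ X, (-1 : ℝ) ^ k =
      (-1) ^ s.choose 2 := by
    rw [mul_comm, Finset.prod_sdiff hX, Finset.prod_pow_eq_pow_sum, Finset.sum_range_id,
      Nat.choose_two_right]
  have h2 : ∀ k : ℕ, |(k : ℝ) + 1| = k + 1 := fun k => abs_of_nonneg (by positivity)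
  have h3 : ∀ k : ℕ, |-((k : ℝ) + 1)| = -1 * -((k : ℝ) + 1) := fun k => by
    rw [abs_neg, h2]; ring
  have hsq : (-1 : ℝ) ^ s.choose 2 * (-1) ^ s.choose 2 = 1 := by rw [← mul_pow]; norm_num
  simp only [h2, h3]
  rw [Finset.prod_mul_distrib]
  linear_combination ((-1) ^ s.choose 2 * (∏ k ∈ Finset.range t \ X, (-1 : ℝ)) *
    (∏ k ∈ Finset.range s \ X, ((k : ℝ) + 1)) * ∏ k ∈ Finset.range t \ X, -((k : ℝ) + 1)) * h1 +
    ((∏ k ∈ Finset.range t \ X, (-1 : ℝ)) *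
    (∏ k ∈ Finset.range s \ X, ((k : ℝ) + 1)) * ∏ k ∈ Finset.range t \ X, -((k : ℝ) + 1)) * hsq

theorem det_rowLabels (s t : ℕ) {X : Finset ℕ} (hX : X ⊆ Finset.range s) :
    (-1) ^ s.choose 2 * (∏ k ∈ X, (-1 : ℝ) ^ k) * ((rowLabels s t X).map rowSign).prod *
      (Matrix.of fun i k : Fin (rowLabels s t X).length =>
        rowCoeff (rowPoint ((rowLabels s t X).get i)) k).det *
      (∏ k : Fin (rowLabels s t X).length, (k.val.factorial : ℝ)⁻¹) =
        labelWeight (rowLabels s t X) := by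
  rw [det_rowCoeff, labelWeight, prod_get _ rowPoint, prod_get _ fun q => |rowPoint q|,
    ← prod_rowSign s t hX, Finset.prod_inv_distrib,
    ← Finset.prod_range fun k => (k.factorial : ℝ)]
  have h1 : ∏ l ∈ Finset.range (rowLabels s t X).length, ((l + 1).factorial : ℝ) ≠ 0 :=
    Finset.prod_ne_zero_iff.2 fun l _ => by positivity
  have h2 : ∏ l ∈ Finset.range (rowLabels s t X).length, (l.factorial : ℝ) ≠ 0 :=
    Finset.prod_ne_zero_iff.2 fun l _ => by positivity
  field_simp

/-- After the reversal the labels are ordered by decreasing points, so all differences in the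
Vandermonde product are positive. -/
theorem pairwise_rowLabels (s t : ℕ) (X : Finset ℕ) :
    (rowLabels s t X).Pairwise fun a b => rowPoint b < rowPoint a := by
  unfold rowLabels
  rw [List.pairwise_append]
  refine ⟨?_, ?_, ?_⟩
  · rw [List.pairwise_map, List.pairwise_reverse]
    refine (List.pairwise_lt_range.filter _).imp fun {a b} h => ?_
    simp only [rowPoint, add_lt_add_iff_right, Nat.cast_lt]
    exact h
  · rw [List.pairwise_map]
    refine (List.pairwise_lt_range.filter _).imp fun {a b} h => ?_
    simp only [rowPoint, neg_lt_neg_iff, add_lt_add_iff_right, Nat.cast_lt]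
    exact h
  · intro a ha b hb
    obtain ⟨i, -, rfl⟩ := List.mem_map.1 ha
    obtain ⟨k, -, rfl⟩ := List.mem_map.1 hb
    simp only [rowPoint]
    have : (0 : ℝ) ≤ i := Nat.cast_nonneg i
    have : (0 : ℝ) ≤ k := Nat.cast_nonneg k
    linarith

theorem labelWeight_pos (s t : ℕ) (X : Finset ℕ) : 0 < labelWeight (rowLabels s t X) := by
  unfold labelWeight
  refine div_pos (mul_pos (Finset.prod_pos fun i _ => abs_pos.2 (rowPoint_ne_zero _)) ?_) ?_
  · refine Finset.prod_pos fun i _ => Finset.prod_pos fun k hk => sub_pos.2 ?_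
    exact List.pairwise_iff_get.1 (pairwise_rowLabels s t X) i k (Finset.mem_Ioi.1 hk)
  · exact mul_pos (Finset.prod_pos fun i _ => by positivity)
      (Finset.prod_pos fun i _ => by positivity)

theorem fusionConstant_nonneg (s t m : ℕ) : 0 ≤ fusionConstant s t m := by
  unfold fusionConstant
  have := Real.pi_pos
  refine mul_nonneg (by positivity) (Finset.sum_nonneg fun X _ => ?_)
  exact mul_nonneg (by positivity) (labelWeight_pos s t X).le

end Constants

/-! ### Power counting and the leading coefficient -/

section TermLimit

variable {O : Type*} [Fintype O] [DecidableEq O]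

theorem eliminationFactor_eq (s t : ℕ) (p : ℝ × ℝ) : eliminationFactor s t p =
    (∏ i ∈ Finset.range s, (i.factorial : ℝ)) * (∏ i ∈ Finset.range t, (i.factorial : ℝ)) *
      ((p.2 - p.1) ^ s.choose 2 * (p.2 - p.1) ^ t.choose 2)⁻¹ := by
  unfold eliminationFactor
  rw [Finset.prod_mul_distrib, Finset.prod_mul_distrib, Finset.prod_inv_distrib,
    Finset.prod_inv_distrib, Finset.prod_pow_eq_pow_sum, Finset.prod_pow_eq_pow_sum,
    Finset.sum_range_id, Finset.sum_range_id, ← Nat.choose_two_right, ← Nat.choose_two_right,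
    mul_inv]
  ring

theorem fusionExponent_eq (s t m : ℕ) :
    fusionExponent s t m = 2 * (m : ℝ) ^ 2 - m * (2 * s + 2 * t + 1) + s * t := by
  unfold fusionExponent kacWeight
  push_cast
  ring

theorem rpow_fusionExponent {s t m : ℕ} (hm : m ≤ min s t) {x : ℝ} (hx : 0 < x) :
    x ^ fusionExponent s t m = x ^ (s + t - 2 * m).choose 2 /
      (x ^ s.choose 2 * x ^ t.choose 2 * x ^ (2 * m)) := by
  have h : 2 * m ≤ s + t := by
    have := le_min_iff.1 hm
    omega
  rw [← pow_add, ← pow_add, ← Real.rpow_natCast, ← Real.rpow_natCast, ← Real.rpow_sub hx]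
  congr 1
  rw [fusionExponent_eq]
  push_cast [Nat.cast_choose_two, Nat.cast_sub h]
  ring

/-- Power counting: dividing by the expected asymptotics leaves `δ ^ (2 (m - r))`, where `r` is the
number of pairs, times the row Pfaffian divided by the power of `δ` expected from `s + t - 2m` rows.
-/
theorem eliminationFactor_mul_partTerm {S : Matrix O O ℝ} (hS : ∀ a b, S a b = -S b a)
    (g : O → ℕ → ℝ → ℝ) (c : O → ℝ) (l₁ l₂ : List O) {s : ℕ} (t : ℕ) (σ : Fin s → Fin 3)
    (h : pairedRows σ ⊆ Finset.range t) {m : ℕ} (hm : m ≤ min s t)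
    (hr : (pairedRows σ).card ≤ m) (p : ℝ × ℝ) (hp : p.1 < p.2) :
    eliminationFactor s t p * partTerm hS g c l₁ l₂ t σ p / |p.2 - p.1| ^ fusionExponent s t m =
      ((∏ i ∈ Finset.range s, (i.factorial : ℝ)) * (∏ i ∈ Finset.range t, (i.factorial : ℝ)) /
        Real.pi ^ (pairedRows σ).card * ∏ k ∈ pairedRows σ, ((k : ℝ) + 1)) *
      ((-1) ^ s.choose 2 * (∏ k ∈ pairedRows σ, (-1 : ℝ) ^ k) *
        ((rowLabels s t (pairedRows σ)).map rowSign).prod) *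
      ((p.2 - p.1) ^ (2 * (m - (pairedRows σ).card)) *
        (rowPfaffian hS l₁ l₂ ((rowLabels s t (pairedRows σ)).map (remainingRow g c σ p)) /
          (p.2 - p.1) ^ (s + t - 2 * m).choose 2)) := by
  have hδ : 0 < p.2 - p.1 := sub_pos.2 hp
  rw [abs_of_pos hδ, rpow_fusionExponent hm hδ, eliminationFactor_eq, partTerm_eq hS g c l₁ l₂ t σ p h]
  have h1 : ∏ k ∈ pairedRows σ, rowPairing k p = (∏ k ∈ pairedRows σ, (-1 : ℝ) ^ k) *
      (∏ k ∈ pairedRows σ, ((k : ℝ) + 1)) / Real.pi ^ (pairedRows σ).card /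
        ((p.2 - p.1) ^ 2) ^ (pairedRows σ).card := by
    unfold rowPairing
    rw [Finset.prod_div_distrib, Finset.prod_div_distrib, Finset.prod_mul_distrib,
      Finset.prod_const, Finset.prod_const]
  have h2 : (p.2 - p.1) ^ (2 * m) = (p.2 - p.1) ^ (2 * (m - (pairedRows σ).card)) *
      ((p.2 - p.1) ^ 2) ^ (pairedRows σ).card := by
    rw [← pow_mul, ← pow_add]
    congr 1
    omega
  rw [h1, h2]
  have := Real.pi_ne_zero
  generalize p.2 - p.1 = δ at hδ
  field_simp

/-- If every part proportional to `ε` is a pairing, there are `m` pairs and all remaining rows carry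
the factor `c`, so no row is exempt from the expansion (`κ` is empty) and the powers of `δ` balance
exactly. -/
theorem tendsto_partTerm_leading {S : Matrix O O ℝ} (hS : ∀ a b, S a b = -S b a) {ξ : ℝ}
    {g : O → ℕ → ℝ → ℝ} (hg : ∀ o, DerivativesNear ξ (g o)) (c : O → ℝ) (l₁ l₂ : List O) {s : ℕ}
    (t : ℕ) (σ : Fin s → Fin 3) (h : pairedRows σ ⊆ Finset.range t) {m : ℕ} (hm : m ≤ min s t)
    (hr : (pairedRows σ).card = m) (h1 : ∀ k, extendPart σ k ≠ 1) :
    Tendsto (fun p => eliminationFactor s t p * partTerm hS g c l₁ l₂ t σ p /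
      |p.2 - p.1| ^ fusionExponent s t m) (fusionFilter ξ)
      (𝓝 ((∏ i ∈ Finset.range s, (i.factorial : ℝ)) * (∏ i ∈ Finset.range t, (i.factorial : ℝ)) /
        Real.pi ^ m * ((∏ k ∈ pairedRows σ, ((k : ℝ) + 1)) *
          labelWeight (rowLabels s t (pairedRows σ))) *
        rowPfaffian hS l₁ l₂ ((List.range (s + t - 2 * m)).map fun k o => c o * g o k ξ))) := by
  have hXs : pairedRows σ ⊆ Finset.range s := Finset.filter_subset _ _
  have hlen : (rowLabels s t (pairedRows σ)).length = s + t - 2 * m := by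
    rw [length_rowLabels hXs h, hr]
    have := le_min_iff.1 hm
    omega
  have hrow : ∀ q p, remainingRow g c σ p q = c * fusionRow g p q := by
    rintro (k | k) p
    · simp [remainingRow, h1]
    · rfl
  have hlim := tendsto_rowPfaffian hS l₁ l₂ hg c (nodup_rowLabels s t (pairedRows σ))
    (fun p => remainingRow g c σ p) (Equiv.emptySum Empty (Fin (rowLabels s t (pairedRows σ)).length))
    (fun i => i.elim) (fun i => i.elim) (fun i p => hrow _ p)
  have hval : (rowPfaffianAlt hS l₁ l₂ (rowLabels s t (pairedRows σ)).length fun i =>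
      Sum.elim (fun i : Empty => i.elim) (fun (k : Fin (rowLabels s t (pairedRows σ)).length) o =>
        c o * (g o k ξ / k.val.factorial))
        ((Equiv.emptySum Empty (Fin (rowLabels s t (pairedRows σ)).length)).symm i)) =
      (∏ k : Fin (rowLabels s t (pairedRows σ)).length, (k.val.factorial : ℝ)⁻¹) *
      rowPfaffian hS l₁ l₂ ((List.range (s + t - 2 * m)).map fun k o => c o * g o k ξ) := by
    have h2 := (rowPfaffianAlt hS l₁ l₂
      (rowLabels s t (pairedRows σ)).length).toMultilinearMap.map_smul_univ
      (fun k : Fin (rowLabels s t (pairedRows σ)).length => (k.val.factorial : ℝ)⁻¹)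
      (fun k o => c o * g o k ξ)
    have h3 := rowPfaffianAlt_apply hS l₁ l₂ (rowLabels s t (pairedRows σ)).length
      (fun k o => c o * g o k ξ)
    rw [ofFn_eq_map_range (fun k o => c o * g o k ξ)] at h3
    rw [← hlen, ← h3]
    refine Eq.trans ?_ h2
    change rowPfaffianAlt hS l₁ l₂ _ _ = rowPfaffianAlt hS l₁ l₂ _ _
    congr 1
    funext i o
    simp only [Equiv.emptySum_symm_apply, Sum.elim_inr, Pi.smul_apply, smul_eq_mul]
    ring
  rw [hval] at hlim
  have h4 := hlim.const_mul (((∏ i ∈ Finset.range s, (i.factorial : ℝ)) *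
    (∏ i ∈ Finset.range t, (i.factorial : ℝ)) / Real.pi ^ m * ∏ k ∈ pairedRows σ, ((k : ℝ) + 1)) *
      ((-1) ^ s.choose 2 * (∏ k ∈ pairedRows σ, (-1 : ℝ) ^ k) *
        ((rowLabels s t (pairedRows σ)).map rowSign).prod))
  have h5 := det_rowLabels s t hXs
  simp only [Equiv.emptySum_apply_inr] at h4
  refine (h4.congr' ?_).trans (le_of_eq ?_)
  · filter_upwards [eventually_lt_fusionFilter ξ] with p hp
    rw [eliminationFactor_mul_partTerm hS g c l₁ l₂ t σ h hm hr.le p hp, hr, Nat.sub_self, mul_zero,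
      pow_zero, one_mul]
    simp only [hlen]
  · rw [← h5]
    congr 1
    ring

/-- The rows to which the part without pairing, proportional to `ε`, is assigned. -/
def unpairedRows {s : ℕ} (σ : Fin s → Fin 3) : Finset ℕ :=
  (Finset.range s).filter fun k => extendPart σ k = 1

theorem partDegree_eq {s : ℕ} (σ : Fin s → Fin 3) :
    partDegree σ = (pairedRows σ).card + (unpairedRows σ).card := by
  have h : ∀ j : Fin 3, (if j ≠ 0 then 1 else 0) = (if j = 2 then 1 else 0) + if j = 1 then 1 else 0 := by
    decide
  have hext : ∀ k : Fin s, extendPart σ k = σ k := fun k => by simp [extendPart]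
  rw [partDegree, pairedRows, unpairedRows, Finset.card_filter, Finset.card_filter,
    Finset.card_filter, Finset.sum_range, Finset.sum_range, ← Finset.sum_add_distrib]
  refine Finset.sum_congr rfl fun k _ => ?_
  rw [hext]
  exact h (σ k)

/-- Let `r < m` be the number of pairs, so that `m - r` left rows take the unpaired part. At least
`s + t - r - m ≥ s + t - 2m` rows still carry the factor `c` and supply at least the expected power
of `δ`. The missing pairs leave the extra factor `δ ^ (2 (m - r))`, which tends to zero. -/
theorem tendsto_partTerm_zero {S : Matrix O O ℝ} (hS : ∀ a b, S a b = -S b a) {ξ : ℝ}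
    {g : O → ℕ → ℝ → ℝ} (hg : ∀ o, DerivativesNear ξ (g o)) (c : O → ℝ) (l₁ l₂ : List O) {s : ℕ}
    (t : ℕ) (σ : Fin s → Fin 3) {m : ℕ} (hm : m ≤ min s t)
    (hσ : partDegree σ = m) (h1 : ∃ k, extendPart σ k = 1) :
    Tendsto (fun p => eliminationFactor s t p * partTerm hS g c l₁ l₂ t σ p /
      |p.2 - p.1| ^ fusionExponent s t m) (fusionFilter ξ) (𝓝 0) := by
  by_cases h : pairedRows σ ⊆ Finset.range t
  swap
  · simp only [partTerm_eq_zero hS g c l₁ l₂ t σ _ h, mul_zero, zero_div]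
    exact tendsto_const_nhds
  classical
  have hXs : pairedRows σ ⊆ Finset.range s := Finset.filter_subset _ _
  set l := rowLabels s t (pairedRows σ) with hl
  have hnd : l.Nodup := nodup_rowLabels _ _ _
  have hdeg := partDegree_eq σ
  rw [hσ] at hdeg
  have hpos : 0 < (unpairedRows σ).card := by
    obtain ⟨k, hk⟩ := h1
    have hks : k < s := by
      by_contra hks
      rw [extendPart, dif_neg hks] at hk
      exact absurd hk (by decide)
    exact Finset.card_pos.2 ⟨k, Finset.mem_filter.2 ⟨Finset.mem_range.2 hks, hk⟩⟩
  have hlen : l.length = s - (pairedRows σ).card + (t - (pairedRows σ).card) :=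
    length_rowLabels hXs h
  -- The positions of the rows without the factor `c`; for these, mere convergence is used.
  let P : Fin l.length → Prop := fun i => ∃ k, l.get i = Sum.inl k ∧ extendPart σ k = 1
  have hP : Fintype.card {i // P i} ≤ (unpairedRows σ).card := by
    rw [Fintype.card_subtype, ← Finset.card_image_of_injective (unpairedRows σ)
      (Sum.inl_injective (α := ℕ) (β := ℕ))]
    refine Finset.card_le_card_of_injOn l.get ?_ hnd.injective_get.injOn
    intro i hi
    obtain ⟨k, hk, hk1⟩ := (Finset.mem_filter.1 hi).2
    have hmem : l.get i ∈ l := List.get_mem l i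
    rw [hk, hl, rowLabels] at hmem
    simp only [List.mem_append, List.mem_map, List.mem_reverse, List.mem_filter, List.mem_range,
      Sum.inl.injEq, exists_eq_right, reduceCtorEq, and_false, exists_false, or_false] at hmem
    rw [hk]
    exact Finset.mem_coe.2 (Finset.mem_image_of_mem _
      (Finset.mem_filter.2 ⟨Finset.mem_range.2 hmem.1, hk1⟩))
  have hn : s + t - 2 * m ≤ Fintype.card {i // ¬ P i} := by
    rw [Fintype.card_subtype_compl, Fintype.card_fin]
    have := Finset.card_le_card h
    have := Finset.card_le_card hXs
    rw [Finset.card_range] at *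
    omega
  let e : {i // P i} ⊕ Fin (Fintype.card {i // ¬ P i}) ≃ Fin l.length :=
    (Equiv.sumCongr (Equiv.refl _) (Fintype.equivFin {i // ¬ P i}).symm).trans (Equiv.sumCompl P)
  have hκ : ∀ i : {i // P i}, ∃ z : O → ℝ,
      Tendsto (fun p => remainingRow g c σ p (l.get (e (Sum.inl i)))) (fusionFilter ξ) (𝓝 z) := by
    rintro ⟨i, hi⟩
    obtain ⟨k, hk, hk1⟩ := hi
    obtain ⟨z, hz⟩ := tendsto_leftRow hg k
    refine ⟨(-1 : ℝ) ^ k • z, ?_⟩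
    have he : e (Sum.inl ⟨i, k, hk, hk1⟩) = i := by simp [e]
    simp only [he, hk, remainingRow, hk1, if_true, fusionRow]
    exact hz.const_smul _
  choose z₀ hz₀ using hκ
  have hrow : ∀ i p, remainingRow g c σ p (l.get (e (Sum.inr i))) =
      c * fusionRow g p (l.get (e (Sum.inr i))) := by
    intro i p
    have hi : ¬ P (e (Sum.inr i)) := by
      have : e (Sum.inr i) = ((Fintype.equivFin {i // ¬ P i}).symm i).1 := by simp [e]
      rw [this]
      exact ((Fintype.equivFin {i // ¬ P i}).symm i).2
    rcases hq : l.get (e (Sum.inr i)) with k | k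
    · have : extendPart σ k ≠ 1 := fun hk => hi ⟨k, hq, hk⟩
      simp [remainingRow, this]
    · rfl
  have hlim := tendsto_rowPfaffian hS l₁ l₂ hg c hnd (fun p => remainingRow g c σ p) e z₀ hz₀ hrow
  have hδ := tendsto_sub_fusionFilter ξ
  obtain ⟨r, hr⟩ := Nat.exists_eq_add_of_le (Nat.choose_le_choose 2 hn)
  have hsmall : Tendsto (fun p : ℝ × ℝ => (p.2 - p.1) ^ (2 * (m - (pairedRows σ).card)))
      (fusionFilter ξ) (𝓝 0) := by
    have := hδ.pow (2 * (m - (pairedRows σ).card))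
    rwa [zero_pow (by omega)] at this
  have hall := (hsmall.mul ((hδ.pow r).mul hlim)).const_mul
    (((∏ i ∈ Finset.range s, (i.factorial : ℝ)) * (∏ i ∈ Finset.range t, (i.factorial : ℝ)) /
        Real.pi ^ (pairedRows σ).card * ∏ k ∈ pairedRows σ, ((k : ℝ) + 1)) *
      ((-1) ^ s.choose 2 * (∏ k ∈ pairedRows σ, (-1 : ℝ) ^ k) *
        ((rowLabels s t (pairedRows σ)).map rowSign).prod))
  rw [zero_mul, mul_zero] at hall
  refine hall.congr' ?_
  filter_upwards [eventually_lt_fusionFilter ξ] with p hp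
  rw [eliminationFactor_mul_partTerm hS g c l₁ l₂ t σ h hm (by omega) p hp]
  congr 2
  have h0 : p.2 - p.1 ≠ 0 := (sub_pos.2 hp).ne'
  rw [← hl, hr, pow_add]
  generalize p.2 - p.1 = δ at h0
  field_simp

/-- The coefficient of `ε ^ m` in the Pfaffian near the fusion. -/
noncomputable def fusionCoeff {S : Matrix O O ℝ} (hS : ∀ a b, S a b = -S b a) (g : O → ℕ → ℝ → ℝ)
    (c : O → ℝ) (l₁ l₂ : List O) (s t m : ℕ) (p : ℝ × ℝ) : ℝ :=
  ∑ σ : Fin s → Fin 3 with partDegree σ = m,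
    eliminationFactor s t p * partTerm hS g c l₁ l₂ t σ p

/-- The leading asymptotics of the coefficient of `ε ^ m`. -/
theorem tendsto_fusionCoeff {S : Matrix O O ℝ} (hS : ∀ a b, S a b = -S b a) {ξ : ℝ}
    {g : O → ℕ → ℝ → ℝ} (hg : ∀ o, DerivativesNear ξ (g o)) (c : O → ℝ) (l₁ l₂ : List O)
    {s t m : ℕ} (hm : m ≤ min s t) :
    Tendsto (fun p => fusionCoeff hS g c l₁ l₂ s t m p / |p.2 - p.1| ^ fusionExponent s t m)
      (fusionFilter ξ) (𝓝 (fusionConstant s t m *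
        rowPfaffian hS l₁ l₂ ((List.range (s + t - 2 * m)).map fun k o => c o * g o k ξ))) := by
  classical
  set D := rowPfaffian hS l₁ l₂ ((List.range (s + t - 2 * m)).map fun k o => c o * g o k ξ)
  let lim : (Fin s → Fin 3) → ℝ := fun σ =>
    if (∀ k, extendPart σ k ≠ 1) ∧ pairedRows σ ⊆ Finset.range t then
      (∏ i ∈ Finset.range s, (i.factorial : ℝ)) * (∏ i ∈ Finset.range t, (i.factorial : ℝ)) /
        Real.pi ^ m * ((∏ k ∈ pairedRows σ, ((k : ℝ) + 1)) *
          labelWeight (rowLabels s t (pairedRows σ))) * D else 0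
  have hlim : ∀ σ ∈ Finset.univ.filter (fun σ : Fin s → Fin 3 => partDegree σ = m),
      Tendsto (fun p => eliminationFactor s t p * partTerm hS g c l₁ l₂ t σ p /
        |p.2 - p.1| ^ fusionExponent s t m) (fusionFilter ξ) (𝓝 (lim σ)) := by
    intro σ hσ
    have hdeg := (Finset.mem_filter.1 hσ).2
    by_cases h1 : ∀ k, extendPart σ k ≠ 1
    · by_cases h : pairedRows σ ⊆ Finset.range t
      · simp only [lim]
        rw [if_pos ⟨h1, h⟩]
        refine tendsto_partTerm_leading hS hg c l₁ l₂ t σ h hm ?_ h1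
        have := partDegree_eq σ
        rw [hdeg, unpairedRows, Finset.filter_false_of_mem fun k _ => h1 k] at this
        simpa using this.symm
      · simp only [lim]
        rw [if_neg fun h' => h h'.2]
        simp only [partTerm_eq_zero hS g c l₁ l₂ t σ _ h, mul_zero, zero_div]
        exact tendsto_const_nhds
    · simp only [lim]
      rw [if_neg fun h' => h1 h'.1]
      push Not at h1
      exact tendsto_partTerm_zero hS hg c l₁ l₂ t σ hm hdeg h1
  have hsum := tendsto_finsetSum _ hlim
  simp only [fusionCoeff, Finset.sum_div]
  refine hsum.trans (le_of_eq ?_)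
  congr 1
  rw [fusionConstant, Finset.mul_sum, Finset.sum_mul]
  symm
  -- The assignments with nonzero limit correspond to the sets `X` of `m` paired numbers below `min
  -- s t`, which index the sum in `fusionConstant`.
  let e : Finset ℕ → Fin s → Fin 3 := fun X k => if k.val ∈ X then 2 else 0
  have hpaired : ∀ X ⊆ Finset.range s, pairedRows (e X) = X := by
    intro X hX
    ext k
    rw [pairedRows, Finset.mem_filter, Finset.mem_range]
    constructor
    · rintro ⟨hk, h2⟩
      rw [extendPart, dif_pos hk] at h2
      by_contra hkX
      simp [e, hkX] at h2
    · intro hk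
      have hks := Finset.mem_range.1 (hX hk)
      refine ⟨hks, ?_⟩
      rw [extendPart, dif_pos hks]
      simp [e, hk]
  have hno : ∀ X k, extendPart (e X) k ≠ 1 := by
    intro X k
    simp only [extendPart, e]
    split_ifs <;> decide
  have hsub : ∀ X ∈ (Finset.range (min s t)).powersetCard m,
      X ⊆ Finset.range s ∧ X ⊆ Finset.range t ∧ X.card = m := by
    intro X hX
    obtain ⟨h1, h2⟩ := Finset.mem_powersetCard.1 hX
    exact ⟨h1.trans (Finset.range_mono (min_le_left _ _)),
      h1.trans (Finset.range_mono (min_le_right _ _)), h2⟩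
  refine Finset.sum_of_injOn e ?_ ?_ ?_ ?_
  · intro X hX Y hY hXY
    rw [← hpaired X (hsub X hX).1, hXY, hpaired Y (hsub Y hY).1]
  · intro X hX
    refine Finset.mem_coe.2 (Finset.mem_filter.2 ⟨Finset.mem_univ _, ?_⟩)
    rw [partDegree_eq, hpaired X (hsub X hX).1, (hsub X hX).2.2, unpairedRows,
      Finset.filter_false_of_mem fun k _ => hno X k]
    rfl
  · intro σ hσ himg
    refine if_neg ?_
    rintro ⟨h1, h2⟩
    refine himg ⟨pairedRows σ, Finset.mem_coe.2 (Finset.mem_powersetCard.2 ⟨?_, ?_⟩), ?_⟩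
    · intro k hk
      rw [Finset.mem_range, lt_min_iff]
      exact ⟨Finset.mem_range.1 (Finset.filter_subset _ _ hk), Finset.mem_range.1 (h2 hk)⟩
    · have := partDegree_eq σ
      rw [(Finset.mem_filter.1 hσ).2, unpairedRows, Finset.filter_false_of_mem fun k _ => h1 k] at this
      simpa using this.symm
    · funext k
      have h3 := h1 k
      have h4 : k.val ∈ pairedRows σ ↔ extendPart σ k = 2 := by
        rw [pairedRows, Finset.mem_filter, Finset.mem_range]
        exact ⟨fun h => h.2, fun h => ⟨k.isLt, h⟩⟩
      have h5 : extendPart σ k = σ k := by simp [extendPart]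
      simp only [e, h4]
      rw [h5] at h3 ⊢
      generalize σ k = j at h3
      revert h3
      revert j
      decide
  · intro X hX
    obtain ⟨h1, h2, h3⟩ := hsub X hX
    simp only [lim]
    rw [if_pos ⟨hno X, by rw [hpaired X h1]; exact h2⟩, hpaired X h1]

/-- The expansion of the Pfaffian near the fusion in powers of `ε`. -/
theorem pfaffian_eq_sum_fusionCoeff {V : Type*} [AddCommGroup V] [Module ℝ V]
    (B : LinearMap.BilinForm ℝ V) (hB : ∀ v, B v v = 0) {S : Matrix O O ℝ}
    (hS : ∀ a b, S a b = -S b a) (g : O → ℕ → ℝ → ℝ) (c : O → ℝ) (l₁ l₂ : List O) (s t : ℕ)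
    (p : ℝ × ℝ) (hp : p.1 < p.2) (ε : ℝ) (ψ : O → V) (A A' : ℕ → V)
    (hO : ∀ o o', B (ψ o) (ψ o') = S o o')
    (hAO : ∀ i < s, ∀ o, B (A i) (ψ o) = g o i p.1 * (c o + ε))
    (hAO' : ∀ i < t, ∀ o, B (A' i) (ψ o) = g o i p.2 * c o)
    (hA : ∀ i < s, ∀ k < s, B (A i) (A k) = 0) (hA' : ∀ i < t, ∀ k < t, B (A' i) (A' k) = 0)
    (hAA' : ∀ i < s, ∀ l < t, B (A i) (A' l) =
      ε * ((-1) ^ l * (i + l + 1).factorial / Real.pi / (p.2 - p.1) ^ (2 + i + l))) :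
    pfaffian B hB (l₁.map ψ ++ ((List.range s).map A ++ ((List.range t).map A' ++ l₂.map ψ))) =
      ∑ m ∈ Finset.range (s + 1), ε ^ m * fusionCoeff hS g c l₁ l₂ s t m p := by
  classical
  rw [pfaffian_eq_sum_partTerm B hB hS g c l₁ l₂ s t p hp ε ψ A A' hO hAO hAO' hA hA' hAA',
    Finset.mul_sum]
  have hmaps : ∀ σ ∈ (Finset.univ : Finset (Fin s → Fin 3)), partDegree σ ∈ Finset.range (s + 1) := by
    intro σ _
    have := Finset.card_filter_le (Finset.univ : Finset (Fin s)) fun k => σ k ≠ 0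
    rw [Finset.card_univ, Fintype.card_fin] at this
    exact Finset.mem_range.2 (Nat.lt_succ_of_le this)
  rw [← Finset.sum_fiberwise_of_maps_to hmaps]
  refine Finset.sum_congr rfl fun m _ => ?_
  rw [fusionCoeff, Finset.mul_sum]
  refine Finset.sum_congr rfl fun σ hσ => ?_
  rw [(Finset.mem_filter.1 hσ).2]
  ring

end TermLimit


/-! ### The values of the constants for extremal multiplicities -/

section ConstantValues

/-- The product of the differences of the entries of a list, the earlier minus the later. -/
def descProd : List ℝ → ℝ
  | [] => 1
  | a :: l => (l.map fun b => a - b).prod * descProd l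

theorem descProd_concat (l : List ℝ) (b : ℝ) :
    descProd (l ++ [b]) = descProd l * (l.map fun a => a - b).prod := by
  induction l with
  | nil => simp [descProd]
  | cons a l ih =>
    simp only [List.cons_append, descProd, ih, List.map_append, List.prod_append, List.map_cons,
      List.map_nil, List.prod_cons, List.prod_nil]
    ring

theorem prod_Ioi_eq_descProd {X : Type*} (f : X → ℝ) (l : List X) :
    ∏ i : Fin l.length, ∏ k ∈ Finset.Ioi i, (f (l.get i) - f (l.get k)) = descProd (l.map f) := by
  induction l with
  | nil => simp [descProd]
  | cons a l ih =>
    rw [List.map_cons, descProd, ← ih]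
    refine (Fin.prod_univ_succ (n := l.length) fun i =>
      ∏ k ∈ Finset.Ioi i, (f ((a :: l).get i) - f ((a :: l).get k))).trans ?_
    congr 1
    · rw [Fin.prod_Ioi_zero, List.map_map, ← prod_get l]
      rfl
    · refine Finset.prod_congr rfl fun i _ => ?_
      rw [Fin.prod_Ioi_succ]
      rfl

theorem labelWeight_eq (l : List (ℕ ⊕ ℕ)) : labelWeight l =
    (l.map fun q => |rowPoint q|).prod * descProd (l.map rowPoint) /
      ((∏ k ∈ Finset.range l.length, ((k + 1).factorial : ℝ)) *
        ∏ k ∈ Finset.range l.length, (k.factorial : ℝ)) := by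
  rw [labelWeight, prod_get l fun q => |rowPoint q|, prod_Ioi_eq_descProd]

theorem prod_map_range (n : ℕ) (f : ℕ → ℝ) :
    ((List.range n).map f).prod = ∏ k ∈ Finset.range n, f k := by
  rw [← ofFn_eq_map_range, List.prod_ofFn, Finset.prod_range]

theorem prod_range_add_one (n : ℕ) : ∏ k ∈ Finset.range n, ((k : ℝ) + 1) = n.factorial := by
  have := Finset.prod_range_add_one_eq_factorial n
  exact_mod_cast this

theorem prod_range_sub (n : ℕ) : ∏ k ∈ Finset.range n, ((n : ℝ) - k) = n.factorial := by
  rw [← prod_range_add_one, ← Finset.prod_range_reflect]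
  refine Finset.prod_congr rfl fun k hk => ?_
  have := Finset.mem_range.1 hk
  rw [Nat.sub_sub, Nat.cast_sub (by omega)]
  push_cast
  ring

theorem prod_factorial_succ (n : ℕ) : ∏ k ∈ Finset.range n, ((k + 1).factorial : ℝ) =
    n.factorial * ∏ k ∈ Finset.range n, (k.factorial : ℝ) := by
  have h1 := Finset.prod_range_succ (fun k => (k.factorial : ℝ)) n
  have h2 := Finset.prod_range_succ' (fun k => (k.factorial : ℝ)) n
  rw [h2] at h1
  simp only [Nat.factorial_zero, Nat.cast_one, mul_one] at h1
  rw [h1, mul_comm]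

theorem rowLabels_empty (s t : ℕ) : rowLabels s t ∅ =
    (List.range s).reverse.map Sum.inl ++ (List.range t).map Sum.inr := by
  simp [rowLabels]

/-- All labels remain. The list is built first from the right labels, appended at the end, and then
from the left labels, put in front; each new label contributes a factorial or a quotient of
factorials. -/
theorem descProd_rowLabels_empty (s t : ℕ) : descProd ((rowLabels s t ∅).map rowPoint) =
    (∏ k ∈ Finset.range s, (k.factorial : ℝ) * (k + 1 + t).factorial / (k + 1).factorial) *
      ∏ k ∈ Finset.range t, (k.factorial : ℝ) := by
  induction s with
  | zero =>
    rw [rowLabels_empty]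
    simp only [List.range_zero, List.reverse_nil, List.map_nil, List.nil_append,
      Finset.range_zero, Finset.prod_empty, one_mul]
    induction t with
    | zero => simp [descProd]
    | succ t ih =>
      rw [List.range_succ, List.map_append, List.map_append, List.map_cons, List.map_nil,
        List.map_cons, List.map_nil, descProd_concat, ih, Finset.prod_range_succ, List.map_map,
        List.map_map, prod_map_range, ← prod_range_sub t]
      congr 1
      refine Finset.prod_congr rfl fun k _ => ?_
      simp only [Function.comp, rowPoint]
      ring
  | succ s ih =>
    have h1 : rowLabels (s + 1) t ∅ = Sum.inl s :: rowLabels s t ∅ := by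
      rw [rowLabels_empty, rowLabels_empty, List.range_succ, List.reverse_append]
      rfl
    rw [h1, List.map_cons, descProd, ih, Finset.prod_range_succ, List.map_map,
      prod_map_rowLabels]
    simp only [Finset.sdiff_empty, Function.comp, rowPoint]
    have h2 : ∏ k ∈ Finset.range s, ((s : ℝ) + 1 - (k + 1)) = s.factorial := by
      rw [← prod_range_sub]
      exact Finset.prod_congr rfl fun k _ => by ring
    have h3 : ((s + 1).factorial : ℝ) * ∏ k ∈ Finset.range t, ((s : ℝ) + 1 - -(k + 1)) =
        (s + 1 + t).factorial := by
      rw [← prod_range_add_one (s + 1 + t), Finset.prod_range_add, prod_range_add_one]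
      congr 1
      refine Finset.prod_congr rfl fun k _ => ?_
      push_cast
      ring
    have := Nat.factorial_ne_zero (s + 1)
    rw [h2, ← h3]
    field_simp

theorem fusionConstant_zero (s t : ℕ) : fusionConstant s t 0 =
    (∏ k ∈ Finset.range s, (k.factorial : ℝ)) * (∏ k ∈ Finset.range t, (k.factorial : ℝ)) /
      ∏ k ∈ Finset.range (s + t), (k.factorial : ℝ) := by
  rw [fusionConstant, Finset.powersetCard_zero, Finset.sum_singleton, labelWeight_eq,
    descProd_rowLabels_empty, prod_map_rowLabels, length_rowLabels (by simp) (by simp)]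
  simp only [Finset.sdiff_empty, rowPoint, Finset.card_empty, Nat.sub_zero, pow_zero, div_one,
    Finset.prod_empty, one_mul, abs_neg]
  have h1 : ∀ n : ℕ, ∏ k ∈ Finset.range n, |(k : ℝ) + 1| = n.factorial := by
    intro n
    rw [← prod_range_add_one]
    exact Finset.prod_congr rfl fun k _ => abs_of_nonneg (by positivity)
  have h2 : ∏ k ∈ Finset.range (s + t), ((k + 1).factorial : ℝ) =
      t.factorial * (∏ k ∈ Finset.range t, (k.factorial : ℝ)) *
        ∏ k ∈ Finset.range s, ((k + 1 + t).factorial : ℝ) := by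
    rw [add_comm s t, Finset.prod_range_add, prod_factorial_succ]
    congr 1
    exact Finset.prod_congr rfl fun k _ => by rw [show t + k + 1 = k + 1 + t by ring]
  rw [h1, h1, h2, Finset.prod_div_distrib, Finset.prod_mul_distrib, prod_factorial_succ s]
  have h3 : ∀ n, ∏ k ∈ Finset.range n, (k.factorial : ℝ) ≠ 0 := fun n =>
    Finset.prod_ne_zero_iff.2 fun k _ => by positivity
  have h4 : ∏ k ∈ Finset.range s, ((k + 1 + t).factorial : ℝ) ≠ 0 :=
    Finset.prod_ne_zero_iff.2 fun k _ => by positivity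
  have := h3 s
  have := h3 t
  have := h3 (s + t)
  have := Nat.factorial_ne_zero s
  have := Nat.factorial_ne_zero t
  field_simp

theorem filter_range_not_mem_range {s t : ℕ} (h : t ≤ s) :
    ((List.range s).filter fun k => k ∉ Finset.range t) = (List.range (s - t)).map (t + ·) := by
  obtain ⟨r, rfl⟩ := Nat.exists_eq_add_of_le h
  rw [List.range_add, List.filter_append, Nat.add_sub_cancel_left]
  have h1 : ((List.range t).filter fun k => k ∉ Finset.range t) = [] := by
    rw [List.filter_eq_nil_iff]
    intro k hk
    simpa using hk
  rw [h1, List.nil_append, List.filter_eq_self]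
  intro k hk
  obtain ⟨i, -, rfl⟩ := List.mem_map.1 hk
  simp

theorem descProd_left (t n : ℕ) :
    descProd (((List.range n).map (t + ·)).reverse.map fun k => rowPoint (Sum.inl k)) =
      ∏ k ∈ Finset.range n, (k.factorial : ℝ) := by
  induction n with
  | zero => simp [descProd]
  | succ n ih =>
    rw [List.range_succ, List.map_append, List.reverse_append, List.map_append,
      Finset.prod_range_succ, ← ih, ← prod_range_sub n, ← prod_map_range, mul_comm]
    simp only [List.map_cons, List.map_nil, List.reverse_cons, List.reverse_nil, List.nil_append,
      List.cons_append, descProd]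
    congr 1
    rw [List.map_map, ((List.reverse_perm _).map _).prod_eq, List.map_map]
    congr 1
    refine List.map_congr_left fun k _ => ?_
    simp only [Function.comp, rowPoint]
    push_cast
    ring

theorem descProd_right (t n : ℕ) :
    descProd (((List.range n).map (t + ·)).map fun k => rowPoint (Sum.inr k)) =
      ∏ k ∈ Finset.range n, (k.factorial : ℝ) := by
  induction n with
  | zero => simp [descProd]
  | succ n ih =>
    rw [List.range_succ, List.map_append, List.map_append, List.map_cons, List.map_nil,
      List.map_cons, List.map_nil, descProd_concat,
      Finset.prod_range_succ, ← ih, ← prod_range_sub n, ← prod_map_range]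
    congr 1
    rw [List.map_map, List.map_map]
    congr 1
    refine List.map_congr_left fun k _ => ?_
    simp only [Function.comp, rowPoint]
    push_cast
    ring

/-- When all possible pairs are removed, only consecutive labels of the longer side remain, and the
Vandermonde product becomes a product of factorials that cancels part of the denominator. -/
theorem labelWeight_min (s t : ℕ) :
    labelWeight (rowLabels s t (Finset.range (min s t))) * (min s t).factorial =
      (max s t).factorial / ∏ k ∈ Finset.range (max s t - min s t), ((k + 1).factorial : ℝ) := by
  have hprod : ∀ m r : ℕ, (∏ k ∈ Finset.range r, |((m + k : ℕ) : ℝ) + 1|) * m.factorial =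
      (m + r).factorial := by
    intro m r
    rw [← prod_range_add_one (m + r), Finset.prod_range_add, prod_range_add_one, mul_comm]
    congr 1
    exact Finset.prod_congr rfl fun k _ => abs_of_nonneg (by positivity)
  have h3 : ∀ n, ∏ k ∈ Finset.range n, (k.factorial : ℝ) ≠ 0 := fun n =>
    Finset.prod_ne_zero_iff.2 fun k _ => by positivity
  have h4 : ∀ n, ∏ k ∈ Finset.range n, ((k + 1).factorial : ℝ) ≠ 0 := fun n =>
    Finset.prod_ne_zero_iff.2 fun k _ => by positivity
  rcases le_total t s with h | h
  · rw [min_eq_right h, max_eq_left h]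
    obtain ⟨r, rfl⟩ := Nat.exists_eq_add_of_le h
    have hl : rowLabels (t + r) t (Finset.range t) =
        ((List.range r).map (t + ·)).reverse.map Sum.inl := by
      rw [rowLabels, filter_range_not_mem_range h, filter_range_not_mem_range le_rfl]
      simp
    rw [hl, labelWeight_eq, Nat.add_sub_cancel_left, ← hprod t r]
    simp only [List.map_map, List.length_map, List.length_reverse, List.length_range]
    have h5 := descProd_left t r
    simp only [Function.comp_def] at h5 ⊢
    rw [h5, ((List.reverse_perm _).map _).prod_eq, List.map_map, prod_map_range]
    simp only [Function.comp_def, rowPoint]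
    have := h3 r
    have := h4 r
    field_simp
  · rw [min_eq_left h, max_eq_right h]
    obtain ⟨r, rfl⟩ := Nat.exists_eq_add_of_le h
    have hl : rowLabels s (s + r) (Finset.range s) =
        ((List.range r).map (s + ·)).map Sum.inr := by
      rw [rowLabels, filter_range_not_mem_range h, filter_range_not_mem_range le_rfl]
      simp
    rw [hl, labelWeight_eq, Nat.add_sub_cancel_left, ← hprod s r]
    have h5 := descProd_right s r
    simp only [List.map_map, List.length_map, List.length_range] at h5 ⊢
    simp only [Function.comp_def] at h5 ⊢
    rw [h5, prod_map_range]
    simp only [rowPoint, abs_neg]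
    have := h3 r
    have := h4 r
    field_simp

/-- For the maximal multiplicity there is only one set of pairs, namely all numbers below `min s t`.
-/
theorem fusionConstant_min (s t : ℕ) : fusionConstant s t (min s t) =
    1 / Real.pi ^ min s t *
      (∏ k ∈ Finset.range (min s t), ((max s t - min s t + k + 1).factorial : ℝ)) *
        ∏ k ∈ Finset.range (min s t), (k.factorial : ℝ) := by
  have h := labelWeight_min s t
  have hst : (∏ i ∈ Finset.range s, (i.factorial : ℝ)) * (∏ i ∈ Finset.range t, (i.factorial : ℝ)) =
      (∏ i ∈ Finset.range (max s t), (i.factorial : ℝ)) *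
        ∏ i ∈ Finset.range (min s t), (i.factorial : ℝ) := by
    rcases le_total t s with h | h
    · rw [min_eq_right h, max_eq_left h]
    · rw [min_eq_left h, max_eq_right h, mul_comm]
  have hle : min s t ≤ max s t := min_le_max
  have hpow : (Finset.range (min s t)).powersetCard (min s t) = {Finset.range (min s t)} := by
    conv_lhs => rw [← Finset.card_range (min s t)]
    rw [Finset.card_range, ← Finset.powersetCard_self, Finset.card_range]
  rw [fusionConstant, hpow, Finset.sum_singleton, hst, prod_range_add_one, mul_comm _ (labelWeight _),
    h]
  generalize max s t = M at *
  generalize min s t = μ at *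
  obtain ⟨r, rfl⟩ := Nat.exists_eq_add_of_le hle
  rw [Nat.add_sub_cancel_left]
  have h6 : ((μ + r).factorial : ℝ) * ∏ i ∈ Finset.range (μ + r), (i.factorial : ℝ) =
      (∏ k ∈ Finset.range r, ((k + 1).factorial : ℝ)) *
        ∏ k ∈ Finset.range μ, ((r + k + 1).factorial : ℝ) := by
    rw [← prod_factorial_succ, add_comm μ r, Finset.prod_range_add]
  have h4 : ∏ k ∈ Finset.range r, ((k + 1).factorial : ℝ) ≠ 0 :=
    Finset.prod_ne_zero_iff.2 fun k _ => by positivity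
  have := Real.pi_ne_zero
  field_simp
  linear_combination h6

theorem prod_Icc_one (n : ℕ) (f : ℕ → ℝ) :
    ∏ k ∈ Finset.Icc 1 n, f k = ∏ k ∈ Finset.range n, f (k + 1) := by
  induction n with
  | zero => simp
  | succ n ih => rw [Finset.prod_Icc_succ_top (by omega), ih, Finset.prod_range_succ]

theorem fusionConstant_zero_eq (s t : ℕ) : fusionConstant s t 0 =
    (∏ k ∈ Finset.Icc 1 (min s t), ((k - 1).factorial : ℝ)) /
      ∏ l ∈ Finset.Icc 1 (min s t), ((max s t + l - 1).factorial : ℝ) := by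
  rw [prod_Icc_one, prod_Icc_one, fusionConstant_zero]
  have h3 : ∀ n, ∏ k ∈ Finset.range n, (k.factorial : ℝ) ≠ 0 := fun n =>
    Finset.prod_ne_zero_iff.2 fun k _ => by positivity
  have h4 : ∀ M n : ℕ, ∏ k ∈ Finset.range n, ((M + k).factorial : ℝ) ≠ 0 := fun M n =>
    Finset.prod_ne_zero_iff.2 fun k _ => by positivity
  have key : ∀ M μ : ℕ, (∏ k ∈ Finset.range M, (k.factorial : ℝ)) *
      (∏ k ∈ Finset.range μ, (k.factorial : ℝ)) / ∏ k ∈ Finset.range (M + μ), (k.factorial : ℝ) =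
      (∏ k ∈ Finset.range μ, ((k + 1 - 1).factorial : ℝ)) /
        ∏ k ∈ Finset.range μ, ((M + (k + 1) - 1).factorial : ℝ) := by
    intro M μ
    have h1 : ∀ k, M + (k + 1) - 1 = M + k := fun k => by omega
    simp only [Nat.add_sub_cancel, h1, Finset.prod_range_add]
    have := h3 M
    have := h4 M μ
    field_simp
  rcases le_total t s with h | h
  · rw [min_eq_right h, max_eq_left h, key]
  · rw [min_eq_left h, max_eq_right h, ← key, mul_comm, add_comm s t]

theorem fusionConstant_zero_pos (s t : ℕ) : 0 < fusionConstant s t 0 := by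
  rw [fusionConstant_zero]
  positivity

theorem fusionConstant_min_eq (s t : ℕ) : fusionConstant s t (min s t) = 1 / Real.pi ^ (min s t) *
    (∏ l ∈ Finset.Icc 1 (min s t), ((max s t - min s t + l).factorial : ℝ)) *
      ∏ r ∈ Finset.Icc 1 (min s t), ((r - 1).factorial : ℝ) := by
  rw [prod_Icc_one, prod_Icc_one, fusionConstant_min]
  simp only [Nat.add_sub_cancel, add_assoc]

theorem fusionConstant_min_pos (s t : ℕ) : 0 < fusionConstant s t (min s t) := by
  rw [fusionConstant_min]
  have := Real.pi_pos
  positivity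

end ConstantValues


/-! ### Partition functions as Pfaffians of lists -/

section Configuration

/-- The indices of a configuration in order, as pairs of a point and a number. -/
def configList {d : ℕ} (s : Fin d → ℕ) : List (Fin d × ℕ) :=
  (List.ofFn fun i => (List.range (s i)).map (Prod.mk i)).flatten

theorem mem_configList {d : ℕ} {s : Fin d → ℕ} {p : Fin d × ℕ} :
    p ∈ configList s ↔ p.2 < s p.1 := by
  obtain ⟨i, m⟩ := p
  simp [configList, List.mem_flatten, List.mem_ofFn', eq_comm]

/-- Both lists are strictly increasing for the lexicographic order and have the same elements. -/
theorem ofFn_eq_configList {d : ℕ} (s : Fin d → ℕ) :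
    List.ofFn (fun a : Fin (∑ i, s i) => (blockOf a, (finSigmaFinEquiv.symm a).2.val)) =
      configList s := by
  let R : Fin d × ℕ → Fin d × ℕ → Prop := fun p q => p.1 < q.1 ∨ (p.1 = q.1 ∧ p.2 < q.2)
  have hR : ∀ p q, R p q → p ≠ q := by
    rintro p q h rfl
    rcases h with h | h
    · exact lt_irrefl _ h
    · exact lt_irrefl _ h.2
  have hasymm : ∀ p q, R p q → R q p → p = q := by
    rintro p q (h | h) (h' | h')
    · exact absurd h h'.asymm
    · exact absurd h'.1 h.ne'
    · exact absurd h.1 h'.ne'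
    · exact absurd h.2 h'.2.asymm
  have h1 : (List.ofFn (fun a : Fin (∑ i, s i) =>
      (blockOf a, (finSigmaFinEquiv.symm a).2.val))).Pairwise R := by
    rw [List.pairwise_ofFn]
    intro a b hab
    have := (finSigmaFinEquiv_lt_iff (finSigmaFinEquiv.symm a) (finSigmaFinEquiv.symm b)).1
      (by simpa using hab)
    exact this
  have h2 : (configList s).Pairwise R := by
    rw [configList, List.pairwise_flatten, List.pairwise_ofFn]
    constructor
    · intro l hl
      obtain ⟨i, rfl⟩ := (List.mem_ofFn' _ _).1 hl
      rw [List.pairwise_map]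
      exact List.pairwise_lt_range.imp fun h => Or.inr ⟨rfl, h⟩
    · intro i k hik p hp q hq
      obtain ⟨a, -, rfl⟩ := List.mem_map.1 hp
      obtain ⟨b, -, rfl⟩ := List.mem_map.1 hq
      exact Or.inl hik
  refine List.Perm.eq_of_pairwise (le := R) (fun p q _ _ => hasymm p q) h1 h2
    ((List.perm_ext_iff_of_nodup (h1.imp fun h => hR _ _ h) (h2.imp fun h => hR _ _ h)).2 ?_)
  intro p
  rw [mem_configList, List.mem_ofFn']
  constructor
  · rintro ⟨a, rfl⟩
    exact (finSigmaFinEquiv.symm a).2.isLt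
  · intro h
    refine ⟨finSigmaFinEquiv ⟨p.1, p.2, h⟩, ?_⟩
    simp only [blockOf]
    rw [Equiv.symm_apply_apply]

/-- The partition functions are the coefficients of the Pfaffian of a labelled list of vectors. -/
theorem pfaffian_eq_sum_partitionFunction {d : ℕ} {s : Fin d → ℕ} {x : Fin d → ℝ}
    (hx : Function.Injective x) (t : Fin d → ℝ) {V : Type*} [AddCommGroup V] [Module ℝ V]
    (B : LinearMap.BilinForm ℝ V) (hB : ∀ v, B v v = 0) {κ : Type*} (l : List κ)
    (lab : κ → Fin d × ℕ) (hl : l.map lab = configList s) (Ψ : κ → V)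
    (h : ∀ a b, B (Ψ a) (Ψ b) = kernelDeriv (lab a).2 (lab b).2 (x (lab a).1) (x (lab b).1) *
      (t (lab b).1 - t (lab a).1)) :
    pfaffian B hB (l.map Ψ) =
      ∑ α : ValencedLinkPattern s, α.partitionFunction x * α.differenceProd t := by
  rw [← ofFn_eq_configList] at hl
  have hlen : l.length = ∑ i, s i := by
    have := congrArg List.length hl
    rwa [List.length_map, List.length_ofFn] at this
  obtain ⟨f, rfl⟩ : ∃ f : Fin (∑ i, s i) → κ, l = List.ofFn f :=
    ⟨fun a => l[a.val]'(by omega), List.ext_getElem (by simp [hlen]) fun i _ _ => by simp⟩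
  rw [List.map_ofFn] at hl ⊢
  have hf : ∀ a, lab (f a) = (blockOf a, (finSigmaFinEquiv.symm a).2.val) := fun a =>
    congrFun (List.ofFn_injective hl) a
  refine pfaffian_eq_sum_valenced B hB (valencedKernel s x) (valencedKernel_symm s hx) t _ ?_
  intro a b
  simp only [Function.comp, h, hf, valencedKernel_eq s hx]
  -- Two indices of the same point: the kernel is set to zero there, while on the other side the
  -- difference of the parameters vanishes whatever the kernel is.
  split_ifs with hab
  · rw [hab, sub_self, mul_zero, mul_zero]
  · rfl

/-- Every configuration is realized by vectors with an alternating form. -/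
theorem exists_configForm {d : ℕ} (s : Fin d → ℕ) (x t : Fin d → ℝ) :
    ∃ (B : LinearMap.BilinForm ℝ (((i : Fin d) × Fin (s i)) → ℝ)) (_ : ∀ v, B v v = 0)
      (Φ : Fin d × ℕ → ((i : Fin d) × Fin (s i)) → ℝ),
      ∀ a b, a.2 < s a.1 → b.2 < s b.1 → B (Φ a) (Φ b) =
        kernelDeriv a.2 b.2 (x a.1) (x b.1) * (t b.1 - t a.1) := by
  let A : Matrix ((i : Fin d) × Fin (s i)) ((i : Fin d) × Fin (s i)) ℝ := Matrix.of fun p q =>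
    kernelDeriv p.2 q.2 (x p.1) (x q.1) * (t q.1 - t p.1)
  refine ⟨Matrix.toBilin' A, toBilin'_self_eq_zero A fun p q => ?_,
    fun p => if h : p.2 < s p.1 then Pi.single ⟨p.1, p.2, h⟩ 1 else 0, fun a b ha hb => ?_⟩
  · simp only [A, Matrix.of_apply]
    rw [kernelDeriv_swap]
    ring
  · simp only
    rw [dif_pos ha, dif_pos hb, Matrix.toBilin'_single]
    rfl

variable {n : ℕ}

theorem ofFn_succAbove {X : Type*} (j : Fin (n + 1)) (f : Fin (n + 1) → X) :
    List.ofFn f = (List.ofFn (f ∘ j.succAbove)).take j ++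
      f j :: (List.ofFn (f ∘ j.succAbove)).drop j := by
  have hj := j.isLt
  apply List.ext_getElem
  · simp
    omega
  · intro i h1 h2
    rw [List.getElem_ofFn, List.getElem_append]
    simp only [List.length_take, List.length_ofFn, min_eq_left (Nat.lt_succ_iff.1 hj)]
    rw [List.length_ofFn] at h1
    split_ifs with h
    · simp only [List.getElem_take, List.getElem_ofFn, Function.comp]
      congr 1
      exact (Fin.succAbove_of_castSucc_lt j ⟨i, by omega⟩ h).symm
    · rcases Nat.lt_or_ge j.val i with h3 | h3
      · obtain ⟨k, hk⟩ : ∃ k, i - j.val = k + 1 := ⟨i - j.val - 1, by omega⟩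
        simp only [hk, List.getElem_cons_succ, List.getElem_drop, List.getElem_ofFn, Function.comp]
        congr 1
        rw [Fin.succAbove_of_le_castSucc j _ (by rw [Fin.le_def]; simp)]
        apply Fin.ext
        simp only [Fin.val_succ]
        omega
      · have hk : i - j.val = 0 := by omega
        simp only [hk, List.getElem_cons_zero]
        congr 1
        apply Fin.ext
        simp only
        omega

/-- The indices before the fused points. -/
def leftIndices (j : Fin (n + 1)) (s : Fin n → ℕ) : List ((i : Fin n) × Fin (s i)) :=
  ((List.ofFn fun i => List.ofFn fun m : Fin (s i) =>
    (⟨i, m⟩ : (i : Fin n) × Fin (s i))).take j).flatten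

/-- The indices after the fused points. -/
def rightIndices (j : Fin (n + 1)) (s : Fin n → ℕ) : List ((i : Fin n) × Fin (s i)) :=
  ((List.ofFn fun i => List.ofFn fun m : Fin (s i) =>
    (⟨i, m⟩ : (i : Fin n) × Fin (s i))).drop j).flatten

theorem map_leftIndices {d : ℕ} (j : Fin (n + 1)) (s : Fin n → ℕ) (e : Fin n → Fin d) :
    (leftIndices j s).map (fun o => (e o.1, o.2.val)) =
      ((List.ofFn fun i => (List.range (s i)).map (Prod.mk (e i))).take j).flatten := by
  simp only [leftIndices, List.map_flatten, List.map_take, List.map_ofFn, Function.comp_def,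
    ← ofFn_eq_map_range]

theorem map_rightIndices {d : ℕ} (j : Fin (n + 1)) (s : Fin n → ℕ) (e : Fin n → Fin d) :
    (rightIndices j s).map (fun o => (e o.1, o.2.val)) =
      ((List.ofFn fun i => (List.range (s i)).map (Prod.mk (e i))).drop j).flatten := by
  simp only [rightIndices, List.map_flatten, List.map_drop, List.map_ofFn, Function.comp_def,
    ← ofFn_eq_map_range]

theorem configList_otherPoint (j : Fin (n + 1)) (s : Fin (n + 2) → ℕ) :
    configList s = (leftIndices j (s ∘ otherPoint j)).map (fun o => (otherPoint j o.1, o.2.val)) ++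
      ((List.range (s j.castSucc)).map (Prod.mk j.castSucc) ++
        ((List.range (s j.succ)).map (Prod.mk j.succ) ++
          (rightIndices j (s ∘ otherPoint j)).map (fun o => (otherPoint j o.1, o.2.val)))) := by
  rw [map_leftIndices, map_rightIndices, configList, ofFn_otherPoint j, List.flatten_append,
    List.flatten_cons, List.flatten_cons]
  rfl

theorem configList_succAbove (j : Fin (n + 1)) (s : Fin n → ℕ) (s' : Fin (n + 1) → ℕ)
    (h : ∀ i, s' (j.succAbove i) = s i) :
    configList s' = (leftIndices j s).map (fun o => (j.succAbove o.1, o.2.val)) ++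
      ((List.range (s' j)).map (Prod.mk j) ++
        (rightIndices j s).map (fun o => (j.succAbove o.1, o.2.val))) := by
  obtain rfl : s' ∘ j.succAbove = s := funext h
  rw [map_leftIndices, map_rightIndices, configList, ofFn_succAbove j, List.flatten_append,
    List.flatten_cons]
  rfl

theorem configList_self (j : Fin (n + 1)) (s : Fin n → ℕ) :
    configList s = (leftIndices j s).map (fun o => (o.1, o.2.val)) ++
      (rightIndices j s).map (fun o => (o.1, o.2.val)) := by
  have h1 := map_leftIndices j s id
  have h2 := map_rightIndices j s id
  simp only [id] at h1 h2
  rw [h1, h2, ← List.flatten_append, List.take_append_drop]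
  rfl

end Configuration


/-! ### The generating function of the partition functions near a fusion -/

section NearFusion

variable {n : ℕ}

theorem eq_or_eq_or_eq_otherPoint (j : Fin (n + 1)) (i : Fin (n + 2)) :
    i = j.castSucc ∨ i = j.succ ∨ ∃ k, i = otherPoint j k := by
  rcases Fin.eq_self_or_eq_succAbove j.castSucc i with h | ⟨k, rfl⟩
  · exact Or.inl h
  · rcases Fin.eq_self_or_eq_succAbove j k with rfl | ⟨k', rfl⟩
    · exact Or.inr (Or.inl (Fin.succAbove_castSucc_self _))
    · exact Or.inr (Or.inr ⟨k', rfl⟩)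

theorem nearFusion_castSucc (j : Fin (n + 1)) (y : Fin (n + 1) → ℝ) (u v : ℝ) :
    nearFusion j y u v j.castSucc = u := if_pos rfl

theorem nearFusion_succ (j : Fin (n + 1)) (y : Fin (n + 1) → ℝ) (u v : ℝ) :
    nearFusion j y u v j.succ = v := by
  rw [nearFusion, if_neg Fin.castSucc_lt_succ.ne', if_pos rfl]

theorem nearFusion_otherPoint (j : Fin (n + 1)) (y : Fin (n + 1) → ℝ) (u v : ℝ) (i : Fin n) :
    nearFusion j y u v (otherPoint j i) = y (j.succAbove i) := by
  rw [nearFusion, if_neg (otherPoint_ne_castSucc j i), if_neg (otherPoint_ne_succ j i),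
    predAbove_otherPoint]

/-- Near the fusion the points are distinct. -/
theorem eventually_injective_nearFusion (j : Fin (n + 1)) {y : Fin (n + 1) → ℝ}
    (hy : Function.Injective y) :
    ∀ᶠ p in fusionFilter (y j), Function.Injective (nearFusion j y p.1 p.2) := by
  have h1 : ∀ᶠ x in 𝓝 (y j), ∀ i : Fin n, x ≠ y (j.succAbove i) :=
    eventually_all.2 fun i => eventually_ne_nhds fun h => Fin.succAbove_ne j i (hy h).symm
  filter_upwards [(tendsto_fst_fusionFilter (y j)).eventually h1,
    (tendsto_snd_fusionFilter (y j)).eventually h1, eventually_lt_fusionFilter (y j)] with p h2 h3 h4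
  intro i k hik
  rcases eq_or_eq_or_eq_otherPoint j i with rfl | rfl | ⟨i, rfl⟩ <;>
    rcases eq_or_eq_or_eq_otherPoint j k with rfl | rfl | ⟨k, rfl⟩ <;>
    simp only [nearFusion_castSucc, nearFusion_succ, nearFusion_otherPoint] at hik
  · rfl
  · exact absurd hik h4.ne
  · exact absurd hik (h2 k)
  · exact absurd hik h4.ne'
  · rfl
  · exact absurd hik (h3 k)
  · exact absurd hik.symm (h2 i)
  · exact absurd hik.symm (h3 i)
  · rw [Fin.succAbove_right_injective (hy hik)]

variable (s : Fin n → ℕ) (j : Fin (n + 1)) (y t : Fin (n + 1) → ℝ)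

/-- The derivatives of the kernel between a point near the fusion and the other points. -/
noncomputable def outerKernel (o : (i : Fin n) × Fin (s i)) (k : ℕ) (x : ℝ) : ℝ :=
  kernelDeriv k o.2 x (y (j.succAbove o.1))

/-- The alternating matrix of the points other than the fused ones. -/
noncomputable def outerMatrix : Matrix ((i : Fin n) × Fin (s i)) ((i : Fin n) × Fin (s i)) ℝ :=
  Matrix.of fun o o' => kernelDeriv o.2 o'.2 (y (j.succAbove o.1)) (y (j.succAbove o'.1)) *
    (t (j.succAbove o'.1) - t (j.succAbove o.1))

/-- The differences of the parameters of the other points and the fused point. -/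
def outerDiff (o : (i : Fin n) × Fin (s i)) : ℝ := t (j.succAbove o.1) - t j

theorem outerMatrix_swap (o o' : (i : Fin n) × Fin (s i)) :
    outerMatrix s j y t o o' = -outerMatrix s j y t o' o := by
  simp only [outerMatrix, Matrix.of_apply]
  rw [kernelDeriv_swap]
  ring

variable {y} in
theorem derivativesNear_outerKernel (hy : Function.Injective y) (o : (i : Fin n) × Fin (s i)) :
    DerivativesNear (y j) (outerKernel s j y o) := by
  have h : y j ≠ y (j.succAbove o.1) := fun h => Fin.succAbove_ne j o.1 (hy h).symm
  filter_upwards [eventually_ne_nhds h] with x hx i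
  exact hasDerivAt_kernelDeriv i o.2 hx

/-- The coefficients of the generating function near the fusion. -/
noncomputable def nearCoeff (s : Fin (n + 2) → ℕ) (m : ℕ) (p : ℝ × ℝ) : ℝ :=
  fusionCoeff (outerMatrix_swap (s ∘ otherPoint j) j y t) (outerKernel (s ∘ otherPoint j) j y)
    (outerDiff (s ∘ otherPoint j) j t) (leftIndices j (s ∘ otherPoint j))
    (rightIndices j (s ∘ otherPoint j)) (s j.castSucc) (s j.succ) m p

/-- The Pfaffian of the fused configuration with `r` rows at the fused point. -/
noncomputable def fusedPfaffian (r : ℕ) : ℝ :=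
  rowPfaffian (outerMatrix_swap s j y t) (leftIndices j s) (rightIndices j s)
    ((List.range r).map fun k o => outerDiff s j t o * outerKernel s j y o k (y j))

variable {y} in
theorem tendsto_nearCoeff (s : Fin (n + 2) → ℕ) (hy : Function.Injective y) {m : ℕ}
    (hm : m ≤ min (s j.castSucc) (s j.succ)) :
    Tendsto (fun p => nearCoeff j y t s m p /
        |p.2 - p.1| ^ fusionExponent (s j.castSucc) (s j.succ) m) (fusionFilter (y j))
      (𝓝 (fusionConstant (s j.castSucc) (s j.succ) m *
        fusedPfaffian (s ∘ otherPoint j) j y t (s j.castSucc + s j.succ - 2 * m))) :=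
  tendsto_fusionCoeff _ (derivativesNear_outerKernel _ j hy) _ _ _ hm

/-- The merging points get the parameters `t j - ε` and `t j`. Relative to an outer point the
difference is then `c + ε` on the left and `c` on the right, and between the two points it is `ε`,
which matches the hypotheses of the expansion. -/
theorem sum_partitionFunction_nearFusion (s : Fin (n + 2) → ℕ) (p : ℝ × ℝ) (hp : p.1 < p.2)
    (hinj : Function.Injective (nearFusion j y p.1 p.2)) (ε : ℝ) :
    ∑ α : ValencedLinkPattern s, α.partitionFunction (nearFusion j y p.1 p.2) *
        α.differenceProd (nearFusion j t (t j - ε) (t j)) =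
      ∑ m ∈ Finset.range (s j.castSucc + 1), ε ^ m * nearCoeff j y t s m p := by
  obtain ⟨B, hB, Φ, hΦ⟩ :=
    exists_configForm s (nearFusion j y p.1 p.2) (nearFusion j t (t j - ε) (t j))
  have hsum := pfaffian_eq_sum_partitionFunction hinj (nearFusion j t (t j - ε) (t j)) B hB
    (configList s).attach Subtype.val (List.attach_map_subtype_val _) (fun a => Φ a.1) fun a b =>
      hΦ a.1 b.1 (mem_configList.1 a.2) (mem_configList.1 b.2)
  rw [← hsum, List.attach_map_val, configList_otherPoint j]
  simp only [List.map_append, List.map_map]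
  have hlt : ∀ o : (i : Fin n) × Fin ((s ∘ otherPoint j) i), o.2.val < s (otherPoint j o.1) :=
    fun o => o.2.isLt
  refine pfaffian_eq_sum_fusionCoeff B hB (outerMatrix_swap _ j y t) _ _ _ _ _ _ p hp ε
    (fun o => Φ (otherPoint j o.1, o.2.val)) (fun i => Φ (j.castSucc, i)) (fun i => Φ (j.succ, i))
    ?_ ?_ ?_ ?_ ?_ ?_
  · intro o o'
    rw [hΦ _ _ (hlt o) (hlt o')]
    simp only [nearFusion_otherPoint]
    rfl
  · intro i hi o
    rw [hΦ _ _ hi (hlt o)]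
    simp only [nearFusion_otherPoint, nearFusion_castSucc, outerKernel, outerDiff]
    ring
  · intro i hi o
    rw [hΦ _ _ hi (hlt o)]
    simp only [nearFusion_otherPoint, nearFusion_succ, outerKernel, outerDiff]
  · intro i hi k hk
    rw [hΦ _ _ hi hk, sub_self, mul_zero]
  · intro i hi k hk
    rw [hΦ _ _ hi hk, sub_self, mul_zero]
  · intro i hi l hl
    rw [hΦ _ _ hi hl]
    simp only [nearFusion_castSucc, nearFusion_succ]
    -- The symmetry of the kernel is used so that the denominator is a power of the positive
    -- difference of right and left point.
    rw [kernelDeriv_swap, kernelDeriv, add_comm l i, show 2 + l + i = 2 + i + l by ring]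
    ring

variable {y} in
-- The limiting rows are the kernel derivatives of orders below `s' j` at the fused point, that is,
-- the rows of that point in the fused configuration with parameter `t j`.
theorem fusedPfaffian_eq_sum (hy : Function.Injective y) (s' : Fin (n + 1) → ℕ)
    (h : ∀ i, s' (j.succAbove i) = s i) : fusedPfaffian s j y t (s' j) =
      ∑ γ : ValencedLinkPattern s', γ.partitionFunction y * γ.differenceProd t := by
  rw [← pfaffian_eq_sum_partitionFunction hy t (rowForm (outerMatrix s j y t))
    (rowForm_self (outerMatrix_swap s j y t))
    ((leftIndices j s).map Sum.inl ++ ((List.range (s' j)).map Sum.inr ++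
      (rightIndices j s).map Sum.inl))
    (Sum.elim (fun o => (j.succAbove o.1, o.2.val)) fun k => (j, k))
    (by
      rw [configList_succAbove j s s' h]
      simp only [List.map_append, List.map_map]
      rfl)
    (Sum.elim pointVec fun k => rowVec fun o => outerDiff s j t o * outerKernel s j y o k (y j))]
  · simp only [List.map_append, List.map_map]
    rw [fusedPfaffian, rowPfaffian, List.map_map]
    rfl
  · rintro (o | k) (o' | k')
    · exact rowForm_point_point _ o o'
    · have h2 := rowForm_row_point (outerMatrix s j y t)
        (fun o => outerDiff s j t o * outerKernel s j y o k' (y j)) o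
      have h3 := LinearMap.IsAlt.neg (B := rowForm (outerMatrix s j y t))
        (rowForm_self (outerMatrix_swap s j y t)) (pointVec o)
        (rowVec fun o => outerDiff s j t o * outerKernel s j y o k' (y j))
      simp only [Sum.elim_inl, Sum.elim_inr]
      rw [h2] at h3
      rw [kernelDeriv_swap]
      simp only [outerDiff, outerKernel] at h3 ⊢
      linear_combination -h3
    · refine (rowForm_row_point _ _ o').trans ?_
      simp only [Sum.elim_inl, Sum.elim_inr, outerDiff, outerKernel]
      ring
    · refine (rowForm_row_row _ _ _).trans ?_
      simp

variable {y} in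
-- Without rows at the fused point, the Pfaffian is that of the configuration in which this point is
-- absent.
theorem fusedPfaffian_zero_eq_sum (hy : Function.Injective y) : fusedPfaffian s j y t 0 =
    ∑ γ : ValencedLinkPattern s, γ.partitionFunction (y ∘ j.succAbove) *
      γ.differenceProd (t ∘ j.succAbove) := by
  rw [← pfaffian_eq_sum_partitionFunction (hy.comp Fin.succAbove_right_injective) (t ∘ j.succAbove)
    (rowForm (outerMatrix s j y t)) (rowForm_self (outerMatrix_swap s j y t))
    (leftIndices j s ++ rightIndices j s) (fun o => (o.1, o.2.val))
    (by rw [List.map_append, ← configList_self]) pointVec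
    fun o o' => rowForm_point_point _ o o']
  rw [fusedPfaffian, rowPfaffian, List.map_append]
  rfl

end NearFusion


/-! ### Asymptotics of the partition functions -/

section Asymptotics

variable {n : ℕ} {s : Fin (n + 2) → ℕ}

theorem predAbove_lt_predAbove_iff (j : Fin (n + 1)) (i k : Fin (n + 2)) :
    j.predAbove i < j.predAbove k ↔ i < k ∧ ¬ (i = j.castSucc ∧ k = j.succ) := by
  have hj := j.isLt
  have hval : ∀ i : Fin (n + 2), (j.predAbove i).val = if j.val < i.val then i.val - 1 else i.val := by
    intro i
    rw [Fin.predAbove]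
    simp only [Fin.lt_def, Fin.val_castSucc]
    split_ifs <;> simp
  rw [Fin.lt_def, hval, hval, Fin.lt_def, Fin.ext_iff, Fin.ext_iff, Fin.val_castSucc, Fin.val_succ]
  split_ifs <;> omega

namespace ValencedLinkPattern

variable (α : ValencedLinkPattern s) (j : Fin (n + 1))

/-- The product of the differences over the links which are not removed by the fusion. -/
def contractedProd (t : Fin (n + 1) → ℝ) : ℝ :=
  ∏ i, ∏ k, if j.predAbove i < j.predAbove k then
    (t (j.predAbove k) - t (j.predAbove i)) ^ α.mult i k else 1

open Polynomial in
/-- The parameters near the fusion, as polynomials in their difference. -/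
noncomputable def nearParameter (t : Fin (n + 1) → ℝ) (i : Fin (n + 2)) : ℝ[X] :=
  C (t (j.predAbove i)) - if i = j.castSucc then X else 0

open Polynomial in
/-- The product of the differences over the links which are not removed by the fusion, as a
polynomial in the difference of the fused parameters. -/
noncomputable def nearPoly (t : Fin (n + 1) → ℝ) : ℝ[X] :=
  ∏ i, ∏ k, if j.predAbove i < j.predAbove k then
    (nearParameter j t k - nearParameter j t i) ^ α.mult i k else 1

theorem eval_nearParameter (t : Fin (n + 1) → ℝ) (i : Fin (n + 2)) (ε : ℝ) :
    (nearParameter j t i).eval ε = nearFusion j t (t j - ε) (t j) i := by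
  rcases eq_or_eq_or_eq_otherPoint j i with rfl | rfl | ⟨i, rfl⟩
  · rw [nearFusion_castSucc]
    simp [nearParameter]
  · rw [nearFusion_succ]
    simp [nearParameter, Fin.castSucc_lt_succ.ne']
  · rw [nearFusion_otherPoint]
    simp [nearParameter, otherPoint_ne_castSucc, predAbove_otherPoint]

theorem coeff_zero_nearPoly (t : Fin (n + 1) → ℝ) :
    (α.nearPoly j t).coeff 0 = α.contractedProd j t := by
  rw [Polynomial.coeff_zero_eq_eval_zero, nearPoly, contractedProd]
  simp only [Polynomial.eval_prod]
  refine Finset.prod_congr rfl fun i _ => Finset.prod_congr rfl fun k _ => ?_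
  have h : ∀ i, (nearParameter j t i).eval 0 = t (j.predAbove i) := fun i => by
    rw [nearParameter, Polynomial.eval_sub, Polynomial.eval_C, apply_ite (Polynomial.eval 0)]
    simp
  split_ifs <;> simp [h]

/-- Each link between the merging points contributes the difference `ε` of their parameters; the
other factors are polynomial in `ε` with constant term given by the fused parameters. -/
theorem differenceProd_nearFusion (t : Fin (n + 1) → ℝ) (ε : ℝ) :
    α.differenceProd (nearFusion j t (t j - ε) (t j)) =
      ε ^ α.mult j.castSucc j.succ * (α.nearPoly j t).eval ε := by
  have h1 : ε ^ α.mult j.castSucc j.succ = ∏ i, ∏ k,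
      if i = j.castSucc then (if k = j.succ then ε ^ α.mult j.castSucc j.succ else 1) else 1 := by
    rw [Finset.prod_eq_single j.castSucc]
    · simp
    · intro i _ hi
      simp [hi]
    · simp
  rw [h1, nearPoly, differenceProd]
  simp only [Polynomial.eval_prod, ← Finset.prod_mul_distrib]
  refine Finset.prod_congr rfl fun i _ => Finset.prod_congr rfl fun k _ => ?_
  have h2 := predAbove_lt_predAbove_iff j i k
  by_cases h3 : i = j.castSucc ∧ k = j.succ
  · obtain ⟨rfl, rfl⟩ := h3
    rw [if_neg (show ¬ _ from fun h => (h2.1 h).2 ⟨rfl, rfl⟩), if_pos Fin.castSucc_lt_succ,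
      if_pos rfl, if_pos rfl, nearFusion_castSucc, nearFusion_succ]
    simp
  · have h4 : (if i = j.castSucc then
        (if k = j.succ then ε ^ α.mult j.castSucc j.succ else 1) else 1) = 1 := by
      split_ifs <;> tauto
    rw [h4, one_mul]
    by_cases h5 : i < k
    · rw [if_pos h5, if_pos (h2.2 ⟨h5, h3⟩)]
      simp [eval_nearParameter]
    · rw [if_neg h5, if_neg fun h => h5 (h2.1 h).1]
      simp

theorem mult_le_min : α.mult j.castSucc j.succ ≤ min (s j.castSucc) (s j.succ) := by
  refine le_min ?_ ?_
  · rw [← α.valence j.castSucc]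
    exact Finset.single_le_sum (f := α.mult j.castSucc) (fun _ _ => Nat.zero_le _)
      (Finset.mem_univ _)
  · rw [← α.valence j.succ, α.symm]
    exact Finset.single_le_sum (f := α.mult j.succ) (fun _ _ => Nat.zero_le _)
      (Finset.mem_univ _)

end ValencedLinkPattern

/-- The generating function of the patterns with a given multiplicity. -/
theorem sum_contractedProd (j : Fin (n + 1)) (y t : Fin (n + 1) → ℝ) (p : ℝ × ℝ) (hp : p.1 < p.2)
    (hinj : Function.Injective (nearFusion j y p.1 p.2)) {m : ℕ} (hm : m ≤ s j.castSucc) :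
    ∑ α : ValencedLinkPattern s with α.mult j.castSucc j.succ = m,
        α.partitionFunction (nearFusion j y p.1 p.2) * α.contractedProd j t =
      nearCoeff j y t s m p - ∑ α : ValencedLinkPattern s with α.mult j.castSucc j.succ < m,
        α.partitionFunction (nearFusion j y p.1 p.2) *
          (α.nearPoly j t).coeff (m - α.mult j.castSucc j.succ) := by
  -- The identity holds for all real `ε`, hence as an identity of polynomials, and the coefficients
  -- of `X ^ m` can be compared.
  have hpoly : ∑ α : ValencedLinkPattern s,
      Polynomial.C (α.partitionFunction (nearFusion j y p.1 p.2)) *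
        (α.nearPoly j t * Polynomial.X ^ α.mult j.castSucc j.succ) =
      ∑ m ∈ Finset.range (s j.castSucc + 1),
        Polynomial.monomial m (nearCoeff j y t s m p) := by
    apply Polynomial.funext
    intro ε
    have h := sum_partitionFunction_nearFusion j y t s p hp hinj ε
    simp only [Polynomial.eval_finsetSum, Polynomial.eval_mul, Polynomial.eval_C,
      Polynomial.eval_pow, Polynomial.eval_X, Polynomial.eval_monomial]
    simp only [ValencedLinkPattern.differenceProd_nearFusion] at h
    simpa only [mul_comm] using h
  have h1 := congrArg (fun P => P.coeff m) hpoly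
  simp only [Polynomial.finsetSum_coeff, Polynomial.coeff_C_mul, Polynomial.coeff_mul_X_pow',
    Polynomial.coeff_monomial, Finset.sum_ite_eq', Finset.mem_range] at h1
  rw [if_pos (by omega)] at h1
  rw [← h1, eq_sub_iff_add_eq, Finset.sum_filter, Finset.sum_filter, ← Finset.sum_add_distrib]
  refine Finset.sum_congr rfl fun α _ => ?_
  rcases lt_trichotomy (α.mult j.castSucc j.succ) m with h | h | h
  · rw [if_neg h.ne, if_pos h, if_pos h.le, zero_add]
  · rw [if_pos h, if_neg (by omega), if_pos h.le, add_zero, h, Nat.sub_self,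
      α.coeff_zero_nearPoly]
  · rw [if_neg h.ne', if_neg (by omega), if_neg (by omega), mul_zero, add_zero]

/-- The difference of the exponents is `(m - m') (2m + 2m' - 2s - 2t - 1)`, and the second factor is
negative. -/
theorem fusionExponent_lt {s t m m' : ℕ} (h : m' < m) (hm : m ≤ min s t) :
    fusionExponent s t m < fusionExponent s t m' := by
  rw [fusionExponent_eq, fusionExponent_eq]
  obtain ⟨h1, h2⟩ := le_min_iff.1 hm
  have h3 : (m' : ℝ) + 1 ≤ m := by exact_mod_cast h
  have h4 : (m : ℝ) ≤ s := by exact_mod_cast h1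
  have h5 : (m : ℝ) ≤ t := by exact_mod_cast h2
  nlinarith

/-- The asymptotics of a pattern whose multiplicity is too small is negligible. -/
theorem tendsto_zero_of_exponent_lt {ξ a b L : ℝ} {f : ℝ × ℝ → ℝ}
    (h : Tendsto (fun p => f p / |p.2 - p.1| ^ b) (fusionFilter ξ) (𝓝 L)) (hab : a < b) :
    Tendsto (fun p => f p / |p.2 - p.1| ^ a) (fusionFilter ξ) (𝓝 0) := by
  have h1 : Tendsto (fun p : ℝ × ℝ => |p.2 - p.1| ^ (b - a)) (fusionFilter ξ) (𝓝 0) := by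
    have h2 := (tendsto_sub_fusionFilter ξ).abs
    rw [abs_zero] at h2
    have h3 := h2.rpow_const (p := b - a) (Or.inr (by linarith))
    rwa [Real.zero_rpow (by linarith)] at h3
  have h4 := h.mul h1
  rw [mul_zero] at h4
  refine h4.congr' ?_
  filter_upwards [eventually_lt_fusionFilter ξ] with p hp
  have h5 : 0 < |p.2 - p.1| := abs_pos.2 (sub_pos.2 hp).ne'
  rw [Real.rpow_sub h5]
  have := (Real.rpow_pos_of_pos h5 a).ne'
  have := (Real.rpow_pos_of_pos h5 b).ne'
  field_simp

/-- The asymptotics of the patterns with a given multiplicity, whose fusions are described by an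
injection `e` to the valenced link patterns on the points `ρ`. -/
theorem tendsto_partitionFunction_of_injective (j : Fin (n + 1)) {y : Fin (n + 1) → ℝ}
    (hy : Function.Injective y) {m : ℕ} (hm : m ≤ min (s j.castSucc) (s j.succ))
    (hlow : ∀ α : ValencedLinkPattern s, α.mult j.castSucc j.succ < m → ∃ L, Tendsto
      (fun p : ℝ × ℝ => α.partitionFunction (nearFusion j y p.1 p.2) /
        |p.2 - p.1| ^ fusionExponent (s j.castSucc) (s j.succ) (α.mult j.castSucc j.succ))
      (fusionFilter (y j)) (𝓝 L))
    {d : ℕ} {s' : Fin d → ℕ} {ρ : Fin d → Fin (n + 1)} (hρ : Function.Injective ρ)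
    (e : {α : ValencedLinkPattern s // α.mult j.castSucc j.succ = m} → ValencedLinkPattern s')
    (he : Function.Injective e)
    (hprod : ∀ α t, α.1.contractedProd j t = (e α).differenceProd (t ∘ ρ))
    (hlim : ∀ t, fusedPfaffian (s ∘ otherPoint j) j y t (s j.castSucc + s j.succ - 2 * m) =
      ∑ γ : ValencedLinkPattern s', γ.partitionFunction (y ∘ ρ) * γ.differenceProd (t ∘ ρ))
    (α : {α : ValencedLinkPattern s // α.mult j.castSucc j.succ = m}) :
    Tendsto (fun p : ℝ × ℝ => α.1.partitionFunction (nearFusion j y p.1 p.2) /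
        |p.2 - p.1| ^ fusionExponent (s j.castSucc) (s j.succ) m) (fusionFilter (y j))
      (𝓝 (fusionConstant (s j.castSucc) (s j.succ) m * (e α).partitionFunction (y ∘ ρ))) := by
  classical
  set Δ := fusionExponent (s j.castSucc) (s j.succ) m with hΔ
  -- The generating function of the patterns with exactly `m` links between the points: by `hlow`
  -- and the strict order of the exponents, the correction from smaller multiplicities vanishes in
  -- the limit.
  have hgen : ∀ t, Tendsto (fun p : ℝ × ℝ => ∑ α : ValencedLinkPattern s with
      α.mult j.castSucc j.succ = m, α.partitionFunction (nearFusion j y p.1 p.2) /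
        |p.2 - p.1| ^ Δ * α.contractedProd j t) (fusionFilter (y j))
      (𝓝 (fusionConstant (s j.castSucc) (s j.succ) m *
        fusedPfaffian (s ∘ otherPoint j) j y t (s j.castSucc + s j.succ - 2 * m))) := by
    intro t
    have h1 : Tendsto (fun p : ℝ × ℝ => ∑ α : ValencedLinkPattern s with
        α.mult j.castSucc j.succ < m, α.partitionFunction (nearFusion j y p.1 p.2) /
          |p.2 - p.1| ^ Δ * (α.nearPoly j t).coeff (m - α.mult j.castSucc j.succ))
        (fusionFilter (y j)) (𝓝 (∑ α : ValencedLinkPattern s with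
        α.mult j.castSucc j.succ < m, 0)) := by
      refine tendsto_finsetSum _ fun α hα => ?_
      have hα' := (Finset.mem_filter.1 hα).2
      obtain ⟨L, hL⟩ := hlow α hα'
      have h2 := (tendsto_zero_of_exponent_lt hL (fusionExponent_lt hα' hm)).mul_const
        ((α.nearPoly j t).coeff (m - α.mult j.castSucc j.succ))
      rwa [zero_mul] at h2
    have h3 := (tendsto_nearCoeff j t s hy hm).sub h1
    rw [Finset.sum_const_zero, sub_zero] at h3
    refine h3.congr' ?_
    filter_upwards [eventually_lt_fusionFilter (y j), eventually_injective_nearFusion j hy]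
      with p hp hinj
    have h4 := sum_contractedProd (s := s) j y t p hp hinj (hm.trans (min_le_left _ _))
    simp only [div_mul_eq_mul_div, ← Finset.sum_div]
    rw [h4, sub_div]
  -- The sum over the patterns is rewritten as a sum over all patterns on the fused points, with
  -- coefficient zero outside the image of `e`, so that the independence lemma applies.
  have hsplit : ∀ (f : ValencedLinkPattern s → ℝ) (t : Fin d → ℝ),
      ∑ γ, (∑ α : {α : ValencedLinkPattern s // α.mult j.castSucc j.succ = m},
        if e α = γ then f α.1 else 0) * γ.differenceProd t =
      ∑ α : {α : ValencedLinkPattern s // α.mult j.castSucc j.succ = m},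
        f α.1 * (e α).differenceProd t := by
    intro f t
    simp only [Finset.sum_mul, ite_mul, zero_mul]
    rw [Finset.sum_comm]
    simp
  have hself : ∀ f : ValencedLinkPattern s → ℝ,
      (∑ α' : {α : ValencedLinkPattern s // α.mult j.castSucc j.succ = m},
        if e α' = e α then f α'.1 else 0) = f α.1 := by
    intro f
    simp [he.eq_iff]
  have hmain := ValencedLinkPattern.tendsto_of_tendsto_sum (l := fusionFilter (y j))
    (fun (p : ℝ × ℝ) γ => ∑ α : {α : ValencedLinkPattern s // α.mult j.castSucc j.succ = m},
      if e α = γ then α.1.partitionFunction (nearFusion j y p.1 p.2) / |p.2 - p.1| ^ Δ else 0)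
    (fun γ => fusionConstant (s j.castSucc) (s j.succ) m * γ.partitionFunction (y ∘ ρ))
    (fun t' => ?_) (e α)
  · exact hmain.congr fun p =>
      hself fun α => α.partitionFunction (nearFusion j y p.1 p.2) / |p.2 - p.1| ^ Δ
  -- Since `ρ` is injective, all parameters on the points of the fused pattern arise by restriction.
  · obtain ⟨t, rfl⟩ : ∃ t : Fin (n + 1) → ℝ, t ∘ ρ = t' :=
      ⟨Function.extend ρ t' 0, Function.extend_comp hρ _ _⟩
    have h5 := hgen t
    rw [hlim, Finset.mul_sum] at h5
    simp only [← mul_assoc] at h5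
    refine h5.congr fun p => ?_
    rw [hsplit fun α => α.partitionFunction (nearFusion j y p.1 p.2) / |p.2 - p.1| ^ Δ]
    simp only [← hprod]
    exact (Finset.sum_subtype _ (by simp) _)

end Asymptotics


/-! ### Fusing and removing points of valenced link patterns -/

section FusedPatterns

variable {n : ℕ} {s : Fin (n + 2) → ℕ}

namespace ValencedLinkPattern

theorem differenceProd_fuse (α : ValencedLinkPattern s) (j : Fin (n + 1)) (t : Fin (n + 1) → ℝ) :
    (α.fuse j).differenceProd t = α.contractedProd j t := by
  have h1 : ∀ a b : Fin (n + 1), (if a < b then (t b - t a) ^ (α.fuse j).mult a b else 1) =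
      ∏ i, ∏ k, if j.predAbove i = a then (if j.predAbove k = b then
        (if j.predAbove i < j.predAbove k then
          (t (j.predAbove k) - t (j.predAbove i)) ^ α.mult i k else 1) else 1) else 1 := by
    intro a b
    split_ifs with h
    · have h2 : (α.fuse j).mult a b =
          ∑ i with j.predAbove i = a, ∑ k with j.predAbove k = b, α.mult i k := if_neg h.ne
      rw [h2]
      simp only [← Finset.prod_pow_eq_pow_sum, Finset.prod_filter]
      refine Finset.prod_congr rfl fun i _ => ?_
      by_cases hi : j.predAbove i = a
      · subst hi
        simp only [if_true]
        refine Finset.prod_congr rfl fun k _ => ?_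
        by_cases hk : j.predAbove k = b
        · subst hk
          simp only [if_true, if_pos h]
        · simp only [if_neg hk]
      · simp only [if_neg hi, Finset.prod_const_one]
    · symm
      refine Finset.prod_eq_one fun i _ => Finset.prod_eq_one fun k _ => ?_
      split_ifs with h1 h2 h3
      · exact absurd (h1 ▸ h2 ▸ h3) h
      all_goals rfl
  simp only [differenceProd, h1]
  calc _ = ∏ a, ∏ i, ∏ b, ∏ k, _ := Finset.prod_congr rfl fun a _ => Finset.prod_comm
    _ = ∏ i, ∏ a, ∏ b, ∏ k, _ := Finset.prod_comm
    _ = _ := by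
      refine Finset.prod_congr rfl fun i _ => ?_
      rw [Finset.prod_eq_single (j.predAbove i) (fun a _ ha => by simp [ha.symm]) (by simp)]
      simp only [if_true]
      rw [Finset.prod_comm]
      simp

theorem leftValence_fuse (α : ValencedLinkPattern s) (j a : Fin (n + 1)) :
    (α.fuse j).leftValence a =
      ∑ i with j.predAbove i = a, ∑ k with j.predAbove k < a, α.mult i k := by
  have h1 : ∀ b ∈ Finset.univ.filter (· < a), (α.fuse j).mult a b =
      ∑ i with j.predAbove i = a, ∑ k with j.predAbove k = b, α.mult i k := fun b hb =>
    if_neg (Finset.mem_filter.1 hb).2.ne'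
  rw [leftValence, Finset.sum_congr rfl h1, Finset.sum_comm]
  refine Finset.sum_congr rfl fun i _ => ?_
  simp only [Finset.sum_filter]
  rw [← Finset.sum_filter, Finset.sum_comm]
  refine Finset.sum_congr rfl fun k _ => ?_
  rw [Finset.sum_ite_eq]
  simp

theorem leftValence_fuse_succAbove (α : ValencedLinkPattern s) (j : Fin (n + 1)) (b : Fin n) :
    (α.fuse j).leftValence (j.succAbove b) = α.leftValence (otherPoint j b) := by
  have h1 : Finset.univ.filter (fun i => j.predAbove i = j.succAbove b) = {otherPoint j b} := by
    ext i
    rw [Finset.mem_filter, Finset.mem_singleton]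
    rcases eq_or_eq_or_eq_otherPoint j i with rfl | rfl | ⟨i, rfl⟩
    · simp [(Fin.succAbove_ne j b).symm, (otherPoint_ne_castSucc j b).symm]
    · simp [(Fin.succAbove_ne j b).symm, (otherPoint_ne_succ j b).symm]
    · simp [predAbove_otherPoint, (otherPoint_strictMono j).injective.eq_iff]
  rw [leftValence_fuse, h1, Finset.sum_singleton, leftValence]
  refine Finset.sum_congr (Finset.filter_congr fun k _ => ?_) fun _ _ => rfl
  rw [← predAbove_otherPoint, predAbove_lt_predAbove_iff]
  have := otherPoint_ne_succ j b
  tauto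

/-- The links between the two points count as left links of the right point before the fusion and
disappear afterwards. -/
theorem leftValence_fuse_self (α : ValencedLinkPattern s) (j : Fin (n + 1)) :
    (α.fuse j).leftValence j + α.mult j.castSucc j.succ =
      α.leftValence j.castSucc + α.leftValence j.succ := by
  have h1 : Finset.univ.filter (fun i => j.predAbove i = j) = {j.castSucc, j.succ} := by
    ext i
    rw [Finset.mem_filter, Finset.mem_insert, Finset.mem_singleton]
    rcases eq_or_eq_or_eq_otherPoint j i with rfl | rfl | ⟨i, rfl⟩
    · simp
    · simp
    · simp [predAbove_otherPoint, Fin.succAbove_ne, otherPoint_ne_castSucc, otherPoint_ne_succ]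
  have h2 : Finset.univ.filter (fun k => j.predAbove k < j) =
      Finset.univ.filter (· < j.castSucc) := by
    refine Finset.filter_congr fun k _ => ?_
    have h := predAbove_lt_predAbove_iff j k j.castSucc
    rw [Fin.predAbove_castSucc_self] at h
    rw [h]
    exact and_iff_left fun h' => Fin.castSucc_lt_succ.ne h'.2
  have h3 : Finset.univ.filter (· < j.succ) =
      insert j.castSucc (Finset.univ.filter (· < j.castSucc)) := by
    ext k
    simp only [Finset.mem_filter, Finset.mem_univ, true_and, Finset.mem_insert, Fin.lt_def,
      Fin.ext_iff, Fin.val_castSucc, Fin.val_succ]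
    omega
  rw [leftValence_fuse, h1, h2, Finset.sum_pair Fin.castSucc_lt_succ.ne, leftValence, leftValence,
    h3, Finset.sum_insert (by simp), α.symm j.succ j.castSucc]
  ring

theorem leftValence_add_sum (α : ValencedLinkPattern s) (i : Fin (n + 2)) :
    α.leftValence i + ∑ k with i < k, α.mult i k = s i := by
  rw [← α.valence i, leftValence, Finset.sum_filter, Finset.sum_filter, ← Finset.sum_add_distrib]
  refine Finset.sum_congr rfl fun k _ => ?_
  rcases lt_trichotomy i k with h | rfl | h
  · simp [h, h.not_gt]
  · simp [α.irrefl]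
  · simp [h, h.not_gt]

/-- The links at two neighbouring points do not cross. -/
theorem neighbour_planar (α : ValencedLinkPattern s) (j : Fin (n + 1)) :
    α.leftValence j.succ = α.mult j.castSucc j.succ ∨
      α.leftValence j.castSucc + α.mult j.castSucc j.succ = s j.castSucc := by
  by_cases h : ∃ a < j.castSucc, α.mult a j.succ ≠ 0
  · obtain ⟨a, ha, h1⟩ := h
    right
    rw [← α.leftValence_add_sum j.castSucc]
    congr 1
    symm
    refine Finset.sum_eq_single_of_mem _ (by simp) fun b hb hbj => ?_
    have hb' := (Finset.mem_filter.1 hb).2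
    refine (α.planar a j.castSucc j.succ b ha Fin.castSucc_lt_succ ?_).resolve_left h1
    rw [Fin.lt_def, Fin.val_castSucc] at hb'
    rw [ne_eq, Fin.ext_iff, Fin.val_succ] at hbj
    rw [Fin.lt_def, Fin.val_succ]
    omega
  · left
    push Not at h
    rw [leftValence, α.symm]
    refine Finset.sum_eq_single_of_mem _ (by simp) fun b hb hbj => ?_
    rw [α.symm]
    refine h b ?_
    have hb' := (Finset.mem_filter.1 hb).2
    rw [Fin.lt_def, Fin.val_succ] at hb'
    rw [ne_eq, Fin.ext_iff, Fin.val_castSucc] at hbj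
    rw [Fin.lt_def, Fin.val_castSucc]
    omega

theorem leftValence_add_mult_le (α : ValencedLinkPattern s) (j : Fin (n + 1)) :
    α.leftValence j.castSucc + α.mult j.castSucc j.succ ≤ s j.castSucc := by
  rw [← α.leftValence_add_sum j.castSucc]
  exact Nat.add_le_add_left (Finset.single_le_sum (f := α.mult j.castSucc)
    (fun _ _ => Nat.zero_le _) (by simp)) _

theorem mult_le_leftValence (α : ValencedLinkPattern s) (j : Fin (n + 1)) :
    α.mult j.castSucc j.succ ≤ α.leftValence j.succ := by
  rw [α.symm]
  exact Finset.single_le_sum (f := α.mult j.succ)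
    (fun _ _ => Nat.zero_le _) (by simp)

/-- A pattern is determined by its fusion and the number of the removed links. -/
theorem eq_of_leftValence_fuse {α γ : ValencedLinkPattern s} (j : Fin (n + 1))
    (hm : α.mult j.castSucc j.succ = γ.mult j.castSucc j.succ)
    (h : ∀ a, (α.fuse j).leftValence a = (γ.fuse j).leftValence a) : α = γ := by
  have h1 := h j
  have h2 := α.leftValence_fuse_self j
  have h3 := γ.leftValence_fuse_self j
  have h4 := α.neighbour_planar j
  have h5 := γ.neighbour_planar j
  have h6 := α.leftValence_add_mult_le j
  have h7 := γ.leftValence_add_mult_le j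
  have h8 := α.mult_le_leftValence j
  have h9 := γ.mult_le_leftValence j
  refine eq_of_leftValence fun i => ?_
  -- The sum of the left valences of the two points is known. By planarity either the right point
  -- has the least possible left valence `m` or the left point has the largest possible one, `s
  -- j.castSucc - m`; comparing the sum with `s j.castSucc` decides which, so both valences are
  -- determined.
  rcases eq_or_eq_or_eq_otherPoint j i with rfl | rfl | ⟨i, rfl⟩
  · omega
  · omega
  · rw [← leftValence_fuse_succAbove, h, leftValence_fuse_succAbove]

/-- The fusion of a pattern with `m` links between the fused points. -/
def fuseOfMult (j : Fin (n + 1)) (m : ℕ)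
    (α : {α : ValencedLinkPattern s // α.mult j.castSucc j.succ = m}) :
    ValencedLinkPattern (fusedValence s j m) :=
  α.2 ▸ α.1.fuse j

theorem fuseOfMult_injective (j : Fin (n + 1)) (m : ℕ) :
    Function.Injective (fuseOfMult (s := s) j m) := by
  have h1 : ∀ (α : {α : ValencedLinkPattern s // α.mult j.castSucc j.succ = m}) a,
      (fuseOfMult j m α).leftValence a = (α.1.fuse j).leftValence a := by
    rintro ⟨α, rfl⟩ a
    rfl
  intro α γ h
  refine Subtype.ext (eq_of_leftValence_fuse j (α.2.trans γ.2.symm) fun a => ?_)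
  rw [← h1, ← h1, h]

theorem differenceProd_fuseOfMult (j : Fin (n + 1)) (m : ℕ)
    (α : {α : ValencedLinkPattern s // α.mult j.castSucc j.succ = m}) (t : Fin (n + 1) → ℝ) :
    (fuseOfMult j m α).differenceProd t = α.1.contractedProd j t := by
  obtain ⟨α, rfl⟩ := α
  exact α.differenceProd_fuse j t

/-- If all the links at two neighbouring points connect them, there are no other links there. -/
theorem mult_otherPoint_eq_zero (α : ValencedLinkPattern s) (j : Fin (n + 1))
    (hl : α.mult j.castSucc j.succ = s j.castSucc) (hr : α.mult j.castSucc j.succ = s j.succ)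
    (i : Fin n) :
    α.mult j.castSucc (otherPoint j i) = 0 ∧ α.mult j.succ (otherPoint j i) = 0 := by
  have h1 := α.valence j.castSucc
  have h2 := α.valence j.succ
  rw [sum_pair_add_sum_otherPoint j, α.irrefl] at h1
  rw [sum_pair_add_sum_otherPoint j, α.irrefl, α.symm j.succ] at h2
  have h4 := Finset.single_le_sum (f := fun i => α.mult j.castSucc (otherPoint j i))
    (fun _ _ => Nat.zero_le _) (Finset.mem_univ i)
  have h5 := Finset.single_le_sum (f := fun i => α.mult j.succ (otherPoint j i))
    (fun _ _ => Nat.zero_le _) (Finset.mem_univ i)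
  omega

theorem prod_eq_prod_otherPoint (j : Fin (n + 1)) (f : Fin (n + 2) → ℝ) (h1 : f j.castSucc = 1)
    (h2 : f j.succ = 1) : ∏ i, f i = ∏ i, f (otherPoint j i) := by
  rw [Fin.prod_univ_succAbove f j.castSucc, Fin.prod_univ_succAbove _ j,
    Fin.succAbove_castSucc_self, h1, h2, one_mul, one_mul]
  rfl

theorem differenceProd_removePair (α : ValencedLinkPattern s) (j : Fin (n + 1))
    (hl : α.mult j.castSucc j.succ = s j.castSucc) (hr : α.mult j.castSucc j.succ = s j.succ)
    (t : Fin (n + 1) → ℝ) :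
    (α.removePair j hl hr).differenceProd (t ∘ j.succAbove) = α.contractedProd j t := by
  have h0 := α.mult_otherPoint_eq_zero j hl hr
  have h0' : ∀ i, α.mult (otherPoint j i) j.castSucc = 0 ∧ α.mult (otherPoint j i) j.succ = 0 :=
    fun i => by rw [α.symm, α.symm _ j.succ]; exact h0 i
  have hpair : ∀ i k, (i = j.castSucc ∨ i = j.succ) → (if j.predAbove i < j.predAbove k then
      (t (j.predAbove k) - t (j.predAbove i)) ^ α.mult i k else 1) = 1 := by
    rintro i k (rfl | rfl) <;> rcases eq_or_eq_or_eq_otherPoint j k with rfl | rfl | ⟨k, rfl⟩ <;>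
      simp [h0]
  rw [contractedProd, prod_eq_prod_otherPoint j _
    (Finset.prod_eq_one fun k _ => hpair _ _ (Or.inl rfl))
    (Finset.prod_eq_one fun k _ => hpair _ _ (Or.inr rfl))]
  refine Finset.prod_congr rfl fun i _ => ?_
  rw [prod_eq_prod_otherPoint j _ (by simp [h0']) (by simp [h0'])]
  refine Finset.prod_congr rfl fun k _ => ?_
  simp only [predAbove_otherPoint, Fin.succAbove_lt_succAbove_iff]
  rfl

theorem eq_of_removePair {α γ : ValencedLinkPattern s} (j : Fin (n + 1))
    (hl : α.mult j.castSucc j.succ = s j.castSucc) (hr : α.mult j.castSucc j.succ = s j.succ)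
    (hl' : γ.mult j.castSucc j.succ = s j.castSucc) (hr' : γ.mult j.castSucc j.succ = s j.succ)
    (h : α.removePair j hl hr = γ.removePair j hl' hr') : α = γ := by
  have h0 := α.mult_otherPoint_eq_zero j hl hr
  have h0' := γ.mult_otherPoint_eq_zero j hl' hr'
  have hjs : α.mult j.succ j.castSucc = γ.mult j.succ j.castSucc := by
    rw [α.symm, γ.symm, hl, hl']
  apply mult_injective
  funext i k
  rcases eq_or_eq_or_eq_otherPoint j i with rfl | rfl | ⟨i, rfl⟩ <;>
    rcases eq_or_eq_or_eq_otherPoint j k with rfl | rfl | ⟨k, rfl⟩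
  · rw [α.irrefl, γ.irrefl]
  · rw [hl, hl']
  · rw [(h0 k).1, (h0' k).1]
  · exact hjs
  · rw [α.irrefl, γ.irrefl]
  · rw [(h0 k).2, (h0' k).2]
  · rw [α.symm, γ.symm, (h0 i).1, (h0' i).1]
  · rw [α.symm, γ.symm, (h0 i).2, (h0' i).2]
  · exact congrFun (congrFun (congrArg ValencedLinkPattern.mult h) i) k

/-- The asymptotics of the partition function when two neighbouring points are fused. -/
theorem tendsto_partitionFunction_fuse (j : Fin (n + 1)) {y : Fin (n + 1) → ℝ}
    (hy : Function.Injective y) (α : ValencedLinkPattern s) :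
    Tendsto (fun p : ℝ × ℝ => α.partitionFunction (nearFusion j y p.1 p.2) /
        |p.2 - p.1| ^ fusionExponent (s j.castSucc) (s j.succ) (α.mult j.castSucc j.succ))
      (fusionFilter (y j)) (𝓝 (fusionConstant (s j.castSucc) (s j.succ)
        (α.mult j.castSucc j.succ) * (α.fuse j).partitionFunction y)) := by
  obtain ⟨m, hm⟩ : ∃ m, α.mult j.castSucc j.succ = m := ⟨_, rfl⟩
  induction m using Nat.strong_induction_on generalizing α with
  | _ m ih =>
  subst hm
  -- The induction hypothesis supplies the asymptotics for smaller multiplicities, which are needed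
  -- to discard them.
  refine tendsto_partitionFunction_of_injective j hy (α.mult_le_min j)
    (fun γ hγ => ⟨_, ih _ hγ γ rfl⟩) (ρ := id) Function.injective_id
    (fuseOfMult j (α.mult j.castSucc j.succ)) (fuseOfMult_injective j _)
    (fun γ t => (differenceProd_fuseOfMult j _ γ t).symm) (fun t => ?_) ⟨α, rfl⟩
  have h1 : fusedValence s j (α.mult j.castSucc j.succ) j =
      s j.castSucc + s j.succ - 2 * α.mult j.castSucc j.succ := if_pos rfl
  rw [← h1]
  exact fusedPfaffian_eq_sum _ j t hy _ fun i => if_neg (Fin.succAbove_ne j i)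

/-- The asymptotics of the partition function when two neighbouring points are fused, all of
whose links connect them. -/
theorem tendsto_partitionFunction_removePair (j : Fin (n + 1)) {y : Fin (n + 1) → ℝ}
    (hy : Function.Injective y) (α : ValencedLinkPattern s)
    (hl : α.mult j.castSucc j.succ = s j.castSucc) (hr : α.mult j.castSucc j.succ = s j.succ) :
    Tendsto (fun p : ℝ × ℝ => α.partitionFunction (nearFusion j y p.1 p.2) /
        |p.2 - p.1| ^ fusionExponent (s j.castSucc) (s j.succ) (α.mult j.castSucc j.succ))
      (fusionFilter (y j)) (𝓝 (fusionConstant (s j.castSucc) (s j.succ)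
        (α.mult j.castSucc j.succ) *
          (α.removePair j hl hr).partitionFunction (y ∘ j.succAbove))) := by
  refine tendsto_partitionFunction_of_injective j hy (α.mult_le_min j)
    -- Smaller multiplicities are already covered by the fusion theorem, so no further induction is
    -- needed.
    (fun γ _ => ⟨_, γ.tendsto_partitionFunction_fuse j hy⟩) (ρ := j.succAbove)
    Fin.succAbove_right_injective
    (fun γ => γ.1.removePair j (γ.2.trans hl) (γ.2.trans hr))
    (fun γ γ' h => Subtype.ext (eq_of_removePair j _ _ _ _ h))
    (fun γ t => (γ.1.differenceProd_removePair j _ _ t).symm) (fun t => ?_) ⟨α, rfl⟩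
  rw [show s j.castSucc + s j.succ - 2 * α.mult j.castSucc j.succ = 0 by omega]
  exact fusedPfaffian_zero_eq_sum _ j t hy

end ValencedLinkPattern

end FusedPatterns

end PurePartition

open PurePartition
theorem theorem6p1 :
    ∃ C : ℕ → ℕ → ℕ → ℝ,
      (∀ s t m : ℕ, 0 ≤ C s t m) ∧
      (∀ s t : ℕ, 0 < s → 0 < t → 0 < C s t 0 ∧
        C s t 0 = (∏ k ∈ Finset.Icc 1 (min s t), ((k - 1).factorial : ℝ)) /
          ∏ l ∈ Finset.Icc 1 (min s t), ((max s t + l - 1).factorial : ℝ)) ∧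
      (∀ s t : ℕ, 0 < s → 0 < t → 0 < C s t (min s t) ∧
        C s t (min s t) = 1 / Real.pi ^ (min s t) *
          (∏ l ∈ Finset.Icc 1 (min s t), ((max s t - min s t + l).factorial : ℝ)) *
          ∏ r ∈ Finset.Icc 1 (min s t), ((r - 1).factorial : ℝ)) ∧
      (∀ s t m : ℕ, fusionExponent s t m =
        2 * (m : ℝ) ^ 2 - m * (2 * s + 2 * t + 1) + s * t) ∧
      ∀ (n : ℕ) (s : Fin (n + 2) → ℕ) (_ : ∀ i, 0 < s i) (α : ValencedLinkPattern s)
        (j : Fin (n + 1)) (y : Fin (n + 1) → ℝ) (_ : StrictMono y),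
        (¬ (α.mult j.castSucc j.succ = s j.castSucc ∧ α.mult j.castSucc j.succ = s j.succ) →
          Tendsto
            (fun p : ℝ × ℝ => α.partitionFunction (nearFusion j y p.1 p.2) /
              |p.2 - p.1| ^ fusionExponent (s j.castSucc) (s j.succ) (α.mult j.castSucc j.succ))
            (𝓝[{p : ℝ × ℝ | p.1 < p.2}] (y j, y j))
            (𝓝 (C (s j.castSucc) (s j.succ) (α.mult j.castSucc j.succ) *
              (α.fuse j).partitionFunction y))) ∧
        (∀ (hl : α.mult j.castSucc j.succ = s j.castSucc)
          (hr : α.mult j.castSucc j.succ = s j.succ),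
          Tendsto
            (fun p : ℝ × ℝ => α.partitionFunction (nearFusion j y p.1 p.2) /
              |p.2 - p.1| ^ fusionExponent (s j.castSucc) (s j.succ) (α.mult j.castSucc j.succ))
            (𝓝[{p : ℝ × ℝ | p.1 < p.2}] (y j, y j))
            (𝓝 (C (s j.castSucc) (s j.succ) (α.mult j.castSucc j.succ) *
              (α.removePair j hl hr).partitionFunction (y ∘ j.succAbove)))) := by
  refine ⟨fusionConstant, fusionConstant_nonneg,
    fun s t _ _ => ⟨fusionConstant_zero_pos s t, fusionConstant_zero_eq s t⟩,
    fun s t _ _ => ⟨fusionConstant_min_pos s t, fusionConstant_min_eq s t⟩, fusionExponent_eq, ?_⟩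
  intro n s _ α j y hy
  exact ⟨fun _ => α.tendsto_partitionFunction_fuse j hy.injective,
    fun hl hr => α.tendsto_partitionFunction_removePair j hy.injective hl hr⟩
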